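/- Conventions. A decision tree over $\{0,1\}^d$ is a binary tree whose inner nodes query a coordinate and whose leaves carry numbers; it computes a function of $x$ by following the path of $x$ to a leaf. A depth-$\ell$ tree is one with at most $\ell$ queries on every root-to-leaf path. A distribution on $\{0,1\}^d$ is representable by a depth-$\ell$ decision tree if its probability mass function is computed by such a tree, and is monotone if $D(x)\ge D(y)$ whenever $x\ge y$ coordinatewise. A subcube conditional sampling oracle for $D$ answers each query, a subcube $S$ with $D(S)>0$, by a fresh independent sample from $D(\cdot\mid S)$ (its answers on subcubes of mass $0$ are unspecified). Algorithms are randomized random access machine programs with logarithmic cost, reading an internal string $r$ of independent fair bits and querying an oracle. An algorithm is $\rho$-replicable with respect to $D$ if two executions with the same $r$ and independent oracle samples give different outputs with probability at most $\rho$. Theorem (replicably learning decision tree distributions). There are two algorithms and a constant $C$ such that the following holds for all integers $d,\ell\ge 0$, all $\alpha,\rho\in(0,1)$ and all $\beta\in(0,\rho/3)$. Each algorithm receives as input only $d$, $\ell$, $\lceil 1/\alpha\rceil$, $\lceil 1/\rho\rceil$, $\lceil 1/\beta\rceil$. The first has only access to independent samples from an unknown distribution $D$ on $\{0,1\}^d$;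 the second has access to a subcube conditional sampling oracle for $D$. Let $D$ be representable by a depth-$\ell$ decision tree and, for the first algorithm, also monotone. Then each algorithm (a) is $\rho$-replicable with respect to $D$; (b) for every value of its internal random string, with probability at least $1-\beta$ over the draw of the samples, outputs a depth-$\ell$ decision tree with rational leaf values that computes the probability mass function of a distribution $D'$ with $\mathrm{TV}(D,D')\le\alpha$; (c) always halts within running time, and with a number of samples, at most $$C\,\bigl(d+\tfrac1\alpha+\tfrac1\rho+\log\tfrac1\beta\bigr)^{C}\cdot\Bigl(\frac{2\ell}{\alpha}\Bigr)^{C\ell},$$ that is, $\mathrm{poly}(d,1/\alpha,1/\rho,\log(1/\beta))\cdot(2\ell/\alpha)^{O(\ell)}$, where $0^0=1$ for $\ell=0$. -/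

import Mathlib

namespace ReplicableDT

/-! ### The hypercube, decision trees, distributions -/

/-- The Boolean hypercube `{0,1}^d`; the order is the pointwise one, with `false < true`. -/
abbrev Cube (d : ℕ) : Type := Fin d → Bool

/-- Decision trees over `{0,1}^d` whose leaves carry labels from `V`. -/
inductive DecisionTree (d : ℕ) (V : Type) : Type where
  | leaf (v : V) : DecisionTree d V
  | node (i : Fin d) (left right : DecisionTree d V) : DecisionTree d V

namespace DecisionTree

/-- The label of the leaf reached by `x`: at a node querying `i`, go left if `x i = 0` and right
if `x i = 1`. -/
def eval {d : ℕ} {V : Type} : DecisionTree d V → Cube d → V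
  | leaf v, _ => v
  | node i l r, x => if x i then r.eval x else l.eval x

/-- The largest number of queries on a root-to-leaf path. -/
def depth {d : ℕ} {V : Type} : DecisionTree d V → ℕ
  | leaf _ => 0
  | node _ l r => max l.depth r.depth + 1

/-- Prefix notation of a tree whose leaves carry fractions `a / b`: a leaf is written `0, a, b`,
and an inner node querying coordinate `i` is written `i + 1`, followed by its two subtrees. -/
def encode {d : ℕ} : DecisionTree d (ℕ × ℕ+) → List ℕ
  | leaf v => [0, v.1, (v.2 : ℕ)]
  | node i l r => ((i : ℕ) + 1) :: (l.encode ++ r.encode)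

/-- A word is the prefix notation of at most one tree. -/
theorem encode_append_inj {d : ℕ} (t : DecisionTree d (ℕ × ℕ+)) :
    ∀ (t' : DecisionTree d (ℕ × ℕ+)) (u u' : List ℕ),
      t.encode ++ u = t'.encode ++ u' → t = t' ∧ u = u' := by
  induction t with
  | leaf v =>
    intro t' u u' h
    cases t' with
    | leaf v' =>
      obtain ⟨a, b⟩ := v
      obtain ⟨a', b'⟩ := v'
      simp [encode] at h
      obtain ⟨rfl, h2, rfl⟩ := h
      subst h2
      exact ⟨rfl, rfl⟩
    | node i l r => simp [encode] at h
  | node i l r ihl ihr =>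
    intro t' u u' h
    cases t' with
    | leaf v' => simp [encode] at h
    | node i' l' r' =>
      simp only [encode, List.cons_append, List.append_assoc, List.cons.injEq] at h
      obtain ⟨h1, h2⟩ := h
      have hi : i = i' := Fin.ext (by omega)
      obtain ⟨rfl, h3⟩ := ihl _ _ _ h2
      obtain ⟨rfl, rfl⟩ := ihr _ _ _ h3
      exact ⟨by rw [hi], rfl⟩

end DecisionTree

/-- The tree `T`, with leaf labels read as real numbers through `val`, computes the probability
mass function of `D`. -/
def Computes {d : ℕ} {V : Type} (T : DecisionTree d V) (val : V → ℝ) (D : PMF (Cube d)) : Prop :=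
  ∀ x : Cube d, (D x).toReal = val (T.eval x)

/-- `D` is representable by a depth-`ℓ` decision tree (with real leaf labels). -/
def Representable {d : ℕ} (D : PMF (Cube d)) (ℓ : ℕ) : Prop :=
  ∃ T : DecisionTree d ℝ, T.depth ≤ ℓ ∧ Computes T id D

/-- The distribution `D` is monotone: `x ≥ y` implies `D x ≥ D y`. -/
def MonotoneDist {d : ℕ} (D : PMF (Cube d)) : Prop :=
  ∀ x y : Cube d, y ≤ x → D y ≤ D x

/-- Total variation distance. -/
noncomputable def tv {d : ℕ} (D D' : PMF (Cube d)) : ℝ :=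
  (1 / 2) * ∑ x : Cube d, |(D x).toReal - (D' x).toReal|

/-! ### Sampling oracles -/

/-- A subcube of `{0,1}^d`: coordinate `i` is fixed to `b` if `S i = some b`, and free if
`S i = none`. -/
abbrev Subcube (d : ℕ) : Type := Fin d → Option Bool

/-- The points of a subcube. -/
def Subcube.points {d : ℕ} (S : Subcube d) : Set (Cube d) :=
  {x | ∀ (i : Fin d) (b : Bool), S i = some b → x i = b}

/-- A memoryless oracle: the query `S` is answered by a fresh sample from `O S`. -/
abbrev Oracle (d : ℕ) : Type := Subcube d → PMF (Cube d)

/-- Plain sample access to `D`: whatever the query, the answer is a fresh sample from `D`. -/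
def sampleOracle {d : ℕ} (D : PMF (Cube d)) : Oracle d := fun _ => D

/-- `O` is a subcube conditional sampling oracle for `D`: on a subcube `S` with `D(S) > 0` it
samples from `D(· | S)`. Nothing is promised about subcubes of mass `0`, where `D(· | S)` is
undefined. -/
def IsSubcubeOracle {d : ℕ} (D : PMF (Cube d)) (O : Oracle d) : Prop :=
  ∀ (S : Subcube d) (h : ∃ x ∈ S.points, x ∈ D.support), O S = D.filter S.points h

/-! ### The machine model

Randomized random access machines under the logarithmic cost criterion, with structured programs.
The memory holds a natural number at every natural address. -/

/-- Arithmetic expressions; `load a` is the contents of memory at address `a`, subtraction is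
truncated and division is rounded down. -/
inductive Expr : Type where
  | lit (n : ℕ) : Expr
  | load (a : Expr) : Expr
  | add (a b : Expr) : Expr
  | sub (a b : Expr) : Expr
  | mul (a b : Expr) : Expr
  | div (a b : Expr) : Expr

namespace Expr

/-- Value of an expression. -/
def eval (mem : ℕ → ℕ) : Expr → ℕ
  | lit n => n
  | load a => mem (a.eval mem)
  | add a b => a.eval mem + b.eval mem
  | sub a b => a.eval mem - b.eval mem
  | mul a b => a.eval mem * b.eval mem
  | div a b => a.eval mem / b.eval mem

/-- Logarithmic cost of evaluating an expression: every operation costs one plus the bit length of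
its result, on top of the costs of its arguments (which cover the bit lengths of the operands). -/
def cost (mem : ℕ → ℕ) : Expr → ℕ
  | lit n => 1 + n.size
  | load a => a.cost mem + 1 + (mem (a.eval mem)).size
  | add a b => a.cost mem + b.cost mem + 1 + (a.eval mem + b.eval mem).size
  | sub a b => a.cost mem + b.cost mem + 1 + (a.eval mem - b.eval mem).size
  | mul a b => a.cost mem + b.cost mem + 1 + (a.eval mem * b.eval mem).size
  | div a b => a.cost mem + b.cost mem + 1 + (a.eval mem / b.eval mem).size

end Expr

/-- Programs: assignment `mem[a] := v`; sequencing; branching on `c ≠ 0`; repetition while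
`c ≠ 0`; `flip a` stores a fresh internal random bit at address `a`; `draw p a` queries the oracle
with the subcube described by the `d` cells from address `p` on, and stores the answer in the `d`
cells from address `a` on; `emit v` appends a number to the output. -/
inductive Program : Type where
  | skip : Program
  | store (a v : Expr) : Program
  | seq (P Q : Program) : Program
  | ite (c : Expr) (P Q : Program) : Program
  | loop (c : Expr) (P : Program) : Program
  | flip (a : Expr) : Program
  | draw (p a : Expr) : Program
  | emit (v : Expr) : Program

/-- Machine states: memory, number of random bits used, number of oracle queries made, output. -/
structure State : Type where
  mem : ℕ → ℕ
  flips : ℕ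
  draws : ℕ
  out : List ℕ

/-- The subcube described by the `d` cells from address `p` on: `0` and `1` fix a coordinate to that
value, everything else leaves it free. -/
def readSubcube (d : ℕ) (mem : ℕ → ℕ) (p : ℕ) : Subcube d := fun i =>
  if mem (p + i) = 0 then some false else if mem (p + i) = 1 then some true else none

/-- Write the coordinates of `x` into the `d` cells from address `a` on. -/
def writePoint {d : ℕ} (mem : ℕ → ℕ) (a : ℕ) (x : Cube d) : ℕ → ℕ := fun j =>
  if h : a ≤ j ∧ j < a + d then (x ⟨j - a, by omega⟩).toNat else mem j

/-- The internal random string: an infinite sequence of bits, read one after the other. -/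
abbrev Coins : Type := ℕ → Bool

/-- The oracle's answers: if the query number `k` is the subcube `S`, its answer is the entry at
`(k, S)`. No entry is ever read twice. -/
abbrev Answers (d : ℕ) : Type := ℕ × Subcube d → Cube d

/-- `Exec r ω P s t n`: with random bits `r` and oracle answers `ω`, the program `P`, started in
state `s`, halts in state `t` after time `n`. -/
inductive Exec {d : ℕ} (r : Coins) (ω : Answers d) : Program → State → State → ℕ → Prop
  | skip (s : State) : Exec r ω .skip s s 1
  | store (a v : Expr) (s : State) :
      Exec r ω (.store a v) s
        { s with mem := Function.update s.mem (a.eval s.mem) (v.eval s.mem) }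
        (a.cost s.mem + v.cost s.mem + 1)
  | seq {P Q : Program} {s t u : State} {m n : ℕ} :
      Exec r ω P s t m → Exec r ω Q t u n → Exec r ω (.seq P Q) s u (m + n)
  | ite_true {c : Expr} {P Q : Program} {s t : State} {n : ℕ} :
      c.eval s.mem ≠ 0 → Exec r ω P s t n → Exec r ω (.ite c P Q) s t (c.cost s.mem + 1 + n)
  | ite_false {c : Expr} {P Q : Program} {s t : State} {n : ℕ} :
      c.eval s.mem = 0 → Exec r ω Q s t n → Exec r ω (.ite c P Q) s t (c.cost s.mem + 1 + n)
  | loop_true {c : Expr} {P : Program} {s t u : State} {m n : ℕ} :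
      c.eval s.mem ≠ 0 → Exec r ω P s t m → Exec r ω (.loop c P) t u n →
        Exec r ω (.loop c P) s u (c.cost s.mem + 1 + m + n)
  | loop_false {c : Expr} {P : Program} {s : State} :
      c.eval s.mem = 0 → Exec r ω (.loop c P) s s (c.cost s.mem + 1)
  | flip (a : Expr) (s : State) :
      Exec r ω (.flip a) s
        { s with
          mem := Function.update s.mem (a.eval s.mem) (r s.flips).toNat
          flips := s.flips + 1 }
        (a.cost s.mem + 1)
  | draw (p a : Expr) (s : State) :
      Exec r ω (.draw p a) s
        { s with
          mem := writePoint s.mem (a.eval s.mem)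
            (ω (s.draws, readSubcube d s.mem (p.eval s.mem)))
          draws := s.draws + 1 }
        (p.cost s.mem + a.cost s.mem + d + 1)
  | emit (v : Expr) (s : State) :
      Exec r ω (.emit v) s { s with out := s.out ++ [v.eval s.mem] } (v.cost s.mem + 1)

/-- Execution is deterministic once the random bits and the oracle's answers are fixed. -/
theorem Exec.unique {d : ℕ} {r : Coins} {ω : Answers d} {P : Program} {s t : State} {n : ℕ}
    (h : Exec r ω P s t n) : ∀ {t' : State} {n' : ℕ}, Exec r ω P s t' n' → t = t' ∧ n = n' := by
  induction h with
  | skip s => intro t' n' h'; cases h'; exact ⟨rfl, rfl⟩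
  | store a v s => intro t' n' h'; cases h'; exact ⟨rfl, rfl⟩
  | seq _ _ ih1 ih2 =>
    intro t' n' h'
    cases h' with
    | seq h1 h2 =>
      obtain ⟨rfl, rfl⟩ := ih1 h1
      obtain ⟨rfl, rfl⟩ := ih2 h2
      exact ⟨rfl, rfl⟩
  | ite_true hc _ ih =>
    intro t' n' h'
    cases h' with
    | ite_true _ h1 => obtain ⟨rfl, rfl⟩ := ih h1; exact ⟨rfl, rfl⟩
    | ite_false hc' _ => exact absurd hc' hc
  | ite_false hc _ ih =>
    intro t' n' h'
    cases h' with
    | ite_true hc' _ => exact absurd hc hc'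
    | ite_false _ h1 => obtain ⟨rfl, rfl⟩ := ih h1; exact ⟨rfl, rfl⟩
  | loop_true hc _ _ ih1 ih2 =>
    intro t' n' h'
    cases h' with
    | loop_true _ h1 h2 =>
      obtain ⟨rfl, rfl⟩ := ih1 h1
      obtain ⟨rfl, rfl⟩ := ih2 h2
      exact ⟨rfl, rfl⟩
    | loop_false hc' => exact absurd hc' hc
  | loop_false hc =>
    intro t' n' h'
    cases h' with
    | loop_true hc' _ _ => exact absurd hc hc'
    | loop_false _ => exact ⟨rfl, rfl⟩
  | flip a s => intro t' n' h'; cases h'; exact ⟨rfl, rfl⟩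
  | draw p a s => intro t' n' h'; cases h'; exact ⟨rfl, rfl⟩
  | emit v s => intro t' n' h'; cases h'; exact ⟨rfl, rfl⟩

/-- The initial state on a given input: the input numbers in the first memory cells, zeros
everywhere else. -/
def initial (input : List ℕ) : State where
  mem := fun j => input.getD j 0
  flips := 0
  draws := 0
  out := []

/-- With random bits `r` and oracle answers `ω`, the program halts on the input with output `w`. -/
def Outputs {d : ℕ} (P : Program) (input : List ℕ) (r : Coins) (ω : Answers d) (w : List ℕ) :
    Prop :=
  ∃ (t : State) (n : ℕ), Exec r ω P (initial input) t n ∧ t.out = w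

/-- Whatever the random bits and the oracle's answers (which are points of `{0,1}^d`), the program
halts within time `B` and after at most `B` oracle queries. -/
def RunsWithin (d : ℕ) (P : Program) (input : List ℕ) (B : ℝ) : Prop :=
  ∀ (r : Coins) (ω : Answers d), ∃ (t : State) (n : ℕ),
    Exec r ω P (initial input) t n ∧ (n : ℝ) ≤ B ∧ (t.draws : ℝ) ≤ B

/-! ### Replicable learning -/

/-- The law of the internal random string: independent fair bits. -/
noncomputable def coinLaw : MeasureTheory.Measure Coins :=
  MeasureTheory.Measure.infinitePi fun _ : ℕ => (PMF.uniformOfFintype Bool).toMeasure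

/-- The law of the oracle's answers: independent, a query `S` being answered according to `O S`. -/
noncomputable def answerLaw {d : ℕ} (O : Oracle d) : MeasureTheory.Measure (Answers d) :=
  MeasureTheory.Measure.infinitePi fun q : ℕ × Subcube d => (O q.2).toMeasure

/-- `ρ`-replicability: two executions with the same internal random string and independent answers
of the oracle fail to give the same output with probability at most `ρ`. -/
def Replicable {d : ℕ} (P : Program) (input : List ℕ) (O : Oracle d) (ρ : ℝ) : Prop :=
  (coinLaw.prod ((answerLaw O).prod (answerLaw O)))
      {z : Coins × Answers d × Answers d |
        ¬ ∃ w : List ℕ, Outputs P input z.1 z.2.1 w ∧ Outputs P input z.1 z.2.2 w}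
    ≤ ENNReal.ofReal ρ

/-- The word `w` is a depth-`ℓ` tree representing a distribution `D'` with `TV(D, D') ≤ α`. -/
def GoodOutput {d : ℕ} (D : PMF (Cube d)) (ℓ : ℕ) (α : ℝ) (w : List ℕ) : Prop :=
  ∃ (T : DecisionTree d (ℕ × ℕ+)) (D' : PMF (Cube d)),
    w = T.encode ∧ T.depth ≤ ℓ ∧ Computes T (fun v => (v.1 : ℝ) / ((v.2 : ℕ) : ℝ)) D' ∧
      tv D D' ≤ α

/-- With probability at least `1 - β` over the samples, whatever the internal random string, the
program outputs a depth-`ℓ` tree representing a distribution `D'` with `TV(D, D') ≤ α`. -/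
def Learns {d : ℕ} (P : Program) (input : List ℕ) (O : Oracle d) (D : PMF (Cube d)) (ℓ : ℕ)
    (α β : ℝ) : Prop :=
  ∀ r : Coins, ENNReal.ofReal (1 - β) ≤
    answerLaw O {ω : Answers d | ∃ w : List ℕ, Outputs P input r ω w ∧ GoodOutput D ℓ α w}

/-- The input of the learner: the dimension, the depth, and the accuracy, replicability and
confidence parameters in the form of the integers `⌈1/α⌉`, `⌈1/ρ⌉`, `⌈1/β⌉`. -/
noncomputable def learnerInput (d ℓ : ℕ) (α ρ β : ℝ) : List ℕ :=
  [d, ℓ, ⌈1 / α⌉₊, ⌈1 / ρ⌉₊, ⌈1 / β⌉₊]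

/-- The bound `poly(d, 1/α, 1/ρ, log(1/β)) · (2ℓ/α)^{O(ℓ)}`, with the constant `C` for the polynomial
and for the `O(·)`. (All of `1/α`, `1/ρ` exceed `1`, so that powers of the sum dominate every
polynomial.) -/
noncomputable def complexityBound (C d ℓ : ℕ) (α ρ β : ℝ) : ℝ :=
  C * ((d : ℝ) + 1 / α + 1 / ρ + Real.log (1 / β)) ^ C * (2 * (ℓ : ℝ) / α) ^ (C * ℓ)

end ReplicableDT

/-! Write `w` for the mass function of `D` and `w(S)` for the mass of a subcube. Both learners are
the same program; they differ only in the 0/1 marks attached to a sample. For a free direction `i`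
of a subcube `S`, the probability that a sample lies in `S` and is marked at `i` equals `(w(S) +
η_i(S)) / 2`, so counting marks estimates an influence `η_i(S)`. If `w` is monotone and the mark is
the bit `x i`, then `η_i` is half the absolute difference along edges (`measures_plainMark`). With
conditional samples, the mark compares `x` with a fresh sample from the edge through `x`, and `η_i`
is a normalized squared difference (`measures_pairMark`). Both satisfy `EdgeBound`, from which the
absolute differences are recovered by the inequality of arithmetic and geometric means.

Total influence telescopes along a tree (`totalInfluence_split`): the influences of the queries add
up to the total influence at the root minus that at the leaves. Thus the tree of largest gain leaves
the least influence at its leaves. A function is within its total influence of its mean in L1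
(`sum_abs_sub_mean_le`), so spreading the mass of each leaf evenly is then accurate. Conversely, a
depth-`ℓ` tree is sensitive to at most `ℓ` directions at each point, hence its total influence on
`S` is at most `ℓ` times its L1 distance to any constant (`Sensitivity.totalInfluence_le`). The true
tree therefore has leaves without influence, and nearly so after its queries of low relative
influence have been removed (`exists_valid_tree`). It suffices to optimize over promising
directions, whose influence is a noticeable fraction of `w(S)`. Sensitivity allows only `poly(ℓ /
α)` of them per subcube (`Accurate.mem_choices`), which is the source of the factor `(2ℓ/α)^{O(ℓ)}`.

For replicability, counts are rounded after adding a random offset, one for each level. The subcubes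
inspected at a level depend only on the offsets of earlier levels, so the current offset is fresh. A
union bound over the inspected subcubes, rather than all `3^d`, shows that rounding rarely separates
the two ends of the typical range of a count (`coinLaw_shiftedEst_ne_le`). Otherwise the plan is a
function of the coins alone (`learnerPlan_eq`). Counts are typical for all subcubes at once by
Hoeffding's inequality over disjoint blocks of queries (`blockSum_tail`).

The algorithm is written in a small array language that is translated to the machine with polynomial
overhead (`ACode.simulated`). As the program text is fixed, the number of steps is polynomial in the
parameters controlling its loops (`exists_steps_le`). -/

namespace ReplicableDT

/-! ### A language of programs over named two-dimensional arrays -/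

/-- Contents of the arrays: `M k i j` is the entry `(i, j)` of array number `k`. -/
abbrev Store : Type := ℕ → ℕ → ℕ → ℕ

/-- Arithmetic expressions over array entries. -/
inductive AExpr : Type where
  | lit (n : ℕ) : AExpr
  | get (k : ℕ) (i j : AExpr) : AExpr
  | add (a b : AExpr) : AExpr
  | sub (a b : AExpr) : AExpr
  | mul (a b : AExpr) : AExpr
  | div (a b : AExpr) : AExpr

namespace AExpr

/-- Value of an expression. -/
def eval (M : Store) : AExpr → ℕ
  | lit n => n
  | get k i j => M k (i.eval M) (j.eval M)
  | add a b => a.eval M + b.eval M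
  | sub a b => a.eval M - b.eval M
  | mul a b => a.eval M * b.eval M
  | div a b => a.eval M / b.eval M

/-- The arrays an expression reads. -/
def ids : AExpr → List ℕ
  | lit _ => []
  | get k i j => k :: (i.ids ++ j.ids)
  | add a b => a.ids ++ b.ids
  | sub a b => a.ids ++ b.ids
  | mul a b => a.ids ++ b.ids
  | div a b => a.ids ++ b.ids

/-- Expressions whose value has few bits more than the largest array entry. -/
def mild : AExpr → Bool
  | lit _ => true
  | get _ _ _ => true
  | add a b => a.mild && b.mild
  | sub a _ => a.mild
  | mul _ _ => false
  | div a _ => a.mild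

/-- For a mild expression, how many bits more. -/
def rate : AExpr → ℕ
  | lit n => n.size
  | get _ _ _ => 0
  | add a b => a.rate + b.rate + 1
  | sub a _ => a.rate
  | mul _ _ => 0
  | div a _ => a.rate

/-- Number of bits by which storing the value may increase the bit length of the entries. -/
def growth (M : Store) (e : AExpr) : ℕ := if e.mild then e.rate else (e.eval M).size

theorem eval_congr {M M' : Store} : ∀ e : AExpr, (∀ k ∈ e.ids, M k = M' k) →
    e.eval M = e.eval M'
  | lit _, _ => rfl
  | get k i j, h => by
    simp only [ids, List.mem_cons, List.mem_append] at h
    simp only [eval]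
    rw [eval_congr i fun k hk => h k (by simp [hk]), eval_congr j fun k hk => h k (by simp [hk]),
      h k (by simp)]
  | add a b, h | sub a b, h | mul a b, h | div a b, h => by
    simp only [ids, List.mem_append] at h
    simp only [eval]
    rw [eval_congr a fun k hk => h k (Or.inl hk), eval_congr b fun k hk => h k (Or.inr hk)]

/-- Addition is the only mild operation that can lengthen its operands, by one bit; truncated
subtraction and division never exceed their first argument, so the second one need not be mild. -/
theorem size_eval_le_of_mild {M : Store} {b : ℕ} (hM : ∀ k i j, (M k i j).size ≤ b) :
    ∀ e : AExpr, e.mild → (e.eval M).size ≤ b + e.rate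
  | lit n, _ => by simp [eval, rate]
  | get k i j, _ => by simpa [eval, rate] using hM _ _ _
  | add x y, h => by
    simp only [mild, Bool.and_eq_true] at h
    have hx := Nat.size_le.1 (size_eval_le_of_mild hM x h.1)
    have hy := Nat.size_le.1 (size_eval_le_of_mild hM y h.2)
    simp only [eval, rate]
    rw [Nat.size_le]
    calc x.eval M + y.eval M < 2 ^ (b + x.rate) + 2 ^ (b + y.rate) := by omega
      _ ≤ 2 ^ (b + x.rate + y.rate) + 2 ^ (b + x.rate + y.rate) :=
          Nat.add_le_add (Nat.pow_le_pow_right (by norm_num) (by omega))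
            (Nat.pow_le_pow_right (by norm_num) (by omega))
      _ = 2 ^ (b + (x.rate + y.rate + 1)) := by ring
  | sub x y, h => by
    have := size_eval_le_of_mild hM x (by simpa [mild] using h)
    exact (Nat.size_le_size (Nat.sub_le _ _)).trans this
  | mul x y, h => by simp [mild] at h
  | div x y, h => by
    have := size_eval_le_of_mild hM x (by simpa [mild] using h)
    exact (Nat.size_le_size (Nat.div_le_self _ _)).trans this

/-- For an expression that is not mild, `growth` is the bit length of the value itself, so the bound
is immediate there. -/
theorem size_eval_le {M : Store} {b : ℕ} (hM : ∀ k i j, (M k i j).size ≤ b) (e : AExpr) :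
    (e.eval M).size ≤ b + e.growth M := by
  unfold growth
  split_ifs with h
  · exact size_eval_le_of_mild hM e h
  · omega

end AExpr

/-- Array programs: `set` assigns an array entry, `rep k n P` runs `P` with the counter `k` running
from `0` to `n - 1`, `draw p i q j` queries the oracle with row `i` of array `p` and stores the
answer in row `j` of array `q`, `size k v` stores the bit length of `v`. -/
inductive ACode : Type where
  | skip : ACode
  | set (k : ℕ) (i j v : AExpr) : ACode
  | seq (P Q : ACode) : ACode
  | ite (c : AExpr) (P Q : ACode) : ACode
  | rep (k : ℕ) (n : AExpr) (P : ACode) : ACode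
  | flip (k : ℕ) : ACode
  | draw (p : ℕ) (i : AExpr) (q : ℕ) (j : AExpr) : ACode
  | emit (v : AExpr) : ACode
  | size (k : ℕ) (v : AExpr) : ACode

/-- States of array programs. -/
@[ext] structure AState : Type where
  mem : Store
  flips : ℕ
  draws : ℕ
  out : List ℕ

namespace AState

/-- Assign one array entry. -/
def put (s : AState) (k i j v : ℕ) : AState :=
  { s with mem := fun k' i' j' => if k' = k ∧ i' = i ∧ j' = j then v else s.mem k' i' j' }

/-- Assign a row, and count an oracle query. -/
def putPoint {d : ℕ} (s : AState) (k i : ℕ) (x : Cube d) : AState :=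
  { s with
    mem := fun k' i' j' =>
      if h : k' = k ∧ i' = i ∧ j' < d then (x ⟨j', h.2.2⟩).toNat else s.mem k' i' j'
    draws := s.draws + 1 }

@[simp] theorem put_mem (s : AState) (k i j v k' i' j' : ℕ) : (s.put k i j v).mem k' i' j' =
    if k' = k ∧ i' = i ∧ j' = j then v else s.mem k' i' j' := rfl
@[simp] theorem put_flips (s : AState) (k i j v : ℕ) : (s.put k i j v).flips = s.flips := rfl
@[simp] theorem put_draws (s : AState) (k i j v : ℕ) : (s.put k i j v).draws = s.draws := rfl
@[simp] theorem put_out (s : AState) (k i j v : ℕ) : (s.put k i j v).out = s.out := rfl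

theorem put_mem_ne (s : AState) {k k' : ℕ} (i j v : ℕ) (h : k' ≠ k) :
    (s.put k i j v).mem k' = s.mem k' := by
  funext i' j'; simp [h]

end AState

/-- `iterate f n a` is `f (n - 1) (… (f 1 (f 0 a)))`. -/
def iterate {α : Type} (f : ℕ → α → α) : ℕ → α → α
  | 0, a => a
  | n + 1, a => f n (iterate f n a)

namespace ACode

/-- The state reached from a given state. -/
def den {d : ℕ} (r : Coins) (ω : Answers d) : ACode → AState → AState
  | skip, s => s
  | set k i j v, s => s.put k (i.eval s.mem) (j.eval s.mem) (v.eval s.mem)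
  | seq P Q, s => den r ω Q (den r ω P s)
  | ite c P Q, s => if c.eval s.mem ≠ 0 then den r ω P s else den r ω Q s
  | rep k n P, s =>
    (iterate (fun j t => den r ω P (t.put k 0 0 j)) (n.eval s.mem) s).put k 0 0 (n.eval s.mem)
  | flip k, s => { s.put k 0 0 (r s.flips).toNat with flips := s.flips + 1 }
  | draw p i q j, s =>
    s.putPoint q (j.eval s.mem) (ω (s.draws, readSubcube d (s.mem p (i.eval s.mem)) 0))
  | emit v, s => { s with out := s.out ++ [v.eval s.mem] }
  | size k v, s => s.put k 0 0 (v.eval s.mem).size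

/-- The states at the beginning of the iterations of a loop. -/
def passes {d : ℕ} (r : Coins) (ω : Answers d) (k : ℕ) (P : ACode) (j : ℕ) (s : AState) : AState :=
  iterate (fun j t => den r ω P (t.put k 0 0 j)) j s

/-- Number of steps. -/
def steps {d : ℕ} (r : Coins) (ω : Answers d) : ACode → AState → ℕ
  | skip, _ => 1
  -- Steps pay not only for time but also for the growth of the words in memory: the simulation
  -- bounds the final word length by the initial one plus the number of steps.
  | set _ _ _ v, s => 1 + v.growth s.mem
  | seq P Q, s => steps r ω P s + steps r ω Q (den r ω P s)
  -- Both branches are charged, whichever is taken; this keeps the static bounds free of case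
  -- distinctions.
  | ite _ P Q, s =>
    1 + steps r ω P s + steps r ω Q s
  | rep k n P, s =>
    2 + ∑ j ∈ Finset.range (n.eval s.mem), (2 + steps r ω P ((passes r ω k P j s).put k 0 0 j))
  | flip _, _ => 1
  | draw _ _ _ j, s => 4 * d + 4 + j.growth s.mem
  | emit _, _ => 1
  | size _ v, s => 2 + 3 * (v.eval s.mem).size + v.growth s.mem

end ACode

/-! ### Translation to the machine -/

/-- An injective pairing function. -/
def pairing (x y : ℕ) : ℕ := (x + y) * (x + y) + y

/-- With `s = x + y`, the value `s² + y` lies between `s²` and `(s + 1)² - 1`, so it determines `s`,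
and then `y`. -/
theorem pairing_inj {x y x' y' : ℕ} (h : pairing x y = pairing x' y') : x = x' ∧ y = y' := by
  unfold pairing at h
  have h1 : x + y = x' + y' := by
    rcases lt_trichotomy (x + y) (x' + y') with h1 | h1 | h1
    · nlinarith
    · exact h1
    · nlinarith
  rw [h1] at h
  omega

/-- The address of an array entry. -/
def cell (d k i j : ℕ) : ℕ := 8 + 2 * d + pairing (pairing i j) k

theorem cell_inj {d k i j k' i' j' : ℕ} (h : cell d k i j = cell d k' i' j') :
    k = k' ∧ i = i' ∧ j = j' := by
  obtain ⟨h1, h2⟩ := pairing_inj (Nat.add_left_cancel h)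
  obtain ⟨h3, h4⟩ := pairing_inj h1
  exact ⟨h2, h3, h4⟩

namespace Expr

/-- The expression for `pairing`. -/
def pairE (x y : Expr) : Expr := add (mul (add x y) (add x y)) y

/-- The expression for `cell`. -/
def cellE (k : ℕ) (i j : Expr) : Expr :=
  add (add (lit 8) (mul (lit 2) (load (lit 0)))) (pairE (pairE i j) (lit k))

theorem eval_cellE (mem : ℕ → ℕ) (k : ℕ) (i j : Expr) :
    (cellE k i j).eval mem = cell (mem 0) k (i.eval mem) (j.eval mem) := rfl

/-- The bit length of a result is at most the sum of the bit lengths of the operands. For a fixed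
expression, cost and length of the value are therefore linear in the word length of the memory. -/
theorem exists_bound (e : Expr) : ∃ c : ℕ, ∀ (mem : ℕ → ℕ) (b : ℕ), 1 ≤ b →
    (∀ a, (mem a).size ≤ b) → e.cost mem ≤ c * b ∧ (e.eval mem).size ≤ c * b := by
  -- For positive `x`, `y` this is `x + y < 2 ^ x.size * 2 ^ y.size`; if one of them is zero that
  -- factor is `1`, hence the separate cases.
  have two : ∀ x y : ℕ, (x + y).size ≤ x.size + y.size := fun x y => by
    rw [Nat.size_le, pow_add]
    rcases Nat.eq_zero_or_pos x with rfl | hx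
    · simpa using Nat.lt_size_self y
    rcases Nat.eq_zero_or_pos y with rfl | hy
    · simpa using Nat.lt_size_self x
    have h1 := Nat.lt_size_self x
    have h2 := Nat.lt_size_self y
    nlinarith
  have mulsize : ∀ x y : ℕ, (x * y).size ≤ x.size + y.size := fun x y => by
    rw [Nat.size_le, pow_add]
    exact Nat.mul_lt_mul'' (Nat.lt_size_self x) (Nat.lt_size_self y)
  induction e with
  | lit n =>
    refine ⟨1 + n.size, fun mem b hb _ => ?_⟩
    simp only [cost, eval]
    constructor <;> nlinarith
  | load a ih =>
    obtain ⟨c, hc⟩ := ih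
    refine ⟨c + 2, fun mem b hb hm => ?_⟩
    have := hc mem b hb hm
    have h2 := hm (a.eval mem)
    simp only [cost, eval]
    constructor <;> nlinarith
  | add x y ihx ihy =>
    obtain ⟨c, hc⟩ := ihx
    obtain ⟨c', hc'⟩ := ihy
    refine ⟨2 * c + 2 * c' + 1, fun mem b hb hm => ?_⟩
    have h1 := hc mem b hb hm
    have h2 := hc' mem b hb hm
    have h3 := two (x.eval mem) (y.eval mem)
    simp only [cost, eval]
    constructor <;> nlinarith
  | sub x y ihx ihy =>
    obtain ⟨c, hc⟩ := ihx
    obtain ⟨c', hc'⟩ := ihy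
    refine ⟨2 * c + 2 * c' + 1, fun mem b hb hm => ?_⟩
    have h1 := hc mem b hb hm
    have h2 := hc' mem b hb hm
    have h3 := Nat.size_le_size (Nat.sub_le (x.eval mem) (y.eval mem))
    simp only [cost, eval]
    constructor <;> nlinarith
  | mul x y ihx ihy =>
    obtain ⟨c, hc⟩ := ihx
    obtain ⟨c', hc'⟩ := ihy
    refine ⟨2 * c + 2 * c' + 1, fun mem b hb hm => ?_⟩
    have h1 := hc mem b hb hm
    have h2 := hc' mem b hb hm
    have h3 := mulsize (x.eval mem) (y.eval mem)
    simp only [cost, eval]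
    constructor <;> nlinarith
  | div x y ihx ihy =>
    obtain ⟨c, hc⟩ := ihx
    obtain ⟨c', hc'⟩ := ihy
    refine ⟨2 * c + 2 * c' + 1, fun mem b hb hm => ?_⟩
    have h1 := hc mem b hb hm
    have h2 := hc' mem b hb hm
    have h3 := Nat.size_le_size (Nat.div_le_self (x.eval mem) (y.eval mem))
    simp only [cost, eval]
    constructor <;> nlinarith

/-- A common cost bound for finitely many expressions. -/
theorem exists_bound_list (es : List Expr) : ∃ c : ℕ, 1 ≤ c ∧ ∀ (mem : ℕ → ℕ) (b : ℕ), 1 ≤ b →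
    (∀ a, (mem a).size ≤ b) → ∀ e ∈ es, e.cost mem + 1 ≤ c * b := by
  induction es with
  | nil => exact ⟨1, le_rfl, by simp⟩
  | cons e es ih =>
    obtain ⟨c, hc1, hc⟩ := ih
    obtain ⟨c', hc'⟩ := e.exists_bound
    refine ⟨c + c' + 1, by omega, fun mem b hb hm e' he' => ?_⟩
    rcases List.mem_cons.1 he' with rfl | he'
    · have := (hc' mem b hb hm).1
      nlinarith
    · have := hc mem b hb hm e' he'
      nlinarith

end Expr

/-- Translation of expressions. -/
def AExpr.comp : AExpr → Expr
  | .lit n => .lit n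
  | .get k i j => .load (.cellE k i.comp j.comp)
  | .add a b => .add a.comp b.comp
  | .sub a b => .sub a.comp b.comp
  | .mul a b => .mul a.comp b.comp
  | .div a b => .div a.comp b.comp

/-- `for mem[5] = 0, …, mem[0] - 1 do P`. -/
def Program.overCoords (P : Program) : Program :=
  .seq (.store (.lit 5) (.lit 0)) (.loop (.sub (.load (.lit 0)) (.load (.lit 5)))
    (.seq P (.store (.lit 5) (.add (.load (.lit 5)) (.lit 1)))))

/-- Translation of programs. Cells `5`, `6` and the `2 d` cells from address `8` on are scratch
space. -/
def ACode.comp : ACode → Program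
  | .skip => .skip
  | .set k i j v => .store (.cellE k i.comp j.comp) v.comp
  | .seq P Q => .seq P.comp Q.comp
  | .ite c P Q => .ite c.comp P.comp Q.comp
  | .rep k n P =>
    .seq (.store (.cellE k (.lit 0) (.lit 0)) (.lit 0))
      (.loop (.sub n.comp (.load (.cellE k (.lit 0) (.lit 0))))
        (.seq P.comp (.store (.cellE k (.lit 0) (.lit 0))
          (.add (.load (.cellE k (.lit 0) (.lit 0))) (.lit 1)))))
  | .flip k => .flip (.cellE k (.lit 0) (.lit 0))
  | .draw p i q j =>
    .seq (.overCoords (.store (.add (.lit 8) (.load (.lit 5)))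
        (.load (.cellE p i.comp (.load (.lit 5))))))
      (.seq (.draw (.lit 8) (.add (.lit 8) (.load (.lit 0))))
        (.seq (.store (.lit 6) j.comp)
          (.overCoords (.store (.cellE q (.load (.lit 6)) (.load (.lit 5)))
            (.load (.add (.add (.lit 8) (.load (.lit 0))) (.load (.lit 5))))))))
  | .emit v => .emit v.comp
  | .size k v =>
    .seq (.store (.lit 5) v.comp)
      (.seq (.store (.lit 6) (.lit 0))
        (.seq (.loop (.load (.lit 5))
            (.seq (.store (.lit 5) (.div (.load (.lit 5)) (.lit 2)))
              (.store (.lit 6) (.add (.load (.lit 6)) (.lit 1)))))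
          (.store (.cellE k (.lit 0) (.lit 0)) (.load (.lit 6)))))

/-- The arrays a program writes to. -/
def ACode.writes : ACode → List ℕ
  | .skip => []
  | .set k _ _ _ => [k]
  | .seq P Q => P.writes ++ Q.writes
  | .ite _ P Q => P.writes ++ Q.writes
  | .rep k _ P => k :: P.writes
  | .flip k => [k]
  | .draw _ _ q _ => [q]
  | .emit _ => []
  | .size k _ => [k]

/-- Loops do not change their own counters and bounds. -/
def ACode.Wf : ACode → Prop
  | .seq P Q => P.Wf ∧ Q.Wf
  | .ite _ P Q => P.Wf ∧ Q.Wf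
  | .rep k n P => k ∉ P.writes ∧ (∀ k' ∈ n.ids, k' ∉ k :: P.writes) ∧ P.Wf
  | _ => True

namespace ACode

variable {d : ℕ} (r : Coins) (ω : Answers d)

theorem iterate_mem {f : ℕ → AState → AState} {k : ℕ}
    (h : ∀ j t, (f j t).mem k = t.mem k) (n : ℕ) (s : AState) :
    (iterate f n s).mem k = s.mem k := by
  induction n with
  | zero => rfl
  | succ n ih => rw [iterate, h, ih]

/-- The frame rule. For concrete programs and array numbers the side condition is decidable, which
is how values are carried across the phases of the learner. -/
theorem den_mem {k : ℕ} : ∀ (P : ACode) (s : AState), k ∉ P.writes →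
    (den r ω P s).mem k = s.mem k
  | .skip, s, _ => rfl
  | .set k' i j v, s, h => by
    simp only [writes, List.mem_singleton] at h
    exact AState.put_mem_ne _ _ _ _ h
  | .seq P Q, s, h => by
    simp only [writes, List.mem_append, not_or] at h
    simp only [den]
    rw [den_mem Q _ h.2, den_mem P _ h.1]
  | .ite c P Q, s, h => by
    simp only [writes, List.mem_append, not_or] at h
    simp only [den]
    split_ifs
    · exact den_mem P _ h.1
    · exact den_mem Q _ h.2
  | .rep k' n P, s, h => by
    simp only [writes, List.mem_cons, not_or] at h
    simp only [den]
    rw [AState.put_mem_ne _ _ _ _ h.1, iterate_mem]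
    intro j t
    rw [den_mem P _ h.2, AState.put_mem_ne _ _ _ _ h.1]
  | .flip k', s, h => by
    simp only [writes, List.mem_singleton] at h
    exact AState.put_mem_ne _ _ _ _ h
  | .draw p i q j, s, h => by
    simp only [writes, List.mem_singleton] at h
    funext i' j'
    simp [den, AState.putPoint, h]
  | .emit v, s, _ => rfl
  | .size k' v, s, h => by
    simp only [writes, List.mem_singleton] at h
    exact AState.put_mem_ne _ _ _ _ h

theorem passes_mem {k k' : ℕ} {P : ACode} (h : k ∉ k' :: P.writes) (j : ℕ) (s : AState) :
    (passes r ω k' P j s).mem k = s.mem k := by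
  simp only [List.mem_cons, not_or] at h
  refine iterate_mem (fun j t => ?_) _ _
  rw [den_mem r ω P _ h.2, AState.put_mem_ne _ _ _ _ h.1]

end ACode

/-- The machine state `s` represents the array state `S`, with entries of bit length at most `b`. -/
structure Sim (d : ℕ) (s : State) (S : AState) (b : ℕ) : Prop where
  dim : s.mem 0 = d
  mem : ∀ k i j, s.mem (cell d k i j) = S.mem k i j
  flips : s.flips = S.flips
  draws : s.draws = S.draws
  out : s.out = S.out
  size_le : ∀ a, (s.mem a).size ≤ b

/-! ### Machine states that represent array states. -/

namespace Sim

variable {d : ℕ} {s : State} {S : AState} {b b' : ℕ}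

theorem eval (h : Sim d s S b) : ∀ e : AExpr, e.comp.eval s.mem = e.eval S.mem
  | .lit n => rfl
  | .get k i j => by
    simp only [AExpr.comp, Expr.eval, Expr.eval_cellE, AExpr.eval, h.dim, h.eval i, h.eval j, h.mem]
  | .add x y | .sub x y | .mul x y | .div x y => by
    simp only [AExpr.comp, Expr.eval, AExpr.eval, h.eval x, h.eval y]

theorem entry_size_le (h : Sim d s S b) (k i j : ℕ) : (S.mem k i j).size ≤ b := by
  rw [← h.mem]; exact h.size_le _

theorem mono (h : Sim d s S b) (hb : b ≤ b') : Sim d s S b' :=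
  { h with size_le := fun a => (h.size_le a).trans hb }

theorem put (h : Sim d s S b) (hb : b ≤ b') (k i j : ℕ) {v : ℕ} (hv : v.size ≤ b') :
    Sim d { s with mem := Function.update s.mem (cell d k i j) v } (S.put k i j v) b' where
  dim := by
    dsimp only
    rw [Function.update_of_ne]
    · exact h.dim
    · unfold cell; omega
  mem k' i' j' := by
    rw [AState.put_mem]
    split_ifs with hk
    · obtain ⟨rfl, rfl, rfl⟩ := hk
      simp
    · dsimp only
      rw [Function.update_of_ne, h.mem]
      exact fun he => hk (cell_inj he)
  flips := h.flips
  draws := h.draws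
  out := h.out
  size_le a := by
    rcases eq_or_ne a (cell d k i j) with rfl | ha
    · simpa using hv
    · dsimp only
      rw [Function.update_of_ne ha]
      exact (h.size_le a).trans hb

/-- All array cells have addresses at least `8 + 2 * d`; among the smaller ones only address `0`,
which holds the dimension, is part of the representation. -/
theorem scratch (h : Sim d s S b) (hb : b ≤ b') {a v : ℕ} (ha : a ≠ 0) (ha' : a < 8 + 2 * d)
    (hv : v.size ≤ b') : Sim d { s with mem := Function.update s.mem a v } S b' where
  dim := by
    dsimp only
    rw [Function.update_of_ne ha.symm]
    exact h.dim
  mem k' i' j' := by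
    dsimp only
    rw [Function.update_of_ne, h.mem]
    unfold cell; omega
  flips := h.flips
  draws := h.draws
  out := h.out
  size_le a' := by
    rcases eq_or_ne a' a with rfl | ha
    · simpa using hv
    · dsimp only
      rw [Function.update_of_ne ha]
      exact (h.size_le a').trans hb

end Sim

/-- Total correctness of loops, with time bounds. -/
theorem Exec.loop_total {d : ℕ} {r : Coins} {ω : Answers d} {c : Expr} {P : Program} (n : ℕ)
    (τ : ℕ → ℕ) (κ : ℕ) (Inv : ℕ → State → Prop)
    (hstep : ∀ j < n, ∀ s, Inv j s → c.eval s.mem ≠ 0 ∧ ∃ t m, Exec r ω P s t m ∧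
      c.cost s.mem + 1 + m ≤ τ j ∧ Inv (j + 1) t)
    (hend : ∀ s, Inv n s → c.eval s.mem = 0 ∧ c.cost s.mem + 1 ≤ κ) (s : State) (hs : Inv 0 s) :
    ∃ t m, Exec r ω (.loop c P) s t m ∧ m ≤ ∑ j ∈ Finset.range n, τ j + κ ∧ Inv n t := by
  -- Induction on the number `k` of remaining passes, since a loop is unfolded at its first pass.
  have key : ∀ k j, j + k = n → ∀ s, Inv j s → ∃ t m, Exec r ω (.loop c P) s t m ∧
      m ≤ ∑ i ∈ Finset.range k, τ (j + i) + κ ∧ Inv n t := by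
    intro k
    induction k with
    | zero =>
      intro j hj s hs
      obtain rfl : j = n := by omega
      obtain ⟨h1, h2⟩ := hend s hs
      exact ⟨s, _, .loop_false h1, by simpa using h2, hs⟩
    | succ k ih =>
      intro j hj s hs
      obtain ⟨h1, t, m, h2, h3, h4⟩ := hstep j (by omega) s hs
      obtain ⟨u, m', h5, h6, h7⟩ := ih (j + 1) (by omega) t h4
      refine ⟨u, _, .loop_true h1 h2 h5, ?_, h7⟩
      rw [Finset.sum_range_succ']
      simp only [add_zero]
      have : ∑ i ∈ Finset.range k, τ (j + 1 + i) = ∑ i ∈ Finset.range k, τ (j + (i + 1)) :=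
        Finset.sum_congr rfl fun i _ => by congr 1; ring
      omega
  obtain ⟨t, m, h1, h2, h3⟩ := key n 0 (by omega) s hs
  exact ⟨t, m, h1, by simpa using h2, h3⟩

/-- Every query takes time, so the bound for the number of queries comes for free with the time
bound. -/
theorem Exec.draws_le {d : ℕ} {r : Coins} {ω : Answers d} {P : Program} {s t : State} {n : ℕ}
    (h : Exec r ω P s t n) : t.draws ≤ s.draws + n := by
  induction h <;> (try dsimp only) <;> omega

/-- The invariant speaks of states in which the counter, cell `5`, has just been set. The body only
has to return this cell unchanged and to establish the invariant for the state with the incremented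
counter. The constant `c` depends on nothing; the cost of the body enters through `κ`. -/
theorem Program.overCoords_total : ∃ c : ℕ, ∀ {d : ℕ} (r : Coins) (ω : Answers d) (P : Program)
    (b κ : ℕ) (Inv : ℕ → State → Prop), 1 ≤ b →
    (∀ j s, Inv j s → s.mem 0 = d ∧ s.mem 5 = j ∧ ∀ a, (s.mem a).size ≤ b) →
    (∀ j < d, ∀ s, Inv j s → ∃ t m, Exec r ω P s t m ∧ m ≤ κ * b ∧ t.mem 5 = j ∧
      (∀ a, (t.mem a).size ≤ b) ∧ Inv (j + 1) { t with mem := Function.update t.mem 5 (j + 1) }) →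
    ∀ s, (∀ a, (s.mem a).size ≤ b) → Inv 0 { s with mem := Function.update s.mem 5 0 } →
    ∃ t m, Exec r ω P.overCoords s t m ∧ m ≤ (c + κ) * b * (d + 1) ∧ Inv d t := by
  obtain ⟨c, hc1, hc⟩ := Expr.exists_bound_list [.lit 5, .lit 0,
    .sub (.load (.lit 0)) (.load (.lit 5)), .add (.load (.lit 5)) (.lit 1)]
  simp only [List.mem_cons, List.not_mem_nil, or_false, forall_eq_or_imp, forall_eq] at hc
  refine ⟨4 * c, fun {d} r ω P b κ Inv hb hi hP s hs h0 => ?_⟩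
  obtain ⟨t, m, h1, h2, h3⟩ := Exec.loop_total (r := r) (ω := ω)
    (c := .sub (.load (.lit 0)) (.load (.lit 5)))
    (P := .seq P (.store (.lit 5) (.add (.load (.lit 5)) (.lit 1)))) d
    (fun _ => (3 * c + κ) * b) (c * b) Inv (by
      intro j hj s hs
      obtain ⟨e0, e5, es⟩ := hi j s hs
      refine ⟨by simp only [Expr.eval, e0, e5]; omega, ?_⟩
      obtain ⟨t, m, h1, h2, h3, h4, h5⟩ := hP j hj s hs
      refine ⟨_, _, .seq h1 (.store _ _ _), ?_, by simpa [Expr.eval, h3] using h5⟩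
      have k1 := hc s.mem b hb es
      have k2 := hc t.mem b hb h4
      nlinarith) (by
      intro s hs
      obtain ⟨e0, e5, es⟩ := hi d s hs
      have k1 := hc s.mem b hb es
      exact ⟨by simp [Expr.eval, e0, e5], k1.2.2.1⟩) _ h0
  refine ⟨t, _, .seq (.store _ _ _) h1, ?_, h3⟩
  have k1 := hc s.mem b hb hs
  simp only [Finset.sum_const, Finset.card_range, smul_eq_mul] at h2
  have : c * b ≤ c * b * (d + 1) := Nat.le_mul_of_pos_right _ (by omega)
  nlinarith

namespace Sim

variable {d : ℕ} {s : State} {S : AState} {b : ℕ}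

/-- Answers are received in the upper half of the scratch cells, because the machine writes to
consecutive addresses and the rows of an array are not consecutive. -/
theorem writePoint (h : Sim d s S b) (hb : 1 ≤ b) (x : Cube d) :
    Sim d { s with mem := writePoint s.mem (8 + d) x, draws := s.draws + 1 }
      { S with draws := S.draws + 1 } b where
  dim := by
    simp only [ReplicableDT.writePoint]
    rw [dif_neg (by omega)]
    exact h.dim
  mem k i j := by
    simp only [ReplicableDT.writePoint]
    rw [dif_neg (by unfold cell; omega)]
    exact h.mem k i j
  flips := h.flips
  draws := by simp [h.draws]
  out := h.out
  size_le a := by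
    simp only [ReplicableDT.writePoint]
    split_ifs
    · cases x _ <;> simp [hb]
    · exact h.size_le a

end Sim

namespace AState

variable {d : ℕ}

/-- Assign the first `n` entries of a row, and count an oracle query. -/
def putPrefix (s : AState) (k i : ℕ) (x : Cube d) (n : ℕ) : AState :=
  { s with
    mem := fun k' i' j' => if h : k' = k ∧ i' = i ∧ j' < d then
        (if j' < n then (x ⟨j', h.2.2⟩).toNat else s.mem k' i' j') else s.mem k' i' j'
    draws := s.draws + 1 }

theorem putPrefix_zero (s : AState) (k i : ℕ) (x : Cube d) :
    s.putPrefix k i x 0 = { s with draws := s.draws + 1 } := by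
  simp [putPrefix]

theorem putPrefix_dim (s : AState) (k i : ℕ) (x : Cube d) :
    s.putPrefix k i x d = s.putPoint k i x := by
  simp only [putPrefix, putPoint]
  congr 1
  funext k' i' j'
  by_cases h : k' = k ∧ i' = i ∧ j' < d
  · rw [dif_pos h, dif_pos h, if_pos h.2.2]
  · rw [dif_neg h, dif_neg h]

theorem put_putPrefix (s : AState) (k i : ℕ) (x : Cube d) {n : ℕ} (hn : n < d) :
    (s.putPrefix k i x n).put k i n (x ⟨n, hn⟩).toNat = s.putPrefix k i x (n + 1) := by
  simp only [putPrefix, put]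
  congr 1
  funext k' i' j'
  by_cases h : k' = k ∧ i' = i ∧ j' = n
  · obtain ⟨rfl, rfl, rfl⟩ := h
    rw [if_pos ⟨rfl, rfl, rfl⟩, dif_pos ⟨rfl, rfl, hn⟩, if_pos (by omega)]
  · rw [if_neg h]
    by_cases h' : k' = k ∧ i' = i ∧ j' < d
    · rw [dif_pos h', dif_pos h']
      have : j' < n + 1 ↔ j' < n := by
        have := fun e => h ⟨h'.1, h'.2.1, e⟩
        omega
      simp only [this]
    · rw [dif_neg h', dif_neg h']

end AState

/-- The program is simulated by its translation. -/
def ACode.Simulated (P : ACode) : Prop :=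
  ∃ c : ℕ, ∀ {d : ℕ} (r : Coins) (ω : Answers d) (s : State) (S : AState) (b : ℕ), 1 ≤ b →
    Sim d s S b → ∃ t n, Exec r ω P.comp s t n ∧ Sim d t (P.den r ω S) (b + P.steps r ω S) ∧
      n ≤ c * ((b + P.steps r ω S) * P.steps r ω S)

/-! ### Simulation of array programs with polynomial overhead. -/

namespace ACode

theorem simulated_set (k : ℕ) (i j v : AExpr) : (set k i j v).Simulated := by
  obtain ⟨c, hc1, hc⟩ := Expr.exists_bound_list [.cellE k i.comp j.comp, v.comp]
  simp only [List.mem_cons, List.not_mem_nil, or_false, forall_eq_or_imp, forall_eq] at hc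
  refine ⟨2 * c, fun {d} r ω s S b hb h => ⟨_, _, .store _ _ _, ?_, ?_⟩⟩
  · rw [Expr.eval_cellE, h.dim, h.eval, h.eval, h.eval]
    refine h.put (by omega) _ _ _ ?_
    have := AExpr.size_eval_le h.entry_size_le v
    simp only [steps]; omega
  · have k1 := hc s.mem b hb h.size_le
    have h1 : 1 ≤ (set k i j v).steps r ω S := by simp [steps]
    generalize (set k i j v).steps r ω S = q at *
    have h2 : c * b ≤ c * ((b + q) * q) := Nat.mul_le_mul_left _ (by nlinarith)
    linarith

/-- The query row is copied to the cells from `8` on, the answer is received from `8 + d` on and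
then copied to its row. The index of the target row is saved in cell `6` beforehand, since `j` may
itself read the array that is being overwritten. -/
theorem simulated_draw (p : ℕ) (i : AExpr) (q : ℕ) (j : AExpr) : (draw p i q j).Simulated := by
  obtain ⟨c, hc1, hc⟩ := Expr.exists_bound_list [.add (.lit 8) (.load (.lit 5)),
    .load (.cellE p i.comp (.load (.lit 5))), .lit 8, .add (.lit 8) (.load (.lit 0)),
    .lit 6, j.comp, .cellE q (.load (.lit 6)) (.load (.lit 5)),
    .load (.add (.add (.lit 8) (.load (.lit 0))) (.load (.lit 5)))]
  obtain ⟨c', hc'⟩ := Program.overCoords_total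
  simp only [List.mem_cons, List.not_mem_nil, or_false, forall_eq_or_imp, forall_eq] at hc
  refine ⟨2 * (c' + 2 * c) + 4 * c + 1, fun {d} r ω s S b hb h => ?_⟩
  set i0 := i.eval S.mem with hi0
  set j0 := j.eval S.mem with hj0
  set b' := b + j.growth S.mem + 1 with hb'
  obtain ⟨t, m, h1, h2, h3, h4, h5⟩ := hc' r ω (.store (.add (.lit 8) (.load (.lit 5)))
        (.load (.cellE p i.comp (.load (.lit 5))))) (b + d) (2 * c)
    (fun j s' => Sim d s' S (b + d) ∧ s'.mem 5 = j ∧ ∀ i < j, s'.mem (8 + i) = S.mem p i0 i)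
    (by omega) (fun j s' hs => ⟨hs.1.dim, hs.2.1, hs.1.size_le⟩) (by
      rintro j hj s' ⟨e1, e2, e3⟩
      have hv : (Expr.load (.cellE p i.comp (.load (.lit 5)))).eval s'.mem = S.mem p i0 j := by
        simp only [Expr.eval, Expr.eval_cellE, e1.dim, e1.eval, e2, e1.mem, ← hi0]
      have ha : (Expr.add (.lit 8) (.load (.lit 5))).eval s'.mem = 8 + j := by
        simp [Expr.eval, e2]
      have e4 := e1.scratch (b' := b + d) le_rfl (a := 8 + j) (v := S.mem p i0 j) (by omega)
        (by omega) (e1.entry_size_le _ _ _)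
      refine ⟨_, _, .store _ _ _, ?_, ?_, ?_, ?_, ?_, ?_⟩
      · have := hc s'.mem (b + d) (by omega) e1.size_le
        nlinarith
      · rw [hv, ha]
        dsimp only
        rw [Function.update_of_ne (by omega), e2]
      · rw [hv, ha]
        exact e4.size_le
      · rw [hv, ha]
        refine e4.scratch le_rfl (by omega) (by omega) ?_
        exact (Nat.size_le.2 Nat.lt_two_pow_self).trans (by omega)
      · simp
      · intro i hi
        rw [hv, ha]
        dsimp only
        rw [Function.update_of_ne (by omega)]
        rcases Nat.lt_succ_iff_lt_or_eq.1 hi with hi | rfl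
        · rw [Function.update_of_ne (by omega), e3 i hi]
        · simp) s (fun a => (h.size_le a).trans (by omega))
      ⟨h.scratch (by omega) (by omega) (by omega) (by simp), by simp, by simp⟩
  set x := ω (S.draws, readSubcube d (S.mem p i0) 0) with hx
  have hdraw := Exec.draw (r := r) (ω := ω) (.lit 8) (.add (.lit 8) (.load (.lit 0))) t
  have hsub : readSubcube d t.mem ((Expr.lit 8).eval t.mem) = readSubcube d (S.mem p i0) 0 := by
    funext c
    simp [readSubcube, Expr.eval, h5 c c.2]
  have hadr : (Expr.add (.lit 8) (.load (.lit 0))).eval t.mem = 8 + d := by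
    simp [Expr.eval, h3.dim]
  rw [hsub, hadr, h3.draws, ← hx, ← h3.draws] at hdraw
  set T : State := { t with mem := writePoint t.mem (8 + d) x, draws := t.draws + 1 } with hT
  have hTs : Sim d T { S with draws := S.draws + 1 } (b + d) := h3.writePoint (by omega) x
  have hTj : j.comp.eval T.mem = j0 := hTs.eval j
  have hst := Exec.store (r := r) (ω := ω) (.lit 6) j.comp T
  rw [hTj] at hst
  have hj0s : j0.size ≤ b + d + j.growth S.mem :=
    (AExpr.size_eval_le h.entry_size_le j).trans (by omega)
  set B := b + d + j.growth S.mem with hB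
  have hT6 := hTs.scratch (b' := B) (by omega) (a := 6) (v := j0) (by omega) (by omega) hj0s
  set T6 : State := { T with mem := Function.update T.mem 6 j0 } with hT6d
  -- The array state when `n` coordinates of the answer have been written back; the query is counted
  -- from the start.
  set part : ℕ → AState := fun n => S.putPrefix q j0 x n with hpart
  have hp0 : part 0 = { S with draws := S.draws + 1 } := S.putPrefix_zero q j0 x
  have hpd : part d = S.putPoint q j0 x := S.putPrefix_dim q j0 x
  have hps : ∀ n (hn : n < d), (part n).put q j0 n (x ⟨n, hn⟩).toNat = part (n + 1) :=
    fun n hn => S.put_putPrefix q j0 x hn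
  obtain ⟨t', m', k1, k2, k3, k4, k5, k6⟩ := hc' r ω
    (.store (.cellE q (.load (.lit 6)) (.load (.lit 5)))
            (.load (.add (.add (.lit 8) (.load (.lit 0))) (.load (.lit 5))))) B (2 * c)
    (fun n s' => Sim d s' (part n) B ∧ s'.mem 5 = n ∧ s'.mem 6 = j0 ∧
      ∀ (i : ℕ) (hi : i < d), s'.mem (8 + d + i) = (x ⟨i, hi⟩).toNat)
    (by omega) (fun j s' hs => ⟨hs.1.dim, hs.2.1, hs.1.size_le⟩) (by
      rintro n hn s' ⟨e1, e2, e3, e4⟩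
      have hv : (Expr.load (.add (.add (.lit 8) (.load (.lit 0))) (.load (.lit 5)))).eval s'.mem
          = (x ⟨n, hn⟩).toNat := by
        simp only [Expr.eval, e1.dim, e2, e4 n hn]
      have ha : (Expr.cellE q (.load (.lit 6)) (.load (.lit 5))).eval s'.mem = cell d q j0 n := by
        simp [Expr.eval_cellE, Expr.eval, e2, e3, e1.dim]
      have hcell : ∀ k i j a, a < 8 + 2 * d → a ≠ cell d k i j := by
        intro k i j a ha; unfold cell; omega
      have e5 := e1.put (b' := B) le_rfl q j0 n (v := (x ⟨n, hn⟩).toNat)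
        (by cases x ⟨n, hn⟩ <;> simp; omega)
      rw [hps n hn] at e5
      refine ⟨_, _, .store _ _ _, ?_, ?_, ?_, ?_, ?_, ?_, ?_⟩
      · have := hc s'.mem B (by omega) e1.size_le
        nlinarith
      · rw [hv, ha]
        dsimp only
        rw [Function.update_of_ne (hcell _ _ _ _ (by omega)), e2]
      · rw [hv, ha]
        exact e5.size_le
      · rw [hv, ha]
        refine e5.scratch le_rfl (by omega) (by omega) ?_
        exact (Nat.size_le.2 Nat.lt_two_pow_self).trans (by omega)
      · simp
      · rw [hv, ha]
        dsimp only
        rw [Function.update_of_ne (by omega), Function.update_of_ne (hcell _ _ _ _ (by omega)), e3]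
      · intro i hi
        rw [hv, ha]
        dsimp only
        rw [Function.update_of_ne (by omega), Function.update_of_ne (hcell _ _ _ _ (by omega)),
          e4 i hi]) T6 hT6.size_le (by
      refine ⟨?_, by simp, by simp [hT6d], ?_⟩
      · rw [hp0]
        exact hT6.scratch le_rfl (by omega) (by omega) (by simp)
      · intro i hi
        simp only [hT6d, hT]
        rw [Function.update_of_ne (by omega), Function.update_of_ne (by omega), writePoint,
          dif_pos (by omega)]
        simp)
  have hbs : B ≤ b + (draw p i q j).steps r ω S := by simp only [steps]; omega
  refine ⟨t', _, .seq h1 (.seq hdraw (.seq hst k1)), ?_, ?_⟩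
  · simp only [den]
    rw [hpd] at k3
    exact k3.mono hbs
  · have q1 := hc t.mem (b + d) (by omega) h3.size_le
    have q2 := hc T.mem (b + d) (by omega) hTs.size_le
    have hd1 : d + 1 ≤ (draw p i q j).steps r ω S := by simp only [steps]; omega
    have hB1 : b + d ≤ B := by omega
    generalize (draw p i q j).steps r ω S = σ at *
    have w1 : (c' + 2 * c) * (b + d) * (d + 1) ≤ (c' + 2 * c) * ((b + σ) * σ) := by
      rw [mul_assoc]
      exact Nat.mul_le_mul_left _ (Nat.mul_le_mul (by omega) hd1)
    have w2 : (c' + 2 * c) * B * (d + 1) ≤ (c' + 2 * c) * ((b + σ) * σ) := by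
      rw [mul_assoc]
      exact Nat.mul_le_mul_left _ (Nat.mul_le_mul hbs hd1)
    have w3 : c * (b + d) ≤ c * ((b + σ) * σ) := Nat.mul_le_mul_left _
      ((by omega : b + d ≤ b + σ).trans (Nat.le_mul_of_pos_right _ (by omega)))
    have w4 : d + 1 ≤ (b + σ) * σ := hd1.trans (Nat.le_mul_of_pos_left _ (by omega))
    obtain ⟨-, -, q3, q4, -, -, -, -⟩ := q1
    obtain ⟨-, -, -, -, q5, q6, -, -⟩ := q2
    have : (2 * (c' + 2 * c) + 4 * c + 1) * ((b + σ) * σ) =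
      (c' + 2 * c) * ((b + σ) * σ) + (c' + 2 * c) * ((b + σ) * σ) + 4 * (c * ((b + σ) * σ))
        + (b + σ) * σ := by ring
    rw [this]
    omega

/-- The bit length is the number of halvings that lead to zero. It is therefore also the number of
passes of the loop, and is included in `steps` to pay for them. -/
theorem simulated_size (k : ℕ) (v : AExpr) : (size k v).Simulated := by
  obtain ⟨c, hc1, hc⟩ := Expr.exists_bound_list [.lit 5, v.comp, .lit 6, .lit 0, .load (.lit 5),
    .div (.load (.lit 5)) (.lit 2), .add (.load (.lit 6)) (.lit 1),
    .cellE k (.lit 0) (.lit 0), .load (.lit 6)]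
  simp only [List.mem_cons, List.not_mem_nil, or_false, forall_eq_or_imp, forall_eq] at hc
  refine ⟨20 * c, fun {d} r ω s S b hb h => ?_⟩
  set B := b + (size k v).steps r ω S with hB
  set v0 := v.eval S.mem with hv0
  have hv0s : v0.size ≤ B := by
    have := AExpr.size_eval_le h.entry_size_le v
    simp only [hB, steps, ← hv0] at this ⊢; omega
  have hss : ∀ j ≤ v0.size, j.size ≤ B := fun j hj =>
    (Nat.size_le.2 Nat.lt_two_pow_self).trans (hj.trans hv0s)
  have hst := Exec.store (r := r) (ω := ω) (.lit 5) v.comp s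
  rw [h.eval, ← hv0] at hst
  have h5 := h.scratch (b' := B) (by omega) (a := 5) (v := v0) (by omega) (by omega) hv0s
  set t5 : State := { s with mem := Function.update s.mem 5 v0 } with ht5
  have h6 := h5.scratch (b' := B) le_rfl (a := 6) (v := 0) (by omega) (by omega) (by simp)
  have hst6 := Exec.store (r := r) (ω := ω) (.lit 6) (.lit 0) t5
  obtain ⟨t, m, k1, k2, k3, k4, k5⟩ := Exec.loop_total (r := r) (ω := ω) (c := .load (.lit 5))
    (P := (.seq (.store (.lit 5) (.div (.load (.lit 5)) (.lit 2)))
              (.store (.lit 6) (.add (.load (.lit 6)) (.lit 1))))) v0.size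
    (fun _ => 5 * c * B) (c * B)
    (fun j s' => Sim d s' S B ∧ s'.mem 5 = v0 / 2 ^ j ∧ s'.mem 6 = j) (by
      rintro j hj s' ⟨e1, e2, e3⟩
      have hpos : v0 / 2 ^ j ≠ 0 :=
        (Nat.div_pos (Nat.lt_size.1 hj) (by positivity)).ne'
      refine ⟨by simpa [Expr.eval, e2] using hpos, _, _, .seq (.store _ _ _) (.store _ _ _),
        ?_, ?_, ?_, ?_⟩
      · have w1 := hc s'.mem B (by omega) e1.size_le
        have e4 := e1.scratch (b' := B) le_rfl (a := 5) (v := v0 / 2 ^ j / 2) (by omega) (by omega)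
          ((Nat.size_le_size ((Nat.div_le_self _ _).trans (Nat.div_le_self _ _))).trans hv0s)
        have w2 := hc _ B (by omega) e4.size_le
        simp only [Expr.eval, e2] at w2 ⊢
        obtain ⟨a1, -, -, -, a2, a3, -⟩ := w1
        obtain ⟨-, -, a4, -, -, -, a5, -⟩ := w2
        have : 5 * c * B = c * B + c * B + c * B + c * B + c * B := by ring
        rw [this]
        omega
      · have e4 := e1.scratch (b' := B) le_rfl (a := 5) (v := v0 / 2 ^ j / 2) (by omega) (by omega)
          ((Nat.size_le_size ((Nat.div_le_self _ _).trans (Nat.div_le_self _ _))).trans hv0s)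
        simp only [Expr.eval, e2]
        refine e4.scratch (b' := B) le_rfl (by omega) (by omega) ?_
        rw [Function.update_of_ne (by norm_num), e3]
        exact hss _ (by omega)
      · simp [Expr.eval, e2, Nat.div_div_eq_div_mul, pow_succ]
      · simp [Expr.eval, e3]) (by
      rintro s' ⟨e1, e2, e3⟩
      have w1 := hc s'.mem B (by omega) e1.size_le
      refine ⟨?_, w1.2.2.2.2.1⟩
      simp only [Expr.eval, e2]
      exact Nat.div_eq_of_lt (Nat.lt_size_self _)) _
    ⟨h6, by simp [ht5], by simp⟩
  have hfin := Exec.store (r := r) (ω := ω) (.cellE k (.lit 0) (.lit 0)) (.load (.lit 6)) t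
  refine ⟨_, _, .seq hst (.seq hst6 (.seq k1 hfin)), ?_, ?_⟩
  · rw [Expr.eval_cellE, k3.dim]
    simp only [Expr.eval, k5, den]
    exact k3.put le_rfl _ _ _ (hss _ le_rfl)
  · have w1 := hc s.mem B (by omega) (fun a => (h.size_le a).trans (by omega))
    have w2 := hc t5.mem B (by omega) h5.size_le
    have w3 := hc t.mem B (by omega) k3.size_le
    simp only [Finset.sum_const, Finset.card_range, smul_eq_mul] at k2
    obtain ⟨a1, a2, -⟩ := w1
    obtain ⟨-, -, a3, a4, -⟩ := w2
    obtain ⟨-, -, -, -, -, -, -, a5, a6⟩ := w3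
    have hst1 : v0.size + 1 ≤ (size k v).steps r ω S := by simp only [steps, ← hv0]; omega
    have : (20 * c) * (B * (size k v).steps r ω S) ≥ (20 * c) * (B * (v0.size + 1)) := by gcongr
    have e : (20 * c) * (B * (v0.size + 1)) = 4 * (v0.size * (5 * c * B)) + 20 * (c * B) := by ring
    omega

/-- The constant depends on the program text alone. If `b` bounds the words at the start, then `b +
steps` bounds them throughout, and each step costs a constant times this length. -/
theorem simulated : ∀ P : ACode, P.Wf → P.Simulated
  | .skip, _ => ⟨1, fun {d} r ω s S b hb h => ⟨s, 1, .skip s, h.mono (by omega), by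
      simp only [steps]; omega⟩⟩
  | .set k i j v, _ => simulated_set k i j v
  | .seq P Q, hw => by
    obtain ⟨c1, h1⟩ := simulated P hw.1
    obtain ⟨c2, h2⟩ := simulated Q hw.2
    refine ⟨c1 + c2, fun {d} r ω s S b hb h => ?_⟩
    obtain ⟨t, n, e1, e2, e3⟩ := h1 r ω s S b hb h
    obtain ⟨u, m, f1, f2, f3⟩ := h2 r ω t _ _ (by omega) e2
    refine ⟨u, _, .seq e1 f1, f2.mono (by simp only [steps]; omega), ?_⟩
    simp only [steps]
    generalize P.steps r ω S = p at *
    generalize Q.steps r ω (P.den r ω S) = q at *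
    have g1 : (b + p) * p ≤ (b + (p + q)) * (p + q) := Nat.mul_le_mul (by omega) (by omega)
    have g2 : (b + p + q) * q ≤ (b + (p + q)) * (p + q) := Nat.mul_le_mul (by omega) (by omega)
    calc n + m ≤ c1 * ((b + (p + q)) * (p + q)) + c2 * ((b + (p + q)) * (p + q)) :=
          Nat.add_le_add (e3.trans (Nat.mul_le_mul_left _ g1)) (f3.trans (Nat.mul_le_mul_left _ g2))
      _ = _ := by ring
  | .ite c P Q, hw => by
    obtain ⟨c1, h1⟩ := simulated P hw.1
    obtain ⟨c2, h2⟩ := simulated Q hw.2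
    obtain ⟨c3, hc1, hc⟩ := Expr.exists_bound_list [c.comp]
    simp only [List.mem_cons, List.not_mem_nil, or_false, forall_eq] at hc
    refine ⟨c1 + c2 + c3, fun {d} r ω s S b hb h => ?_⟩
    have k := hc s.mem b hb h.size_le
    simp only [steps, den]
    generalize hp : P.steps r ω S = p at *
    generalize hq : Q.steps r ω S = q at *
    have g0 : b ≤ (b + (1 + p + q)) * (1 + p + q) := by nlinarith
    have g1 : (b + p) * p ≤ (b + (1 + p + q)) * (1 + p + q) :=
      Nat.mul_le_mul (by omega) (by omega)
    have g2 : (b + q) * q ≤ (b + (1 + p + q)) * (1 + p + q) :=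
      Nat.mul_le_mul (by omega) (by omega)
    by_cases hce : c.eval S.mem ≠ 0
    · obtain ⟨t, n, e1, e2, e3⟩ := h1 r ω s S b hb h
      rw [hp] at e2 e3
      refine ⟨t, _, .ite_true (by rwa [h.eval]) e1, ?_, ?_⟩
      · rw [if_pos hce]; exact e2.mono (by omega)
      · have := Nat.mul_le_mul_left c1 g1
        have := Nat.mul_le_mul_left c3 g0
        have : 0 ≤ c2 * ((b + (1 + p + q)) * (1 + p + q)) := Nat.zero_le _
        rw [add_mul, add_mul]
        omega
    · obtain ⟨t, n, e1, e2, e3⟩ := h2 r ω s S b hb h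
      rw [hq] at e2 e3
      refine ⟨t, _, .ite_false (by rw [h.eval]; exact not_not.1 hce) e1, ?_, ?_⟩
      · rw [if_neg hce]; exact e2.mono (by omega)
      · have := Nat.mul_le_mul_left c2 g2
        have := Nat.mul_le_mul_left c3 g0
        have : 0 ≤ c1 * ((b + (1 + p + q)) * (1 + p + q)) := Nat.zero_le _
        rw [add_mul, add_mul]
        omega
  | .rep k n P, hw => by
    obtain ⟨hk, hn, hP⟩ := hw
    obtain ⟨c1, h1⟩ := simulated P hP
    obtain ⟨c, hc1, hc⟩ := Expr.exists_bound_list [.cellE k (.lit 0) (.lit 0), .lit 0,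
      .sub n.comp (.load (.cellE k (.lit 0) (.lit 0))),
      .add (.load (.cellE k (.lit 0) (.lit 0))) (.lit 1)]
    simp only [List.mem_cons, List.not_mem_nil, or_false, forall_eq_or_imp, forall_eq] at hc
    refine ⟨c1 + 4 * c, fun {d} r ω s S b hb h => ?_⟩
    set n0 := n.eval S.mem with hn0
    -- The state at the start of pass `j`, with the counter already set; the machine sets the
    -- counter for the next pass at the end of the current one.
    set T : ℕ → AState := fun j => (passes r ω k P j S).put k 0 0 j with hT
    set q : ℕ → ℕ := fun j => 2 + P.steps r ω (T j) with hq
    have hsteps : (rep k n P).steps r ω S = 2 + ∑ j ∈ Finset.range n0, q j := rfl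
    set B := b + (rep k n P).steps r ω S with hB
    have hpart : ∀ j ≤ n0, b + 1 + ∑ i ∈ Finset.range j, q i ≤ B := by
      intro j hj
      have := Finset.sum_le_sum_of_subset (f := q) (Finset.range_mono hj)
      omega
    -- Each pass is charged at least two steps, so the counter, and all the more its bit length,
    -- fits into the word length granted so far.
    have hjle : ∀ j ≤ n0, j ≤ ∑ i ∈ Finset.range j, q i := by
      intro j _
      calc j = ∑ i ∈ Finset.range j, 1 := by simp
        _ ≤ _ := Finset.sum_le_sum fun i _ => by simp only [hq]; omega
    -- The machine evaluates the bound anew in each pass; well-formedness guarantees the same value.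
    have hTn : ∀ j, n.eval (T j).mem = n0 := by
      intro j
      refine AExpr.eval_congr n fun k' hk' => ?_
      have := hn k' hk'
      simp only [hT]
      rw [AState.put_mem_ne _ _ _ _ (by simp at this; exact this.1), passes_mem r ω this]
    have hTk : ∀ j, (T j).mem k 0 0 = j := by intro j; simp [hT]
    have hTs : ∀ j, (P.den r ω (T j)).put k 0 0 (j + 1) = T (j + 1) := fun j => rfl
    have hst := Exec.store (r := r) (ω := ω) (.cellE k (.lit 0) (.lit 0)) (.lit 0) s
    rw [Expr.eval_cellE, h.dim] at hst
    simp only [Expr.eval] at hst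
    have h0 : Sim d { s with mem := Function.update s.mem (cell d k 0 0) 0 } (T 0) (b + 1) :=
      h.put (by omega) k 0 0 (by simp)
    obtain ⟨t, m, e1, e2, e3⟩ := Exec.loop_total (r := r) (ω := ω)
      (c := .sub n.comp (.load (.cellE k (.lit 0) (.lit 0))))
      (P := .seq P.comp (.store (.cellE k (.lit 0) (.lit 0))
          (.add (.load (.cellE k (.lit 0) (.lit 0))) (.lit 1)))) n0
      (fun j => (c1 + 3 * c) * (B * q j)) (c * B)
      (fun j s' => Sim d s' (T j) (b + 1 + ∑ i ∈ Finset.range j, q i)) (by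
        intro j hj s' hs'
        have hx : (Expr.load (.cellE k (.lit 0) (.lit 0))).eval s'.mem = j := by
          simp only [Expr.eval, Expr.eval_cellE, hs'.dim, hs'.mem, hTk]
        have hpj := hpart (j + 1) hj
        rw [Finset.sum_range_succ] at hpj
        refine ⟨by rw [Expr.eval, hx, hs'.eval, hTn]; omega, ?_⟩
        obtain ⟨t, m, e1, e2, e3⟩ := h1 r ω s' _ _ (by omega) hs'
        have hx' : (Expr.load (.cellE k (.lit 0) (.lit 0))).eval t.mem = j := by
          simp only [Expr.eval, Expr.eval_cellE, e2.dim, e2.mem]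
          rw [den_mem r ω P _ hk, hTk]
        refine ⟨_, _, .seq e1 (.store _ _ _), ?_, ?_⟩
        · have w1 := hc s'.mem B (by omega) (fun a => (hs'.size_le a).trans (by omega))
          have w2 := hc t.mem B (by omega) (fun a => (e2.size_le a).trans (by
            simp only [hq] at hpj ⊢; omega))
          obtain ⟨-, -, a1, -⟩ := w1
          obtain ⟨a2, -, -, a3⟩ := w2
          have hqj : P.steps r ω (T j) ≤ q j := by simp only [hq]; omega
          have w3 : (b + 1 + ∑ i ∈ Finset.range j, q i + P.steps r ω (T j)) * P.steps r ω (T j)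
            ≤ B * q j := Nat.mul_le_mul (by omega) hqj
          have w4 := Nat.mul_le_mul_left c1 w3
          have w5 : c * B ≤ c * (B * q j) :=
            Nat.mul_le_mul_left _ (Nat.le_mul_of_pos_right _ (by simp only [hq]; omega))
          have : (c1 + 3 * c) * (B * q j) = c1 * (B * q j) + 3 * (c * (B * q j)) := by ring
          rw [this]
          omega
        · have hx2 : (Expr.add (.load (.cellE k (.lit 0) (.lit 0))) (.lit 1)).eval t.mem = j + 1 :=
            congrArg (· + 1) hx'
          rw [Expr.eval_cellE, e2.dim, hx2]
          simp only [Expr.eval]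
          rw [← hTs]
          refine e2.put (by rw [Finset.sum_range_succ]; simp only [hq]; omega) _ _ _ ?_
          refine (Nat.size_le.2 Nat.lt_two_pow_self).trans ?_
          have := hjle (j + 1) hj
          omega) (by
        intro s' hs'
        have hx : (Expr.load (.cellE k (.lit 0) (.lit 0))).eval s'.mem = n0 := by
          simp only [Expr.eval, Expr.eval_cellE, hs'.dim, hs'.mem, hTk]
        have w1 := hc s'.mem B (by omega)
          (fun a => (hs'.size_le a).trans (hpart n0 le_rfl))
        exact ⟨by rw [Expr.eval, hx, hs'.eval, hTn]; omega, w1.2.2.1⟩) _ (by simpa using h0)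
    refine ⟨t, _, .seq hst e1, e3.mono (hpart n0 le_rfl), ?_⟩
    have w1 := hc s.mem B (by omega) (fun a => (h.size_le a).trans (by omega))
    rw [← Finset.mul_sum, ← Finset.mul_sum] at e2
    rw [hsteps]
    generalize ∑ j ∈ Finset.range n0, q j = Q at *
    have : (c1 + 4 * c) * (B * (2 + Q)) = (c1 + 3 * c) * (B * Q) + c * (B * Q) + 2 * c1 * B
      + 8 * (c * B) := by ring
    rw [this]
    have := w1.1
    have := w1.2.1
    omega
  | .flip k, _ => by
    obtain ⟨c, hc1, hc⟩ := Expr.exists_bound_list [.cellE k (.lit 0) (.lit 0)]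
    simp only [List.mem_cons, List.not_mem_nil, or_false, forall_eq] at hc
    refine ⟨c, fun {d} r ω s S b hb h => ⟨_, _, .flip _ _, ?_, ?_⟩⟩
    · rw [Expr.eval_cellE, h.dim, h.flips]
      have := h.put (b' := b + (flip k).steps r ω S) (by omega) k 0 0 (v := (r S.flips).toNat)
        (by cases r S.flips <;> simp; omega)
      exact ⟨this.dim, this.mem, rfl, this.draws, this.out, this.size_le⟩
    · have k1 := hc s.mem b hb h.size_le
      simp only [steps]
      nlinarith
  | .draw p i q j, _ => simulated_draw p i q j
  | .emit v, _ => by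
    obtain ⟨c, hc1, hc⟩ := Expr.exists_bound_list [v.comp]
    simp only [List.mem_cons, List.not_mem_nil, or_false, forall_eq] at hc
    refine ⟨c, fun {d} r ω s S b hb h => ⟨_, _, .emit _ _, ?_, ?_⟩⟩
    · rw [h.eval]
      have := h.mono (b' := b + (emit v).steps r ω S) (by omega)
      exact ⟨this.dim, this.mem, this.flips, this.draws, by simp [den, this.out], this.size_le⟩
    · have k1 := hc s.mem b hb h.size_le
      simp only [steps]
      nlinarith
  | .size k v, _ => simulated_size k v

end ACode
namespace ACode

/-! ### Static bounds for the number of steps -/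

/-- The arrays that loop bounds depend on. -/
def boundIds : ACode → List ℕ
  | seq P Q => P.boundIds ++ Q.boundIds
  | ite _ P Q => P.boundIds ++ Q.boundIds
  | rep _ n P => n.ids ++ P.boundIds
  | _ => []

/-- All stored values are mild, and no loop bound is changed by the program. -/
def Static : ACode → Prop
  | set _ _ _ v => v.mild
  | seq P Q => P.Static ∧ Q.Static ∧ ∀ k ∈ Q.boundIds, k ∉ P.writes
  | ite _ P Q => P.Static ∧ Q.Static
  | rep k _ P => P.Static ∧ ∀ k' ∈ P.boundIds, k' ∉ k :: P.writes
  | draw _ _ _ j => j.mild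
  | size _ _ => False
  | _ => True

/-- Bound for the number of steps, from the values of the loop bounds at the beginning. -/
def stepBound (d : ℕ) (M : Store) : ACode → ℕ
  | set _ _ _ v => 1 + v.rate
  | seq P Q => P.stepBound d M + Q.stepBound d M
  | ite _ P Q => 1 + P.stepBound d M + Q.stepBound d M
  | rep _ n P => 2 + n.eval M * (2 + P.stepBound d M)
  | draw _ _ _ j => 4 * d + 4 + j.rate
  | _ => 1

theorem stepBound_congr {d : ℕ} {M M' : Store} : ∀ P : ACode, (∀ k ∈ P.boundIds, M k = M' k) →
    P.stepBound d M = P.stepBound d M'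
  | seq P Q, h | ite _ P Q, h => by
    simp only [boundIds, List.mem_append] at h
    simp only [stepBound]
    rw [stepBound_congr P fun k hk => h k (Or.inl hk),
      stepBound_congr Q fun k hk => h k (Or.inr hk)]
  | rep k n P, h => by
    simp only [boundIds, List.mem_append] at h
    simp only [stepBound]
    rw [stepBound_congr P fun k hk => h k (Or.inr hk),
      AExpr.eval_congr n fun k hk => h k (Or.inl hk)]
  | skip, _ | set _ _ _ _, _ | flip _, _ | draw _ _ _ _, _ | emit _, _ | size _ _, _ => rfl

variable {d : ℕ} (r : Coins) (ω : Answers d)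

/-- Mild assignments grow words by a constant, and `Static` ensures that every loop bound still has
its initial value when the loop is reached. Hence the count can be read off the initial memory,
without following the execution. -/
theorem steps_le : ∀ (P : ACode) (s : AState), P.Static → P.steps r ω s ≤ P.stepBound d s.mem
  | skip, _, _ | flip _, _, _ | emit _, _, _ => le_rfl
  | set _ _ _ v, s, h => by
    simp only [Static] at h
    simp [steps, stepBound, AExpr.growth, h]
  | draw _ _ _ j, s, h => by
    simp only [Static] at h
    simp [steps, stepBound, AExpr.growth, h]
  | seq P Q, s, h => by
    obtain ⟨h1, h2, h3⟩ := h
    simp only [steps, stepBound]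
    refine Nat.add_le_add (steps_le P s h1) ((steps_le Q _ h2).trans_eq ?_)
    exact stepBound_congr Q fun k hk => den_mem r ω P s (h3 k hk)
  | ite _ P Q, s, h => by
    have h1 := steps_le P s h.1
    have h2 := steps_le Q s h.2
    simp only [steps, stepBound]
    omega
  | rep k n P, s, h => by
    simp only [steps, stepBound]
    refine Nat.add_le_add_left ?_ _
    refine (Finset.sum_le_card_nsmul _ _ (2 + P.stepBound d s.mem) fun j _ => ?_).trans (by simp)
    refine Nat.add_le_add_left ((steps_le P _ h.1).trans_eq ?_) _
    refine stepBound_congr P fun k' hk' => ?_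
    have := h.2 k' hk'
    rw [AState.put_mem_ne _ _ _ _ (by simp at this; exact this.1), passes_mem r ω this]
  | size _ _, _, h => h.elim

/-! ### Reasoning about loops -/

/-- A loop rule in which the invariant always sees the counter already set. Inside a pass, all
arrays outside the frame of the loop are known to be unchanged. -/
theorem rep_rule {P : ACode} {k : ℕ} {e : AExpr} {s : AState} (Inv : ℕ → AState → Prop)
    (h0 : Inv 0 (s.put k 0 0 0))
    (hs : ∀ j < e.eval s.mem, ∀ t, t.mem k 0 0 = j →
      (∀ k' ∉ k :: P.writes, t.mem k' = s.mem k') → Inv j t →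
      Inv (j + 1) ((P.den r ω t).put k 0 0 (j + 1))) :
    Inv (e.eval s.mem) ((rep k e P).den r ω s) := by
  have key : ∀ j ≤ e.eval s.mem, Inv j ((passes r ω k P j s).put k 0 0 j) := by
    intro j
    induction j with
    | zero => intro _; exact h0
    | succ j ih =>
      intro hj
      refine hs j hj _ (by simp) (fun k' hk' => ?_) (ih (by omega))
      rw [AState.put_mem_ne _ _ _ _ (by simp at hk'; exact hk'.1)]
      exact passes_mem r ω hk' j s
  exact key _ le_rfl

/-- Programs without random bits, queries and output. -/
def Quiet : ACode → Prop
  | seq P Q => P.Quiet ∧ Q.Quiet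
  | ite _ P Q => P.Quiet ∧ Q.Quiet
  | rep _ _ P => P.Quiet
  | flip _ => False
  | draw _ _ _ _ => False
  | emit _ => False
  | _ => True

theorem den_quiet : ∀ (P : ACode) (s : AState), P.Quiet → (P.den r ω s).flips = s.flips ∧
    (P.den r ω s).draws = s.draws ∧ (P.den r ω s).out = s.out
  | skip, _, _ | set _ _ _ _, _, _ | size _ _, _, _ => ⟨rfl, rfl, rfl⟩
  | seq P Q, s, h => by
    have h1 := den_quiet P s h.1
    have h2 := den_quiet Q (P.den r ω s) h.2
    simp only [den]
    rw [h2.1, h2.2.1, h2.2.2]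
    exact h1
  | ite c P Q, s, h => by
    simp only [den]
    split_ifs
    · exact den_quiet P s h.1
    · exact den_quiet Q s h.2
  | rep k n P, s, h =>
    rep_rule r ω (fun _ t => t.flips = s.flips ∧ t.draws = s.draws ∧ t.out = s.out)
      ⟨rfl, rfl, rfl⟩ fun j _ t _ _ ht => by
        have := den_quiet P t h
        simp only [AState.put_flips, AState.put_draws, AState.put_out]
        rw [this.1, this.2.1, this.2.2]
        exact ht

end ACode

/-! ### The programs

Arrays: `0, …, 4` hold the input `d, ℓ, ⌈1/α⌉, ⌈1/ρ⌉, ⌈1/β⌉`; `5` the bit length of the last one;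
`6, 7, 8` the parameters `p, p ^ 6, p ^ 7`; `9` the number `2 ^ ℓ`; `10` the bound for the number of
nodes; `11` the resolution; `12, 13` auxiliary numbers; `14` the rounding width; `16` the number of
samples; `20` the query; `21, 22` the samples and their marks; `23` an auxiliary sample; `24, 25` the
subcubes and levels of the nodes; `26` the estimates; `27` the number of edges; `28, 29` their
parents and coordinates; `30, 31, 32` the gains, best edges and masses of the nodes; `33, 34` the
stack; `35` the offsets; the others are auxiliary. -/

/-- A number stored as the entry `(0, 0)` of an array. -/
abbrev AExpr.var (k : ℕ) : AExpr := .get k (.lit 0) (.lit 0)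

/-- Assignment to a number stored as the entry `(0, 0)` of an array. -/
abbrev ACode.assign (k : ℕ) (v : AExpr) : ACode := .set k (.lit 0) (.lit 0) v

open AExpr ACode

/-- Sequences of programs. -/
def ACode.block : List ACode → ACode
  | [] => .skip
  | [P] => P
  | P :: Ps => .seq P (block Ps)

/-- Basic parameters. -/
def paramsCode : ACode := .block [
  .size 5 (var 4),
  assign 6 (.mul (.add (var 1) (.lit 1)) (var 2)),
  assign 7 (.mul (.mul (.mul (var 6) (var 6)) (.mul (var 6) (var 6))) (.mul (var 6) (var 6))),
  assign 8 (.mul (var 7) (var 6))]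

/-- Exponentials. -/
def powersCode : ACode := .block [
  assign 9 (.lit 1),
  .rep 50 (var 1) (assign 9 (.add (var 9) (var 9))),
  assign 10 (.lit 1),
  .rep 50 (var 1) (.block [
    assign 17 (.lit 0),
    .rep 51 (.add (.add (var 8) (var 8)) (.lit 1)) (assign 17 (.add (var 17) (var 10))),
    assign 10 (var 17)])]

/-- Derived parameters. -/
def widthsCode : ACode := .block [
  assign 11 (.mul (.mul (.lit 32) (var 9)) (var 7)),
  assign 12 (.mul (.mul (.mul (.lit 12) (var 10)) (.add (var 0) (.lit 1))) (var 3)),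
  assign 13 (.mul (.mul (.mul (var 12) (var 12)) (var 11))
    (.add (.add (.mul (.lit 3) (var 0)) (var 5)) (.lit 3)))]

/-- The random offsets of the levels. -/
def offsetsCode : ACode :=
  .rep 50 (.add (var 1) (.lit 1)) (.block [
    assign 14 (.lit 1),
    .set 35 (var 50) (.lit 0) (.lit 0),
    .rep 51 (var 13) (.ite (.sub (var 13) (var 14))
      (.block [
        .flip 15,
        .set 35 (var 50) (.lit 0)
          (.add (.add (.get 35 (var 50) (.lit 0)) (.get 35 (var 50) (.lit 0))) (var 15)),
        assign 14 (.add (var 14) (var 14))])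
      .skip)])

/-- The number of samples. -/
def samplesCode : ACode := assign 16 (.mul (var 14) (var 11))

/-- Draw the samples and, by means of `P`, compute their marks. -/
def drawCode (P : ACode) : ACode :=
  .rep 50 (var 16) (.block [
    .rep 51 (var 0) (.set 20 (.lit 0) (var 51) (.lit 2)),
    .draw 20 (.lit 0) 21 (var 50),
    P,
    .set 22 (var 50) (var 0) (.lit 1)])

/-- The marks of a sample are its coordinates. -/
def plainMarks : ACode :=
  .rep 51 (var 0) (.set 22 (var 50) (var 51) (.get 21 (var 50) (var 51)))

/-- The mark at `i` tells whether a fresh sample from the edge in direction `i` through the given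
sample agrees with it. -/
def pairMarks : ACode := .block [
  .rep 51 (var 0) (.set 20 (.lit 0) (var 51) (.get 21 (var 50) (var 51))),
  .rep 51 (var 0) (.block [
    .set 20 (.lit 0) (var 51) (.lit 2),
    .draw 20 (.lit 0) 23 (.lit 0),
    .set 22 (var 50) (var 51)
      (.add (.sub (.add (.get 23 (.lit 0) (var 51)) (.get 21 (var 50) (var 51))) (.lit 1))
        (.sub (.lit 1) (.add (.get 23 (.lit 0) (var 51)) (.get 21 (var 50) (var 51))))),
    .set 20 (.lit 0) (var 51) (.get 21 (var 50) (var 51))])]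

/-- Set `var 37` to zero unless the sample number `var 52` lies in the subcube of the node number
`var 50`. -/
def memberCode : ACode :=
  .rep 53 (var 0) (.ite
    (.sub (.lit 1) (.add
      (.sub (.add (.get 24 (var 50) (var 53)) (.get 21 (var 52) (var 53))) (.lit 1))
      (.sub (.lit 1) (.add (.get 24 (var 50) (var 53)) (.get 21 (var 52) (var 53))))))
    (assign 37 (.lit 0)) .skip)

/-- Sum of the marks at `var 51` of the samples in the subcube of the node number `var 50`. -/
def tallyCode : ACode :=
  .rep 52 (var 16) (.block [
    assign 37 (.get 22 (var 52) (var 51)),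
    memberCode,
    assign 36 (.add (var 36) (var 37))])

/-- The rounded estimates at the node number `var 50`. -/
def tableCode : ACode :=
  .rep 51 (.add (var 0) (.lit 1)) (.block [
    assign 36 (.lit 0),
    tallyCode,
    .set 26 (var 50) (var 51)
      (.div (.add (var 36) (.get 35 (.get 25 (var 50) (.lit 0)) (.lit 0))) (var 14))])

/-- The rounded estimates, and the mass as initial value of the mass of the best tree. -/
def estimateCode : ACode := .block [tableCode,
  .set 32 (var 50) (.lit 0) (.get 26 (var 50) (var 0))]

/-- Copy the row of the node number `var 50` to its new children. -/
def copyCode : ACode :=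
  .rep 52 (var 0) (.block [
    .set 24 (.add (.add (var 27) (var 27)) (.lit 1)) (var 52) (.get 24 (var 50) (var 52)),
    .set 24 (.add (.add (var 27) (var 27)) (.lit 2)) (var 52) (.get 24 (var 50) (var 52))])

/-- Create the two children of the node number `var 50` in direction `var 51`. -/
def childCode : ACode := .block [
  assign 38 (.add (var 38) (.lit 1)),
  .set 28 (var 27) (.lit 0) (var 50),
  .set 29 (var 27) (.lit 0) (var 51),
  copyCode,
  .set 24 (.add (.add (var 27) (var 27)) (.lit 1)) (var 51) (.lit 0),
  .set 24 (.add (.add (var 27) (var 27)) (.lit 2)) (var 51) (.lit 1),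
  .set 25 (.add (.add (var 27) (var 27)) (.lit 1)) (.lit 0)
    (.add (.get 25 (var 50) (.lit 0)) (.lit 1)),
  .set 25 (.add (.add (var 27) (var 27)) (.lit 2)) (.lit 0)
    (.add (.get 25 (var 50) (.lit 0)) (.lit 1)),
  assign 27 (.add (var 27) (.lit 1))]

/-- Create children of the node number `var 50` in direction `var 51`, if it is promising. -/
def tryCode : ACode :=
  .ite (.sub (.get 24 (var 50) (var 51)) (.lit 1))
    (.ite (.sub
        (.add (.mul (var 7) (.sub (.mul (.lit 2) (.get 26 (var 50) (var 51)))
          (.get 26 (var 50) (var 0)))) (.lit 1))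
        (.add (.get 26 (var 50) (var 0)) (.add (.mul (.lit 6) (var 7)) (.lit 3))))
      (.ite (.sub (var 8) (var 38)) childCode .skip) .skip) .skip

/-- Create children of the node number `var 50` in all promising directions. -/
def expandCode : ACode := .block [assign 38 (.lit 0), .rep 51 (var 0) tryCode]

/-- Process the node number `var 50`. -/
def nodeCode : ACode :=
  .block [estimateCode, .ite (.sub (var 1) (.get 25 (var 50) (.lit 0))) expandCode .skip]

/-- The root. -/
def rootCode : ACode := .rep 51 (var 0) (.set 24 (.lit 0) (var 51) (.lit 2))

/-- Build the forest of candidates, in breadth-first order. -/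
def growCode : ACode := .block [rootCode,
  .rep 50 (var 10) (.ite (.sub (.add (.add (var 27) (var 27)) (.lit 1)) (var 50)) nodeCode .skip)]

/-- Take the edge number `E - 1 - var 50` into account. -/
def compareCode : ACode := .block [
  assign 46 (.sub (.sub (var 27) (.lit 1)) (var 50)),
  assign 39 (.add (.add
    (.sub (.add (.get 26 (.get 28 (var 46) (.lit 0)) (.get 29 (var 46) (.lit 0)))
        (.get 26 (.get 28 (var 46) (.lit 0)) (.get 29 (var 46) (.lit 0))))
      (.get 26 (.get 28 (var 46) (.lit 0)) (var 0)))
    (.get 30 (.add (.add (var 46) (var 46)) (.lit 1)) (.lit 0)))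
    (.get 30 (.add (.add (var 46) (var 46)) (.lit 2)) (.lit 0))),
  .ite (.sub (var 39) (.get 30 (.get 28 (var 46) (.lit 0)) (.lit 0)))
    (.block [
      .set 30 (.get 28 (var 46) (.lit 0)) (.lit 0) (var 39),
      .set 31 (.get 28 (var 46) (.lit 0)) (.lit 0) (.add (var 46) (.lit 1)),
      .set 32 (.get 28 (var 46) (.lit 0)) (.lit 0)
        (.add (.get 32 (.add (.add (var 46) (var 46)) (.lit 1)) (.lit 0))
          (.get 32 (.add (.add (var 46) (var 46)) (.lit 2)) (.lit 0)))])
    .skip]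

/-- Find the best edge of each node, from the last edge to the first. -/
def selectCode : ACode := .rep 50 (var 27) compareCode

/-- Multiply `var 48` by the number of points of the subcube of the node number `var 47`. -/
def doubleCode : ACode :=
  .rep 51 (var 0) (.ite (.sub (.sub (var 0) (.get 25 (var 47) (.lit 0))) (var 51))
    (assign 48 (.add (var 48) (var 48))) .skip)

/-- Write the node on the top of the stack, and replace it by its children. -/
def popCode : ACode := .block [
  assign 34 (.sub (var 34) (.lit 1)),
  assign 47 (.get 33 (var 34) (.lit 0)),
  .ite (.get 31 (var 47) (.lit 0))
    (.block [
      assign 46 (.sub (.get 31 (var 47) (.lit 0)) (.lit 1)),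
      .emit (.add (.get 29 (var 46) (.lit 0)) (.lit 1)),
      .set 33 (var 34) (.lit 0) (.add (.add (var 46) (var 46)) (.lit 2)),
      .set 33 (.add (var 34) (.lit 1)) (.lit 0) (.add (.add (var 46) (var 46)) (.lit 1)),
      assign 34 (.add (var 34) (.lit 2))])
    (.block [
      .emit (.lit 0),
      .emit (.get 26 (var 47) (var 0)),
      assign 48 (.get 32 (.lit 0) (.lit 0)),
      doubleCode,
      .emit (var 48)])]

/-- Write the best tree. -/
def writeCode : ACode := .block [
  assign 34 (.lit 1),
  .rep 50 (var 10) (.ite (var 34) popCode .skip)]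

/-- The whole learner; `P` computes the marks. -/
def learnerCode (P : ACode) : ACode :=
  .block [paramsCode, powersCode, widthsCode, offsetsCode, samplesCode, drawCode P, growCode,
    selectCode, writeCode]

/-- Copy the input into the arrays, then run the learner. -/
def learnerProgram (P : ACode) : Program :=
  .seq (.store (.cellE 0 (.lit 0) (.lit 0)) (.load (.lit 0)))
    (.seq (.store (.cellE 1 (.lit 0) (.lit 0)) (.load (.lit 1)))
      (.seq (.store (.cellE 2 (.lit 0) (.lit 0)) (.load (.lit 2)))
        (.seq (.store (.cellE 3 (.lit 0) (.lit 0)) (.load (.lit 3)))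
          (.seq (.store (.cellE 4 (.lit 0) (.lit 0)) (.load (.lit 4)))
            (learnerCode P).comp))))

theorem learnerCode_plainMarks_wf : (learnerCode plainMarks).Wf := by
  simp [learnerCode, ACode.block, paramsCode, powersCode, widthsCode, offsetsCode, samplesCode,
    drawCode, plainMarks, growCode, selectCode, writeCode, estimateCode, childCode, expandCode,
    popCode, compareCode, doubleCode, memberCode, tallyCode, tableCode, copyCode, tryCode,
    nodeCode, rootCode, ACode.Wf, ACode.writes, AExpr.ids]

theorem learnerCode_pairMarks_wf : (learnerCode pairMarks).Wf := by
  simp [learnerCode, ACode.block, paramsCode, powersCode, widthsCode, offsetsCode, samplesCode,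
    drawCode, pairMarks, growCode, selectCode, writeCode, estimateCode, childCode, expandCode,
    popCode, compareCode, doubleCode, memberCode, tallyCode, tableCode, copyCode, tryCode,
    nodeCode, rootCode, ACode.Wf, ACode.writes, AExpr.ids]

/-- The number of nodes is not known in advance, so the main loop runs up to the bound in array `10`
and skips missing nodes. This and the other loop bounds, in arrays `0` and `16`, are never written
by the search. -/
theorem growCode_static : growCode.Static := by
  simp [ACode.block, growCode, estimateCode, childCode, expandCode,
    memberCode, tallyCode, tableCode, copyCode, tryCode, nodeCode, rootCode, ACode.Static,
    ACode.writes, AExpr.ids, ACode.boundIds, AExpr.mild]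

/-! ### Meaning of the programs that count and that create children. -/

section den
variable {d : ℕ} (r : Coins) (ω : Answers d)

theorem ACode.den_skip (s : AState) : skip.den r ω s = s := rfl
theorem ACode.den_set (k : ℕ) (i j v : AExpr) (s : AState) :
    (set k i j v).den r ω s = s.put k (i.eval s.mem) (j.eval s.mem) (v.eval s.mem) := rfl
theorem ACode.den_seq (P Q : ACode) (s : AState) :
    (seq P Q).den r ω s = Q.den r ω (P.den r ω s) := rfl
theorem ACode.den_ite (c : AExpr) (P Q : ACode) (s : AState) :
    (ite c P Q).den r ω s = if c.eval s.mem ≠ 0 then P.den r ω s else Q.den r ω s := rfl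
theorem ACode.den_block_cons (P Q : ACode) (Ps : List ACode) (s : AState) :
    (block (P :: Q :: Ps)).den r ω s = (block (Q :: Ps)).den r ω (P.den r ω s) := rfl
theorem ACode.den_block_one (P : ACode) (s : AState) :
    (block [P]).den r ω s = P.den r ω s := rfl

/-- The sample number `t` lies in the subcube of the node number `v`. -/
def Store.Inside (M : Store) (v t : ℕ) : Prop := ∀ c < M 0 0 0, M 24 v c + M 21 t c ≠ 1

instance (M : Store) (v t : ℕ) : Decidable (M.Inside v t) :=
  inferInstanceAs (Decidable (∀ c < M 0 0 0, M 24 v c + M 21 t c ≠ 1))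

/-- Sum of the marks at `i` of the samples in the subcube of the node number `v`. -/
def Store.tally (M : Store) (v i : ℕ) : ℕ :=
  ∑ t ∈ Finset.range (M 16 0 0), if M.Inside v t then M 22 t i else 0

/-- The rounded estimate. -/
def Store.rounded (M : Store) (v i : ℕ) : ℕ :=
  (M.tally v i + M 35 (M 25 v 0) 0) / M 14 0 0

theorem Store.tally_congr {M M' : Store} (h : ∀ k ∈ [0, 16, 21, 22, 24], M k = M' k) (v i : ℕ) :
    M.tally v i = M'.tally v i := by
  simp only [List.mem_cons, List.not_mem_nil, or_false, forall_eq_or_imp, forall_eq] at h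
  obtain ⟨h0, h1, h2, h3, h4⟩ := h
  have hi : ∀ t, M.Inside v t = M'.Inside v t := fun t => by simp only [Inside, h0, h2, h4]
  unfold tally
  rw [h1, h3]
  exact Finset.sum_congr rfl fun t _ => if_congr (iff_of_eq (hi t)) rfl rfl

/-- A row entry `0` or `1` fixes a coordinate and `2` leaves it free, so entry plus sample bit
equals `1` exactly at a conflict. The branch condition `1 - ((s - 1) + (1 - s))` in truncated
arithmetic tests `s = 1`. -/
theorem memberCode_den (s : AState) : (memberCode.den r ω s).mem 37 0 0 =
    if s.mem.Inside (s.mem 50 0 0) (s.mem 52 0 0) then s.mem 37 0 0 else 0 := by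
  refine rep_rule r ω (k := 53) (s := s) (fun j t => t.mem 37 0 0 =
    if ∀ c < j, s.mem 24 (s.mem 50 0 0) c + s.mem 21 (s.mem 52 0 0) c ≠ 1 then s.mem 37 0 0 else 0)
    (by simp) ?_
  intro j _ t hj hf ht
  have f50 := hf 50 (by decide)
  have f24 := hf 24 (by decide)
  have f21 := hf 21 (by decide)
  have f52 := hf 52 (by decide)
  simp only [den_ite, AExpr.eval, hj, f50, f24, f21, f52, den_set, den_skip]
  by_cases h1 : s.mem 24 (s.mem 50 0 0) j + s.mem 21 (s.mem 52 0 0) j = 1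
  · have h2 : ¬ ∀ c < j + 1, s.mem 24 (s.mem 50 0 0) c + s.mem 21 (s.mem 52 0 0) c ≠ 1 :=
      fun h => h j (by omega) h1
    rw [if_neg h2, if_pos (by rw [h1]; norm_num)]
    simp
  · have h2 : (∀ c < j + 1, s.mem 24 (s.mem 50 0 0) c + s.mem 21 (s.mem 52 0 0) c ≠ 1) ↔
        ∀ c < j, s.mem 24 (s.mem 50 0 0) c + s.mem 21 (s.mem 52 0 0) c ≠ 1 := by
      refine ⟨fun h c hc => h c (by omega), fun h c hc => ?_⟩
      rcases Nat.lt_succ_iff_lt_or_eq.1 hc with hc | rfl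
      · exact h c hc
      · exact h1
    rw [if_neg (by omega)]
    simp only [h2]
    simpa using ht

theorem tallyCode_den (s : AState) : (tallyCode.den r ω s).mem 36 0 0 =
    s.mem 36 0 0 + s.mem.tally (s.mem 50 0 0) (s.mem 51 0 0) := by
  refine rep_rule r ω (s := s) (fun j t => t.mem 36 0 0 = s.mem 36 0 0 +
    ∑ t ∈ Finset.range j, if s.mem.Inside (s.mem 50 0 0) t then s.mem 22 t (s.mem 51 0 0) else 0)
    (by simp) ?_
  intro j _ t hj hf ht
  have f0 := hf 0 (by decide)
  have f50 := hf 50 (by decide)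
  have f51 := hf 51 (by decide)
  have f24 := hf 24 (by decide)
  have f21 := hf 21 (by decide)
  have f22 := hf 22 (by decide)
  simp only [den_block_cons, den_block_one, den_set, AExpr.eval]
  simp only [AState.put_mem]
  rw [memberCode_den, den_mem r ω memberCode _ (by decide)]
  have hin : ∀ a v w, Store.Inside (t.put 37 0 0 a).mem v w = s.mem.Inside v w := fun a v w => by
    simp [Store.Inside, f0, f24, f21]
  simp only [hin]
  simp [Finset.sum_range_succ, ht, hj, f50, f51, f22, add_assoc]

theorem tableCode_den (s : AState) (u i : ℕ) : (tableCode.den r ω s).mem 26 u i =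
    if u = s.mem 50 0 0 ∧ i ≤ s.mem 0 0 0 then s.mem.rounded (s.mem 50 0 0) i
    else s.mem 26 u i := by
  have key : ∀ u i, (tableCode.den r ω s).mem 26 u i =
      if u = s.mem 50 0 0 ∧ i < s.mem 0 0 0 + 1 then s.mem.rounded (s.mem 50 0 0) i
      else s.mem 26 u i := by
    refine rep_rule r ω (s := s) (fun j t => ∀ u i, t.mem 26 u i =
      if u = s.mem 50 0 0 ∧ i < j then s.mem.rounded (s.mem 50 0 0) i else s.mem 26 u i)
      (by simp) ?_
    intro j _ t hj hf ht u i
    have f0 := hf 0 (by decide)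
    have f16 := hf 16 (by decide)
    have f50 := hf 50 (by decide)
    have f24 := hf 24 (by decide)
    have f21 := hf 21 (by decide)
    have f22 := hf 22 (by decide)
    have f35 := hf 35 (by decide)
    have f25 := hf 25 (by decide)
    have f14 := hf 14 (by decide)
    simp only [den_block_cons, den_block_one, den_set, AExpr.eval]
    simp only [AState.put_mem, tallyCode_den]
    rw [den_mem r ω tallyCode _ (k := 50) (by decide),
    den_mem r ω tallyCode _ (k := 51) (by decide),
      den_mem r ω tallyCode _ (k := 35) (by decide), den_mem r ω tallyCode _ (k := 25) (by decide),
      den_mem r ω tallyCode _ (k := 14) (by decide), den_mem r ω tallyCode _ (k := 26) (by decide)]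
    have htal : ∀ v i, Store.tally (t.put 36 0 0 0).mem v i = s.mem.tally v i := by
      intro v i
      refine Store.tally_congr (fun k hk => ?_) v i
      simp only [List.mem_cons, List.not_mem_nil, or_false] at hk
      rcases hk with rfl | rfl | rfl | rfl | rfl <;>
        (rw [AState.put_mem_ne _ _ _ _ (by decide)]; exact hf _ (by decide))
    simp only [AState.put_mem, ht, hj, htal, f50, f35, f25, f14]
    by_cases hu : u = s.mem 50 0 0 <;> by_cases hi : i = j
    · subst hu hi
      simp [Store.rounded]
    · have : i < j + 1 ↔ i < j := by omega
      simp [hu, hi, this]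
    · simp [hu]
    · simp [hu]
  rw [key]
  simp only [Nat.lt_succ_iff]

theorem estimateCode_den (s : AState) (u i : ℕ) : (estimateCode.den r ω s).mem 26 u i =
    if u = s.mem 50 0 0 ∧ i ≤ s.mem 0 0 0 then s.mem.rounded (s.mem 50 0 0) i
    else s.mem 26 u i := by
  simp only [estimateCode, den_block_cons, den_block_one, den_set]
  rw [AState.put_mem_ne _ _ _ _ (by decide), tableCode_den]

theorem estimateCode_den_mass (s : AState) (u : ℕ) : (estimateCode.den r ω s).mem 32 u 0 =
    if u = s.mem 50 0 0 then s.mem.rounded (s.mem 50 0 0) (s.mem 0 0 0) else s.mem 32 u 0 := by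
  simp only [estimateCode, den_block_cons, den_block_one, den_set, AExpr.eval, AState.put_mem]
  rw [den_mem r ω tableCode _ (k := 50) (by decide), den_mem r ω tableCode _ (k := 0) (by decide),
    den_mem r ω tableCode _ (k := 32) (by decide), tableCode_den]
  simp

/-- The hypothesis says that the node is older than the two new rows, so the source is not
overwritten while it is being copied. -/
theorem copyCode_den (s : AState) (hv : s.mem 50 0 0 < 2 * s.mem 27 0 0 + 1) (u c : ℕ) :
    (copyCode.den r ω s).mem 24 u c =
      if (u = 2 * s.mem 27 0 0 + 1 ∨ u = 2 * s.mem 27 0 0 + 2) ∧ c < s.mem 0 0 0 then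
        s.mem 24 (s.mem 50 0 0) c else s.mem 24 u c := by
  revert u c
  refine rep_rule r ω (s := s) (fun j t => ∀ u c, t.mem 24 u c =
    if (u = 2 * s.mem 27 0 0 + 1 ∨ u = 2 * s.mem 27 0 0 + 2) ∧ c < j then
        s.mem 24 (s.mem 50 0 0) c else s.mem 24 u c)
    (by simp) ?_
  intro j _ t hj hf ht u c
  have f50 := hf 50 (by decide)
  have f27 := hf 27 (by decide)
  simp only [den_block_cons, den_block_one, den_set, AExpr.eval]
  simp only [AState.put_mem]
  have e1 : s.mem 27 0 0 + s.mem 27 0 0 = 2 * s.mem 27 0 0 := by ring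
  simp only [ht, hj, f50, f27, e1]
  generalize s.mem 27 0 0 = E at *
  generalize s.mem 50 0 0 = v at *
  have h1 : ¬ v = 2 * E + 1 := by omega
  have h2 : ¬ v = 2 * E + 2 := by omega
  by_cases hc : c = j
  · subst hc
    by_cases hu1 : u = 2 * E + 1 <;> by_cases hu2 : u = 2 * E + 2 <;> simp [*]
  · have : c < j + 1 ↔ c < j := by omega
    simp [hc, this]

end den

/-! ### Nodes and edges -/

/-- Fix a coordinate. -/
def Subcube.fix {d : ℕ} (S : Subcube d) (i : Fin d) (b : Bool) : Subcube d :=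
  Function.update S i (some b)

/-- The subcube of the node number `u`. -/
def Store.cube (d : ℕ) (M : Store) (u : ℕ) : Subcube d := readSubcube d (M 24 u) 0

/-- `M'` arises from `M` by giving the node number `v` two children in direction `i`. -/
structure AddEdge (d : ℕ) (M M' : Store) (v i : ℕ) : Prop where
  count : M' 27 0 0 = M 27 0 0 + 1
  par : M' 28 (M 27 0 0) 0 = v
  par_ne : ∀ e, e ≠ M 27 0 0 → M' 28 e 0 = M 28 e 0
  dir : M' 29 (M 27 0 0) 0 = i
  dir_ne : ∀ e, e ≠ M 27 0 0 → M' 29 e 0 = M 29 e 0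
  row_ne : ∀ u, u < 2 * M 27 0 0 + 1 → M' 24 u = M 24 u
  lev_ne : ∀ u, u < 2 * M 27 0 0 + 1 → M' 25 u 0 = M 25 u 0
  cube_false : ∀ h : i < d, M'.cube d (2 * M 27 0 0 + 1) = (M.cube d v).fix ⟨i, h⟩ false
  cube_true : ∀ h : i < d, M'.cube d (2 * M 27 0 0 + 2) = (M.cube d v).fix ⟨i, h⟩ true
  lev_false : M' 25 (2 * M 27 0 0 + 1) 0 = M 25 v 0 + 1
  lev_true : M' 25 (2 * M 27 0 0 + 2) 0 = M 25 v 0 + 1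
  slots : M' 38 0 0 = M 38 0 0 + 1

theorem childCode_den {d : ℕ} (r : Coins) (ω : Answers d) (s : AState) (hd : s.mem 0 0 0 = d)
    (hv : s.mem 50 0 0 < 2 * s.mem 27 0 0 + 1) :
    AddEdge d s.mem (childCode.den r ω s).mem (s.mem 50 0 0) (s.mem 51 0 0) := by
  have hv1 : ¬ s.mem 50 0 0 = 2 * s.mem 27 0 0 + 1 := by omega
  have hv2 : ¬ s.mem 50 0 0 = 2 * s.mem 27 0 0 + 2 := by omega
  have e1 : s.mem 27 0 0 + s.mem 27 0 0 = 2 * s.mem 27 0 0 := by ring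
  have hmem : ∀ k u c, (childCode.den r ω s).mem k u c =
      if k = 27 ∧ u = 0 ∧ c = 0 then s.mem 27 0 0 + 1
      else if k = 25 ∧ u = 2 * s.mem 27 0 0 + 2 ∧ c = 0 then s.mem 25 (s.mem 50 0 0) 0 + 1
      else if k = 25 ∧ u = 2 * s.mem 27 0 0 + 1 ∧ c = 0 then s.mem 25 (s.mem 50 0 0) 0 + 1
      else if k = 24 ∧ u = 2 * s.mem 27 0 0 + 2 ∧ c = s.mem 51 0 0 then 1
      else if k = 24 ∧ u = 2 * s.mem 27 0 0 + 1 ∧ c = s.mem 51 0 0 then 0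
      else if k = 24 ∧ (u = 2 * s.mem 27 0 0 + 1 ∨ u = 2 * s.mem 27 0 0 + 2) ∧ c < d then
        s.mem 24 (s.mem 50 0 0) c
      else if k = 29 ∧ u = s.mem 27 0 0 ∧ c = 0 then s.mem 51 0 0
      else if k = 28 ∧ u = s.mem 27 0 0 ∧ c = 0 then s.mem 50 0 0
      else if k = 38 ∧ u = 0 ∧ c = 0 then s.mem 38 0 0 + 1
      -- Array `52` is the counter of the copying loop; its contents are irrelevant, so nothing is
      -- asserted about it.
      else if k = 52 then (childCode.den r ω s).mem k u c
      else s.mem k u c := by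
    intro k u c
    by_cases h52 : k = 52
    · subst h52; simp
    simp only [h52, if_false]
    simp only [childCode, den_block_cons, den_block_one, den_set, AExpr.eval]
    set s1 := ((s.put 38 0 0 (s.mem 38 0 0 + 1)).put 28 ((s.put 38 0 0 (s.mem 38 0 0 + 1)).mem 27 0 0)
      0 ((s.put 38 0 0 (s.mem 38 0 0 + 1)).mem 50 0 0)) with hs1
    set s2 := s1.put 29 (s1.mem 27 0 0) 0 (s1.mem 51 0 0) with hs2
    have hs2m : ∀ k u c, s2.mem k u c = if k = 29 ∧ u = s.mem 27 0 0 ∧ c = 0 then s.mem 51 0 0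
      else if k = 28 ∧ u = s.mem 27 0 0 ∧ c = 0 then s.mem 50 0 0
      else if k = 38 ∧ u = 0 ∧ c = 0 then s.mem 38 0 0 + 1 else s.mem k u c := by
      intro k u c
      simp [hs2, hs1]
    have hcop : ∀ k u c, k ≠ 52 → (copyCode.den r ω s2).mem k u c =
        if k = 24 ∧ (u = 2 * s.mem 27 0 0 + 1 ∨ u = 2 * s.mem 27 0 0 + 2) ∧ c < d then
          s.mem 24 (s.mem 50 0 0) c else s2.mem k u c := by
      intro k u c hk
      by_cases hk24 : k = 24
      · subst hk24
        rw [copyCode_den r ω s2 (by simp [hs2m, hv])]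
        simp [hs2m, hd]
      · rw [den_mem r ω copyCode _ (by simp [copyCode, block, writes, hk, hk24])]
        simp [hk24]
    simp only [AState.put_mem, hcop _ _ _ (by decide : (27 : ℕ) ≠ 52),
      hcop _ _ _ (by decide : (51 : ℕ) ≠ 52), hcop _ _ _ (by decide : (50 : ℕ) ≠ 52),
      hcop _ _ _ (by decide : (25 : ℕ) ≠ 52), hcop _ _ _ h52]
    simp [hs2m, e1, hv1]
  generalize hM : (childCode.den r ω s).mem = M' at *
  generalize s.mem 50 0 0 = v at *
  generalize s.mem 51 0 0 = i at *
  constructor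
  · simp [hmem]
  · simp [hmem]
  · intro e he
    simp [hmem, he]
  · simp [hmem]
  · intro e he
    simp [hmem, he]
  · intro u hu
    funext c
    have h1 : ¬ u = 2 * s.mem 27 0 0 + 1 := by omega
    have h2 : ¬ u = 2 * s.mem 27 0 0 + 2 := by omega
    simp [hmem, h1, h2]
  · intro u hu
    have h1 : ¬ u = 2 * s.mem 27 0 0 + 1 := by omega
    have h2 : ¬ u = 2 * s.mem 27 0 0 + 2 := by omega
    simp [hmem, h1, h2]
  · intro h
    funext c
    by_cases hc : c = ⟨i, h⟩
    · subst hc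
      simp [Store.cube, Subcube.fix, readSubcube, hmem]
    · have hc' : ¬ (c : ℕ) = i := fun h => hc (Fin.ext h)
      rw [Subcube.fix, Function.update_of_ne hc]
      simp [Store.cube, readSubcube, hmem, hc', c.2]
  · intro h
    funext c
    by_cases hc : c = ⟨i, h⟩
    · subst hc
      simp [Store.cube, Subcube.fix, readSubcube, hmem]
    · have hc' : ¬ (c : ℕ) = i := fun h => hc (Fin.ext h)
      rw [Subcube.fix, Function.update_of_ne hc]
      simp [Store.cube, readSubcube, hmem, hc', c.2]
  · simp [hmem]
  · simp [hmem]
  · simp [hmem]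

/-! ### The learner as a function of the rounded estimates -/

/-- Rounded estimates: `f lev S i` for the subcube `S` at level `lev`. The index `i < d` stands for
the marks at `i`, the index `d` for the mass. -/
abbrev Est (d : ℕ) : Type := ℕ → Subcube d → ℕ → ℕ

instance {d : ℕ} (S : Subcube d) (x : Cube d) : Decidable (x ∈ S.points) :=
  inferInstanceAs (Decidable (∀ (i : Fin d) (b : Bool), S i = some b → x i = b))

/-- Sum of the marks at `i` of the samples in `S`. -/
def count {d : ℕ} (x : ℕ → Cube d) (g : ℕ → ℕ → ℕ) (m : ℕ) (S : Subcube d) (i : ℕ) : ℕ :=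
  ∑ t ∈ Finset.range m, if x t ∈ S.points then g t i else 0

/-- The rounded estimates obtained from samples, marks and offsets. -/
def roundedEst {d : ℕ} (x : ℕ → Cube d) (g : ℕ → ℕ → ℕ) (m : ℕ) (o : ℕ → ℕ) (W : ℕ) : Est d :=
  fun lev S i => (count x g m S i + o lev) / W

/-- A tree with its total gain and the total mass of its leaves. -/
structure Plan (d : ℕ) : Type where
  gain : ℕ
  mass : ℕ
  tree : DecisionTree d (ℕ × ℕ)

namespace Est

variable {d : ℕ} (A K : ℕ) (f : Est d)

/-- The estimated influence. -/
def gain (lev : ℕ) (S : Subcube d) (i : ℕ) : ℕ := 2 * f lev S i - f lev S d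

/-- The direction `i` is promising. -/
def Flagged (lev : ℕ) (S : Subcube d) (i : Fin d) : Prop :=
  S i = none ∧ f lev S d + (6 * A + 3) ≤ A * f.gain lev S i

instance (lev : ℕ) (S : Subcube d) (i : Fin d) : Decidable (f.Flagged A lev S i) :=
  inferInstanceAs (Decidable (_ ∧ _))

/-- The directions that are tried. -/
def choices (lev : ℕ) (S : Subcube d) : List (Fin d) :=
  ((List.finRange d).filter (fun i => f.Flagged A lev S i)).take K

/-- The plan that makes the subcube a leaf. -/
def asLeaf (lev : ℕ) (S : Subcube d) : Plan d := ⟨0, f lev S d, .leaf (f lev S d, lev)⟩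

/-- Replace `acc` by the plan that queries `i`, if this is better. -/
def improve (lev : ℕ) (S : Subcube d) (i : Fin d) (l r acc : Plan d) : Plan d :=
  if acc.gain < f.gain lev S i + l.gain + r.gain then
    ⟨f.gain lev S i + l.gain + r.gain, l.mass + r.mass, .node i l.tree r.tree⟩
  else acc

/-- The best plan of depth `k`. -/
def plan : ℕ → ℕ → Subcube d → Plan d
  | 0, lev, S => f.asLeaf lev S
  | k + 1, lev, S => (f.choices A K lev S).foldr (fun i acc => f.improve lev S i
      (plan k (lev + 1) (S.fix i false)) (plan k (lev + 1) (S.fix i true)) acc) (f.asLeaf lev S)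

end Est

/-- The output for a tree with leaf labels `(mass, level)`, if the total mass is `q`. -/
def outputWord {d : ℕ} (q : ℕ) : DecisionTree d (ℕ × ℕ) → List ℕ
  | .leaf v => [0, v.1, q * 2 ^ (d - v.2)]
  | .node i l r => ((i : ℕ) + 1) :: (outputWord q l ++ outputWord q r)

/-- Number of nodes. -/
def DecisionTree.nodes {d : ℕ} {V : Type} : DecisionTree d V → ℕ
  | .leaf _ => 1
  | .node _ l r => 1 + l.nodes + r.nodes

/-! ### Growing the forest of candidates -/

theorem Store.rounded_eq {d : ℕ} {M : Store} (hd : M 0 0 0 = d) {x : ℕ → Cube d}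
    (hx : ∀ t < M 16 0 0, ∀ c : Fin d, M 21 t c = (x t c).toNat) (v i : ℕ) :
    M.rounded v i =
      roundedEst x (M 22) (M 16 0 0) (fun l => M 35 l 0) (M 14 0 0) (M 25 v 0) (M.cube d v) i := by
  have hin : ∀ t < M 16 0 0, M.Inside v t ↔ x t ∈ (M.cube d v).points := by
    intro t ht
    simp only [Inside, hd, Subcube.points, Set.mem_ofPred_eq, cube, readSubcube, zero_add]
    constructor
    · intro h i b hb
      have h1 := h i i.2
      rw [hx t ht i] at h1
      split_ifs at hb with h2 h3
      · rw [h2] at h1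
        obtain rfl : false = b := by simpa using hb
        cases hxi : x t i
        · rfl
        · simp [hxi] at h1
      · rw [h3] at h1
        obtain rfl : true = b := by simpa using hb
        cases hxi : x t i
        · simp [hxi] at h1
        · rfl
    · intro h c hc h1
      rw [hx t ht ⟨c, hc⟩] at h1
      have h0 := h ⟨c, hc⟩
      simp only at h0
      cases hxi : x t ⟨c, hc⟩
      · rw [hxi] at h1
        have h2 : M 24 v c = 1 := by simpa using h1
        rw [h2] at h0
        have := h0 true (by simp)
        simp [hxi] at this
      · rw [hxi] at h1
        have h2 : M 24 v c = 0 := by simpa using h1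
        rw [h2] at h0
        have := h0 false (by simp)
        simp [hxi] at this
  simp only [rounded, roundedEst, tally, count]
  congr 2
  refine Finset.sum_congr rfl fun t ht => ?_
  simp only [hin t (Finset.mem_range.1 ht)]

/-- The nodes and edges stored in the memory are consistent. -/
structure Forest (d : ℕ) (M : Store) : Prop where
  root : M.cube d 0 = fun _ => none
  root_lev : M 25 0 0 = 0
  par_lt : ∀ e < M 27 0 0, M 28 e 0 < 2 * e + 1
  dir_lt : ∀ e < M 27 0 0, M 29 e 0 < d
  child : ∀ e < M 27 0 0, ∀ h : M 29 e 0 < d,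
    M.cube d (2 * e + 1) = (M.cube d (M 28 e 0)).fix ⟨_, h⟩ false ∧
    M.cube d (2 * e + 2) = (M.cube d (M 28 e 0)).fix ⟨_, h⟩ true ∧
    M 25 (2 * e + 1) 0 = M 25 (M 28 e 0) 0 + 1 ∧ M 25 (2 * e + 2) 0 = M 25 (M 28 e 0) 0 + 1

theorem Store.cube_congr {d : ℕ} {M M' : Store} {u : ℕ} (h : M' 24 u = M 24 u) :
    M'.cube d u = M.cube d u := by
  simp only [cube, h]

theorem Forest.addEdge {d : ℕ} {M M' : Store} {v i : ℕ} (h : Forest d M)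
    (ha : AddEdge d M M' v i) (hv : v < 2 * M 27 0 0 + 1) (hi : i < d) : Forest d M' where
  root := by rw [Store.cube_congr (ha.row_ne 0 (by omega)), h.root]
  root_lev := by rw [ha.lev_ne 0 (by omega), h.root_lev]
  par_lt e he := by
    rw [ha.count] at he
    rcases Nat.lt_succ_iff_lt_or_eq.1 he with he | rfl
    · rw [ha.par_ne e he.ne]
      exact h.par_lt e he
    · rw [ha.par]
      exact hv
  dir_lt e he := by
    rw [ha.count] at he
    rcases Nat.lt_succ_iff_lt_or_eq.1 he with he | rfl
    · rw [ha.dir_ne e he.ne]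
      exact h.dir_lt e he
    · rwa [ha.dir]
  child e he hd := by
    rw [ha.count] at he
    rcases Nat.lt_succ_iff_lt_or_eq.1 he with he | rfl
    · have hp := h.par_lt e he
      have hd' := h.dir_lt e he
      have hdir : (⟨_, hd⟩ : Fin d) = ⟨_, hd'⟩ := Fin.ext (ha.dir_ne e he.ne)
      rw [hdir, ha.par_ne e he.ne, Store.cube_congr (ha.row_ne _ (by omega)),
        Store.cube_congr (ha.row_ne _ (by omega)), Store.cube_congr (ha.row_ne _ (by omega)),
        ha.lev_ne _ (by omega), ha.lev_ne _ (by omega), ha.lev_ne _ (by omega)]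
      exact h.child e he hd'
    · have hdir : (⟨_, hd⟩ : Fin d) = ⟨i, hi⟩ := Fin.ext ha.dir
      rw [hdir, ha.par, Store.cube_congr (ha.row_ne v hv), ha.lev_ne v hv]
      exact ⟨ha.cube_false hi, ha.cube_true hi, ha.lev_false, ha.lev_true⟩

/-- The node number `v` has the direction `i` free, and it is promising. -/
def Store.Promising (M : Store) (v i : ℕ) : Prop :=
  2 ≤ M 24 v i ∧ M 26 v (M 0 0 0) + (6 * M 7 0 0 + 3) ≤
    M 7 0 0 * (2 * M 26 v i - M 26 v (M 0 0 0))

instance (M : Store) (v i : ℕ) : Decidable (M.Promising v i) :=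
  inferInstanceAs (Decidable (_ ∧ _))

section den
variable {d : ℕ} (r : Coins) (ω : Answers d)

theorem tryCode_den (s : AState) : tryCode.den r ω s =
    if s.mem.Promising (s.mem 50 0 0) (s.mem 51 0 0) ∧ s.mem 38 0 0 < s.mem 8 0 0 then
      childCode.den r ω s else s := by
  simp only [tryCode, den_ite, den_skip]
  by_cases h1 : 2 ≤ s.mem 24 (s.mem 50 0 0) (s.mem 51 0 0)
  · rw [if_pos (by simp only [AExpr.eval]; omega)]
    by_cases h2 : s.mem 26 (s.mem 50 0 0) (s.mem 0 0 0) + (6 * s.mem 7 0 0 + 3) ≤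
      s.mem 7 0 0 * (2 * s.mem 26 (s.mem 50 0 0) (s.mem 51 0 0) -
        s.mem 26 (s.mem 50 0 0) (s.mem 0 0 0))
    · rw [if_pos (by simp only [AExpr.eval]; omega)]
      by_cases h3 : s.mem 38 0 0 < s.mem 8 0 0
      · rw [if_pos (by simp only [AExpr.eval]; omega), if_pos ⟨⟨h1, h2⟩, h3⟩]
      · rw [if_neg (by simp only [AExpr.eval]; omega), if_neg (fun h => h3 h.2)]
    · rw [if_neg (by simp only [AExpr.eval]; omega), if_neg (fun h => h2 h.1.2)]
  · rw [if_neg (by simp only [AExpr.eval]; omega), if_neg (fun h => h1 h.1.1)]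

/-- The memory `M'` arises from `M` by giving the node number `v` children in the directions `l`. -/
structure Expanded (d : ℕ) (M M' : Store) (v : ℕ) (l : List ℕ) : Prop where
  forest : Forest d M'
  count : M' 27 0 0 = M 27 0 0 + l.length
  par_old : ∀ e < M 27 0 0, M' 28 e 0 = M 28 e 0
  dir_old : ∀ e < M 27 0 0, M' 29 e 0 = M 29 e 0
  row_old : ∀ u < 2 * M 27 0 0 + 1, M' 24 u = M 24 u
  lev_old : ∀ u < 2 * M 27 0 0 + 1, M' 25 u 0 = M 25 u 0
  par_new : ∀ e, M 27 0 0 ≤ e → e < M' 27 0 0 → M' 28 e 0 = v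
  dir_new : (List.range' (M 27 0 0) l.length).map (fun e => M' 29 e 0) = l
  lev_new : ∀ u, 2 * M 27 0 0 + 1 ≤ u → u < 2 * M' 27 0 0 + 1 → M' 25 u 0 = M 25 v 0 + 1

theorem Expanded.addEdge {M M' M'' : Store} {v i : ℕ} {l : List ℕ} (h : Expanded d M M' v l)
    (ha : AddEdge d M' M'' v i) (hv : v < 2 * M 27 0 0 + 1) (hi : i < d) :
    Expanded d M M'' v (l ++ [i]) where
  forest := h.forest.addEdge ha (by have := h.count; omega) hi
  count := by rw [ha.count, h.count]; simp [add_assoc]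
  par_old e he := by rw [ha.par_ne e (by have := h.count; omega), h.par_old e he]
  dir_old e he := by rw [ha.dir_ne e (by have := h.count; omega), h.dir_old e he]
  row_old u hu := by rw [ha.row_ne u (by have := h.count; omega), h.row_old u hu]
  lev_old u hu := by rw [ha.lev_ne u (by have := h.count; omega), h.lev_old u hu]
  par_new e he he' := by
    rw [ha.count] at he'
    rcases Nat.lt_succ_iff_lt_or_eq.1 he' with he' | rfl
    · rw [ha.par_ne e he'.ne, h.par_new e he he']
    · exact ha.par
  dir_new := by
    rw [List.length_append, List.length_singleton, ← List.range'_append_1, List.map_append]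
    congr 1
    · refine Eq.trans (List.map_congr_left fun e he => ?_) h.dir_new
      simp only [List.mem_range'_1] at he
      exact ha.dir_ne e (by have := h.count; omega)
    · have : M 27 0 0 + l.length = M' 27 0 0 := h.count.symm
      simp [this, ha.dir]
  lev_new u hu hu' := by
    rw [ha.count] at hu'
    by_cases h1 : u < 2 * M' 27 0 0 + 1
    · rw [ha.lev_ne u h1, h.lev_new u hu h1]
    · have hvl := h.lev_old v hv
      have : u = 2 * M' 27 0 0 + 1 ∨ u = 2 * M' 27 0 0 + 2 := by omega
      rcases this with rfl | rfl
      · rw [ha.lev_false, hvl]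
      · rw [ha.lev_true, hvl]

/-- Array `38` counts the children pairs created so far. Stopping at the fan-out selects the first
promising directions in increasing order, exactly as the `take` in `Est.choices` does. -/
theorem expandCode_den (s : AState) (hd : s.mem 0 0 0 = d) (hf : Forest d s.mem)
    (hv : s.mem 50 0 0 < 2 * s.mem 27 0 0 + 1) :
    Expanded d s.mem (expandCode.den r ω s).mem (s.mem 50 0 0)
      (((List.range d).filter (fun i => s.mem.Promising (s.mem 50 0 0) i)).take (s.mem 8 0 0)) := by
  simp only [expandCode, den_block_cons, den_block_one, den_set, AExpr.eval]
  have hs : ∀ k, k ≠ 38 → (s.put 38 0 0 0).mem k = s.mem k :=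
    fun k hk => AState.put_mem_ne _ _ _ _ hk
  have key := rep_rule r ω (P := tryCode) (k := 51) (e := var 0) (s := s.put 38 0 0 0)
    (fun j t => let l := ((List.range j).filter
        (fun i => s.mem.Promising (s.mem 50 0 0) i)).take (s.mem 8 0 0)
      t.mem 38 0 0 = l.length ∧ Expanded d s.mem t.mem (s.mem 50 0 0) l) ?_ ?_
  · have h2 := key.2
    simp only [AExpr.eval] at h2
    rw [hs 0 (by decide), hd] at h2
    exact h2
  · refine ⟨by simp, ?_⟩
    have hs' : ∀ k, k ≠ 38 → k ≠ 51 → ((s.put 38 0 0 0).put 51 0 0 0).mem k = s.mem k :=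
      fun k hk hk' => by rw [AState.put_mem_ne _ _ _ _ hk', hs k hk]
    generalize ((s.put 38 0 0 0).put 51 0 0 0).mem = M at *
    have h24 := hs' 24 (by decide) (by decide)
    have h25 := hs' 25 (by decide) (by decide)
    have h27 := hs' 27 (by decide) (by decide)
    have h28 := hs' 28 (by decide) (by decide)
    have h29 := hs' 29 (by decide) (by decide)
    have hc : ∀ u, M.cube d u = s.mem.cube d u := fun u => Store.cube_congr (by rw [h24])
    simp only [List.range_zero, List.filter_nil, List.take_nil]
    refine ⟨⟨?_, ?_, ?_, ?_, ?_⟩, ?_, ?_, ?_, ?_, ?_, ?_, ?_, ?_⟩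
    · rw [hc]; exact hf.root
    · rw [h25]; exact hf.root_lev
    · rw [h27, h28]; exact hf.par_lt
    · rw [h27, h29]; exact hf.dir_lt
    · simp only [h27, h28, h29, h25, hc]; exact hf.child
    · simp [h27]
    · simp [h28]
    · simp [h29]
    · simp [h24]
    · simp [h25]
    · intro e h1 h2; rw [h27] at h2; omega
    · simp
    · intro e h1 h2; rw [h27] at h2; omega
  · intro j hj t htj hfr ht
    obtain ⟨h1, h2⟩ := ht
    have f8 := (hfr 8 (by decide)).trans (hs 8 (by decide))
    have f50 := (hfr 50 (by decide)).trans (hs 50 (by decide))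
    have f26 := (hfr 26 (by decide)).trans (hs 26 (by decide))
    have f0 := (hfr 0 (by decide)).trans (hs 0 (by decide))
    have f7 := (hfr 7 (by decide)).trans (hs 7 (by decide))
    have hjd : j < d := by
      simp only [AExpr.eval] at hj
      rwa [hs 0 (by decide), hd] at hj
    have hpr : t.mem.Promising (t.mem 50 0 0) (t.mem 51 0 0) ↔
        s.mem.Promising (s.mem 50 0 0) j := by
      simp only [Store.Promising, f50, htj, f26, f0, f7, h2.row_old _ hv]
    have hput : ∀ (t : AState) (l : List ℕ), Expanded d s.mem t.mem (s.mem 50 0 0) l →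
        Expanded d s.mem (t.put 51 0 0 (j + 1)).mem (s.mem 50 0 0) l := by
      intro t l h
      have hc : ∀ u, Store.cube d (t.put 51 0 0 (j + 1)).mem u = t.mem.cube d u :=
        fun u => Store.cube_congr (by simp [AState.put])
      refine ⟨⟨?_, ?_, ?_, ?_, ?_⟩, ?_, ?_, ?_, ?_, ?_, ?_, ?_, ?_⟩
      · rw [hc]; exact h.forest.root
      · simpa using h.forest.root_lev
      · simpa using h.forest.par_lt
      · simpa using h.forest.dir_lt
      · simpa [hc] using h.forest.child
      · simpa using h.count
      · simpa using h.par_old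
      · simpa using h.dir_old
      · intro u hu
        rw [← h.row_old u hu]
        simp [AState.put]
      · simpa using h.lev_old
      · simpa using h.par_new
      · simpa using h.dir_new
      · simpa using h.lev_new
    simp only [List.range_succ, List.filter_append, tryCode_den, hpr]
    set l := (List.range j).filter (fun i => s.mem.Promising (s.mem 50 0 0) i) with hl
    by_cases hp : s.mem.Promising (s.mem 50 0 0) j
    · have e1 : [j].filter (fun i => (s.mem.Promising (s.mem 50 0 0) i : Bool)) = [j] := by
        simp [hp]
      rw [e1, List.take_append]
      by_cases hK : l.length < s.mem 8 0 0
      · have hlen : (l.take (s.mem 8 0 0)).length = l.length := by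
          rw [List.length_take]; omega
        rw [if_pos ⟨hp, by rw [h1, f8, hlen]; exact hK⟩]
        have e2 : [j].take (s.mem 8 0 0 - l.length) = [j] :=
          List.take_of_length_le (by simp; omega)
        rw [e2]
        have ha := childCode_den r ω t (by rw [f0, hd]) (by have := h2.count; rw [f50]; omega)
        rw [f50, htj] at ha
        refine ⟨?_, hput _ _ (h2.addEdge ha hv hjd)⟩
        simp [ha.slots, h1]
      · have e2 : s.mem 8 0 0 - l.length = 0 := by omega
        have hlen : (l.take (s.mem 8 0 0)).length = s.mem 8 0 0 := by
          rw [List.length_take]; omega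
        rw [if_neg (by rw [h1, f8, hlen]; simp), e2, List.take_zero, List.append_nil]
        exact ⟨by simpa using h1, hput _ _ h2⟩
    · have e1 : [j].filter (fun i => (s.mem.Promising (s.mem 50 0 0) i : Bool)) = [] := by
        simp [hp]
      rw [if_neg (fun h => hp h.1), e1, List.append_nil]
      exact ⟨by simpa using h1, hput _ _ h2⟩

end den

/-- The directions of the first `E` edges that start at the node number `u`. -/
def Store.edgeDirs (M : Store) (E u : ℕ) : List ℕ :=
  ((List.range E).filter (fun e => M 28 e 0 = u)).map (fun e => M 29 e 0)

theorem Expanded.edgeDirs {d : ℕ} {M M' : Store} {v : ℕ} {l : List ℕ} (h : Expanded d M M' v l)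
    (u : ℕ) : M'.edgeDirs (M' 27 0 0) u =
      M.edgeDirs (M 27 0 0) u ++ if u = v then l else [] := by
  have h1 : List.range (M' 27 0 0) = List.range (M 27 0 0) ++ List.range' (M 27 0 0) l.length := by
    rw [h.count, List.range_eq_range', List.range_eq_range', ← List.range'_append_1, zero_add]
  rw [Store.edgeDirs, h1, List.filter_append, List.map_append]
  congr 1
  · have h2 : (List.range (M 27 0 0)).filter (fun e => (M' 28 e 0 = u : Bool)) =
        (List.range (M 27 0 0)).filter (fun e => (M 28 e 0 = u : Bool)) :=
      List.filter_congr fun e he => by rw [h.par_old e (List.mem_range.1 he)]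
    rw [h2, Store.edgeDirs]
    refine List.map_congr_left fun e he => ?_
    exact h.dir_old e (List.mem_range.1 (List.mem_filter.1 he).1)
  · have hv : ∀ e ∈ List.range' (M 27 0 0) l.length, M' 28 e 0 = v := by
      intro e he
      rw [List.mem_range'_1] at he
      exact h.par_new e he.1 (by rw [h.count]; exact he.2)
    split_ifs with hu
    · subst hu
      rw [List.filter_eq_self.2 (fun e he => by simpa using hv e he), h.dir_new]
    · rw [List.filter_eq_nil_iff.2, List.map_nil]
      intro e he
      simpa [hv e he] using fun h => hu h.symm

theorem Store.edgeDirs_eq_nil {M : Store} {E u : ℕ} (h : ∀ e < E, M 28 e 0 ≠ u) :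
    M.edgeDirs E u = [] := by
  rw [edgeDirs, List.filter_eq_nil_iff.2, List.map_nil]
  intro e he
  simpa using h e (List.mem_range.1 he)

/-- The first `v` nodes have been processed. -/
structure Grown (d : ℕ) (f : Est d) (M : Store) (v : ℕ) : Prop where
  forest : Forest d M
  par_lt : ∀ e < M 27 0 0, M 28 e 0 < v
  edges : ∀ u < v, u < 2 * M 27 0 0 + 1 → M.edgeDirs (M 27 0 0) u =
    if M 25 u 0 < M 1 0 0 then
      (f.choices (M 7 0 0) (M 8 0 0) (M 25 u 0) (M.cube d u)).map Fin.val else []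
  est : ∀ u < v, u < 2 * M 27 0 0 + 1 → ∀ i ≤ d, M 26 u i = f (M 25 u 0) (M.cube d u) i
  mass : ∀ u < v, u < 2 * M 27 0 0 + 1 → M 32 u 0 = f (M 25 u 0) (M.cube d u) d
  -- A potential: a processed node counts one, and a pending node counts for the largest subtree
  -- that it may still generate, with at most `2K` children per node down to depth `ℓ`.
  size : min v (2 * M 27 0 0 + 1) +
    ∑ u ∈ Finset.Ico v (2 * M 27 0 0 + 1), (2 * M 8 0 0 + 1) ^ (M 1 0 0 - M 25 u 0) ≤ M 10 0 0

theorem Store.promising_eq {d : ℕ} {f : Est d} {M : Store} {v : ℕ} (hd : M 0 0 0 = d)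
    (h : ∀ i ≤ d, M 26 v i = f (M 25 v 0) (M.cube d v) i) :
    ((List.range d).filter (fun i => M.Promising v i)).take (M 8 0 0) =
      (f.choices (M 7 0 0) (M 8 0 0) (M 25 v 0) (M.cube d v)).map Fin.val := by
  rw [Est.choices, List.map_take, ← List.map_coe_finRange_eq_range, List.filter_map]
  congr 3
  funext i
  have hfree : M.cube d v i = none ↔ 2 ≤ M 24 v i := by
    simp only [cube, readSubcube, zero_add]
    split_ifs <;> simp <;> omega
  simp only [Function.comp, Promising, Est.Flagged, Est.gain, hfree, hd, h d le_rfl,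
    h i i.2.le]

section den
variable {d : ℕ} (r : Coins) (ω : Answers d)

theorem Grown.congr {f : Est d} {M M' : Store} {v : ℕ} (h : Grown d f M v)
    (hk : ∀ k ∈ [1, 7, 8, 10, 24, 25, 26, 27, 28, 29, 32], M' k = M k) : Grown d f M' v := by
  simp only [List.mem_cons, List.not_mem_nil, or_false, forall_eq_or_imp, forall_eq] at hk
  obtain ⟨h1, h7, h8, h10, h24, h25, h26, h27, h28, h29, h32⟩ := hk
  have hc : ∀ u, M'.cube d u = M.cube d u := fun u => Store.cube_congr (by rw [h24])
  refine ⟨⟨?_, ?_, ?_, ?_, ?_⟩, ?_, ?_, ?_, ?_, ?_⟩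
  · rw [hc]; exact h.forest.root
  · rw [h25]; exact h.forest.root_lev
  · rw [h27, h28]; exact h.forest.par_lt
  · rw [h27, h29]; exact h.forest.dir_lt
  · simp only [h27, h28, h29, h25, hc]; exact h.forest.child
  · rw [h27, h28]; exact h.par_lt
  · simp only [Store.edgeDirs, h27, h28, h29, h25, hc, h1, h7, h8]; exact h.edges
  · simp only [h26, h27, h25, hc]; exact h.est
  · simp only [h32, h27, h25, hc]; exact h.mass
  · simp only [h27, h8, h1, h25, h10]; exact h.size

/-- Processing a node above the maximal depth replaces the weight `(2K + 1)^(k + 1)` by one plus at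
most `2K` new weights `(2K + 1)^k`. So the potential does not increase. -/
theorem nodeCode_den {f : Est d} (s : AState) {v : ℕ} (hd : s.mem 0 0 0 = d)
    (hv : s.mem 50 0 0 = v) (hlt : v < 2 * s.mem 27 0 0 + 1) (hg : Grown d f s.mem v)
    (hf : ∀ i ≤ d, s.mem.rounded v i = f (s.mem 25 v 0) (s.mem.cube d v) i) :
    Grown d f (nodeCode.den r ω s).mem (v + 1) := by
  set s1 := estimateCode.den r ω s with hs1
  have hfr : ∀ k, k ∉ estimateCode.writes → s1.mem k = s.mem k :=
    fun k hk => den_mem r ω estimateCode s hk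
  have f0 := hfr 0 (by decide)
  have f1 := hfr 1 (by decide)
  have f7 := hfr 7 (by decide)
  have f8 := hfr 8 (by decide)
  have f10 := hfr 10 (by decide)
  have f24 := hfr 24 (by decide)
  have f25 := hfr 25 (by decide)
  have f27 := hfr 27 (by decide)
  have f28 := hfr 28 (by decide)
  have f29 := hfr 29 (by decide)
  have f50 := hfr 50 (by decide)
  have hc : ∀ u, s1.mem.cube d u = s.mem.cube d u := fun u => Store.cube_congr (by rw [f24])
  have h26 : ∀ u i, s1.mem 26 u i = if u = v ∧ i ≤ d then s.mem.rounded v i else s.mem 26 u i := by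
    intro u i; rw [hs1, estimateCode_den, hv, hd]
  have h32 : ∀ u, s1.mem 32 u 0 = if u = v then s.mem.rounded v d else s.mem 32 u 0 := by
    intro u; rw [hs1, estimateCode_den_mass, hv, hd]
  have hforest : Forest d s1.mem := by
    refine ⟨?_, ?_, ?_, ?_, ?_⟩
    · rw [hc]; exact hg.forest.root
    · rw [f25]; exact hg.forest.root_lev
    · rw [f27, f28]; exact hg.forest.par_lt
    · rw [f27, f29]; exact hg.forest.dir_lt
    · simp only [f27, f28, f29, f25, hc]; exact hg.forest.child
  have hest : ∀ u < v + 1, u < 2 * s.mem 27 0 0 + 1 → ∀ i ≤ d,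
      s1.mem 26 u i = f (s1.mem 25 u 0) (s1.mem.cube d u) i := by
    intro u hu hu' i hi
    rw [h26, f25, hc]
    split_ifs with h
    · rw [h.1]; exact hf i hi
    · exact hg.est u (by have := fun e => h ⟨e, hi⟩; omega) hu' i hi
  have hmass : ∀ u < v + 1, u < 2 * s.mem 27 0 0 + 1 →
      s1.mem 32 u 0 = f (s1.mem 25 u 0) (s1.mem.cube d u) d := by
    intro u hu hu'
    rw [h32, f25, hc]
    split_ifs with h
    · rw [h]; exact hf d le_rfl
    · exact hg.mass u (by omega) hu'
  have hedges : ∀ u < v, u < 2 * s.mem 27 0 0 + 1 → s1.mem.edgeDirs (s.mem 27 0 0) u =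
    if s.mem 25 u 0 < s.mem 1 0 0 then (f.choices (s.mem 7 0 0) (s.mem 8 0 0) (s.mem 25 u 0)
      (s.mem.cube d u)).map Fin.val else [] := by
    intro u hu hu'
    rw [← hg.edges u hu hu', Store.edgeDirs, Store.edgeDirs, f28, f29]
  have hnil : s1.mem.edgeDirs (s.mem 27 0 0) v = [] := by
    refine Store.edgeDirs_eq_nil fun e he => ?_
    rw [f28]; exact (hg.par_lt e he).ne
  have hpot := hg.size
  rw [Finset.sum_eq_sum_Ico_succ_bot hlt, min_eq_left (by omega)] at hpot
  simp only [nodeCode, den_block_cons, den_block_one, den_ite, den_skip]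
  rw [← hs1]
  by_cases hl : s.mem 25 v 0 < s.mem 1 0 0
  · rw [if_pos (by simp only [AExpr.eval]; rw [f50, hv, f25, f1]; omega)]
    have hx := expandCode_den r ω s1 (by rw [f0, hd]) hforest (by rw [f50, hv, f27]; exact hlt)
    have hf2 : ∀ k, k ∉ expandCode.writes → (expandCode.den r ω s1).mem k = s1.mem k :=
      fun k hk => den_mem r ω expandCode s1 hk
    have hex := hest v (by omega) hlt
    rw [f50, hv, Store.promising_eq (f := f) (by rw [f0, hd]) hex] at hx
    have g1 := hf2 1 (by decide)
    have g7 := hf2 7 (by decide)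
    have g8 := hf2 8 (by decide)
    have g10 := hf2 10 (by decide)
    have g26 := hf2 26 (by decide)
    have g32 := hf2 32 (by decide)
    generalize (expandCode.den r ω s1).mem = M' at *
    set l := (f.choices (s1.mem 7 0 0) (s1.mem 8 0 0) (s1.mem 25 v 0) (s1.mem.cube d v)).map
      Fin.val with hldef
    have hlen : l.length ≤ s.mem 8 0 0 := by
      rw [hldef, List.length_map, Est.choices, List.length_take, f8]
      exact min_le_left _ _
    have hcount : M' 27 0 0 = s.mem 27 0 0 + l.length := by rw [hx.count, f27]
    have hold : ∀ u < 2 * s.mem 27 0 0 + 1, M' 25 u 0 = s.mem 25 u 0 ∧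
        M'.cube d u = s.mem.cube d u := by
      intro u hu
      rw [hx.lev_old u (by rwa [f27]), f25, Store.cube_congr (hx.row_old u (by rwa [f27])), hc]
      exact ⟨rfl, rfl⟩
    have hlt' : ∀ u < v + 1, u < 2 * s.mem 27 0 0 + 1 := fun u hu => by omega
    refine ⟨hx.forest, ?_, ?_, ?_, ?_, ?_⟩
    · intro e he
      by_cases h : e < s.mem 27 0 0
      · rw [hx.par_old e (by rwa [f27]), f28]
        exact (hg.par_lt e h).trans (by omega)
      · rw [hx.par_new e (by rw [f27]; omega) he]
        omega
    · intro u hu _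
      obtain ⟨hu1, hu2⟩ := hold u (hlt' u hu)
      rw [hx.edgeDirs, f27, hu1, hu2, g1, g7, g8, f1, f7, f8]
      by_cases huv : u = v
      · subst huv
        rw [hnil, if_pos rfl, if_pos hl, hldef, f7, f8, f25, hc]
        rfl
      · rw [if_neg huv, List.append_nil]
        exact hedges u (by omega) (hlt' u hu)
    · intro u hu _ i hi
      obtain ⟨hu1, hu2⟩ := hold u (hlt' u hu)
      rw [hu1, hu2, g26, hest u hu (hlt' u hu) i hi, f25, hc]
    · intro u hu _
      obtain ⟨hu1, hu2⟩ := hold u (hlt' u hu)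
      rw [hu1, hu2, g32, hmass u hu (hlt' u hu), f25, hc]
    · rw [min_eq_left (by omega), g1, g8, g10, f1, f8, f10]
      rw [← Finset.sum_Ico_consecutive _ (show v + 1 ≤ 2 * s.mem 27 0 0 + 1 by omega)
        (show 2 * s.mem 27 0 0 + 1 ≤ 2 * M' 27 0 0 + 1 by omega)]
      have e1 : ∑ u ∈ Finset.Ico (v + 1) (2 * s.mem 27 0 0 + 1),
          (2 * s.mem 8 0 0 + 1) ^ (s.mem 1 0 0 - M' 25 u 0) =
          ∑ u ∈ Finset.Ico (v + 1) (2 * s.mem 27 0 0 + 1),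
          (2 * s.mem 8 0 0 + 1) ^ (s.mem 1 0 0 - s.mem 25 u 0) :=
        Finset.sum_congr rfl fun u hu => by rw [(hold u (Finset.mem_Ico.1 hu).2).1]
      have e2 : ∑ u ∈ Finset.Ico (2 * s.mem 27 0 0 + 1) (2 * M' 27 0 0 + 1),
          (2 * s.mem 8 0 0 + 1) ^ (s.mem 1 0 0 - M' 25 u 0) =
          2 * l.length * (2 * s.mem 8 0 0 + 1) ^ (s.mem 1 0 0 - (s.mem 25 v 0 + 1)) := by
        rw [Finset.sum_congr rfl (g := fun _ =>
          (2 * s.mem 8 0 0 + 1) ^ (s.mem 1 0 0 - (s.mem 25 v 0 + 1))) fun u hu => ?_]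
        · rw [Finset.sum_const, Nat.card_Ico, smul_eq_mul]
          congr 1
          omega
        · rw [Finset.mem_Ico] at hu
          rw [hx.lev_new u (by rw [f27]; exact hu.1) hu.2, f25]
      rw [e1, e2]
      have e3 : s.mem 1 0 0 - s.mem 25 v 0 = s.mem 1 0 0 - (s.mem 25 v 0 + 1) + 1 := by omega
      rw [e3, pow_succ] at hpot
      have hpos : 1 ≤ (2 * s.mem 8 0 0 + 1) ^ (s.mem 1 0 0 - (s.mem 25 v 0 + 1)) :=
        Nat.one_le_pow _ _ (by omega)
      generalize (2 * s.mem 8 0 0 + 1) ^ (s.mem 1 0 0 - (s.mem 25 v 0 + 1)) = w at *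
      -- At most `K` edges are added, hence at most `2K` pending nodes of weight `w`; the last `w ≥
      -- 1` pays for the processed node itself.
      have e4 : 2 * l.length * w ≤ 2 * s.mem 8 0 0 * w := by gcongr
      have e5 : w * (2 * s.mem 8 0 0 + 1) = 2 * s.mem 8 0 0 * w + w := by ring
      omega
  · rw [if_neg (by simp only [AExpr.eval]; rw [f50, hv, f25, f1]; omega)]
    refine ⟨hforest, ?_, ?_, ?_, ?_, ?_⟩
    · intro e he
      rw [f27] at he
      rw [f28]
      exact (hg.par_lt e he).trans (by omega)
    · intro u hu hu'
      rw [f27] at hu' ⊢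
      rw [f25, f1, f7, f8, hc]
      by_cases huv : u = v
      · subst huv
        rw [hnil, if_neg hl]
      · exact hedges u (by omega) hu'
    · rw [f27]; exact hest
    · rw [f27]; exact hmass
    · rw [f27, f8, f1, f10, f25, min_eq_left (by omega)]
      have hpos : 1 ≤ (2 * s.mem 8 0 0 + 1) ^ (s.mem 1 0 0 - s.mem 25 v 0) :=
        Nat.one_le_pow _ _ (by omega)
      omega

theorem rootCode_den (s : AState) (hd : s.mem 0 0 0 = d) :
    (rootCode.den r ω s).mem.cube d 0 = fun _ => none := by
  have key : ∀ c < d, (rootCode.den r ω s).mem 24 0 c = 2 := by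
    have := rep_rule r ω (P := .set 24 (.lit 0) (var 51) (.lit 2)) (k := 51) (e := var 0) (s := s)
      (fun j t => ∀ c < j, t.mem 24 0 c = 2) (by simp) (by
        intro j hj t htj hf ht c hc
        simp only [den_set, AExpr.eval, AState.put_mem, htj]
        rcases Nat.lt_succ_iff_lt_or_eq.1 hc with hc | rfl
        · simp [ht c hc]
        · simp)
    simp only [AExpr.eval, hd] at this
    exact this
  funext c
  simp [Store.cube, readSubcube, key c c.2]

/-- At the start the only node is the root, of potential `(2K + 1)^ℓ`; by `hN` this is also the
number of passes. -/
theorem growCode_den {x : ℕ → Cube d} (s : AState) (hd : s.mem 0 0 0 = d)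
    (hx : ∀ t < s.mem 16 0 0, ∀ c : Fin d, s.mem 21 t c = (x t c).toNat)
    (h25 : s.mem 25 0 0 = 0) (h27 : s.mem 27 0 0 = 0)
    (hN : (2 * s.mem 8 0 0 + 1) ^ s.mem 1 0 0 = s.mem 10 0 0) :
    Grown d (roundedEst x (s.mem 22) (s.mem 16 0 0) (fun l => s.mem 35 l 0) (s.mem 14 0 0))
      (growCode.den r ω s).mem (s.mem 10 0 0) := by
  simp only [growCode, den_block_cons, den_block_one]
  set f := roundedEst x (s.mem 22) (s.mem 16 0 0) (fun l => s.mem 35 l 0) (s.mem 14 0 0) with hf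
  set s0 := rootCode.den r ω s with hs0
  have hfr : ∀ k, k ∉ rootCode.writes → s0.mem k = s.mem k :=
    fun k hk => den_mem r ω rootCode s hk
  have key := rep_rule r ω (P := .ite (.sub (.add (.add (var 27) (var 27)) (.lit 1)) (var 50))
    nodeCode .skip) (k := 50) (e := var 10) (s := s0) (fun v t => Grown d f t.mem v) ?_ ?_
  · simp only [AExpr.eval] at key
    rw [hfr 10 (by decide)] at key
    exact key
  · have e27 : (s0.put 50 0 0 0).mem 27 0 0 = 0 := by simp [hfr 27 (by decide), h27]
    refine ⟨⟨?_, ?_, ?_, ?_, ?_⟩, ?_, ?_, ?_, ?_, ?_⟩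
    · rw [Store.cube_congr (M := s0.mem) (by simp [AState.put]), hs0, rootCode_den r ω s hd]
    · simp [hfr 25 (by decide), h25]
    all_goals rw [e27]
    · simp
    · simp
    · simp
    · simp
    · simp
    · simp
    · simp
    · simp [hfr 25 (by decide), h25, hfr 8 (by decide), hfr 1 (by decide), hfr 10 (by decide), hN]
  · intro v hv t htv hft hg
    have ff : ∀ k, k ∉ growCode.writes → t.mem k = s.mem k := by
      intro k hk
      simp only [growCode, block, writes, List.mem_append, not_or] at hk
      rw [hft k (by simpa [writes] using hk.2), hfr k hk.1]
    refine Grown.congr (M := (ACode.den r ω (.ite (.sub (.add (.add (var 27) (var 27)) (.lit 1))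
      (var 50)) nodeCode .skip) t).mem) ?_ fun k hk => ?_
    · rw [den_ite, den_skip]
      by_cases hlt : v < 2 * t.mem 27 0 0 + 1
      · rw [if_pos (by simp only [AExpr.eval, htv]; omega)]
        refine nodeCode_den r ω t (by rw [ff 0 (by decide), hd]) htv hlt hg fun i _ => ?_
        rw [Store.rounded_eq (x := x) (d := d) (by rw [ff 0 (by decide), hd])
          (by rw [ff 16 (by decide), ff 21 (by decide)]; exact hx), hf, ff 22 (by decide),
          ff 16 (by decide), ff 35 (by decide), ff 14 (by decide)]
      · rw [if_neg (by simp only [AExpr.eval, htv]; omega)]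
        refine ⟨hg.forest, fun e he => (hg.par_lt e he).trans (by omega), ?_, ?_, ?_, ?_⟩
        · exact fun u _ hu => hg.edges u (by omega) hu
        · exact fun u _ hu => hg.est u (by omega) hu
        · exact fun u _ hu => hg.mass u (by omega) hu
        · have := hg.size
          rw [min_eq_right (by omega)] at this ⊢
          rw [Finset.Ico_eq_empty (by omega), Finset.sum_empty] at this ⊢
          exact this
    · refine AState.put_mem_ne _ _ _ _ ?_
      rintro rfl
      simp at hk

end den

/-! ### Selecting and writing the best tree -/

/-- The tree stored at the node number `u`; all its edges have numbers at least `b`. -/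
inductive Store.Reads (d : ℕ) (M : Store) (b : ℕ) : ℕ → DecisionTree d (ℕ × ℕ) → Prop
  | leaf {u : ℕ} : M 31 u 0 = 0 → Reads d M b u (.leaf (M 26 u d, M 25 u 0))
  | node {u e : ℕ} {i : Fin d} {l r : DecisionTree d (ℕ × ℕ)} : M 31 u 0 = e + 1 → b ≤ e →
      M 29 e 0 = i → Reads d M b (2 * e + 1) l → Reads d M b (2 * e + 2) r →
      Reads d M b u (.node i l r)

theorem Store.Reads.mono {d : ℕ} {M : Store} {b b' u : ℕ} {T : DecisionTree d (ℕ × ℕ)}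
    (h : M.Reads d b u T) (hb : b' ≤ b) : M.Reads d b' u T := by
  induction h with
  | leaf h => exact .leaf h
  | node h1 h2 h3 _ _ ih1 ih2 => exact .node h1 (hb.trans h2) h3 ih1 ih2

/-- A tree whose edges have numbers at least `b` meets, below its root, only nodes with numbers at
least `2b + 1`. Changing the best edge of any other node does not affect it. -/
theorem Store.Reads.congr {d : ℕ} {M M' : Store} {b u : ℕ} {T : DecisionTree d (ℕ × ℕ)}
    (h : M.Reads d b u T) (h25 : M' 25 = M 25) (h26 : M' 26 = M 26) (h29 : M' 29 = M 29)
    (h31 : ∀ w, w = u ∨ 2 * b + 1 ≤ w → M' 31 w 0 = M 31 w 0) : M'.Reads d b u T := by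
  induction h with
  | @leaf u h =>
    rw [← h25, ← h26]
    exact .leaf (by rw [h31 u (Or.inl rfl), h])
  | @node u e i l r h1 h2 h3 _ _ ih1 ih2 =>
    refine .node (by rw [h31 u (Or.inl rfl), h1]) h2 (by rw [h29, h3]) (ih1 fun w hw => ?_)
      (ih2 fun w hw => ?_) <;>
    exact h31 w (Or.inr (by omega))

/-- The plan stored at the node number `u`. -/
def Store.Shows (d : ℕ) (M : Store) (b u : ℕ) (P : Plan d) : Prop :=
  M 30 u 0 = P.gain ∧ M 32 u 0 = P.mass ∧ M.Reads d b u P.tree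

section den
variable {d : ℕ} (r : Coins) (ω : Answers d)

/-- The gain of the edge number `e`. -/
def Store.score (M : Store) (e : ℕ) : ℕ :=
  2 * M 26 (M 28 e 0) (M 29 e 0) - M 26 (M 28 e 0) (M 0 0 0) +
    M 30 (2 * e + 1) 0 + M 30 (2 * e + 2) 0

theorem compareCode_den (s : AState) {e : ℕ} (he : s.mem 27 0 0 - 1 - s.mem 50 0 0 = e)
    (k u : ℕ) (hk : k ≠ 39) (hk' : k ≠ 46) : (compareCode.den r ω s).mem k u 0 =
      if s.mem 30 (s.mem 28 e 0) 0 < s.mem.score e ∧ u = s.mem 28 e 0 then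
        if k = 30 then s.mem.score e else if k = 31 then e + 1
        else if k = 32 then s.mem 32 (2 * e + 1) 0 + s.mem 32 (2 * e + 2) 0 else s.mem k u 0
      else s.mem k u 0 := by
  simp only [compareCode, den_block_cons, den_block_one, den_set]
  set s1 := s.put 46 _ _ _ with hs1
  have m1 : ∀ k u c, s1.mem k u c = if k = 46 ∧ u = 0 ∧ c = 0 then e else s.mem k u c := by
    intro k u c
    rw [hs1, AState.put_mem]
    simp only [AExpr.eval, he]
  set s2 := s1.put 39 _ _ _ with hs2
  have e2 : e + e = 2 * e := by ring
  have m2 : ∀ k u c, s2.mem k u c = if k = 39 ∧ u = 0 ∧ c = 0 then s.mem.score e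
      else s1.mem k u c := by
    intro k u c
    rw [hs2, AState.put_mem]
    simp only [AExpr.eval, m1]
    simp [Store.score, ← two_mul]
  rw [den_ite]
  by_cases hc : s.mem 30 (s.mem 28 e 0) 0 < s.mem.score e
  · rw [if_pos (by simp only [AExpr.eval, m2, m1]; simp; omega)]
    simp only [den_block_cons, den_block_one, den_set, AExpr.eval, AState.put_mem, m2, m1]
    by_cases hu : u = s.mem 28 e 0 <;> by_cases h30 : k = 30 <;> by_cases h31 : k = 31 <;>
      by_cases h32 : k = 32 <;> simp_all
  · rw [if_neg (by simp only [AExpr.eval, m2, m1]; simp; omega), if_neg (fun h => hc h.1),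
      den_skip, m2, m1]
    simp [hk, hk']

/-- The best plan for the node number `u`, when only the edges in the directions `l` are used. -/
def Store.foldPlan (f : Est d) (M : Store) (u : ℕ) (l : List (Fin d)) : Plan d :=
  l.foldr (fun i acc => f.improve (M 25 u 0) (M.cube d u) i
    (f.plan (M 7 0 0) (M 8 0 0) (M 1 0 0 - M 25 u 0 - 1) (M 25 u 0 + 1)
      ((M.cube d u).fix i false))
    (f.plan (M 7 0 0) (M 8 0 0) (M 1 0 0 - M 25 u 0 - 1) (M 25 u 0 + 1)
      ((M.cube d u).fix i true)) acc) (f.asLeaf (M 25 u 0) (M.cube d u))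

/-- The edges stored at a processed node are precisely the chosen directions in order, so folding
over them is one unfolding of the recursion for `Est.plan`. -/
theorem Grown.foldPlan_eq {f : Est d} {M : Store} {v u : ℕ} (hg : Grown d f M v) (hu : u < v)
    (hu' : u < 2 * M 27 0 0 + 1) {l : List (Fin d)}
    (hl : l.map Fin.val = M.edgeDirs (M 27 0 0) u) : M.foldPlan f u l =
      f.plan (M 7 0 0) (M 8 0 0) (M 1 0 0 - M 25 u 0) (M 25 u 0) (M.cube d u) := by
  rw [hg.edges u hu hu'] at hl
  split_ifs at hl with h
  · have : l = f.choices (M 7 0 0) (M 8 0 0) (M 25 u 0) (M.cube d u) :=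
      (List.map_injective_iff.2 Fin.val_injective) hl
    obtain ⟨k, hk⟩ : ∃ k, M 1 0 0 - M 25 u 0 = k + 1 := ⟨M 1 0 0 - M 25 u 0 - 1, by omega⟩
    rw [hk, Est.plan, Store.foldPlan, this, hk]
    rfl
  · have : l = [] := by simpa using hl
    rw [this, show M 1 0 0 - M 25 u 0 = 0 by omega]
    rfl

/-- Dynamic programming from the last edge to the first. An edge leaving a child of edge `g` has a
number above `g`, because parents are older than children; so both child plans are final when `g` is
treated. The backward order also matches `foldr`, which settles ties in the same way as `Est.plan`.
-/
theorem selectCode_den {f : Est d} (s : AState) {v : ℕ} (hd : s.mem 0 0 0 = d)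
    (hg : Grown d f s.mem v) (hv : 2 * s.mem 27 0 0 + 1 ≤ v) (h30 : ∀ u, s.mem 30 u 0 = 0)
    (h31 : ∀ u, s.mem 31 u 0 = 0) : (selectCode.den r ω s).mem.Shows d 0 0
      (f.plan (s.mem 7 0 0) (s.mem 8 0 0) (s.mem 1 0 0) 0 fun _ => none) := by
  set E := s.mem 27 0 0 with hE
  let q : ℕ → ℕ → List ℕ := fun e u =>
    ((List.range' (E - e) e).filter (fun e => s.mem 28 e 0 = u)).map (fun e => s.mem 29 e 0)
  have key := rep_rule r ω (P := compareCode) (k := 50) (e := var 27) (s := s)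
    (fun e t => ∀ u < 2 * E + 1, ∃ l : List (Fin d), l.map Fin.val = q e u ∧
      t.mem.Shows d (E - e) u (s.mem.foldPlan f u l)) ?_ ?_
  · simp only [AExpr.eval, ← hE] at key
    obtain ⟨l, hl, hs⟩ := key 0 (by omega)
    rw [hg.foldPlan_eq (by omega) (by omega) (by
      rw [hl]; simp [q, Store.edgeDirs, ← hE, List.range_eq_range'])] at hs
    rw [hg.forest.root_lev, hg.forest.root] at hs
    simpa [selectCode] using hs
  · intro u hu
    refine ⟨[], by simp [q], ?_⟩
    have hcu : ∀ k, k ≠ 50 → (s.put 50 0 0 0).mem k = s.mem k :=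
      fun k hk => AState.put_mem_ne _ _ _ _ hk
    refine ⟨by simp [h30, Store.foldPlan, Est.asLeaf], ?_, ?_⟩
    · rw [hcu 32 (by decide), hg.mass u (by omega) hu]
      rfl
    · have h := hg.est u (by omega) hu d le_rfl
      rw [← hcu 25 (by decide), ← hcu 26 (by decide)] at h
      simp only [Store.foldPlan, List.foldr_nil, Est.asLeaf]
      rw [← hcu 25 (by decide), ← h]
      exact .leaf (by simp [h31])
  · intro e he t hte hft ht
    simp only [AExpr.eval, ← hE] at he
    obtain ⟨g, hge⟩ : ∃ g, E - e = g + 1 := ⟨E - e - 1, by omega⟩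
    have hg' : E - (e + 1) = g := by omega
    have hgE : g < E := by omega
    have f0 := hft 0 (by decide)
    have f25 := hft 25 (by decide)
    have f26 := hft 26 (by decide)
    have f27 := hft 27 (by decide)
    have f28 := hft 28 (by decide)
    have f29 := hft 29 (by decide)
    have hpar := hg.forest.par_lt g hgE
    have hdir := hg.forest.dir_lt g hgE
    obtain ⟨hc1, hc2, hl1, hl2⟩ := hg.forest.child g hgE hdir
    set p := s.mem 28 g 0 with hp
    set i : Fin d := ⟨s.mem 29 g 0, hdir⟩ with hi
    -- the children are complete
    have hchild : ∀ c, 2 * g + 1 ≤ c → c < 2 * E + 1 → t.mem.Shows d (g + 1) c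
        (f.plan (s.mem 7 0 0) (s.mem 8 0 0) (s.mem 1 0 0 - s.mem 25 c 0) (s.mem 25 c 0)
          (s.mem.cube d c)) := by
      intro c hc hcE
      obtain ⟨l, hl, hs⟩ := ht c hcE
      rw [hge] at hs
      rwa [hg.foldPlan_eq (by omega) hcE] at hs
      rw [hl]
      simp only [q, Store.edgeDirs, ← hE]
      have hr : List.range E = List.range (E - e) ++ List.range' (E - e) e := by
        rw [List.range_eq_range', List.range_eq_range', show List.range' (E - e) e =
          List.range' (0 + (E - e)) e by rw [zero_add], List.range'_append_1]
        congr 1; omega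
      have hnil : (List.range (E - e)).filter (fun e => s.mem 28 e 0 = c) = [] := by
        rw [List.filter_eq_nil_iff]
        intro e' he'
        rw [List.mem_range] at he'
        have := hg.forest.par_lt e' (by omega)
        simp only [decide_eq_true_eq]
        omega
      rw [hr, List.filter_append, List.map_append, hnil, List.map_nil, List.nil_append]
    have hplt : s.mem 25 p 0 < s.mem 1 0 0 := by
      have h1 := hg.edges p (hg.par_lt g hgE) (by omega)
      by_contra h2
      rw [if_neg h2, Store.edgeDirs, List.map_eq_nil_iff, List.filter_eq_nil_iff] at h1
      exact h1 g (List.mem_range.2 hgE) (by simp [hp])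
    have hsub : ∀ c, s.mem 25 c 0 = s.mem 25 p 0 + 1 →
        s.mem 1 0 0 - s.mem 25 c 0 = s.mem 1 0 0 - s.mem 25 p 0 - 1 := by
      intro c hc; omega
    obtain ⟨a1, a2, a3⟩ := hchild (2 * g + 1) (by omega) (by omega)
    obtain ⟨b1, b2, b3⟩ := hchild (2 * g + 2) (by omega) (by omega)
    rw [hsub _ hl1, hl1, hc1] at a1 a2 a3
    rw [hsub _ hl2, hl2, hc2] at b1 b2 b3
    set Pl := f.plan (s.mem 7 0 0) (s.mem 8 0 0) (s.mem 1 0 0 - s.mem 25 p 0 - 1)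
      (s.mem 25 p 0 + 1) ((s.mem.cube d p).fix i false) with hPl
    set Pr := f.plan (s.mem 7 0 0) (s.mem 8 0 0) (s.mem 1 0 0 - s.mem 25 p 0 - 1)
      (s.mem 25 p 0 + 1) ((s.mem.cube d p).fix i true) with hPr
    have hscore : t.mem.score g = f.gain (s.mem 25 p 0) (s.mem.cube d p) i + Pl.gain + Pr.gain := by
      have h1 := hg.est p (hg.par_lt g hgE) (by omega)
      simp only [Store.score, f26, f28, f29, f0, ← hp, a1, b1, hd, Est.gain]
      rw [h1 d le_rfl, h1 _ hdir.le]
    have hden : ∀ k, k ≠ 39 → k ≠ 46 → k ≠ 50 → ∀ u,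
        ((compareCode.den r ω t).put 50 0 0 (e + 1)).mem k u 0 =
        if t.mem 30 p 0 < t.mem.score g ∧ u = p then
          if k = 30 then t.mem.score g else if k = 31 then g + 1
          else if k = 32 then t.mem 32 (2 * g + 1) 0 + t.mem 32 (2 * g + 2) 0 else t.mem k u 0
        else t.mem k u 0 := by
      intro k h1 h2 h3 u
      rw [AState.put_mem_ne _ _ _ _ h3,
        compareCode_den r ω t (e := g) (by rw [f27, hte, ← hE]; omega) k u h1 h2, f28]
    have hfr : ∀ k ∈ [25, 26, 29],
        ((compareCode.den r ω t).put 50 0 0 (e + 1)).mem k = t.mem k := by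
      intro k hk
      rw [AState.put_mem_ne _ _ _ _ (by rintro rfl; simp at hk), den_mem r ω compareCode t]
      simp only [List.mem_cons, List.not_mem_nil, or_false] at hk
      rcases hk with rfl | rfl | rfl <;> decide
    generalize ((compareCode.den r ω t).put 50 0 0 (e + 1)).mem = M' at *
    have k25 := hfr 25 (by simp)
    have k26 := hfr 26 (by simp)
    have k29 := hfr 29 (by simp)
    have d30 := hden 30 (by decide) (by decide) (by decide)
    have d31 := hden 31 (by decide) (by decide) (by decide)
    have d32 := hden 32 (by decide) (by decide) (by decide)
    simp only [if_true, reduceIte, Nat.reduceEqDiff] at d30 d31 d32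
    rw [hg']
    intro u hu
    obtain ⟨l, hl, hs1, hs2, hs3⟩ := ht u hu
    rw [hge] at hs3
    have hq : q (e + 1) u = if p = u then (i : ℕ) :: q e u else q e u := by
      simp only [q, hg', List.range'_succ, hge, List.filter_cons, ← hp]
      by_cases hpu : p = u <;> simp [hpu, hi]
    -- Only the entry of the parent `p` may change, and `p < 2g + 1` lies below all nodes occurring
    -- under other roots that use edges above `g`.
    have hstay : ∀ w T, w ≠ p → t.mem.Reads d (g + 1) w T → M'.Reads d (g + 1) w T := by
      intro w T hw h
      refine h.congr k25 k26 k29 fun w' hw' => ?_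
      rw [d31, if_neg]
      rintro ⟨-, h1⟩
      omega
    by_cases hpu : p = u
    · refine ⟨i :: l, by rw [hq, if_pos hpu, List.map_cons, hl], ?_⟩
      subst hpu
      have hfold : s.mem.foldPlan f p (i :: l) =
        f.improve (s.mem 25 p 0) (s.mem.cube d p) i Pl Pr (s.mem.foldPlan f p l) := rfl
      rw [hfold, Est.improve, ← hscore, ← hs1]
      by_cases hlt : t.mem 30 p 0 < t.mem.score g
      · rw [if_pos hlt]
        refine ⟨?_, ?_, ?_⟩
        · rw [d30, if_pos ⟨hlt, rfl⟩]
        · rw [d32, if_pos ⟨hlt, rfl⟩, a2, b2]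
        · refine .node (e := g) ?_ le_rfl ?_ ((hstay _ _ (by omega) a3).mono (by omega))
            ((hstay _ _ (by omega) b3).mono (by omega))
          · rw [d31, if_pos ⟨hlt, rfl⟩]
          · rw [k29, f29]
      · rw [if_neg hlt]
        refine ⟨?_, ?_, ?_⟩
        · rw [d30, if_neg (fun h => hlt h.1), hs1]
        · rw [d32, if_neg (fun h => hlt h.1), hs2]
        · refine (hs3.congr k25 k26 k29 fun w' _ => ?_).mono (by omega)
          rw [d31, if_neg (fun h => hlt h.1)]
    · refine ⟨l, by rw [hq, if_neg hpu, hl], ?_⟩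
      have hpu' : ∀ a : Prop, ¬ (a ∧ u = p) := fun a h => hpu h.2.symm
      refine ⟨?_, ?_, ?_⟩
      · rw [d30, if_neg (hpu' _), hs1]
      · rw [d32, if_neg (hpu' _), hs2]
      · exact (hstay u _ (fun h => hpu h.symm) hs3).mono (by omega)

theorem doubleCode_den (s : AState) (hd : s.mem 0 0 0 = d) : (doubleCode.den r ω s).mem 48 0 0 =
    s.mem 48 0 0 * 2 ^ (d - s.mem 25 (s.mem 47 0 0) 0) := by
  have key := rep_rule r ω (P := .ite (.sub (.sub (var 0) (.get 25 (var 47) (.lit 0))) (var 51))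
    (assign 48 (.add (var 48) (var 48))) .skip) (k := 51) (e := var 0) (s := s)
    (fun j t => t.mem 48 0 0 = s.mem 48 0 0 * 2 ^ min j (d - s.mem 25 (s.mem 47 0 0) 0))
    (by simp) (by
      intro j hj t htj hft ht
      have f0 := hft 0 (by decide)
      have f25 := hft 25 (by decide)
      have f47 := hft 47 (by decide)
      rw [den_ite]
      by_cases hlt : j < d - s.mem 25 (s.mem 47 0 0) 0
      · rw [if_pos (by simp only [AExpr.eval, f0, f25, f47, htj, hd]; omega)]
        have e : min (j + 1) (d - s.mem 25 (s.mem 47 0 0) 0) = j + 1 := by omega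
        have e' : min j (d - s.mem 25 (s.mem 47 0 0) 0) = j := by omega
        simp only [den_set, AExpr.eval, AState.put_mem, ht, e, e']
        simp [pow_succ]
        ring
      · rw [if_neg (by simp only [AExpr.eval, f0, f25, f47, htj, hd]; omega)]
        have e : min (j + 1) (d - s.mem 25 (s.mem 47 0 0) 0) =
          min j (d - s.mem 25 (s.mem 47 0 0) 0) := by omega
        simp [den_skip, ht, e])
  simp only [AExpr.eval, hd] at key
  rw [min_eq_right (by omega)] at key
  exact key

/-- The stack holds the given nodes, which store the given trees. -/
def Store.Stack (d : ℕ) (M : Store) : List (DecisionTree d (ℕ × ℕ)) → Prop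
  | [] => True
  | T :: Ts => M.Reads d 0 (M 33 Ts.length 0) T ∧ M.Stack d Ts

theorem Store.Stack.congr {M M' : Store} {Ts : List (DecisionTree d (ℕ × ℕ))} (h : M.Stack d Ts)
    (hk : ∀ k ∈ [25, 26, 29, 31], M' k = M k) (h33 : ∀ u < Ts.length, M' 33 u 0 = M 33 u 0) :
    M'.Stack d Ts := by
  induction Ts with
  | nil => trivial
  | cons T Ts ih =>
    simp only [List.length_cons] at h33
    refine ⟨?_, ih h.2 fun u hu => h33 u (by omega)⟩
    rw [h33 _ (by omega)]
    exact h.1.congr (hk 25 (by simp)) (hk 26 (by simp)) (hk 29 (by simp))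
      fun w _ => by rw [hk 31 (by simp)]

/-- Two invariants of the stack: what has been written followed by the words of the stacked trees
never changes, and the total number of stacked nodes drops by one. The right child is pushed first,
so the left one is written first. -/
theorem popCode_den (s : AState) (hd : s.mem 0 0 0 = d) {T : DecisionTree d (ℕ × ℕ)}
    {Ts : List (DecisionTree d (ℕ × ℕ))} (hs : s.mem 34 0 0 = Ts.length + 1)
    (h : s.mem.Stack d (T :: Ts)) : ∃ Ts' w, (popCode.den r ω s).mem 34 0 0 = Ts'.length ∧
      (popCode.den r ω s).mem.Stack d Ts' ∧ (popCode.den r ω s).out = s.out ++ w ∧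
      w ++ Ts'.flatMap (outputWord (s.mem 32 0 0)) =
        (T :: Ts).flatMap (outputWord (s.mem 32 0 0)) ∧
      (Ts'.map DecisionTree.nodes).sum + 1 = ((T :: Ts).map DecisionTree.nodes).sum := by
  simp only [popCode, den_block_cons, den_block_one, den_set]
  set s1 := s.put 34 _ _ _ with hs1
  have m1 : ∀ k u c, s1.mem k u c = if k = 34 ∧ u = 0 ∧ c = 0 then Ts.length else s.mem k u c := by
    intro k u c
    rw [hs1, AState.put_mem]
    simp only [AExpr.eval, hs]
    rfl
  set u := s.mem 33 Ts.length 0 with hu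
  set s2 := s1.put 47 _ _ _ with hs2
  have m2 : ∀ k a c, s2.mem k a c = if k = 47 ∧ a = 0 ∧ c = 0 then u else s1.mem k a c := by
    intro k a c
    rw [hs2, AState.put_mem]
    simp only [AExpr.eval, m1]
    simp [hu]
  have hout : s2.out = s.out := rfl
  rw [den_ite]
  obtain ⟨hT, hTs⟩ := h
  rw [← hu] at hT
  cases hT with
  | leaf h31 =>
    rw [if_neg (by simp only [AExpr.eval, m2, m1]; simp [h31])]
    refine ⟨Ts, outputWord (d := d) (s.mem 32 0 0) (.leaf (s.mem 26 u d, s.mem 25 u 0)), ?_⟩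
    refine ⟨?_, ?_, ?_, ?_, ?_⟩
    · simp only [den_block_cons, den_block_one, den, AExpr.eval]
      rw [den_mem r ω doubleCode _ (by decide)]
      simp [m2, m1]
    · have hfr : ∀ k, k ≠ 48 → k ≠ 51 → k ≠ 34 → k ≠ 47 → ((block [.emit (.lit 0),
          .emit (.get 26 (var 47) (var 0)), assign 48 (.get 32 (.lit 0) (.lit 0)), doubleCode,
          .emit (var 48)]).den r ω s2).mem k = s.mem k := by
        intro k h1 h2 h3 h4
        rw [den_mem r ω _ s2 (by simp [block, writes, doubleCode, h1, h2])]
        funext a c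
        simp [m2, m1, h3, h4]
      refine hTs.congr (fun k hk => ?_) fun w _ => ?_
      · refine hfr k ?_ ?_ ?_ ?_ <;> (rintro rfl; simp at hk)
      · rw [hfr 33 (by decide) (by decide) (by decide) (by decide)]
    · simp only [den_block_cons, den_block_one, den]
      have hq := den_quiet r ω doubleCode
      simp only [AExpr.eval]
      rw [(hq _ (by simp [doubleCode, Quiet])).2.2, doubleCode_den r ω _ (by simp [m2, m1, hd])]
      simp [m2, m1, hd, hout, outputWord]
    · simp
    · simp [DecisionTree.nodes, add_comm]
  | @node _ e i l t h31 hb h29 hl ht =>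
    rw [if_pos (by simp only [AExpr.eval, m2, m1]; simp [h31])]
    have e2 : e + e = 2 * e := by ring
    simp only [den_block_cons, den_block_one, den]
    set s3 := s2.put 46 _ _ _ with hs3
    have m3 : ∀ k a c, s3.mem k a c = if k = 46 ∧ a = 0 ∧ c = 0 then e else s2.mem k a c := by
      intro k a c
      rw [hs3, AState.put_mem]
      simp only [AExpr.eval, m2, m1]
      simp [h31]
    have h3out : s3.out = s.out := rfl
    refine ⟨l :: t :: Ts, [(i : ℕ) + 1], ?_, ?_, ?_, ?_, ?_⟩
    · simp [AExpr.eval, m3, m2, m1]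
    · set s4 : AState := { s3 with out := _ } with hs4
      have m4 : ∀ k a c, s4.mem k a c = s3.mem k a c := fun k a c => rfl
      simp only [AExpr.eval]
      refine ⟨?_, ?_, ?_⟩
      · simp only [AState.put_mem, m4, m3, m2, m1]
        simp only [List.length_cons]
        simp [e2]
        refine hl.congr ?_ ?_ ?_ ?_
        · funext a c; simp [m4, m3, m2, m1]
        · funext a c; simp [m4, m3, m2, m1]
        · funext a c; simp [m4, m3, m2, m1]
        · intro w _; simp [m4, m3, m2, m1]
      · simp only [AState.put_mem, m4, m3, m2, m1]
        simp [e2]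
        refine ht.congr ?_ ?_ ?_ ?_
        · funext a c; simp [m4, m3, m2, m1]
        · funext a c; simp [m4, m3, m2, m1]
        · funext a c; simp [m4, m3, m2, m1]
        · intro w _; simp [m4, m3, m2, m1]
      · refine hTs.congr (fun k hk => ?_) fun w hw => ?_
        · have h33 : k ≠ 33 := by rintro rfl; simp at hk
          have h34 : k ≠ 34 := by rintro rfl; simp at hk
          have h46 : k ≠ 46 := by rintro rfl; simp at hk
          have h47 : k ≠ 47 := by rintro rfl; simp at hk
          funext a c; simp [m4, m3, m2, m1, h33, h34, h46, h47]
        · have h1 : w ≠ Ts.length := by omega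
          have h2 : w ≠ Ts.length + 1 := by omega
          simp [m4, m3, m2, m1, h1, h2]
    · simp [AExpr.eval, m3, m2, m1, h3out, h29]
    · simp [outputWord]
    · simp [DecisionTree.nodes]
      ring

theorem DecisionTree.nodes_pos {V : Type} (T : DecisionTree d V) : 0 < T.nodes := by
  cases T <;> simp [DecisionTree.nodes]

/-- Each pass writes one node, so as many passes as there are nodes suffice; passes with an empty
stack are idle. -/
theorem writeCode_den (s : AState) (hd : s.mem 0 0 0 = d) (h33 : s.mem 33 0 0 = 0)
    {P : Plan d} (hP : s.mem.Shows d 0 0 P) (hN : P.tree.nodes ≤ s.mem 10 0 0) :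
    (writeCode.den r ω s).out = s.out ++ outputWord P.mass P.tree := by
  obtain ⟨-, h2, h3⟩ := hP
  simp only [writeCode, den_block_cons, den_block_one, den_set, AExpr.eval]
  set s1 := s.put 34 0 0 1 with hs1
  have hfr : ∀ k, k ≠ 34 → s1.mem k = s.mem k := fun k hk => AState.put_mem_ne _ _ _ _ hk
  have key := rep_rule r ω (P := .ite (var 34) popCode .skip) (k := 50) (e := var 10) (s := s1)
    (fun j t => ∃ Ts, t.mem 34 0 0 = Ts.length ∧ t.mem.Stack d Ts ∧
      t.out ++ Ts.flatMap (outputWord P.mass) = s.out ++ outputWord P.mass P.tree ∧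
      (Ts.map DecisionTree.nodes).sum ≤ s.mem 10 0 0 - j) ?_ ?_
  · simp only [AExpr.eval] at key
    rw [hfr 10 (by decide)] at key
    obtain ⟨Ts, _, _, h5, h6⟩ := key
    have : Ts = [] := by
      cases Ts with
      | nil => rfl
      | cons T Ts =>
        have := T.nodes_pos
        simp at h6
        omega
    subst this
    simpa using h5
  · refine ⟨[P.tree], by simp [hs1], ⟨?_, trivial⟩, by simp [hs1], by simpa using hN⟩
    simp only [List.length_nil, AState.put_mem, hs1]
    simp [h33]
    refine h3.congr ?_ ?_ ?_ ?_
    · funext a c; simp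
    · funext a c; simp
    · funext a c; simp
    · intro w _; simp
  · rintro j hj t htj hft ⟨Ts, h4, h5, h6, h7⟩
    have hput : ∀ (t : AState) Ts, t.mem.Stack d Ts →
        Store.Stack d (t.put 50 0 0 (j + 1)).mem Ts := by
      intro t Ts h
      refine h.congr (fun k hk => AState.put_mem_ne _ _ _ _ ?_) fun u _ => by simp
      rintro rfl
      simp at hk
    have f32 : t.mem 32 0 0 = P.mass := by
      rw [hft 32 (by decide), hfr 32 (by decide), h2]
    rw [den_ite]
    cases Ts with
    | nil =>
      rw [if_neg (by simp only [AExpr.eval, h4]; simp)]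
      exact ⟨[], by simpa [den_skip] using h4, trivial, by simpa [den_skip] using h6, by simp⟩
    | cons T Ts =>
      rw [if_pos (by simp only [AExpr.eval, h4]; simp)]
      obtain ⟨Ts', w, k1, k2, k3, k4, k5⟩ := popCode_den r ω t
        (by rw [hft 0 (by decide), hfr 0 (by decide), hd]) (by simpa using h4) h5
      rw [f32] at k4
      refine ⟨Ts', by simpa using k1, hput _ _ k2, ?_, by omega⟩
      rw [AState.put_out, k3, List.append_assoc, k4, h6]

end den

/-! ### Parameters -/

/-- The basic parameter. -/
def scale (ℓ a : ℕ) : ℕ := (ℓ + 1) * a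

/-- Number of directions that are tried at each node. -/
def fanOut (ℓ a : ℕ) : ℕ := scale ℓ a ^ 7

/-- Bound for the number of nodes of the forest of candidates. -/
def nodeBound (ℓ a : ℕ) : ℕ := (2 * fanOut ℓ a + 1) ^ ℓ

/-- The inverse of the resolution of the rounded estimates. -/
def resolution (ℓ a : ℕ) : ℕ := 32 * 2 ^ ℓ * scale ℓ a ^ 6

/-- The ratio of the rounding width and the deviation of the counts. -/
def slack (d ℓ a q : ℕ) : ℕ := 12 * nodeBound ℓ a * (d + 1) * q

/-- Lower bound for the rounding width. -/
def minWidth (d ℓ a q B : ℕ) : ℕ :=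
  slack d ℓ a q * slack d ℓ a q * resolution ℓ a * (3 * d + B.size + 3)

/-- Number of random bits of each offset. -/
def offsetBits (d ℓ a q B : ℕ) : ℕ := Nat.clog 2 (minWidth d ℓ a q B)

/-- The rounding width. -/
def width (d ℓ a q B : ℕ) : ℕ := 2 ^ offsetBits d ℓ a q B

/-- Number of samples. -/
def sampleSize (d ℓ a q B : ℕ) : ℕ := width d ℓ a q B * resolution ℓ a

/-- The number with the binary digits `r n, …, r (n + b - 1)`. -/
def bits (r : Coins) (n : ℕ) : ℕ → ℕ
  | 0 => 0
  | b + 1 => bits r n b + bits r n b + (r (n + b)).toNat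

/-- The offset of a level, if offsets have `b` bits. -/
def offset (r : Coins) (b lev : ℕ) : ℕ := bits r (lev * b) b

section den
variable {d : ℕ} (r : Coins) (ω : Answers d)

theorem paramsCode_den (s : AState) : (paramsCode.den r ω s).mem 5 0 0 = (s.mem 4 0 0).size ∧
    (paramsCode.den r ω s).mem 7 0 0 = scale (s.mem 1 0 0) (s.mem 2 0 0) ^ 6 ∧
    (paramsCode.den r ω s).mem 8 0 0 = fanOut (s.mem 1 0 0) (s.mem 2 0 0) := by
  simp only [paramsCode, den_block_cons, den_block_one, den, AExpr.eval, fanOut, scale]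
  refine ⟨by simp, ?_, ?_⟩
  · simp; ring
  · simp; ring

theorem powersCode_den (s : AState) : (powersCode.den r ω s).mem 9 0 0 = 2 ^ s.mem 1 0 0 ∧
    (powersCode.den r ω s).mem 10 0 0 = (2 * s.mem 8 0 0 + 1) ^ s.mem 1 0 0 := by
  simp only [powersCode, den_block_cons, den_block_one, den_set]
  set s1 := s.put 9 _ _ _ with hs1
  have k2 := rep_rule r ω (P := assign 9 (.add (var 9) (var 9))) (k := 50) (e := var 1) (s := s1)
    (fun j t => t.mem 9 0 0 = 2 ^ j) (by simp [hs1, AExpr.eval]) (by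
      intro j _ t _ _ ht
      simp [den_set, AExpr.eval, ht, pow_succ]
      ring)
  have f1 : s1.mem 1 0 0 = s.mem 1 0 0 := by simp [hs1]
  simp only [AExpr.eval, f1] at k2
  set s2 := (ACode.rep 50 (var 1) (assign 9 (.add (var 9) (var 9)))).den r ω s1 with hs2
  have hf2 : ∀ k, k ≠ 50 → k ≠ 9 → s2.mem k = s.mem k := fun k h h' => by
    rw [hs2, den_mem r ω _ s1 (by simp [writes, h, h']), hs1, AState.put_mem_ne _ _ _ _ h']
  set s3 := s2.put 10 _ _ _ with hs3
  have hf3 : ∀ k, k ≠ 50 → k ≠ 9 → k ≠ 10 → s3.mem k = s.mem k := fun k h h' h'' => by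
    rw [hs3, AState.put_mem_ne _ _ _ _ h'', hf2 k h h']
  have k3 := rep_rule r ω (P := .block [assign 17 (.lit 0),
    .rep 51 (.add (.add (var 8) (var 8)) (.lit 1)) (assign 17 (.add (var 17) (var 10))),
    assign 10 (var 17)]) (k := 50) (e := var 1) (s := s3)
    (fun j t => t.mem 10 0 0 = (2 * s.mem 8 0 0 + 1) ^ j) (by simp [hs3, AExpr.eval]) (by
      intro j _ t _ hft ht
      simp only [den_block_cons, den_block_one, den_set, AExpr.eval]
      set t1 := t.put 17 0 0 0 with ht1
      have f8 : t1.mem 8 0 0 = s.mem 8 0 0 := by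
        rw [ht1, AState.put_mem_ne _ _ _ _ (by decide), hft 8 (by decide),
          hf3 8 (by decide) (by decide) (by decide)]
      have k4 := rep_rule r ω (P := assign 17 (.add (var 17) (var 10))) (k := 51)
        (e := .add (.add (var 8) (var 8)) (.lit 1)) (s := t1)
        (fun i u => u.mem 17 0 0 = i * t.mem 10 0 0) (by simp [ht1]) (by
          intro i _ u _ hfu hu
          have f10 : u.mem 10 0 0 = t.mem 10 0 0 := by
            rw [hfu 10 (by decide), ht1, AState.put_mem_ne _ _ _ _ (by decide)]
          simp [den_set, AExpr.eval, hu, f10, add_mul])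
      simp only [AExpr.eval, f8] at k4
      simp only [AState.put_mem]
      simp only [k4, ht]
      simp [pow_succ]
      ring)
  simp only [AExpr.eval, hf3 1 (by decide) (by decide) (by decide)] at k3
  refine ⟨?_, k3⟩
  rw [den_mem r ω _ s3 (by decide), hs3, AState.put_mem_ne _ _ _ _ (by decide), k2]

theorem widthsCode_den (s : AState) :
    (widthsCode.den r ω s).mem 11 0 0 = 32 * s.mem 9 0 0 * s.mem 7 0 0 ∧
    (widthsCode.den r ω s).mem 13 0 0 =
      12 * s.mem 10 0 0 * (s.mem 0 0 0 + 1) * s.mem 3 0 0 *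
        (12 * s.mem 10 0 0 * (s.mem 0 0 0 + 1) * s.mem 3 0 0) * (32 * s.mem 9 0 0 * s.mem 7 0 0) *
        (3 * s.mem 0 0 0 + s.mem 5 0 0 + 3) := by
  simp only [widthsCode, den_block_cons, den_block_one, den, AExpr.eval]
  refine ⟨by simp, by simp⟩

/-- The width doubles until it reaches `minWidth`, consuming one coin per doubling. So every level
reads exactly `b = clog 2 Z` coins, and level `lev` reads those from `lev * b` on. Running the inner
loop `Z` times is enough because `b ≤ Z`; surplus passes do nothing. -/
theorem offsetsCode_den (s : AState) (hf : s.flips = 0) :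
    (offsetsCode.den r ω s).mem 14 0 0 = 2 ^ Nat.clog 2 (s.mem 13 0 0) ∧
    ∀ lev ≤ s.mem 1 0 0, (offsetsCode.den r ω s).mem 35 lev 0 =
      offset r (Nat.clog 2 (s.mem 13 0 0)) lev := by
  set Z := s.mem 13 0 0 with hZ
  set b := Nat.clog 2 Z with hb
  have key := rep_rule r ω (P := .block [
    assign 14 (.lit 1),
    .set 35 (var 50) (.lit 0) (.lit 0),
    .rep 51 (var 13) (.ite (.sub (var 13) (var 14))
      (.block [
        .flip 15,
        .set 35 (var 50) (.lit 0)
          (.add (.add (.get 35 (var 50) (.lit 0)) (.get 35 (var 50) (.lit 0))) (var 15)),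
        assign 14 (.add (var 14) (var 14))])
      .skip)]) (k := 50) (e := .add (var 1) (.lit 1)) (s := s)
    (fun j t => t.flips = j * b ∧ (0 < j → t.mem 14 0 0 = 2 ^ b) ∧
      ∀ lev < j, t.mem 35 lev 0 = offset r b lev) (by simp [hf]) ?_
  · simp only [AExpr.eval] at key
    exact ⟨key.2.1 (by omega), fun lev hlev => key.2.2 lev (by omega)⟩
  · rintro j - t htj hft ⟨h1, -, h3⟩
    simp only [den_block_cons, den_block_one, den_set, AExpr.eval]
    set t1 := (t.put 14 0 0 1).put 35 _ 0 0 with ht1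
    have hj1 : t1.mem 50 0 0 = j := by simp [ht1, htj]
    have hZ1 : t1.mem 13 0 0 = Z := by simp [ht1, hft 13 (by decide), ← hZ]
    have k2 := rep_rule r ω (P := .ite (.sub (var 13) (var 14))
      (.block [
        .flip 15,
        .set 35 (var 50) (.lit 0)
          (.add (.add (.get 35 (var 50) (.lit 0)) (.get 35 (var 50) (.lit 0))) (var 15)),
        assign 14 (.add (var 14) (var 14))])
      .skip) (k := 51) (e := var 13) (s := t1)
      (fun i u => u.flips = j * b + min i b ∧ u.mem 14 0 0 = 2 ^ min i b ∧
        (∀ lev < j, u.mem 35 lev 0 = offset r b lev) ∧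
        u.mem 35 j 0 = bits r (j * b) (min i b)) ?_ ?_
    · simp only [AExpr.eval, hZ1] at k2
      have hbZ : min Z b = b := by
        have : b ≤ Z := by
          rw [hb]
          exact Nat.clog_le_of_le_pow Nat.lt_two_pow_self.le
        omega
      rw [hbZ] at k2
      obtain ⟨a1, a2, a3, a4⟩ := k2
      refine ⟨by rw [AState.put_flips, a1]; ring, fun _ => ?_, fun lev hlev => ?_⟩
      · rw [AState.put_mem_ne _ _ _ _ (by decide), a2]
      · rw [AState.put_mem_ne _ _ _ _ (by decide)]
        rcases Nat.lt_succ_iff_lt_or_eq.1 hlev with h | rfl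
        · exact a3 lev h
        · exact a4
    · refine ⟨by simp [ht1, h1], by simp [ht1], fun lev hlev => ?_, ?_⟩
      · have : lev ≠ j := by omega
        simp [ht1, htj, this, h3 lev hlev]
      · simp [ht1, htj, bits]
    · rintro i hi u - hfu ⟨a1, a2, a3, a4⟩
      have fZ : u.mem 13 0 0 = Z := by rw [hfu 13 (by decide), hZ1]
      have fj : u.mem 50 0 0 = j := by rw [hfu 50 (by decide), hj1]
      rw [den_ite]
      by_cases hib : i < b
      · have e1 : min (i + 1) b = i + 1 := by omega
        have e2 : min i b = i := by omega
        have hlt : 2 ^ i < Z := (Nat.lt_clog_iff_pow_lt (by norm_num)).1 hib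
        rw [e2] at a1 a2 a4
        rw [if_pos (by simp only [AExpr.eval, fZ, a2]; omega), e1]
        simp only [den_block_cons, den_block_one, den, AExpr.eval]
        refine ⟨by simp [a1]; ring, by simp [a2, pow_succ]; ring, fun lev hlev => ?_, ?_⟩
        · have : lev ≠ j := by omega
          simp [fj, this, a3 lev hlev]
        · simp [fj, a4, bits, a1]
      · have e1 : min (i + 1) b = b := by omega
        have e2 : min i b = b := by omega
        have hle : Z ≤ 2 ^ b := Nat.le_pow_clog (by norm_num) _
        rw [e2] at a1 a2 a4
        rw [if_neg (by simp only [AExpr.eval, fZ, a2]; omega), e1, den_skip]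
        exact ⟨by simp [a1], by simp [a2], fun lev hlev => by simp [a3 lev hlev], by simp [a4]⟩

end den

/-- What the computation of the marks of a sample does: it makes `w d` queries, and `mark ω n x i`
is the mark at `i` of the sample `x`, if the first of these queries has number `n`. -/
def Marks (P : ACode) (w : ℕ → ℕ) (mark : ∀ {d : ℕ}, Answers d → ℕ → Cube d → ℕ → ℕ) : Prop :=
  ∀ {d : ℕ} (r : Coins) (ω : Answers d) (s : AState) (x : Cube d), s.mem 0 0 0 = d →
    (∀ c : Fin d, s.mem 21 (s.mem 50 0 0) c = (x c).toNat) →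
    (∀ i < d, (P.den r ω s).mem 22 (s.mem 50 0 0) i = mark ω s.draws x i) ∧
    (∀ u ≠ s.mem 50 0 0, (P.den r ω s).mem 22 u = s.mem 22 u) ∧
    (P.den r ω s).draws = s.draws + w d

/-- The sample number `t`, if there are `n` queries per sample. -/
def sampleAt {d : ℕ} (n : ℕ) (ω : Answers d) (t : ℕ) : Cube d := ω (t * n, fun _ => none)

/-! ### Samples, queries and marks. -/

section den
variable {d : ℕ} (r : Coins) (ω : Answers d)

/-- A sample takes one query and its marks take `w d` more, so sample `t` is the answer to query `t
* (w d + 1)`. The extra mark at index `d` is always `1`, which makes the count at `d` the number of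
samples in a subcube. -/
theorem drawCode_den {P : ACode} {w : ℕ → ℕ} {mark : ∀ {d : ℕ}, Answers d → ℕ → Cube d → ℕ → ℕ}
    (hP : Marks P w mark) (hw : ∀ k ∈ P.writes, k ∈ [20, 22, 23, 51]) (s : AState)
    (hd : s.mem 0 0 0 = d) (hs : s.draws = 0) :
    ∀ t < s.mem 16 0 0,
      (∀ c : Fin d, ((drawCode P).den r ω s).mem 21 t c = (sampleAt (w d + 1) ω t c).toNat) ∧
      (∀ i < d, ((drawCode P).den r ω s).mem 22 t i =
        mark ω (t * (w d + 1) + 1) (sampleAt (w d + 1) ω t) i) ∧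
      ((drawCode P).den r ω s).mem 22 t d = 1 := by
  have hnw : ∀ k, k ∉ [20, 22, 23, 51] → k ∉ P.writes := fun k hk h => hk (hw k h)
  have key := rep_rule r ω (P := .block [
    .rep 51 (var 0) (.set 20 (.lit 0) (var 51) (.lit 2)),
    .draw 20 (.lit 0) 21 (var 50),
    P,
    .set 22 (var 50) (var 0) (.lit 1)]) (k := 50) (e := var 16) (s := s)
    (fun j u => u.draws = j * (w d + 1) ∧ ∀ t < j,
      (∀ c : Fin d, u.mem 21 t c = (sampleAt (w d + 1) ω t c).toNat) ∧
      (∀ i < d, u.mem 22 t i = mark ω (t * (w d + 1) + 1) (sampleAt (w d + 1) ω t) i) ∧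
      u.mem 22 t d = 1) (by simp [hs]) ?_
  · exact key.2
  · rintro j - u huj hfu ⟨h1, h2⟩
    have fd : u.mem 0 0 0 = d := by
      rw [hfu 0, hd]
      simp only [block, writes, List.mem_cons, List.mem_append, not_or]
      simp [hnw 0 (by decide)]
    simp only [den_block_cons, den_block_one, den_set]
    set u1 := (ACode.rep 51 (var 0) (.set 20 (.lit 0) (var 51) (.lit 2))).den r ω u with hu1
    have g1 : ∀ k, k ≠ 51 → k ≠ 20 → u1.mem k = u.mem k := fun k a b => by
      rw [hu1, den_mem r ω _ u (by simp [writes, a, b])]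
    have q1 := den_quiet r ω (ACode.rep 51 (var 0) (.set 20 (.lit 0) (var 51) (.lit 2))) u trivial
    rw [← hu1] at q1
    have row : ∀ c < d, u1.mem 20 0 c = 2 := by
      have := rep_rule r ω (P := .set 20 (.lit 0) (var 51) (.lit 2)) (k := 51) (e := var 0) (s := u)
        (fun j t => ∀ c < j, t.mem 20 0 c = 2) (by simp) (by
          intro j hj t htj hft ht c hc
          simp only [den_set, AExpr.eval, AState.put_mem, htj]
          rcases Nat.lt_succ_iff_lt_or_eq.1 hc with hc | rfl
          · simp [ht c hc]
          · simp)
      simp only [AExpr.eval, fd] at this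
      exact this
    have hfree : readSubcube d (u1.mem 20 0) 0 = fun _ => none := by
      funext c
      simp [readSubcube, row c c.2]
    set u2 := (ACode.draw 20 (.lit 0) 21 (var 50)).den r ω u1 with hu2
    have hu2' : u2 = u1.putPoint 21 j (sampleAt (w d + 1) ω j) := by
      rw [hu2]
      simp only [den, AExpr.eval]
      rw [hfree, q1.2.1, h1, g1 50 (by decide) (by decide), huj, sampleAt]
    have d2 : u2.draws = j * (w d + 1) + 1 := by
      rw [hu2', AState.putPoint]; simp only; rw [q1.2.1, h1]
    have g2 : ∀ k, k ≠ 51 → k ≠ 20 → k ≠ 21 → u2.mem k = u.mem k := fun k a b c => by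
      rw [hu2, den_mem r ω _ u1 (by simp [writes, c]), g1 k a b]
    have j2 : u2.mem 50 0 0 = j := by rw [g2 50 (by decide) (by decide) (by decide), huj]
    have x2 : ∀ t, ∀ c : Fin d, u2.mem 21 t c =
        if t = j then (sampleAt (w d + 1) ω j c).toNat else u.mem 21 t c := by
      intro t c
      rw [hu2', AState.putPoint]
      by_cases h : t = j
      · simp [h]
      · simp [h, g1 21 (by decide) (by decide)]
    obtain ⟨p1, p2, p3⟩ := hP r ω u2 (sampleAt (w d + 1) ω j)
      (by rw [g2 0 (by decide) (by decide) (by decide), fd]) (by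
        intro c; rw [j2, x2]; simp)
    set u3 := P.den r ω u2 with hu3
    have g3 : ∀ k, k ∉ [20, 21, 22, 23, 51] → u3.mem k = u.mem k := fun k h => by
      simp only [List.mem_cons, List.not_mem_nil, or_false, not_or] at h
      rw [hu3, den_mem r ω P u2 (hnw k (by simp; tauto)), g2 k (by tauto) (by tauto) (by tauto)]
    rw [j2, d2] at p1
    rw [j2] at p2
    simp only [AExpr.eval]
    rw [g3 50 (by decide), g3 0 (by decide), huj, fd]
    refine ⟨by simp [p3, d2]; ring, fun t ht => ?_⟩
    rw [AState.put_mem_ne _ _ _ _ (k' := 21) (by decide), AState.put_mem_ne _ _ _ _ (k' := 21)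
      (by decide), AState.put_mem_ne _ _ _ _ (k' := 22) (by decide),
      show u3.mem 21 = u2.mem 21 from den_mem r ω P u2 (hnw 21 (by decide))]
    rcases Nat.lt_succ_iff_lt_or_eq.1 ht with ht | rfl
    · have htj : t ≠ j := ht.ne
      obtain ⟨b1, b2, b3⟩ := h2 t ht
      refine ⟨fun c => by rw [x2, if_neg htj, b1], fun i hi => ?_, ?_⟩
      · rw [AState.put_mem, if_neg (by tauto), p2 t htj, g2 22 (by decide) (by decide) (by decide),
          b2 i hi]
      · rw [AState.put_mem, if_neg (by tauto), p2 t htj, g2 22 (by decide) (by decide) (by decide),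
          b3]
    · refine ⟨fun c => by rw [x2, if_pos rfl], fun i hi => ?_, by simp⟩
      have : i ≠ d := hi.ne
      rw [AState.put_mem, if_neg (by tauto), p1 i hi]

/-- The marks given by the coordinates. -/
def plainMark {d : ℕ} (_ : Answers d) (_ : ℕ) (x : Cube d) (i : ℕ) : ℕ :=
  if h : i < d then (x ⟨i, h⟩).toNat else 0

/-- The subcube with the points `x` and `x` with the coordinate `i` flipped. -/
def Subcube.edge {d : ℕ} (x : Cube d) (i : Fin d) : Subcube d :=
  Function.update (fun c => some (x c)) i none

/-- The marks given by comparing with fresh samples from edges. -/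
def pairMark {d : ℕ} (ω : Answers d) (n : ℕ) (x : Cube d) (i : ℕ) : ℕ :=
  if h : i < d then if ω (n + i, Subcube.edge x ⟨i, h⟩) ⟨i, h⟩ = x ⟨i, h⟩ then 1 else 0 else 0

theorem marks_plainMarks : Marks plainMarks (fun _ => 0) plainMark := by
  intro d r ω s x hd hx
  refine ⟨fun i hi => ?_, fun u hu => ?_, by rw [(den_quiet r ω plainMarks s trivial).2.1]; rfl⟩
  · have := rep_rule r ω (P := .set 22 (var 50) (var 51) (.get 21 (var 50) (var 51))) (k := 51)
      (e := var 0) (s := s) (fun j t => ∀ i < j, t.mem 22 (s.mem 50 0 0) i =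
        s.mem 21 (s.mem 50 0 0) i) (by simp) (by
        intro j hj t htj hft ht i hi
        simp only [den_set, AExpr.eval, htj, hft 50 (by decide), hft 21 (by decide),
          AState.put_mem]
        rcases Nat.lt_succ_iff_lt_or_eq.1 hi with hi | rfl
        · simp [ht i hi, hi.ne]
        · simp)
    simp only [AExpr.eval, hd] at this
    rw [plainMarks, this i hi, hx ⟨i, hi⟩]
    change _ = plainMark ω s.draws x i
    rw [plainMark, dif_pos hi]
  · have := rep_rule r ω (P := .set 22 (var 50) (var 51) (.get 21 (var 50) (var 51))) (k := 51)
      (e := var 0) (s := s) (fun j t => t.mem 22 u = s.mem 22 u) (by funext; simp) (by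
        intro j hj t htj hft ht
        funext i
        simp only [den_set, AExpr.eval, hft 50 (by decide), AState.put_mem]
        simp [hu, ht])
    exact this

/-- The query row holds `x` with a single free coordinate, which is restored after each query. With
`s` the sum of the two bits, `(s - 1) + (1 - s)` in truncated arithmetic is `1` for `s = 0, 2` and
`0` for `s = 1`, so it tests agreement. -/
theorem marks_pairMarks : Marks pairMarks (fun d => d) pairMark := by
  intro d r ω s x hd hx
  simp only [pairMarks, den_block_cons, den_block_one]
  set s1 := (ACode.rep 51 (var 0) (.set 20 (.lit 0) (var 51) (.get 21 (var 50) (var 51)))).den r ω s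
    with hs1
  have q1 := den_quiet r ω (ACode.rep 51 (var 0)
    (.set 20 (.lit 0) (var 51) (.get 21 (var 50) (var 51)))) s trivial
  rw [← hs1] at q1
  have g1 : ∀ k, k ≠ 51 → k ≠ 20 → s1.mem k = s.mem k := fun k a b => by
    rw [hs1, den_mem r ω _ s (by simp [writes, a, b])]
  have row : ∀ c : Fin d, s1.mem 20 0 c = (x c).toNat := by
    have := rep_rule r ω (P := .set 20 (.lit 0) (var 51) (.get 21 (var 50) (var 51))) (k := 51)
      (e := var 0) (s := s) (fun j t => ∀ c < j, t.mem 20 0 c = s.mem 21 (s.mem 50 0 0) c)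
      (by simp) (by
        intro j hj t htj hft ht c hc
        simp only [den_set, AExpr.eval, AState.put_mem, htj, hft 50 (by decide),
          hft 21 (by decide)]
        rcases Nat.lt_succ_iff_lt_or_eq.1 hc with hc | rfl
        · simp [ht c hc, hc.ne]
        · simp)
    simp only [AExpr.eval, hd] at this
    intro c
    rw [hs1, this c c.2, hx]
  have key := rep_rule r ω (P := .block [
    .set 20 (.lit 0) (var 51) (.lit 2),
    .draw 20 (.lit 0) 23 (.lit 0),
    .set 22 (var 50) (var 51)
      (.add (.sub (.add (.get 23 (.lit 0) (var 51)) (.get 21 (var 50) (var 51))) (.lit 1))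
        (.sub (.lit 1) (.add (.get 23 (.lit 0) (var 51)) (.get 21 (var 50) (var 51))))),
    .set 20 (.lit 0) (var 51) (.get 21 (var 50) (var 51))]) (k := 51) (e := var 0) (s := s1)
    (fun j t => t.draws = s.draws + j ∧ (∀ c : Fin d, t.mem 20 0 c = (x c).toNat) ∧
      (∀ i < j, t.mem 22 (s.mem 50 0 0) i = pairMark ω s.draws x i) ∧
      ∀ u ≠ s.mem 50 0 0, t.mem 22 u = s.mem 22 u) ?_ ?_
  · simp only [AExpr.eval, g1 0 (by decide) (by decide), hd] at key
    exact ⟨key.2.2.1, key.2.2.2, key.1⟩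
  · refine ⟨by simp [q1.2.1], fun c => by simp [row], by simp, fun u _ => ?_⟩
    rw [AState.put_mem_ne _ _ _ _ (by decide), g1 22 (by decide) (by decide)]
  · simp only [AExpr.eval, g1 0 (by decide) (by decide), hd]
    rintro j hj t htj hft ⟨h1, h2, h3, h4⟩
    have f50 : t.mem 50 = s.mem 50 := by
      rw [hft 50 (by decide), g1 50 (by decide) (by decide)]
    have f21 : t.mem 21 = s.mem 21 := by
      rw [hft 21 (by decide), g1 21 (by decide) (by decide)]
    simp only [den_block_cons, den_block_one, den, AExpr.eval]
    set t1 := t.put 20 0 _ 2 with ht1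
    have hedge : readSubcube d (t1.mem 20 0) 0 = Subcube.edge x ⟨j, hj⟩ := by
      funext c
      by_cases hc : c = ⟨j, hj⟩
      · subst hc
        simp [readSubcube, ht1, htj, Subcube.edge]
      · have hc' : (c : ℕ) ≠ j := fun h => hc (Fin.ext h)
        simp only [readSubcube, zero_add, ht1, AState.put_mem, htj, hc', and_false, if_false, h2,
          Subcube.edge, Function.update_of_ne hc]
        cases x c <;> simp
    have hdr : t1.draws = s.draws + j := h1
    rw [hedge, hdr]
    set y := ω (s.draws + j, Subcube.edge x ⟨j, hj⟩) with hy
    set t2 := t1.putPoint 23 0 y with ht2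
    have m2 : ∀ k u c, k ≠ 23 → t2.mem k u c = if k = 20 ∧ u = 0 ∧ c = j then 2
        else t.mem k u c := by
      intro k u c hk
      simp [ht2, AState.putPoint, hk, ht1, htj]
    have y2 : t2.mem 23 0 j = (y ⟨j, hj⟩).toNat := by
      simp [ht2, AState.putPoint, hj]
    have d2 : t2.draws = s.draws + j + 1 := by rw [← h1]; rfl
    have e51 : t2.mem 51 0 0 = j := by rw [m2 _ _ _ (by decide)]; simp [htj]
    have e50 : t2.mem 50 0 0 = s.mem 50 0 0 := by rw [m2 _ _ _ (by decide)]; simp [f50]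
    have e21 : t2.mem 21 (s.mem 50 0 0) j = (x ⟨j, hj⟩).toNat := by
      rw [m2 _ _ _ (by decide)]; simp [f21, hx ⟨j, hj⟩]
    refine ⟨by simp [d2]; ring, fun c => ?_, fun i hi => ?_, fun u hu => ?_⟩
    · simp only [AState.put_mem, e51, e50]
      by_cases hc : (c : ℕ) = j
      · obtain rfl : c = ⟨j, hj⟩ := Fin.ext hc
        simp [e21]
      · simp [hc, m2, h2]
    · simp only [AState.put_mem, e51, e50, y2, e21]
      rcases Nat.lt_succ_iff_lt_or_eq.1 hi with hi | rfl
      · simp [hi.ne, m2, h3 i hi]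
      · rw [pairMark, dif_pos hj, ← hy]
        cases x ⟨i, hj⟩ <;> cases y ⟨i, hj⟩ <;> simp
    · funext c
      simp only [AState.put_mem, e51, e50]
      simp [hu, m2, h4 u hu]

end den

/-! ### Running the learner -/

/-- The crude base `3` is at most the base `2K + 1` of `nodeBound`, so a plan never has more nodes
than the output loop has passes. -/
theorem DecisionTree.nodes_le_pow {d : ℕ} {V : Type} (T : DecisionTree d V) {k : ℕ}
    (h : T.depth ≤ k) : T.nodes ≤ 3 ^ k := by
  induction T generalizing k with
  | leaf v => exact Nat.one_le_pow _ _ (by norm_num)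
  | node i l r ihl ihr =>
    obtain _ | k := k
    · simp [depth] at h
    simp only [depth] at h
    have h1 := ihl (k := k) (by omega)
    have h2 := ihr (k := k) (by omega)
    have h3 : 1 ≤ 3 ^ k := Nat.one_le_pow _ _ (by norm_num)
    simp only [nodes]
    rw [pow_succ]
    omega

theorem Est.depth_plan_le {d : ℕ} (f : Est d) (A K : ℕ) : ∀ k lev (S : Subcube d),
    (f.plan A K k lev S).tree.depth ≤ k
  | 0, lev, S => by simp [plan, asLeaf, DecisionTree.depth]
  | k + 1, lev, S => by
    rw [plan]
    induction f.choices A K lev S with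
    | nil => simp [asLeaf, DecisionTree.depth]
    | cons i l ih =>
      rw [List.foldr_cons, improve]
      split_ifs
      · have h1 := f.depth_plan_le A K k (lev + 1) (S.fix i false)
        have h2 := f.depth_plan_le A K k (lev + 1) (S.fix i true)
        simp only [DecisionTree.depth]
        omega
      · exact ih

/-- The machine has copied its input into the arrays. -/
def inputState (d ℓ a q B : ℕ) : AState where
  mem k i j := if i = 0 ∧ j = 0 then [d, ℓ, a, q, B].getD k 0 else 0
  flips := 0
  draws := 0
  out := []

/-- Cell `0` of the machine already holds `d`, as the simulation demands. The input cells lie below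
all array cells, so copying the five numbers into arrays leaves the input intact. -/
theorem learnerProgram_exec (P : ACode) (hP : (learnerCode P).Wf) : ∃ c : ℕ, ∀ (d ℓ a q B b : ℕ)
    (r : Coins) (ω : Answers d), (∀ v ∈ [d, ℓ, a, q, B, 1], v.size ≤ b) → ∃ t n,
    Exec r ω (learnerProgram P) (initial [d, ℓ, a, q, B]) t n ∧
      t.out = ((learnerCode P).den r ω (inputState d ℓ a q B)).out ∧
      n ≤ c * ((b + (learnerCode P).steps r ω (inputState d ℓ a q B)) *
        ((learnerCode P).steps r ω (inputState d ℓ a q B) + 1)) := by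
  obtain ⟨c, hc⟩ := (learnerCode P).simulated hP
  obtain ⟨c', -, hc'⟩ := Expr.exists_bound_list [
    .cellE 0 (.lit 0) (.lit 0), .cellE 1 (.lit 0) (.lit 0), .cellE 2 (.lit 0) (.lit 0),
    .cellE 3 (.lit 0) (.lit 0), .cellE 4 (.lit 0) (.lit 0), .load (.lit 0), .load (.lit 1),
    .load (.lit 2), .load (.lit 3), .load (.lit 4)]
  refine ⟨c + 10 * c', fun d ℓ a q B b r ω hb => ?_⟩
  simp only [List.mem_cons, List.not_mem_nil, or_false, forall_eq_or_imp, forall_eq] at hb hc'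
  obtain ⟨b0, b1, b2, b3, b4, hb1⟩ := hb
  have hb1 : 1 ≤ b := by simpa using hb1
  set s0 := initial [d, ℓ, a, q, B] with hs0
  have h0 : Sim d s0 ⟨fun _ _ _ => 0, 0, 0, []⟩ b := by
    refine ⟨rfl, fun k i j => ?_, rfl, rfl, rfl, fun j => ?_⟩
    · exact List.getD_eq_default _ _ (by simp [cell]; omega)
    · simp only [hs0, initial]
      rcases j with _ | _ | _ | _ | _ | j <;> simp [*]
  have step : ∀ (s : State) (S : AState) (k v : ℕ), Sim d s S b → s.mem k = v → v.size ≤ b →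
      (∀ j < 5, s.mem j = s0.mem j) →
      Exec r ω (.store (.cellE k (.lit 0) (.lit 0)) (.load (.lit k))) s
        { s with mem := Function.update s.mem (cell d k 0 0) v }
        ((Expr.cellE k (.lit 0) (.lit 0)).cost s.mem + (Expr.load (.lit k)).cost s.mem + 1) ∧
      Sim d { s with mem := Function.update s.mem (cell d k 0 0) v } (S.put k 0 0 v) b ∧
      ∀ j < 5, Function.update s.mem (cell d k 0 0) v j = s0.mem j := by
    intro s S k v hs hk hv hj
    refine ⟨?_, hs.put le_rfl k 0 0 hv, fun j hj5 => ?_⟩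
    · have := Exec.store (r := r) (ω := ω) (.cellE k (.lit 0) (.lit 0)) (.load (.lit k)) s
      simp only [Expr.eval_cellE, hs.dim, Expr.eval, hk] at this
      exact this
    · rw [Function.update_of_ne, hj j hj5]
      unfold cell; omega
  obtain ⟨e0, h1, m1⟩ := step s0 _ 0 d h0 rfl b0 fun _ _ => rfl
  obtain ⟨e1, h2, m2⟩ := step _ _ 1 ℓ h1 (m1 1 (by norm_num)) b1 m1
  obtain ⟨e2, h3, m3⟩ := step _ _ 2 a h2 (m2 2 (by norm_num)) b2 m2
  obtain ⟨e3, h4, m4⟩ := step _ _ 3 q h3 (m3 3 (by norm_num)) b3 m3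
  obtain ⟨e4, h5, m5⟩ := step _ _ 4 B h4 (m4 4 (by norm_num)) b4 m4
  have hS : (((((AState.mk (fun _ _ _ => 0) 0 0 []).put 0 0 0 d).put 1 0 0 ℓ).put 2 0 0 a).put
      3 0 0 q).put 4 0 0 B = inputState d ℓ a q B := by
    refine AState.ext ?_ rfl rfl rfl
    funext k i j
    simp only [AState.put_mem, inputState]
    by_cases hij : i = 0 ∧ j = 0
    · obtain ⟨rfl, rfl⟩ := hij
      rcases k with _ | _ | _ | _ | _ | k <;> simp
    · simp only [hij, if_false, and_false]
  rw [hS] at h5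
  obtain ⟨t, n, e5, h6, hn⟩ := hc r ω _ _ b hb1 h5
  refine ⟨t, _, .seq e0 (.seq e1 (.seq e2 (.seq e3 (.seq e4 e5)))), h6.out, ?_⟩
  obtain ⟨k0, -, -, -, -, l0, -⟩ := hc' _ b hb1 h0.size_le
  obtain ⟨-, k1, -, -, -, -, l1, -⟩ := hc' _ b hb1 h1.size_le
  obtain ⟨-, -, k2, -, -, -, -, l2, -⟩ := hc' _ b hb1 h2.size_le
  obtain ⟨-, -, -, k3, -, -, -, -, l3, -⟩ := hc' _ b hb1 h3.size_le
  obtain ⟨-, -, -, -, k4, -, -, -, -, l4⟩ := hc' _ b hb1 h4.size_le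
  generalize (learnerCode P).steps r ω (inputState d ℓ a q B) = σ at *
  have : (c + 10 * c') * ((b + σ) * (σ + 1)) = c * ((b + σ) * σ) + c * (b + σ) +
    10 * (c' * b) + 10 * (c' * (σ + (b + σ) * σ)) := by ring
  omega

/-- Estimates that agree where they are used lead to the same plan. -/
theorem Est.plan_congr {d : ℕ} {f f' : Est d} (A K : ℕ) : ∀ k lev (S : Subcube d),
    (∀ l, lev ≤ l → l ≤ lev + k → ∀ S, ∀ i ≤ d, f l S i = f' l S i) →
    f.plan A K k lev S = f'.plan A K k lev S
  | 0, lev, S, h => by simp only [plan, asLeaf, h lev le_rfl le_rfl S d le_rfl]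
  | k + 1, lev, S, h => by
    have h0 := h lev le_rfl (by omega)
    have hg : ∀ i : Fin d, f.gain lev S i = f'.gain lev S i := fun i => by
      simp only [gain, h0 S i i.2.le, h0 S d le_rfl]
    have hc : f.choices A K lev S = f'.choices A K lev S := by
      unfold choices
      congr 2
      funext i
      exact decide_eq_decide.2 (by simp only [Flagged, hg, h0 S d le_rfl])
    have ih := fun S => plan_congr A K k (lev + 1) S fun l hl hl' => h l (by omega) (by omega)
    simp only [plan, asLeaf, improve, hc, hg, h0 S d le_rfl, ih]

namespace ACode

/-- Whether a program writes output. -/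
def emits : ACode → Bool
  | seq P Q | ite _ P Q => P.emits || Q.emits
  | rep _ _ P => P.emits
  | emit _ => true
  | _ => false

/-- Whether a program makes queries. -/
def queries : ACode → Bool
  | seq P Q | ite _ P Q => P.queries || Q.queries
  | rep _ _ P => P.queries
  | draw _ _ _ _ => true
  | _ => false

variable {d : ℕ} (r : Coins) (ω : Answers d)

theorem den_out : ∀ (P : ACode) (s : AState), P.emits = false → (P.den r ω s).out = s.out
  | skip, _, _ | set _ _ _ _, _, _ | size _ _, _, _ | flip _, _, _ | draw _ _ _ _, _, _ => rfl
  | emit _, _, h => by simp [emits] at h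
  | seq P Q, s, h => by
    simp only [emits, Bool.or_eq_false_iff] at h
    rw [den_seq, den_out Q _ h.2, den_out P _ h.1]
  | ite c P Q, s, h => by
    simp only [emits, Bool.or_eq_false_iff] at h
    rw [den_ite]
    split_ifs
    · exact den_out P s h.1
    · exact den_out Q s h.2
  | rep k n P, s, h => rep_rule r ω (fun _ t => t.out = s.out) rfl fun j _ t _ _ ht => by
      rw [AState.put_out, den_out P t h, ht]

theorem den_draws : ∀ (P : ACode) (s : AState), P.queries = false → (P.den r ω s).draws = s.draws
  | skip, _, _ | set _ _ _ _, _, _ | size _ _, _, _ | flip _, _, _ | emit _, _, _ => rfl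
  | draw _ _ _ _, _, h => by simp [queries] at h
  | seq P Q, s, h => by
    simp only [queries, Bool.or_eq_false_iff] at h
    rw [den_seq, den_draws Q _ h.2, den_draws P _ h.1]
  | ite c P Q, s, h => by
    simp only [queries, Bool.or_eq_false_iff] at h
    rw [den_ite]
    split_ifs
    · exact den_draws P s h.1
    · exact den_draws Q s h.2
  | rep k n P, s, h => rep_rule r ω (fun _ t => t.draws = s.draws) rfl fun j _ t _ _ ht => by
      rw [AState.put_draws, den_draws P t h, ht]

end ACode

/-! ### Composition of the phases of the learner. -/

section den
variable {d : ℕ} (r : Coins) (ω : Answers d)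

/-- The parameters after the initial phases of the learner. -/
structure Prepared (ℓ a q B : ℕ) (s : AState) : Prop where
  dim : s.mem 0 0 0 = d
  depth : s.mem 1 0 0 = ℓ
  flagScale : s.mem 7 0 0 = scale ℓ a ^ 6
  fan : s.mem 8 0 0 = fanOut ℓ a
  nodes : s.mem 10 0 0 = nodeBound ℓ a
  resol : s.mem 11 0 0 = resolution ℓ a
  minW : s.mem 13 0 0 = minWidth d ℓ a q B
  flips : s.flips = 0
  draws : s.draws = 0
  out : s.out = []
  zero : ∀ k, k ∉ [0, 1, 2, 3, 4, 5, 6, 7, 8, 9, 10, 11, 12, 13, 17, 50, 51] →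
    ∀ i j, s.mem k i j = 0

theorem prepared (ℓ a q B : ℕ) : Prepared (d := d) ℓ a q B (widthsCode.den r ω
    (powersCode.den r ω (paramsCode.den r ω (inputState d ℓ a q B)))) := by
  have z0 : ∀ k, k ∉ [0, 1, 2, 3, 4] → ∀ i j, (inputState d ℓ a q B).mem k i j = 0 := by
    intro k hk i j
    simp only [inputState]
    split_ifs
    · refine List.getD_eq_default _ _ ?_
      simp only [List.mem_cons, List.not_mem_nil, or_false, not_or] at hk
      simp only [List.length_cons, List.length_nil]
      omega
    · rfl
  set s0 := inputState d ℓ a q B with hs0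
  have v0 : s0.mem 0 0 0 = d := rfl
  have v1 : s0.mem 1 0 0 = ℓ := rfl
  have v2 : s0.mem 2 0 0 = a := rfl
  have v3 : s0.mem 3 0 0 = q := rfl
  have v4 : s0.mem 4 0 0 = B := rfl
  obtain ⟨a5, a7, a8⟩ := paramsCode_den r ω s0
  have q1 := den_quiet r ω paramsCode s0 (by simp [paramsCode, block, Quiet])
  have f1 : ∀ k ∉ paramsCode.writes, (paramsCode.den r ω s0).mem k = s0.mem k :=
    fun k => den_mem r ω _ _
  set s1 := paramsCode.den r ω s0
  obtain ⟨b9, b10⟩ := powersCode_den r ω s1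
  have q2 := den_quiet r ω powersCode s1 (by simp [powersCode, block, Quiet])
  have f2 : ∀ k ∉ powersCode.writes, (powersCode.den r ω s1).mem k = s1.mem k :=
    fun k => den_mem r ω _ _
  set s2 := powersCode.den r ω s1
  obtain ⟨c11, c13⟩ := widthsCode_den r ω s2
  have q3 := den_quiet r ω widthsCode s2 (by simp [widthsCode, block, Quiet])
  have f3 : ∀ k ∉ widthsCode.writes, (widthsCode.den r ω s2).mem k = s2.mem k :=
    fun k => den_mem r ω _ _
  set s3 := widthsCode.den r ω s2
  rw [f1 1 (by decide), v1, a8] at b10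
  rw [f1 1 (by decide), v1] at b9
  rw [v1, v2] at a7 a8 b10
  rw [v4] at a5
  rw [f2 7 (by decide), a7, b9] at c11
  rw [f2 7 (by decide), f2 0 (by decide), f2 3 (by decide), f2 5 (by decide), f1 0 (by decide),
    f1 3 (by decide), a7, a5, b9, b10, v0, v3] at c13
  refine ⟨?_, ?_, ?_, ?_, ?_, c11, c13, ?_, ?_, ?_, ?_⟩
  · rw [f3 0 (by decide), f2 0 (by decide), f1 0 (by decide), v0]
  · rw [f3 1 (by decide), f2 1 (by decide), f1 1 (by decide), v1]
  · rw [f3 7 (by decide), f2 7 (by decide), a7]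
  · rw [f3 8 (by decide), f2 8 (by decide), a8]
  · rw [f3 10 (by decide), b10]; rfl
  · rw [q3.1, q2.1, q1.1]; rfl
  · rw [q3.2.1, q2.2.1, q1.2.1]; rfl
  · rw [q3.2.2, q2.2.2, q1.2.2]; rfl
  · intro k hk i j
    rw [f3 k, f2 k, f1 k, z0 k]
    all_goals
      simp only [List.mem_cons, List.not_mem_nil, or_false, not_or] at hk
      simp [paramsCode, powersCode, widthsCode, block, writes, hk]

/-- What is known when the samples have been drawn. -/
structure Sampled (ω : Answers d) (w : ℕ → ℕ)
    (mark : ∀ {d : ℕ}, Answers d → ℕ → Cube d → ℕ → ℕ) (ℓ a q B : ℕ) (s : AState) : Prop where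
  dim : s.mem 0 0 0 = d
  depth : s.mem 1 0 0 = ℓ
  flagScale : s.mem 7 0 0 = scale ℓ a ^ 6
  fan : s.mem 8 0 0 = fanOut ℓ a
  nodes : s.mem 10 0 0 = nodeBound ℓ a
  width : s.mem 14 0 0 = width d ℓ a q B
  size : s.mem 16 0 0 = sampleSize d ℓ a q B
  offset : ∀ lev ≤ ℓ, s.mem 35 lev 0 = offset r (offsetBits d ℓ a q B) lev
  sample : ∀ t < sampleSize d ℓ a q B, (∀ c : Fin d, s.mem 21 t c = (sampleAt (w d + 1) ω t c).toNat) ∧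
    (∀ i < d, s.mem 22 t i = mark ω (t * (w d + 1) + 1) (sampleAt (w d + 1) ω t) i) ∧
      s.mem 22 t d = 1
  out : s.out = []
  zero : ∀ k ∈ [25, 27, 30, 31, 33], ∀ i j, s.mem k i j = 0

theorem sampled {P : ACode} {w : ℕ → ℕ} {mark : ∀ {d : ℕ}, Answers d → ℕ → Cube d → ℕ → ℕ}
    (hP : Marks P w mark) (hw : ∀ k ∈ P.writes, k ∈ [20, 22, 23, 51]) (he : P.emits = false)
    {ℓ a q B : ℕ} {s : AState} (hs : Prepared (d := d) ℓ a q B s) :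
    Sampled r ω w mark ℓ a q B
      ((drawCode P).den r ω (samplesCode.den r ω (offsetsCode.den r ω s))) := by
  obtain ⟨a14, a35⟩ := offsetsCode_den r ω s hs.flips
  rw [hs.minW] at a14 a35
  rw [hs.depth] at a35
  have f1 : ∀ k ∉ offsetsCode.writes, (offsetsCode.den r ω s).mem k = s.mem k :=
    fun k => den_mem r ω _ _
  have o1 := den_out r ω offsetsCode s (by decide)
  have d1 := den_draws r ω offsetsCode s (by decide)
  set s1 := offsetsCode.den r ω s
  have b16 : (samplesCode.den r ω s1).mem 16 0 0 = sampleSize d ℓ a q B := by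
    simp only [samplesCode, den, AExpr.eval]
    rw [AState.put_mem, if_pos ⟨rfl, rfl, rfl⟩, a14, f1 11 (by decide), hs.resol]
    rfl
  have f2 : ∀ k ∉ samplesCode.writes, (samplesCode.den r ω s1).mem k = s1.mem k :=
    fun k => den_mem r ω _ _
  have o2 := den_out r ω samplesCode s1 (by decide)
  have d2 := den_draws r ω samplesCode s1 (by decide)
  set s2 := samplesCode.den r ω s1
  have c := drawCode_den r ω hP hw s2 (by rw [f2 0 (by decide), f1 0 (by decide), hs.dim])
    (by rw [d2, d1, hs.draws])
  rw [b16] at c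
  have f3 : ∀ k ∉ [20, 21, 22, 23, 50, 51], ((drawCode P).den r ω s2).mem k = s2.mem k := by
    intro k hk
    simp only [List.mem_cons, List.not_mem_nil, or_false, not_or] at hk
    have hkP : k ∉ P.writes := fun h => by
      have := hw k h
      simp only [List.mem_cons, List.not_mem_nil, or_false] at this
      tauto
    exact den_mem r ω _ _ (by simp [drawCode, block, writes, hk, hkP])
  have o3 := den_out r ω (drawCode P) s2 (by simp [drawCode, block, emits, he])
  set s3 := (drawCode P).den r ω s2
  refine ⟨?_, ?_, ?_, ?_, ?_, ?_, ?_, fun lev hlev => ?_, c, ?_, fun k hk i j => ?_⟩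
  · rw [f3 0 (by decide), f2 0 (by decide), f1 0 (by decide), hs.dim]
  · rw [f3 1 (by decide), f2 1 (by decide), f1 1 (by decide), hs.depth]
  · rw [f3 7 (by decide), f2 7 (by decide), f1 7 (by decide), hs.flagScale]
  · rw [f3 8 (by decide), f2 8 (by decide), f1 8 (by decide), hs.fan]
  · rw [f3 10 (by decide), f2 10 (by decide), f1 10 (by decide), hs.nodes]
  · rw [f3 14 (by decide), f2 14 (by decide), a14]; rfl
  · rw [f3 16 (by decide), b16]
  · rw [f3 35 (by decide), f2 35 (by decide), a35 lev hlev]; rfl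
  · rw [o3, o2, o1, hs.out]
  · simp only [List.mem_cons, List.not_mem_nil, or_false] at hk
    rw [f3 k, f2 k, f1 k, hs.zero k]
    all_goals rcases hk with rfl | rfl | rfl | rfl | rfl <;> decide

/-- After as many passes as the bound, a node beyond the bound would still be pending. Its positive
weight would push the potential above the bound. -/
theorem Grown.count_le {d : ℕ} {f : Est d} {M : Store} (hg : Grown d f M (M 10 0 0)) :
    2 * M 27 0 0 + 1 ≤ M 10 0 0 := by
  have := hg.size
  by_contra hlt
  rw [min_eq_left (by omega)] at this
  have h0 := Finset.sum_eq_zero_iff.1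
    (Nat.le_zero.1 (Nat.le_of_add_le_add_left (this.trans_eq (add_zero _).symm)))
    (M 10 0 0) (Finset.mem_Ico.2 ⟨le_rfl, by omega⟩)
  exact (pow_pos (by omega : 0 < 2 * M 8 0 0 + 1) _).ne' h0

/-- What the learner writes. -/
theorem learnerCode_den {P : ACode} {w : ℕ → ℕ}
    {mark : ∀ {d : ℕ}, Answers d → ℕ → Cube d → ℕ → ℕ} (hP : Marks P w mark)
    (hw : ∀ k ∈ P.writes, k ∈ [20, 22, 23, 51]) (he : P.emits = false) (ℓ a q B : ℕ)
    (ha : 1 ≤ a) :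
    ∃ g : ℕ → ℕ → ℕ, (∀ t < sampleSize d ℓ a q B,
      (∀ i < d, g t i = mark ω (t * (w d + 1) + 1) (sampleAt (w d + 1) ω t) i) ∧ g t d = 1) ∧
    ∃ p : Plan d, p = (roundedEst (sampleAt (w d + 1) ω) g (sampleSize d ℓ a q B)
        (offset r (offsetBits d ℓ a q B)) (width d ℓ a q B)).plan
        (scale ℓ a ^ 6) (fanOut ℓ a) ℓ 0 (fun _ => none) ∧
      ((learnerCode P).den r ω (inputState d ℓ a q B)).out = outputWord p.mass p.tree := by
  simp only [learnerCode, den_block_cons, den_block_one]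
  have hs := sampled r ω hP hw he (prepared r ω ℓ a q B)
  set s := (drawCode P).den r ω _
  refine ⟨s.mem 22, fun t ht => (hs.sample t ht).2, _, rfl, ?_⟩
  have hg := growCode_den r ω s hs.dim (x := sampleAt (w d + 1) ω)
    (by rw [hs.size]; exact fun t ht => (hs.sample t ht).1) (hs.zero 25 (by simp) _ _)
    (hs.zero 27 (by simp) _ _) (by rw [hs.fan, hs.depth, hs.nodes]; rfl)
  rw [hs.nodes, hs.size, hs.width] at hg
  have f1 : ∀ k ∉ growCode.writes, (growCode.den r ω s).mem k = s.mem k :=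
    fun k => den_mem r ω _ _
  have o1 := den_out r ω growCode s (by decide)
  set s1 := growCode.den r ω s
  have e1 : s1.mem 1 0 0 = ℓ := by rw [f1 1 (by decide), hs.depth]
  have e8 : s1.mem 8 0 0 = fanOut ℓ a := by rw [f1 8 (by decide), hs.fan]
  have e7 : s1.mem 7 0 0 = scale ℓ a ^ 6 := by rw [f1 7 (by decide), hs.flagScale]
  have hE : 2 * s1.mem 27 0 0 + 1 ≤ nodeBound ℓ a := by
    have hg' := hg
    rw [← hs.nodes, ← f1 10 (by decide)] at hg'
    rw [← hs.nodes, ← f1 10 (by decide)]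
    exact hg'.count_le
  have hsel := selectCode_den r ω s1 (by rw [f1 0 (by decide), hs.dim]) hg hE
    (by intro u; rw [f1 30 (by decide), hs.zero 30 (by simp)])
    (by intro u; rw [f1 31 (by decide), hs.zero 31 (by simp)])
  rw [e1, e7, e8, Est.plan_congr (f' := roundedEst (sampleAt (w d + 1) ω) (s.mem 22)
    (sampleSize d ℓ a q B) (offset r (offsetBits d ℓ a q B)) (width d ℓ a q B)) _ _ ℓ 0 _ (by
      intro l _ hl S i _
      simp only [roundedEst]
      rw [hs.offset l (by omega)])] at hsel
  have f2 : ∀ k ∉ selectCode.writes, (selectCode.den r ω s1).mem k = s1.mem k :=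
    fun k => den_mem r ω _ _
  have o2 := den_out r ω selectCode s1 (by decide)
  set s2 := selectCode.den r ω s1
  rw [writeCode_den r ω s2 (by rw [f2 0 (by decide), f1 0 (by decide), hs.dim])
    (by rw [f2 33 (by decide), f1 33 (by decide), hs.zero 33 (by simp)]) hsel, o2, o1, hs.out,
    List.nil_append]
  rw [f2 10 (by decide), f1 10 (by decide), hs.nodes]
  have hdep := Est.depth_plan_le (roundedEst (sampleAt (w d + 1) ω) (s.mem 22)
    (sampleSize d ℓ a q B) (offset r (offsetBits d ℓ a q B)) (width d ℓ a q B))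
    (scale ℓ a ^ 6) (fanOut ℓ a) ℓ 0 (fun _ => none)
  refine (DecisionTree.nodes_le_pow _ hdep).trans (Nat.pow_le_pow_left ?_ ℓ)
  have : 1 ≤ fanOut ℓ a := Nat.one_le_pow _ _ (Nat.mul_pos (by omega) ha)
  omega

end den

/-! ### Number of steps of the learner -/

/-- All entries read by an expression are at most `U`. -/
def AExpr.Bounded (U : ℕ) (M : Store) : AExpr → Prop
  | .lit _ => True
  | .get k i j => M k (i.eval M) (j.eval M) ≤ U
  | .add a b | .sub a b | .mul a b | .div a b => a.Bounded U M ∧ b.Bounded U M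

/-- All loop bounds are formed from entries that are at most `U`. -/
def ACode.Bounded (U : ℕ) (M : Store) : ACode → Prop
  | .seq P Q | .ite _ P Q => P.Bounded U M ∧ Q.Bounded U M
  | .rep _ n P => n.Bounded U M ∧ P.Bounded U M
  | _ => True

/-- For a fixed expression the value is polynomial in its entries; numerical constants are absorbed
by `n ≤ 2 ^ n ≤ U ^ n`. -/
theorem AExpr.exists_eval_le (e : AExpr) : ∃ c : ℕ, ∀ (U : ℕ) (M : Store), 2 ≤ U →
    e.Bounded U M → e.eval M ≤ U ^ c := by
  induction e with
  | lit n => exact ⟨n, fun U M hU _ => Nat.lt_two_pow_self.le.trans (Nat.pow_le_pow_left hU n)⟩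
  | get k i j => exact ⟨1, fun U M _ h => by rw [pow_one]; exact h⟩
  | add a b iha ihb =>
    obtain ⟨c, hc⟩ := iha
    obtain ⟨c', hc'⟩ := ihb
    refine ⟨c + c' + 1, fun U M hU h => ?_⟩
    have h1 := (hc U M hU h.1).trans (Nat.pow_le_pow_right (by omega) (by omega : c ≤ c + c'))
    have h2 := (hc' U M hU h.2).trans (Nat.pow_le_pow_right (by omega) (by omega : c' ≤ c + c'))
    simp only [eval]
    rw [pow_succ]
    nlinarith
  | sub a b iha ihb =>
    obtain ⟨c, hc⟩ := iha
    exact ⟨c, fun U M hU h => (Nat.sub_le _ _).trans (hc U M hU h.1)⟩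
  | mul a b iha ihb =>
    obtain ⟨c, hc⟩ := iha
    obtain ⟨c', hc'⟩ := ihb
    refine ⟨c + c', fun U M hU h => ?_⟩
    rw [pow_add]
    exact Nat.mul_le_mul (hc U M hU h.1) (hc' U M hU h.2)
  | div a b iha ihb =>
    obtain ⟨c, hc⟩ := iha
    exact ⟨c, fun U M hU h => (Nat.div_le_self _ _).trans (hc U M hU h.1)⟩

/-- The static bound is built by finitely many sums and products from loop bounds and constants,
hence is a power of `U` whose exponent depends only on the text of the program. This replaces an
explicit count of steps. -/
theorem ACode.exists_stepBound_le (P : ACode) : ∃ c : ℕ, ∀ (U d : ℕ) (M : Store), 2 ≤ U → d ≤ U →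
    P.Bounded U M → P.stepBound d M ≤ U ^ c := by
  have const : ∀ n U : ℕ, 2 ≤ U → n ≤ U ^ n := fun n U hU =>
    Nat.lt_two_pow_self.le.trans (Nat.pow_le_pow_left hU n)
  have mono : ∀ {U n c c' : ℕ}, 2 ≤ U → n ≤ U ^ c → c ≤ c' → n ≤ U ^ c' := fun hU h hc =>
    h.trans (Nat.pow_le_pow_right (by omega) hc)
  have add : ∀ {U n n' c c' : ℕ}, 2 ≤ U → n ≤ U ^ c → n' ≤ U ^ c' → n + n' ≤ U ^ (c + c' + 1) := by
    intro U n n' c c' hU h h'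
    have h1 := mono hU h (by omega : c ≤ c + c')
    have h2 := mono hU h' (by omega : c' ≤ c + c')
    rw [pow_succ]
    nlinarith
  have mul : ∀ {U n n' c c' : ℕ}, n ≤ U ^ c → n' ≤ U ^ c' → n * n' ≤ U ^ (c + c') := by
    intro U n n' c c' h h'
    rw [pow_add]
    exact Nat.mul_le_mul h h'
  induction P with
  | skip => exact ⟨1, fun U d M hU _ _ => const 1 U hU⟩
  | set k i j v => exact ⟨1 + v.rate, fun U d M hU _ _ => const _ U hU⟩
  | seq P Q ihP ihQ =>
    obtain ⟨c, hc⟩ := ihP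
    obtain ⟨c', hc'⟩ := ihQ
    exact ⟨_, fun U d M hU hd h => add hU (hc U d M hU hd h.1) (hc' U d M hU hd h.2)⟩
  | ite e P Q ihP ihQ =>
    obtain ⟨c, hc⟩ := ihP
    obtain ⟨c', hc'⟩ := ihQ
    exact ⟨_, fun U d M hU hd h =>
      add hU (add hU (const 1 U hU) (hc U d M hU hd h.1)) (hc' U d M hU hd h.2)⟩
  | rep k n P ihP =>
    obtain ⟨c, hc⟩ := ihP
    obtain ⟨c', hc'⟩ := n.exists_eval_le
    exact ⟨_, fun U d M hU hd h => add hU (const 2 U hU)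
      (mul (hc' U M hU h.1) (add hU (const 2 U hU) (hc U d M hU hd h.2)))⟩
  | flip k => exact ⟨1, fun U d M hU _ _ => const 1 U hU⟩
  | draw p i q j =>
    exact ⟨_, fun U d M hU hd _ => add hU (add hU (mul (const 4 U hU) (hd.trans (pow_one U).ge))
      (const 4 U hU)) (const j.rate U hU)⟩
  | emit v => exact ⟨1, fun U d M hU _ _ => const 1 U hU⟩
  | size k v => exact ⟨1, fun U d M hU _ _ => const 1 U hU⟩

/-- A bound for all parameters that occur in the running time of the learner. -/
def budget (d ℓ a q B : ℕ) : ℕ :=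
  2 + d + ℓ + a + q + B.size + scale ℓ a ^ 7 + 2 ^ ℓ + nodeBound ℓ a + resolution ℓ a +
    slack d ℓ a q + minWidth d ℓ a q B + sampleSize d ℓ a q B

theorem size_le_self (n : ℕ) : n.size ≤ n := Nat.size_le.2 Nat.lt_two_pow_self

section steps
variable {d : ℕ} (r : Coins) (ω : Answers d)

/-- The phases computing parameters by multiplication are not `Static`. They are straight-line
programs, and their growth is bounded by the values themselves, since the bit length of a number is
at most the number. -/
theorem paramsCode_steps_le (s : AState) : paramsCode.steps r ω s ≤ 5 + 3 * (s.mem 4 0 0).size +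
    scale (s.mem 1 0 0) (s.mem 2 0 0) + scale (s.mem 1 0 0) (s.mem 2 0 0) ^ 6 +
    fanOut (s.mem 1 0 0) (s.mem 2 0 0) := by
  have h1 := size_le_self (scale (s.mem 1 0 0) (s.mem 2 0 0))
  have h2 := size_le_self (scale (s.mem 1 0 0) (s.mem 2 0 0) ^ 6)
  have h3 := size_le_self (fanOut (s.mem 1 0 0) (s.mem 2 0 0))
  have e6 : ∀ p : ℕ, p * p * (p * p) * (p * p) = p ^ 6 := fun p => by ring
  have e7 : ∀ p : ℕ, p ^ 6 * p = p ^ 7 := fun p => by ring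
  simp [paramsCode, block, steps, den, AExpr.growth, AExpr.mild, AExpr.rate, AExpr.eval]
  simp only [fanOut, scale] at h1 h2 h3 ⊢
  simp only [e6, e7]
  omega

theorem widthsCode_steps_le (s : AState) : widthsCode.steps r ω s ≤ 3 +
    32 * s.mem 9 0 0 * s.mem 7 0 0 + 12 * s.mem 10 0 0 * (s.mem 0 0 0 + 1) * s.mem 3 0 0 +
      (12 * s.mem 10 0 0 * (s.mem 0 0 0 + 1) * s.mem 3 0 0 *
        (12 * s.mem 10 0 0 * (s.mem 0 0 0 + 1) * s.mem 3 0 0) * (32 * s.mem 9 0 0 * s.mem 7 0 0) *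
        (3 * s.mem 0 0 0 + s.mem 5 0 0 + 3)) := by
  have h1 := size_le_self (32 * s.mem 9 0 0 * s.mem 7 0 0)
  have h2 := size_le_self (12 * s.mem 10 0 0 * (s.mem 0 0 0 + 1) * s.mem 3 0 0)
  have h3 := size_le_self (12 * s.mem 10 0 0 * (s.mem 0 0 0 + 1) * s.mem 3 0 0 *
        (12 * s.mem 10 0 0 * (s.mem 0 0 0 + 1) * s.mem 3 0 0) * (32 * s.mem 9 0 0 * s.mem 7 0 0) *
        (3 * s.mem 0 0 0 + s.mem 5 0 0 + 3))
  simp [widthsCode, block, steps, den, AExpr.growth, AExpr.mild, AExpr.eval]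
  omega

theorem samplesCode_steps_le (s : AState) :
    samplesCode.steps r ω s ≤ 1 + s.mem 14 0 0 * s.mem 11 0 0 := by
  have h1 := size_le_self (s.mem 14 0 0 * s.mem 11 0 0)
  simp [samplesCode, steps, AExpr.growth, AExpr.mild, AExpr.eval]
  omega

end steps

theorem powersCode_static : powersCode.Static := by
  simp [block, powersCode, Static, writes, AExpr.ids, boundIds, AExpr.mild]

theorem offsetsCode_static : offsetsCode.Static := by
  simp [block, offsetsCode, Static, writes, AExpr.ids, boundIds, AExpr.mild]

theorem selectCode_static : selectCode.Static := by
  simp [block, selectCode, compareCode, Static, writes, boundIds, AExpr.mild]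

theorem writeCode_static : writeCode.Static := by
  simp [block, writeCode, popCode, doubleCode, Static, writes, AExpr.ids, boundIds, AExpr.mild]

theorem drawCode_plainMarks_static : (drawCode plainMarks).Static := by
  simp [block, drawCode, plainMarks, Static, writes, AExpr.ids, boundIds, AExpr.mild]

theorem drawCode_pairMarks_static : (drawCode pairMarks).Static := by
  simp [block, drawCode, pairMarks, Static, writes, AExpr.ids, boundIds, AExpr.mild]

theorem exists_steps_le (P : ACode) (hst : (drawCode P).Static)
    {w : ℕ → ℕ} {mark : ∀ {d : ℕ}, Answers d → ℕ → Cube d → ℕ → ℕ} (hP : Marks P w mark)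
    (hw : ∀ k ∈ P.writes, k ∈ [20, 22, 23, 51]) (he : P.emits = false)
    (hPb : ∀ U M, M 0 0 0 ≤ U → P.Bounded U M) :
    ∃ c : ℕ, ∀ {d : ℕ} (r : Coins) (ω : Answers d) (ℓ a q B : ℕ), 1 ≤ a →
      (learnerCode P).steps r ω (inputState d ℓ a q B) ≤ budget d ℓ a q B ^ c := by
  obtain ⟨c1, h1⟩ := powersCode.exists_stepBound_le
  obtain ⟨c2, h2⟩ := offsetsCode.exists_stepBound_le
  obtain ⟨c3, h3⟩ := (drawCode P).exists_stepBound_le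
  obtain ⟨c4, h4⟩ := growCode.exists_stepBound_le
  obtain ⟨c5, h5⟩ := selectCode.exists_stepBound_le
  obtain ⟨c6, h6⟩ := writeCode.exists_stepBound_le
  refine ⟨c1 + c2 + c3 + c4 + c5 + c6 + 10, fun {d} r ω ℓ a q B ha => ?_⟩
  set s0 := inputState d ℓ a q B with hs0
  obtain ⟨U, hU⟩ : ∃ U, budget d ℓ a q B = U := ⟨_, rfl⟩
  have hU' := hU.symm
  rw [budget] at hU'
  rw [hU]
  have hpow : 0 < 2 ^ ℓ := by positivity
  have hU2 : 2 ≤ U := by omega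
  have hdU : d ≤ U := by omega
  have hp : 1 ≤ scale ℓ a := Nat.mul_pos (by omega) ha
  have hp1 : scale ℓ a ≤ scale ℓ a ^ 7 := Nat.le_self_pow (by norm_num) _
  have hp6 : scale ℓ a ^ 6 ≤ scale ℓ a ^ 7 := Nat.pow_le_pow_right hp (by norm_num)
  have hfan : fanOut ℓ a = scale ℓ a ^ 7 := rfl
  -- parameters
  have k1 := paramsCode_steps_le r ω s0
  rw [show s0.mem 4 0 0 = B from rfl, show s0.mem 1 0 0 = ℓ from rfl,
    show s0.mem 2 0 0 = a from rfl] at k1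
  obtain ⟨-, -, a8⟩ := paramsCode_den r ω s0
  have f1 : ∀ k ∉ paramsCode.writes, (paramsCode.den r ω s0).mem k = s0.mem k :=
    fun k => den_mem r ω _ _
  have hprep := prepared r ω ℓ a q B
  rw [← hs0] at hprep
  set s1 := paramsCode.den r ω s0
  have v1 : s1.mem 1 0 0 = ℓ := by rw [f1 1 (by decide)]; rfl
  have k2 := (steps_le r ω powersCode s1 powersCode_static).trans (h1 U d _ hU2 hdU (by
    simp only [powersCode, block, ACode.Bounded, AExpr.Bounded, AExpr.eval, v1, a8,
      show s0.mem 1 0 0 = ℓ from rfl, show s0.mem 2 0 0 = a from rfl]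
    refine ⟨trivial, ⟨by omega, trivial⟩, trivial, by omega, trivial, ⟨⟨⟨?_, ?_⟩, trivial⟩,
    trivial⟩,
      trivial⟩ <;> omega))
  have f2 : ∀ k ∉ powersCode.writes, (powersCode.den r ω s1).mem k = s1.mem k :=
    fun k => den_mem r ω _ _
  set s2 := powersCode.den r ω s1
  have k3 := widthsCode_steps_le r ω s2
  have v12 : (widthsCode.den r ω s2).mem 12 0 0 =
      12 * s2.mem 10 0 0 * (s2.mem 0 0 0 + 1) * s2.mem 3 0 0 := by
    simp [widthsCode, block, den, AExpr.eval]
  have f3 : ∀ k ∉ widthsCode.writes, (widthsCode.den r ω s2).mem k = s2.mem k :=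
    fun k => den_mem r ω _ _
  obtain ⟨b11, b13⟩ := widthsCode_den r ω s2
  rw [← b13, ← b11, hprep.minW, hprep.resol, ← f3 10 (by decide), ← f3 0 (by decide),
    hprep.nodes, hprep.dim, f2 3 (by decide), f1 3 (by decide),
    show s0.mem 3 0 0 = q from rfl] at k3
  change _ ≤ 3 + resolution ℓ a + slack d ℓ a q + minWidth d ℓ a q B at k3
  have hsam := sampled r ω hP hw he hprep
  set s3 := widthsCode.den r ω s2
  have k4 := (steps_le r ω offsetsCode s3 offsetsCode_static).trans (h2 U d _ hU2 hdU (by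
    simp only [offsetsCode, block, ACode.Bounded, AExpr.Bounded, AExpr.eval, hprep.depth,
      hprep.minW]
    refine ⟨⟨by omega, trivial⟩, trivial, trivial, by omega, ⟨trivial, trivial, trivial⟩, trivial⟩))
  obtain ⟨a14, -⟩ := offsetsCode_den r ω s3 hprep.flips
  have f4 : ∀ k ∉ offsetsCode.writes, (offsetsCode.den r ω s3).mem k = s3.mem k :=
    fun k => den_mem r ω _ _
  set s4 := offsetsCode.den r ω s3
  have k5 := samplesCode_steps_le r ω s4
  have e16 : s4.mem 14 0 0 * s4.mem 11 0 0 = sampleSize d ℓ a q B := by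
    rw [a14, hprep.minW, f4 11 (by decide), hprep.resol]; rfl
  rw [e16] at k5
  have v16 : (samplesCode.den r ω s4).mem 16 0 0 = sampleSize d ℓ a q B := by
    rw [← e16]; simp [samplesCode, den, AExpr.eval]
  have f5 : ∀ k ∉ samplesCode.writes, (samplesCode.den r ω s4).mem k = s4.mem k :=
    fun k => den_mem r ω _ _
  set s5 := samplesCode.den r ω s4
  have v50 : s5.mem 0 0 0 = d := by rw [f5 0 (by decide), f4 0 (by decide), hprep.dim]
  have k6 := (steps_le r ω (drawCode P) s5 hst).trans (h3 U d _ hU2 hdU (by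
    have := hPb U s5.mem (by omega)
    simp only [drawCode, block, ACode.Bounded, AExpr.Bounded, AExpr.eval, v16, v50]
    exact ⟨by omega, ⟨by omega, trivial⟩, trivial, this, trivial⟩))
  set s6 := (drawCode P).den r ω s5
  have k7 := (steps_le r ω growCode s6 growCode_static).trans (h4 U d _ hU2 hdU (by
    simp [growCode, rootCode, nodeCode, estimateCode, tableCode, tallyCode, memberCode, expandCode,
      tryCode, childCode, copyCode, block, ACode.Bounded, AExpr.Bounded, AExpr.eval, hsam.dim,
      hsam.nodes, hsam.size]
    omega))
  have hg := growCode_den r ω s6 hsam.dim (x := sampleAt (w d + 1) ω)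
    (by rw [hsam.size]; exact fun t ht => (hsam.sample t ht).1) (hsam.zero 25 (by simp) _ _)
    (hsam.zero 27 (by simp) _ _) (by rw [hsam.fan, hsam.depth, hsam.nodes]; rfl)
  have f7 : ∀ k ∉ growCode.writes, (growCode.den r ω s6).mem k = s6.mem k :=
    fun k => den_mem r ω _ _
  set s7 := growCode.den r ω s6
  rw [← f7 10 (by decide)] at hg
  have hE := hg.count_le
  rw [f7 10 (by decide), hsam.nodes] at hE
  have k8 := (steps_le r ω selectCode s7 selectCode_static).trans (h5 U d _ hU2 hdU (by
    simp [selectCode, compareCode, block, ACode.Bounded, AExpr.Bounded, AExpr.eval]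
    omega))
  have f8 : ∀ k ∉ selectCode.writes, (selectCode.den r ω s7).mem k = s7.mem k :=
    fun k => den_mem r ω _ _
  set s8 := selectCode.den r ω s7
  have k9 := (steps_le r ω writeCode s8 writeCode_static).trans (h6 U d _ hU2 hdU (by
    simp [writeCode, popCode, doubleCode, block, ACode.Bounded, AExpr.Bounded, AExpr.eval,
      f8 10 (by decide), f7 10 (by decide), hsam.nodes, f8 0 (by decide), f7 0 (by decide),
      hsam.dim]
    omega))
  have htot : (learnerCode P).steps r ω s0 = paramsCode.steps r ω s0 + (powersCode.steps r ω s1 +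
      (widthsCode.steps r ω s2 + (offsetsCode.steps r ω s3 + (samplesCode.steps r ω s4 +
      ((drawCode P).steps r ω s5 + (growCode.steps r ω s6 + (selectCode.steps r ω s7 +
        writeCode.steps r ω s8))))))) := rfl
  set X := U ^ (c1 + c2 + c3 + c4 + c5 + c6 + 1) with hX
  have up : ∀ {n c : ℕ}, n ≤ U ^ c → c ≤ c1 + c2 + c3 + c4 + c5 + c6 + 1 → n ≤ X := fun h hc =>
    h.trans (Nat.pow_le_pow_right (by omega) hc)
  have g2 := up k2 (by omega)
  have g4 := up k4 (by omega)
  have g6 := up k6 (by omega)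
  have g7 := up k7 (by omega)
  have g8 := up k8 (by omega)
  have g9 := up k9 (by omega)
  have gU : U ≤ X := up (pow_one U).ge (by omega)
  have hfin : U ^ (c1 + c2 + c3 + c4 + c5 + c6 + 10) = X * U ^ 9 := by rw [hX, ← pow_add]
  -- The additional factor `U ^ 9` absorbs the sum over the nine phases together with the small
  -- constants in the bounds for the straight-line ones.
  have h512 : 2 ^ 9 ≤ U ^ 9 := Nat.pow_le_pow_left hU2 9
  have : X * 2 ^ 9 ≤ X * U ^ 9 := Nat.mul_le_mul_left _ h512
  rw [hfin, htot]
  omega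

/-! ### Sums over subcubes -/

/-- Flip a coordinate. -/
def Cube.flip {d : ℕ} (x : Cube d) (i : Fin d) : Cube d := Function.update x i (!x i)

theorem Cube.flip_flip {d : ℕ} (x : Cube d) (i : Fin d) : (Cube.flip (Cube.flip x i) i) = x := by
  simp [Cube.flip]

theorem Cube.flip_same {d : ℕ} (x : Cube d) (i : Fin d) : Cube.flip x i i = !x i := by
  simp [Cube.flip]

theorem Cube.flip_ne {d : ℕ} (x : Cube d) {i j : Fin d} (h : j ≠ i) : Cube.flip x i j = x j := by
  simp [Cube.flip, h]

namespace Subcube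

variable {d : ℕ}

theorem mem_fix {S : Subcube d} {i : Fin d} (hi : S i = none) (b : Bool) (x : Cube d) :
    x ∈ (S.fix i b).points ↔ x ∈ S.points ∧ x i = b := by
  constructor
  · intro h
    refine ⟨fun j c hj => h j c ?_, h i b (by simp [fix])⟩
    have : j ≠ i := by rintro rfl; simp [hi] at hj
    simpa [fix, this] using hj
  · rintro ⟨h, hb⟩ j c hj
    by_cases hji : j = i
    · subst hji
      simp [fix] at hj
      rw [hb, hj]
    · exact h j c (by simpa [fix, hji] using hj)

theorem flip_mem {S : Subcube d} {i : Fin d} (hi : S i = none) (x : Cube d) :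
    Cube.flip x i ∈ S.points ↔ x ∈ S.points := by
  have key : ∀ x : Cube d, x ∈ S.points → Cube.flip x i ∈ S.points := by
    intro x h j c hj
    have : j ≠ i := by rintro rfl; simp [hi] at hj
    rw [Cube.flip_ne _ this]
    exact h j c hj
  exact ⟨fun h => by simpa [Cube.flip_flip] using key _ h, key x⟩

/-- The sum of `g` over the points of a subcube. -/
noncomputable def sum (S : Subcube d) (g : Cube d → ℝ) : ℝ := ∑ x, if x ∈ S.points then g x else 0

theorem sum_congr {S : Subcube d} {g h : Cube d → ℝ} (H : ∀ x ∈ S.points, g x = h x) :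
    S.sum g = S.sum h :=
  Finset.sum_congr rfl fun x _ => by split_ifs with hx; exacts [H x hx, rfl]

theorem sum_mono {S : Subcube d} {g h : Cube d → ℝ} (H : ∀ x ∈ S.points, g x ≤ h x) :
    S.sum g ≤ S.sum h :=
  Finset.sum_le_sum fun x _ => by split_ifs with hx; exacts [H x hx, le_rfl]

theorem sum_nonneg {S : Subcube d} {g : Cube d → ℝ} (H : ∀ x ∈ S.points, 0 ≤ g x) :
    0 ≤ S.sum g :=
  Finset.sum_nonneg fun x _ => by split_ifs with hx; exacts [H x hx, le_rfl]

theorem sum_add (S : Subcube d) (g h : Cube d → ℝ) :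
    (S.sum fun x => g x + h x) = S.sum g + S.sum h := by
  simp only [sum, ← Finset.sum_add_distrib]
  exact Finset.sum_congr rfl fun x _ => by split_ifs <;> simp

theorem sum_mul (S : Subcube d) (c : ℝ) (g : Cube d → ℝ) :
    (S.sum fun x => c * g x) = c * S.sum g := by
  simp only [sum, Finset.mul_sum]
  exact Finset.sum_congr rfl fun x _ => by split_ifs <;> simp

theorem sum_const (S : Subcube d) (c : ℝ) : (S.sum fun _ => c) = c * S.sum fun _ => 1 := by
  rw [← sum_mul]; simp

theorem abs_sum_le (S : Subcube d) (g : Cube d → ℝ) : |S.sum g| ≤ S.sum fun x => |g x| :=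
  (Finset.abs_sum_le_sum_abs _ _).trans_eq
    (Finset.sum_congr rfl fun x _ => by split_ifs <;> simp)

theorem sum_finset {ι : Type} (S : Subcube d) (s : Finset ι) (g : ι → Cube d → ℝ) :
    (S.sum fun x => ∑ i ∈ s, g i x) = ∑ i ∈ s, S.sum (g i) := by
  simp only [sum]
  rw [Finset.sum_comm]
  exact Finset.sum_congr rfl fun x _ => by split_ifs <;> simp

theorem sum_flip {S : Subcube d} {i : Fin d} (hi : S i = none) (g : Cube d → ℝ) :
    (S.sum fun x => g (Cube.flip x i)) = S.sum g := by
  have hinv : Function.Involutive fun x : Cube d => Cube.flip x i := fun x => Cube.flip_flip x i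
  refine Fintype.sum_equiv (Function.Involutive.toPerm _ hinv) _ _ fun x => ?_
  simp only [Function.Involutive.coe_toPerm, flip_mem hi]

theorem sum_fix {S : Subcube d} {i : Fin d} (hi : S i = none) (g : Cube d → ℝ) :
    S.sum g = (S.fix i false).sum g + (S.fix i true).sum g := by
  simp only [sum, mem_fix hi, ← Finset.sum_add_distrib]
  exact Finset.sum_congr rfl fun x _ => by cases x i <;> simp

theorem sum_fix_flip {S : Subcube d} {i : Fin d} (hi : S i = none) (b : Bool) (g : Cube d → ℝ) :
    ((S.fix i b).sum fun x => g (Cube.flip x i)) = (S.fix i (!b)).sum g := by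
  have hinv : Function.Involutive fun x : Cube d => Cube.flip x i := fun x => Cube.flip_flip x i
  refine Fintype.sum_equiv (Function.Involutive.toPerm _ hinv) _ _ fun x => ?_
  simp only [Function.Involutive.coe_toPerm, mem_fix hi, flip_mem hi, Cube.flip_same]
  cases x i <;> cases b <;> simp

/-- Number of free coordinates. -/
def free (S : Subcube d) : ℕ := (Finset.univ.filter fun i => S i = none).card

theorem free_fix {S : Subcube d} {i : Fin d} (hi : S i = none) (b : Bool) :
    (S.fix i b).free + 1 = S.free := by
  have : (Finset.univ.filter fun j => S.fix i b j = none) =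
      (Finset.univ.filter fun j => S j = none).erase i := by
    ext j
    by_cases hj : j = i
    · subst hj
      simp only [Finset.mem_filter, Finset.mem_erase]
      simp [fix]
    · simp only [Finset.mem_filter, Finset.mem_erase]
      simp [fix, hj]
  rw [free, this, Finset.card_erase_of_mem (by simp [hi]), free, Nat.sub_add_cancel]
  exact Finset.card_pos.2 ⟨i, by simp [hi]⟩

/-- Induction on the number of free coordinates. -/
theorem induction_fix {p : Subcube d → Prop} (h0 : ∀ x : Cube d, p fun i => some (x i))
    (h1 : ∀ (S : Subcube d) (i : Fin d), S i = none → p (S.fix i false) → p (S.fix i true) → p S)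
    (S : Subcube d) : p S := by
  induction hn : S.free generalizing S with
  | zero =>
    have : ∀ i, S i ≠ none := fun i hi => by
      have := free_fix hi true
      omega
    have h2 : S = fun i => some ((S i).getD true) := by
      funext i
      cases h : S i
      · exact absurd h (this i)
      · rfl
    rw [h2]
    exact h0 _
  | succ n ih =>
    obtain ⟨i, hi⟩ : (Finset.univ.filter fun i => S i = none).Nonempty := by
      rw [← Finset.card_pos, ← free]; omega
    have hi : S i = none := by simpa using hi
    exact h1 S i hi (ih _ (by have := free_fix hi false; omega))
      (ih _ (by have := free_fix hi true; omega))

theorem sum_point (x : Cube d) (g : Cube d → ℝ) : sum (fun i => some (x i)) g = g x := by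
  have : ∀ y : Cube d, y ∈ points (fun i => some (x i)) ↔ y = x := by
    intro y
    simp only [points, Set.mem_ofPred_eq, Option.some.injEq]
    exact ⟨fun h => funext fun i => h i _ rfl, by rintro rfl i b h; exact h⟩
  simp [sum, this]

theorem sum_one (S : Subcube d) : (S.sum fun _ => 1) = 2 ^ S.free := by
  induction S using induction_fix with
  | h0 x => simp [sum_point, free]
  | h1 S i hi ih1 ih2 =>
    rw [sum_fix hi, ih1, ih2, ← free_fix hi true, pow_succ]
    have := free_fix hi true
    have := free_fix hi false
    rw [show (S.fix i false).free = (S.fix i true).free by omega]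
    ring

theorem sum_one_pos (S : Subcube d) : 0 < S.sum fun _ => 1 := by
  rw [sum_one]; positivity

end Subcube

/-! ### Influences -/

section influence
variable {d : ℕ} (w : Cube d → ℝ)

/-- Half of the difference along an edge. -/
noncomputable def halfDiff (i : Fin d) (x : Cube d) : ℝ := |w x - w (Cube.flip x i)| / 2

/-- Sum of the influences of the free directions on a subcube. -/
noncomputable def totalInfluence (η : Fin d → Cube d → ℝ) (S : Subcube d) : ℝ :=
  ∑ i, if S i = none then S.sum (η i) else 0

/-- Fixing `i` removes this direction, and every other influence is distributed over the two halves.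
This identity turns the greatest sum of query influences into the least total influence at the
leaves. -/
theorem totalInfluence_split (η : Fin d → Cube d → ℝ) {S : Subcube d} {i : Fin d}
    (hi : S i = none) : totalInfluence η S = S.sum (η i) + (totalInfluence η (S.fix i false) +
      totalInfluence η (S.fix i true)) := by
  simp only [totalInfluence, ← Finset.sum_add_distrib]
  rw [← Finset.add_sum_erase _ _ (Finset.mem_univ i), if_pos hi]
  congr 1
  rw [← Finset.add_sum_erase _ _ (Finset.mem_univ i)]
  simp only [Subcube.fix, Function.update_self, reduceCtorEq, if_false, add_zero, zero_add]
  refine Finset.sum_congr rfl fun j hj => ?_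
  have hj : j ≠ i := Finset.ne_of_mem_erase hj
  simp only [Function.update_of_ne hj]
  split_ifs
  · exact Subcube.sum_fix hi _
  · simp

theorem totalInfluence_mono {η η' : Fin d → Cube d → ℝ} (h : ∀ i x, η i x ≤ η' i x)
    (S : Subcube d) : totalInfluence η S ≤ totalInfluence η' S :=
  Finset.sum_le_sum fun i _ => by
    split_ifs
    · exact Subcube.sum_mono fun x _ => h i x
    · exact le_rfl

/-- Flipping `i` exchanges the halves and preserves the edge differences, so each half carries one
half of the sum, which cancels the factor in `halfDiff`. -/
theorem sum_halfDiff_fix {S : Subcube d} {i : Fin d} (hi : S i = none) (b : Bool) :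
    ((S.fix i b).sum fun x => |w x - w (Cube.flip x i)|) = S.sum (halfDiff w i) := by
  have h : ∀ b, ((S.fix i b).sum fun x => |w x - w (Cube.flip x i)|) =
      2 * (S.fix i b).sum (halfDiff w i) := fun b => by
    rw [← Subcube.sum_mul]
    exact Subcube.sum_congr fun x _ => by simp only [halfDiff]; ring
  have h2 : ((S.fix i b).sum fun x => |w x - w (Cube.flip x i)|) =
      ((S.fix i (!b)).sum fun x => |w x - w (Cube.flip x i)|) := by
    rw [← Subcube.sum_fix_flip hi b]
    exact Subcube.sum_congr fun x _ => by rw [Cube.flip_flip, abs_sub_comm]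
  rw [Subcube.sum_fix hi]
  have h3 := h b
  have h4 := h (!b)
  cases b <;> simp only [Bool.not_false, Bool.not_true] at * <;> linarith

/-- A function differs from its mean by at most its total influence. -/
theorem sum_abs_sub_mean_le (S : Subcube d) :
    (S.sum fun x => |w x - S.sum w / S.sum fun _ => 1|) ≤ totalInfluence (halfDiff w) S := by
  induction S using Subcube.induction_fix with
  | h0 x => simp [Subcube.sum_point, totalInfluence]
  | h1 S i hi ih1 ih2 =>
    rw [totalInfluence_split _ hi]
    set c := (S.fix i false).sum fun _ => 1 with hc
    have hc1 : ((S.fix i true).sum fun _ => 1) = c := by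
      rw [hc, Subcube.sum_one, Subcube.sum_one]
      have h1 := Subcube.free_fix hi false
      have h2 := Subcube.free_fix hi true
      congr 1; omega
    have hcS : (S.sum fun _ => 1) = 2 * c := by
      rw [Subcube.sum_fix hi, hc1, ← hc]; ring
    have hcp : 0 < c := Subcube.sum_one_pos _
    rw [hc1] at ih2
    set A := (S.fix i false).sum w with hA
    set B := (S.fix i true).sum w with hB
    have hAB : S.sum w = A + B := Subcube.sum_fix hi w
    -- Matching each point of one half with its neighbour in the other compares the sums over the
    -- two halves.
    have hdiff : |A - B| ≤ S.sum (halfDiff w i) := by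
      have e : B = (S.fix i false).sum fun x => w (Cube.flip x i) :=
        (Subcube.sum_fix_flip hi false w).symm
      have e2 : A - B = (S.fix i false).sum fun x => w x + (-1) * w (Cube.flip x i) := by
        rw [Subcube.sum_add, Subcube.sum_mul, ← e]; ring
      rw [e2, ← sum_halfDiff_fix w hi false]
      refine (Subcube.abs_sum_le _ _).trans (le_of_eq (Subcube.sum_congr fun x _ => ?_))
      congr 1; ring
    -- Changing the centre from `v` to `u` costs `|v - u|` at every point. The mean over `S` lies
    -- midway between the means over the halves, so each half pays `|A - B| / 2`.
    have tri : ∀ (b : Bool) (u v : ℝ), ((S.fix i b).sum fun x => |w x - u|) ≤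
        ((S.fix i b).sum fun x => |w x - v|) + |v - u| * (S.fix i b).sum fun _ => 1 := by
      intro b u v
      rw [← Subcube.sum_const, ← Subcube.sum_add]
      refine Subcube.sum_mono fun x _ => ?_
      have := abs_add_le (w x - v) (v - u)
      rwa [sub_add_sub_cancel] at this
    rw [Subcube.sum_fix hi, hAB, hcS]
    have t1 := tri false ((A + B) / (2 * c)) (A / c)
    have t2 := tri true ((A + B) / (2 * c)) (B / c)
    rw [← hc] at t1
    rw [hc1] at t2
    have e1 : |A / c - (A + B) / (2 * c)| * c = |A - B| / 2 := by
      rw [show A / c - (A + B) / (2 * c) = (A - B) / (2 * c) by field_simp; ring, abs_div,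
        abs_of_pos (by positivity : 0 < 2 * c)]
      field_simp
    have e2 : |B / c - (A + B) / (2 * c)| * c = |A - B| / 2 := by
      rw [show B / c - (A + B) / (2 * c) = -((A - B) / (2 * c)) by field_simp; ring, abs_neg,
        abs_div, abs_of_pos (by positivity : 0 < 2 * c)]
      field_simp
    rw [e1] at t1
    rw [e2] at t2
    linarith

/-- At each point, `w` is sensitive to at most `ℓ` directions. -/
def Sensitivity (ℓ : ℕ) : Prop :=
  ∀ x, (Finset.univ.filter fun i => w (Cube.flip x i) ≠ w x).card ≤ ℓ

variable {w}

/-- Flipping a free coordinate permutes the points of `S`, so both summands contribute equally.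
After exchanging the sums, each point is counted for at most `ℓ` sensitive directions. -/
theorem Sensitivity.sum_le {ℓ : ℕ} (hs : Sensitivity w ℓ) (S : Subcube d) {h : Cube d → ℝ}
    (hh : ∀ x, 0 ≤ h x) : totalInfluence (fun i x =>
      if w (Cube.flip x i) ≠ w x then h x + h (Cube.flip x i) else 0) S ≤ 2 * ℓ * S.sum h := by
  have step : totalInfluence (fun i x =>
      if w (Cube.flip x i) ≠ w x then h x + h (Cube.flip x i) else 0) S =
      2 * totalInfluence (fun i x => if w (Cube.flip x i) ≠ w x then h x else 0) S := by
    simp only [totalInfluence, Finset.mul_sum]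
    refine Finset.sum_congr rfl fun i _ => ?_
    split_ifs with hi
    · have h2 := Subcube.sum_flip hi (fun x => if w (Cube.flip x i) ≠ w x then h x else 0)
      simp only [Cube.flip_flip] at h2
      rw [two_mul]
      nth_rewrite 2 [← h2]
      rw [← Subcube.sum_add]
      refine Subcube.sum_congr fun x _ => ?_
      by_cases hx : w x = w (Cube.flip x i)
      · simp [hx]
      · simp [hx, Ne.symm hx]
    · simp
  rw [step, mul_assoc]
  refine mul_le_mul_of_nonneg_left ?_ (by norm_num)
  rw [← Subcube.sum_mul]
  calc totalInfluence (fun i x => if w (Cube.flip x i) ≠ w x then h x else 0) S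
      ≤ ∑ i, S.sum fun x => if w (Cube.flip x i) ≠ w x then h x else 0 := by
        refine Finset.sum_le_sum fun i _ => ?_
        split_ifs
        · exact le_rfl
        · exact Subcube.sum_nonneg fun x _ => by split_ifs; exacts [hh x, le_rfl]
    _ = S.sum fun x => ∑ i, if w (Cube.flip x i) ≠ w x then h x else 0 :=
        (Subcube.sum_finset _ _ _).symm
    _ ≤ _ := Subcube.sum_mono fun x _ => by
        rw [← Finset.sum_filter, Finset.sum_const, nsmul_eq_mul]
        exact mul_le_mul_of_nonneg_right (by exact_mod_cast hs x) (hh x)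

/-- The total influence is small if the function is nearly constant. -/
theorem Sensitivity.totalInfluence_le {ℓ : ℕ} (hs : Sensitivity w ℓ) (S : Subcube d) (v : ℝ) :
    totalInfluence (halfDiff w) S ≤ ℓ * S.sum fun x => |w x - v| := by
  have h1 := hs.sum_le S (h := fun x => |w x - v| / 2) (fun x => by positivity)
  have h2 : (2 : ℝ) * ℓ * S.sum (fun x => |w x - v| / 2) = ℓ * S.sum fun x => |w x - v| := by
    rw [mul_comm (2 : ℝ), mul_assoc, ← Subcube.sum_mul]
    congr 1
    exact Subcube.sum_congr fun x _ => by ring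
  rw [h2] at h1
  refine (totalInfluence_mono (fun i x => ?_) S).trans h1
  simp only [halfDiff]
  split_ifs with h
  · have := abs_sub_le (w x) v (w (Cube.flip x i))
    rw [abs_sub_comm v] at this
    linarith
  · push Not at h
    simp [h]

/-- The quantities `η` are a lower bound for the differences along edges, and not much smaller. -/
structure EdgeBound (w : Cube d → ℝ) (η : Fin d → Cube d → ℝ) : Prop where
  nonneg : ∀ i x, 0 ≤ η i x
  le : ∀ i x, η i x ≤ halfDiff w i x
  ge : ∀ i x, (w x - w (Cube.flip x i)) ^ 2 / 2 ≤ η i x * (w x + w (Cube.flip x i))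

variable {η : Fin d → Cube d → ℝ}

/-- The inequality of arithmetic and geometric means: with `u = μ η / 2` and `v = (w x + w x') / (4
μ)`, where `x'` is the flipped point, `(u + v)² ≥ 4uv = η (w x + w x') / 2`, which by `ge` is at
least the square of the left side. -/
theorem EdgeBound.halfDiff_le (hη : EdgeBound w η) (hw : ∀ x, 0 ≤ w x) {μ : ℝ} (hμ : 0 < μ)
    (i : Fin d) (x : Cube d) :
    halfDiff w i x ≤ μ / 2 * η i x + (w x + w (Cube.flip x i)) / (4 * μ) := by
  have h1 := hη.ge i x
  have h2 := hη.nonneg i x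
  have h3 : 0 ≤ w x + w (Cube.flip x i) := add_nonneg (hw _) (hw _)
  have hsq : (halfDiff w i x) ^ 2 = (w x - w (Cube.flip x i)) ^ 2 / 4 := by
    rw [halfDiff, div_pow, sq_abs]; norm_num
  set e := η i x
  set s := w x + w (Cube.flip x i)
  refine abs_le_of_sq_le_sq' ?_ (by positivity) |>.2
  rw [hsq]
  have : (μ / 2 * e + s / (4 * μ)) ^ 2 = (μ / 2 * e - s / (4 * μ)) ^ 2 + e * s / 2 := by
    field_simp; ring
  rw [this]
  nlinarith [sq_nonneg (μ / 2 * e - s / (4 * μ))]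

theorem EdgeBound.sum_halfDiff_le (hη : EdgeBound w η) (hw : ∀ x, 0 ≤ w x) {μ : ℝ} (hμ : 0 < μ)
    {S : Subcube d} {i : Fin d} (hi : S i = none) :
    S.sum (halfDiff w i) ≤ μ / 2 * S.sum (η i) + S.sum w / (2 * μ) := by
  refine (Subcube.sum_mono fun x _ => hη.halfDiff_le hw hμ i x).trans_eq ?_
  rw [Subcube.sum_add, Subcube.sum_mul]
  congr 1
  have : (S.sum fun x => (w x + w (Cube.flip x i)) / (4 * μ)) =
      S.sum fun x => 1 / (4 * μ) * (w x + w (Cube.flip x i)) :=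
    Subcube.sum_congr fun x _ => by ring
  rw [this, Subcube.sum_mul, Subcube.sum_add, Subcube.sum_flip hi w]
  field_simp
  ring

/-- The second term of the pointwise bound is needed only in sensitive directions. Its sum over all
directions therefore costs a factor `ℓ`, and not `d`. -/
theorem EdgeBound.totalInfluence_le (hη : EdgeBound w η) (hw : ∀ x, 0 ≤ w x) {ℓ : ℕ}
    (hs : Sensitivity w ℓ) {μ : ℝ} (hμ : 0 < μ) (S : Subcube d) :
    totalInfluence (halfDiff w) S ≤ μ / 2 * totalInfluence η S + ℓ / (2 * μ) * S.sum w := by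
  have h1 := hs.sum_le S (h := fun x => 1 / (4 * μ) * w x) (fun x => by have := hw x; positivity)
  have h2 : (2 : ℝ) * ℓ * S.sum (fun x => 1 / (4 * μ) * w x) = ℓ / (2 * μ) * S.sum w := by
    rw [Subcube.sum_mul]
    field_simp
    ring
  rw [h2] at h1
  have h3 : totalInfluence (fun i x => μ / 2 * η i x +
      if w (Cube.flip x i) ≠ w x then 1 / (4 * μ) * w x + 1 / (4 * μ) * w (Cube.flip x i) else 0) S
      = μ / 2 * totalInfluence η S + totalInfluence (fun i x =>
      if w (Cube.flip x i) ≠ w x then 1 / (4 * μ) * w x + 1 / (4 * μ) * w (Cube.flip x i) else 0)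
        S := by
    simp only [totalInfluence, Finset.mul_sum, ← Finset.sum_add_distrib]
    refine Finset.sum_congr rfl fun i _ => ?_
    split_ifs
    · rw [Subcube.sum_add, Subcube.sum_mul]
    · simp
  refine (totalInfluence_mono (fun i x => ?_) S).trans (h3.le.trans (by linarith))
  split_ifs with h
  · exact (hη.halfDiff_le hw hμ i x).trans_eq (by ring)
  · push Not at h
    have := mul_nonneg hμ.le (hη.nonneg i x)
    simp only [halfDiff, h, sub_self, abs_zero]
    linarith

end influence

/-! ### Decision trees -/

namespace DecisionTree
variable {d : ℕ} {V : Type}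

/-- Only coordinates queried on the path of `x` can change the value: the query at the root, and
those met in the subtree that `x` enters. -/
theorem sensitivity [DecidableEq V] (T : DecisionTree d V) (x : Cube d) :
    (Finset.univ.filter fun i => T.eval (Cube.flip x i) ≠ T.eval x).card ≤ T.depth := by
  induction T with
  | leaf v => simp [eval, depth]
  | node j l r ihl ihr =>
    have key : ∀ t : DecisionTree d V,
        (∀ y : Cube d, y j = x j → (node j l r).eval y = t.eval y) →
        (Finset.univ.filter fun i => (node j l r).eval (Cube.flip x i) ≠ (node j l r).eval x) ⊆
          insert j (Finset.univ.filter fun i => t.eval (Cube.flip x i) ≠ t.eval x) := by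
      intro t ht i hi
      rw [Finset.mem_insert]
      by_cases hij : j = i
      · exact Or.inl hij.symm
      · right
        simp only [Finset.mem_filter, Finset.mem_univ, true_and] at hi ⊢
        rwa [ht _ (Cube.flip_ne x hij), ht x rfl] at hi
    cases hx : x j
    · refine (Finset.card_le_card (key l fun y hy => by simp [eval, hy, hx])).trans
        ((Finset.card_insert_le _ _).trans ?_)
      simp only [depth]; omega
    · refine (Finset.card_le_card (key r fun y hy => by simp [eval, hy, hx])).trans
        ((Finset.card_insert_le _ _).trans ?_)
      simp only [depth]; omega

/-- Remove the queries of the coordinate `i`, as if the answer were `b`. -/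
def restrict (i : Fin d) (b : Bool) : DecisionTree d V → DecisionTree d V
  | leaf v => leaf v
  | node j l r => if j = i then (if b then r.restrict i b else l.restrict i b)
      else node j (l.restrict i b) (r.restrict i b)

theorem eval_restrict (i : Fin d) (b : Bool) (T : DecisionTree d V) (x : Cube d) :
    (T.restrict i b).eval x = T.eval (Function.update x i b) := by
  induction T with
  | leaf v => rfl
  | node j l r ihl ihr =>
    simp only [restrict]
    by_cases hj : j = i
    · subst hj
      cases b <;> simp [eval, ihl, ihr]
    · simp [hj, eval, ihl, ihr]

theorem depth_restrict_le (i : Fin d) (b : Bool) (T : DecisionTree d V) :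
    (T.restrict i b).depth ≤ T.depth := by
  induction T with
  | leaf v => exact le_rfl
  | node j l r ihl ihr =>
    simp only [restrict]
    split_ifs
    · simp only [depth]; omega
    · simp only [depth]; omega
    · simp only [depth]; omega

/-- Sum of `φ` over the subcubes of the leaves. -/
def leafSum (φ : Subcube d → ℝ) : DecisionTree d V → Subcube d → ℝ
  | leaf _, S => φ S
  | node i l r, S => l.leafSum φ (S.fix i false) + r.leafSum φ (S.fix i true)

end DecisionTree

/-! ### The learner finds a good tree -/

namespace Est
variable {d : ℕ} {V : Type} (A K : ℕ) (f : Est d)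

/-- All queries of the tree are promising. -/
def Valid : ℕ → Subcube d → DecisionTree d V → Prop
  | _, _, .leaf _ => True
  | lev, S, .node i l r => f.Flagged A lev S i ∧ Valid (lev + 1) (S.fix i false) l ∧
      Valid (lev + 1) (S.fix i true) r

/-- Sum of the estimated influences of the queries. -/
def treeGain : ℕ → Subcube d → DecisionTree d V → ℕ
  | _, _, .leaf _ => 0
  | lev, S, .node i l r => f.gain lev S i + treeGain (lev + 1) (S.fix i false) l +
      treeGain (lev + 1) (S.fix i true) r

/-- Sum of the estimated masses of the leaves. -/
def treeMass : ℕ → Subcube d → DecisionTree d V → ℕ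
  | lev, S, .leaf _ => f lev S d
  | lev, S, .node i l r => treeMass (lev + 1) (S.fix i false) l +
      treeMass (lev + 1) (S.fix i true) r

/-- The labels of the leaves are the estimated masses and the levels. -/
def Labeled : ℕ → Subcube d → DecisionTree d (ℕ × ℕ) → Prop
  | lev, S, .leaf v => v = (f lev S d, lev)
  | lev, S, .node i l r => Labeled (lev + 1) (S.fix i false) l ∧ Labeled (lev + 1) (S.fix i true) r

/-- A plan whose data are correct. -/
structure Correct (lev : ℕ) (S : Subcube d) (P : Plan d) : Prop where
  gain : P.gain = f.treeGain lev S P.tree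
  mass : P.mass = f.treeMass lev S P.tree
  valid : f.Valid A lev S P.tree
  labeled : f.Labeled lev S P.tree

theorem correct_asLeaf (lev : ℕ) (S : Subcube d) : f.Correct A lev S (f.asLeaf lev S) :=
  ⟨rfl, rfl, trivial, rfl⟩

theorem correct_plan : ∀ k lev (S : Subcube d), f.Correct A lev S (f.plan A K k lev S)
  | 0, lev, S => f.correct_asLeaf A lev S
  | k + 1, lev, S => by
    have hl : ∀ i ∈ f.choices A K lev S, f.Flagged A lev S i := fun i hi => by
      simpa using (List.mem_filter.1 (List.mem_of_mem_take hi)).2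
    rw [plan]
    generalize f.choices A K lev S = L at hl
    induction L with
    | nil => exact f.correct_asLeaf A lev S
    | cons i l ih =>
      rw [List.foldr_cons, improve]
      split_ifs
      · have h1 := correct_plan k (lev + 1) (S.fix i false)
        have h2 := correct_plan k (lev + 1) (S.fix i true)
        exact ⟨by simp [treeGain, h1.gain, h2.gain], by simp [treeMass, h1.mass, h2.mass],
          ⟨hl i (by simp), h1.valid, h2.valid⟩, h1.labeled, h2.labeled⟩
      · exact ih fun j hj => hl j (by simp [hj])

variable {A K f}

/-- The plan is optimal, if no promising direction is dropped. -/
theorem treeGain_le_plan {ℓ : ℕ}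
    (hK : ∀ lev ≤ ℓ, ∀ S i, f.Flagged A lev S i → i ∈ f.choices A K lev S) :
    ∀ k lev (S : Subcube d) (t : DecisionTree d V), lev + k ≤ ℓ → f.Valid A lev S t →
      t.depth ≤ k → f.treeGain lev S t ≤ (f.plan A K k lev S).gain
  | _, _, _, .leaf _, _, _, _ => Nat.zero_le _
  | 0, _, _, .node _ _ _, _, _, ht => by simp [DecisionTree.depth] at ht
  | k + 1, lev, S, .node i l r, hk, hv, ht => by
    simp only [DecisionTree.depth] at ht
    have h1 := treeGain_le_plan hK k (lev + 1) (S.fix i false) l (by omega) hv.2.1 (by omega)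
    have h2 := treeGain_le_plan hK k (lev + 1) (S.fix i true) r (by omega) hv.2.2 (by omega)
    have hi := hK lev (by omega) S i hv.1
    rw [plan, treeGain]
    refine (Nat.add_le_add (Nat.add_le_add_left h1 _) h2).trans ?_
    generalize f.choices A K lev S = L at hi
    induction L with
    | nil => simp at hi
    | cons j l ih =>
      rw [List.foldr_cons, improve]
      rcases List.mem_cons.1 hi with rfl | hi
      · split_ifs with h
        · exact le_rfl
        · exact not_lt.1 h
      · have := ih hi
        split_ifs with h
        · exact this.trans h.le
        · exact this

end Est

/-- The rounded estimates are close to the true values, multiplied by `H`. -/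
structure Accurate {d : ℕ} (f : Est d) (H ℓ : ℕ) (w : Cube d → ℝ) (η : Fin d → Cube d → ℝ) :
    Prop where
  mass : ∀ lev ≤ ℓ, ∀ S : Subcube d, |(f lev S d : ℝ) - H * S.sum w| < 2
  mark : ∀ lev ≤ ℓ, ∀ (S : Subcube d) (i : Fin d), S i = none →
    |(f lev S i : ℝ) - H * ((S.sum w + S.sum (η i)) / 2)| < 2

/-! ### Consequences of accurate estimates. -/

section accurate
variable {d : ℕ} {V : Type} {f : Est d} {H ℓ A K : ℕ} {w : Cube d → ℝ} {η : Fin d → Cube d → ℝ}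

/-- Twice the error of a mark count plus the error of the mass, `2 * 2 + 2`. Truncated subtraction
does no harm because the quantity estimated is nonnegative. -/
theorem Accurate.gain (hf : Accurate f H ℓ w η) (hη : EdgeBound w η) {lev : ℕ} (hlev : lev ≤ ℓ)
    {S : Subcube d} {i : Fin d} (hi : S i = none) :
    |(f.gain lev S i : ℝ) - H * S.sum (η i)| < 6 := by
  have h1 := abs_lt.1 (hf.mass lev hlev S)
  have h2 := abs_lt.1 (hf.mark lev hlev S i hi)
  have h3 : 0 ≤ H * S.sum (η i) :=
    mul_nonneg (Nat.cast_nonneg _) (Subcube.sum_nonneg fun x _ => hη.nonneg i x)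
  rw [abs_lt, Est.gain]
  rcases le_total (f lev S d) (2 * f lev S i) with h | h
  · rw [Nat.cast_sub h]
    push_cast
    constructor <;> linarith
  · rw [Nat.sub_eq_zero_of_le h]
    have h4 : (2 * f lev S i : ℝ) ≤ f lev S d := by exact_mod_cast h
    push_cast
    constructor <;> linarith

/-- The margin `6 * A + 3` in `Flagged` exceeds `A` times the error of the gain plus the error of
the mass. -/
theorem Accurate.lt_of_flagged (hf : Accurate f H ℓ w η) (hη : EdgeBound w η) (hH : 0 < H)
    {lev : ℕ} (hlev : lev ≤ ℓ) {S : Subcube d} {i : Fin d} (hi : f.Flagged A lev S i) :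
    S.sum w < A * S.sum (η i) := by
  have h1 := abs_lt.1 (hf.mass lev hlev S)
  have h2 := abs_lt.1 (hf.gain hη hlev hi.1)
  have h3 : (f lev S d : ℝ) + (6 * A + 3) ≤ A * f.gain lev S i := by exact_mod_cast hi.2
  have h4 : (A : ℝ) * f.gain lev S i ≤ A * (H * S.sum (η i) + 6) :=
    mul_le_mul_of_nonneg_left (by linarith) (Nat.cast_nonneg _)
  have hH' : (0 : ℝ) < H := by exact_mod_cast hH
  have : H * S.sum w < H * (A * S.sum (η i)) := by linarith
  exact lt_of_mul_lt_mul_left this hH'.le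

/-- In the other direction the margin adds to the errors: `(6A + 3) + (6A + 2) = 12A + 5`. -/
theorem Accurate.le_of_not_flagged (hf : Accurate f H ℓ w η) (hη : EdgeBound w η)
    {lev : ℕ} (hlev : lev ≤ ℓ) {S : Subcube d} {i : Fin d} (hi : S i = none)
    (hi' : ¬ f.Flagged A lev S i) :
    A * (H * S.sum (η i)) ≤ H * S.sum w + (12 * A + 5) := by
  have h1 := abs_lt.1 (hf.mass lev hlev S)
  have h2 := abs_lt.1 (hf.gain hη hlev hi)
  have h3 : A * f.gain lev S i < f lev S d + (6 * A + 3) := by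
    by_contra h
    exact hi' ⟨hi, not_lt.1 h⟩
  have h3' : (A : ℝ) * f.gain lev S i < f lev S d + (6 * A + 3) := by exact_mod_cast h3
  have h4 : (A : ℝ) * (H * S.sum (η i) - 6) ≤ A * f.gain lev S i :=
    mul_le_mul_of_nonneg_left (by linarith) (Nat.cast_nonneg _)
  linarith

/-- Each promising direction has `A` times its influence above the mass of `S`, whereas all
influences together are at most `ℓ` times the mass, by sensitivity and comparison with the constant
`0`. So there are at most `ℓ * A ≤ K` promising directions, and truncation drops none. -/
theorem Accurate.mem_choices (hf : Accurate f H ℓ w η) (hη : EdgeBound w η) (hH : 0 < H)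
    (hs : Sensitivity w ℓ) (hw : ∀ x, 0 ≤ w x) (hK : ℓ * A ≤ K) (lev : ℕ) (hlev : lev ≤ ℓ)
    (S : Subcube d) (i : Fin d) (hi : f.Flagged A lev S i) : i ∈ f.choices A K lev S := by
  have hlen : ((List.finRange d).filter fun i => f.Flagged A lev S i).length ≤ K := by
    have hcard : ((List.finRange d).filter fun i => f.Flagged A lev S i).length =
        (Finset.univ.filter fun i => f.Flagged A lev S i).card := by
      rw [← List.toFinset_card_of_nodup ((List.nodup_finRange d).filter _)]
      congr 1
      ext j
      simp
    rw [hcard]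
    refine le_trans ?_ hK
    set F := Finset.univ.filter fun i => f.Flagged A lev S i with hF
    have hD : 0 ≤ S.sum w := Subcube.sum_nonneg fun x _ => hw x
    have h1 : F.card * S.sum w < ∑ j ∈ F, A * S.sum (η j) := by
      rw [← nsmul_eq_mul, ← Finset.sum_const]
      refine Finset.sum_lt_sum_of_nonempty ⟨i, by simp [hF, hi]⟩ fun j hj => ?_
      exact hf.lt_of_flagged hη hH hlev (by simpa [hF] using hj)
    have h2 : ∑ j ∈ F, A * S.sum (η j) ≤ A * totalInfluence η S := by
      rw [← Finset.mul_sum]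
      refine mul_le_mul_of_nonneg_left ?_ (Nat.cast_nonneg _)
      have h3 : ∑ j ∈ F, S.sum (η j) = ∑ j ∈ F, if S j = none then S.sum (η j) else 0 :=
        Finset.sum_congr rfl fun j hj => by
          have : f.Flagged A lev S j := by simpa [hF] using hj
          rw [if_pos this.1]
      rw [h3]
      refine Finset.sum_le_univ_sum_of_nonneg fun j => ?_
      split_ifs
      · exact Subcube.sum_nonneg fun x _ => hη.nonneg j x
      · exact le_rfl
    have h4 : totalInfluence η S ≤ ℓ * S.sum w := by
      have := hs.totalInfluence_le S 0
      simp only [sub_zero, abs_of_nonneg (hw _)] at this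
      exact (totalInfluence_mono hη.le S).trans this
    have h5 : (F.card : ℝ) * S.sum w < (ℓ * A : ℕ) * S.sum w := by
      push_cast
      have := mul_le_mul_of_nonneg_left h4 (Nat.cast_nonneg A : (0 : ℝ) ≤ A)
      linarith
    have := lt_of_mul_lt_mul_right h5 hD
    exact_mod_cast this.le
  rw [Est.choices, List.take_of_length_le hlen]
  simpa using hi

/-- The influences of the queries telescope, and each of the at most `2 ^ k - 1` inner nodes
contributes an error of at most `6`. -/
theorem Accurate.treeGain (hf : Accurate f H ℓ w η) (hη : EdgeBound w η) :
    ∀ k lev (S : Subcube d) (t : DecisionTree d V), lev + k ≤ ℓ → f.Valid A lev S t →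
      t.depth ≤ k → |(f.treeGain lev S t : ℝ) -
        H * (totalInfluence η S - t.leafSum (totalInfluence η) S)| ≤ 6 * (2 ^ k - 1)
  | k, lev, S, .leaf _, _, _, _ => by
    have : (1 : ℝ) ≤ 2 ^ k := one_le_pow₀ (by norm_num)
    simp [Est.treeGain, DecisionTree.leafSum, this]
  | 0, _, _, .node _ _ _, _, _, ht => by simp [DecisionTree.depth] at ht
  | k + 1, lev, S, .node i l r, hk, hv, ht => by
    simp only [DecisionTree.depth] at ht
    have h1 := abs_le.1
      (hf.treeGain hη k (lev + 1) (S.fix i false) l (by omega) hv.2.1 (by omega))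
    have h2 := abs_le.1
      (hf.treeGain hη k (lev + 1) (S.fix i true) r (by omega) hv.2.2 (by omega))
    have h3 := abs_lt.1 (hf.gain hη (lev := lev) (by omega) hv.1.1)
    rw [totalInfluence_split η hv.1.1]
    simp only [Est.treeGain, DecisionTree.leafSum]
    push_cast
    rw [pow_succ, abs_le]
    constructor <;> nlinarith

/-- There are at most `2 ^ k` leaves, each with an error of at most `2`. -/
theorem Accurate.treeMass (hf : Accurate f H ℓ w η) :
    ∀ k lev (S : Subcube d) (t : DecisionTree d V), lev + k ≤ ℓ → f.Valid A lev S t →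
      t.depth ≤ k → |(f.treeMass lev S t : ℝ) - H * S.sum w| ≤ 2 * 2 ^ k
  | k, lev, S, .leaf _, hk, _, _ => by
    have : (1 : ℝ) ≤ 2 ^ k := one_le_pow₀ (by norm_num)
    have := hf.mass lev (by omega) S
    simp only [Est.treeMass]
    linarith
  | 0, _, _, .node _ _ _, _, _, ht => by simp [DecisionTree.depth] at ht
  | k + 1, lev, S, .node i l r, hk, hv, ht => by
    simp only [DecisionTree.depth] at ht
    have h1 := abs_le.1 (hf.treeMass k (lev + 1) (S.fix i false) l (by omega) hv.2.1 (by omega))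
    have h2 := abs_le.1 (hf.treeMass k (lev + 1) (S.fix i true) r (by omega) hv.2.2 (by omega))
    rw [Subcube.sum_fix hv.1.1]
    simp only [Est.treeMass]
    push_cast
    rw [pow_succ, abs_le]
    constructor <;> nlinarith

/-- Queries of directions that are not promising can be removed. -/
theorem exists_valid_tree (hs : Sensitivity w ℓ) (hle : ∀ i x, η i x ≤ halfDiff w i x)
    (hw : ∀ x, 0 ≤ w x) {τ γ : ℝ} (hτ : 0 ≤ τ) (hγ : 0 ≤ γ)
    (hu : ∀ lev ≤ ℓ, ∀ (S : Subcube d) (i : Fin d), S i = none → ¬ f.Flagged A lev S i →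
      S.sum (halfDiff w i) ≤ τ * S.sum w + γ) :
    ∀ k lev (S : Subcube d) (T : DecisionTree d ℝ), lev + k ≤ ℓ → T.depth ≤ k →
      ∃ t : DecisionTree d Unit, f.Valid A lev S t ∧ t.depth ≤ k ∧
        t.leafSum (totalInfluence η) S ≤
          ℓ * ((S.sum fun x => |w x - T.eval x|) + k * τ * S.sum w + (2 ^ k - 1) * γ)
  | k, lev, S, .leaf v, hk, _ => by
    refine ⟨.leaf (), trivial, Nat.zero_le _, ?_⟩
    refine ((totalInfluence_mono hle S).trans (hs.totalInfluence_le S v)).trans ?_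
    refine mul_le_mul_of_nonneg_left ?_ (Nat.cast_nonneg _)
    have h1 : (1 : ℝ) ≤ 2 ^ k := one_le_pow₀ (by norm_num)
    have h2 : 0 ≤ S.sum w := Subcube.sum_nonneg fun x _ => hw x
    have h3 : 0 ≤ k * τ * S.sum w := by positivity
    have h4 : 0 ≤ (2 ^ k - 1) * γ := mul_nonneg (by linarith) hγ
    simp only [DecisionTree.eval]
    linarith
  | 0, _, _, .node _ _ _, _, ht => by simp [DecisionTree.depth] at ht
  | k + 1, lev, S, .node i l r, hk, ht => by
    simp only [DecisionTree.depth] at ht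
    have hpow : (1 : ℝ) ≤ 2 ^ k := one_le_pow₀ (by norm_num)
    have hD : 0 ≤ S.sum w := Subcube.sum_nonneg fun x _ => hw x
    have hℓ : (0 : ℝ) ≤ ℓ := Nat.cast_nonneg _
    have evl : ∀ x : Cube d, x i = false → (DecisionTree.node i l r).eval x = l.eval x :=
      fun x hx => by simp [DecisionTree.eval, hx]
    have evr : ∀ x : Cube d, x i = true → (DecisionTree.node i l r).eval x = r.eval x :=
      fun x hx => by simp [DecisionTree.eval, hx]
    -- it suffices to replace the tree by one of smaller depth
    have reduce : ∀ T' : DecisionTree d ℝ, T'.depth ≤ k → ((S.sum fun x => |w x - T'.eval x|) ≤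
        (S.sum fun x => |w x - (DecisionTree.node i l r).eval x|) + (τ * S.sum w + γ)) →
        ∃ t : DecisionTree d Unit, f.Valid A lev S t ∧ t.depth ≤ k + 1 ∧
        t.leafSum (totalInfluence η) S ≤
          ℓ * ((S.sum fun x => |w x - (DecisionTree.node i l r).eval x|) +
            (k + 1 : ℕ) * τ * S.sum w + (2 ^ (k + 1) - 1) * γ) := by
      intro T' hT' herr
      obtain ⟨t, h1, h2, h3⟩ := exists_valid_tree hs hle hw hτ hγ hu k lev S T' (by omega) hT'
      refine ⟨t, h1, by omega, h3.trans (mul_le_mul_of_nonneg_left ?_ hℓ)⟩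
      push_cast
      rw [pow_succ]
      nlinarith [mul_nonneg (sub_nonneg.2 hpow) hγ]
    -- A query of a coordinate already fixed by `S` can be skipped without any error.
    cases hSi : S i with
    | some b =>
      have hx : ∀ x ∈ S.points, x i = b := fun x hx => hx i b hSi
      have h0 : 0 ≤ τ * S.sum w + γ := by positivity
      cases b
      · refine reduce l (by omega) ?_
        rw [Subcube.sum_congr fun x hxS => by rw [← evl x (hx x hxS)]]
        linarith
      · refine reduce r (by omega) ?_
        rw [Subcube.sum_congr fun x hxS => by rw [← evr x (hx x hxS)]]
        linarith
    | none =>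
      by_cases hfl : f.Flagged A lev S i
      · obtain ⟨t, h1, h2, h3⟩ := exists_valid_tree hs hle hw hτ hγ hu k (lev + 1) (S.fix i false) l
          (by omega) (by omega)
        obtain ⟨t', h1', h2', h3'⟩ := exists_valid_tree hs hle hw hτ hγ hu k (lev + 1)
          (S.fix i true) r (by omega) (by omega)
        refine ⟨.node i t t', ⟨hfl, h1, h1'⟩, by simp only [DecisionTree.depth]; omega, ?_⟩
        simp only [DecisionTree.leafSum]
        refine (add_le_add h3 h3').trans ?_
        rw [Subcube.sum_fix hSi (fun x => |w x - _|), Subcube.sum_fix hSi w]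
        have e1 : ((S.fix i false).sum fun x => |w x - (DecisionTree.node i l r).eval x|) =
            (S.fix i false).sum fun x => |w x - l.eval x| :=
          Subcube.sum_congr fun x hx => by rw [evl x ((Subcube.mem_fix hSi _ x).1 hx).2]
        have e2 : ((S.fix i true).sum fun x => |w x - (DecisionTree.node i l r).eval x|) =
            (S.fix i true).sum fun x => |w x - r.eval x| :=
          Subcube.sum_congr fun x hx => by rw [evr x ((Subcube.mem_fix hSi _ x).1 hx).2]
        rw [e1, e2, ← mul_add]
        refine mul_le_mul_of_nonneg_left ?_ hℓ
        rw [Subcube.sum_fix hSi w] at hD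
        push_cast
        rw [pow_succ]
        nlinarith [mul_nonneg hτ hD]
      · have hδ := hu lev (by omega) S i hSi hfl
        -- the error after restricting to one of the halves
        have key : ∀ (b : Bool) (c : DecisionTree d ℝ),
            (∀ x : Cube d, x i = b → (DecisionTree.node i l r).eval x = c.eval x) →
            (S.sum fun x => |w x - (c.restrict i b).eval x|) ≤
              2 * ((S.fix i b).sum fun x => |w x - (DecisionTree.node i l r).eval x|) +
                S.sum (halfDiff w i) := by
          intro b c hc
          have split : ∀ g : Cube d → ℝ, S.sum g = (S.fix i b).sum g + (S.fix i (!b)).sum g := by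
            intro g
            rw [Subcube.sum_fix hSi]
            cases b
            · rfl
            · rw [add_comm]; rfl
          rw [split]
          have e1 : ((S.fix i b).sum fun x => |w x - (c.restrict i b).eval x|) =
              (S.fix i b).sum fun x => |w x - (DecisionTree.node i l r).eval x| := by
            refine Subcube.sum_congr fun x hx => ?_
            have hxb := ((Subcube.mem_fix hSi _ x).1 hx).2
            rw [DecisionTree.eval_restrict, hc x hxb, ← hxb, Function.update_eq_self]
          -- On the discarded half the restricted tree answers as at the neighbour across `i`. So
          -- the error at the neighbour and the difference along the edge bound the error here.
          have e2 : ((S.fix i (!b)).sum fun x => |w x - (c.restrict i b).eval x|) ≤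
              ((S.fix i b).sum fun x => |w x - (DecisionTree.node i l r).eval x|) +
                S.sum (halfDiff w i) := by
            rw [← sum_halfDiff_fix w hSi (!b)]
            have := Subcube.sum_fix_flip hSi (!b)
              (fun x => |w x - (DecisionTree.node i l r).eval x|)
            rw [Bool.not_not] at this
            rw [← this, ← Subcube.sum_add]
            refine Subcube.sum_mono fun x hx => ?_
            have hxb : Cube.flip x i i = b := by
              rw [Cube.flip_same, ((Subcube.mem_fix hSi _ x).1 hx).2, Bool.not_not]
            have hup : Function.update x i b = Cube.flip x i := by
              rw [← hxb, Cube.flip_same]; rfl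
            rw [DecisionTree.eval_restrict, hup, ← hc _ hxb]
            have := abs_sub_le (w x) (w (Cube.flip x i))
              ((DecisionTree.node i l r).eval (Cube.flip x i))
            linarith
          linarith
        have k0 := key false l evl
        have k1 := key true r evr
        have hsp := Subcube.sum_fix hSi fun x => |w x - (DecisionTree.node i l r).eval x|
        -- The half with the smaller error is extended to the other one: twice the smaller error is
        -- at most the whole, and only the influence of `i` is lost.
        rcases le_total ((S.fix i false).sum fun x => |w x - (DecisionTree.node i l r).eval x|)
          ((S.fix i true).sum fun x => |w x - (DecisionTree.node i l r).eval x|) with h | h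
        · refine reduce (l.restrict i false) ((l.depth_restrict_le i false).trans (by omega)) ?_
          linarith
        · refine reduce (r.restrict i true) ((r.depth_restrict_le i true).trans (by omega)) ?_
          linarith

/-- The probability that stands for a leaf label, if the total mass is `q`. -/
noncomputable def labelValue (d q : ℕ) (v : ℕ × ℕ) : ℝ := (v.1 : ℝ) / (q * 2 ^ (d - v.2) : ℕ)

/-- A valid tree queries only free coordinates, so a leaf at level `lev` has `2 ^ (d - lev)` points
and receives exactly its estimated mass over `q`. Taking `q` to be the total estimated mass makes
the output an exact distribution. -/
theorem sum_labelValue {q : ℕ} :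
    ∀ lev (S : Subcube d) (t : DecisionTree d (ℕ × ℕ)), f.Valid A lev S t → f.Labeled lev S t →
      S.free + lev = d → (S.sum fun x => labelValue d q (t.eval x)) = f.treeMass lev S t / q
  | lev, S, .leaf v, _, hl, hS => by
    simp only [Est.Labeled] at hl
    subst hl
    have : d - lev = S.free := by omega
    simp only [DecisionTree.eval, labelValue, Est.treeMass, this]
    rw [Subcube.sum_const, Subcube.sum_one]
    push_cast
    field_simp
  | lev, S, .node i l r, hv, hl, hS => by
    have hi := hv.1.1
    have h1 := sum_labelValue (q := q) (lev + 1) (S.fix i false) l hv.2.1 hl.1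
      (by have := Subcube.free_fix hi false; omega)
    have h2 := sum_labelValue (q := q) (lev + 1) (S.fix i true) r hv.2.2 hl.2
      (by have := Subcube.free_fix hi true; omega)
    rw [Subcube.sum_fix hi]
    simp only [Est.treeMass]
    push_cast
    rw [add_div, ← h1, ← h2]
    congr 1
    · exact Subcube.sum_congr fun x hx => by
        simp [DecisionTree.eval, ((Subcube.mem_fix hi _ x).1 hx).2]
    · exact Subcube.sum_congr fun x hx => by
        simp [DecisionTree.eval, ((Subcube.mem_fix hi _ x).1 hx).2]

/-- On a leaf, the deviation from the mean is at most the total influence, which `EdgeBound`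
expresses through `η` and the mass. The mean differs from the label by `|q w(S) - f| / q`, and
inserting `H w(S)` separates the normalization error from the estimation error. The terms add up
over the tree. -/
theorem Accurate.sum_abs_sub_labelValue_le (hf : Accurate f H ℓ w η) (hη : EdgeBound w η)
    (hs : Sensitivity w ℓ) (hw : ∀ x, 0 ≤ w x) {μ : ℝ} (hμ : 0 < μ) {q : ℕ} (hq : 0 < q) :
    ∀ k lev (S : Subcube d) (t : DecisionTree d (ℕ × ℕ)), lev + k ≤ ℓ → t.depth ≤ k →
      f.Valid A lev S t → f.Labeled lev S t → S.free + lev = d →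
      (S.sum fun x => |w x - labelValue d q (t.eval x)|) ≤
        μ / 2 * t.leafSum (totalInfluence η) S +
          (ℓ / (2 * μ) + |(q : ℝ) - H| / q) * S.sum w + 2 ^ k * (2 / q)
  | k, lev, S, .leaf v, hk, _, _, hl, hS => by
    simp only [Est.Labeled] at hl
    subst hl
    have hq' : (0 : ℝ) < q := by exact_mod_cast hq
    have hD : 0 ≤ S.sum w := Subcube.sum_nonneg fun x _ => hw x
    have hfr : d - lev = S.free := by omega
    have hc := S.sum_one
    have hcp := S.sum_one_pos
    set c := S.sum fun _ => 1 with hcdef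
    have hpow : (1 : ℝ) ≤ 2 ^ k := one_le_pow₀ (by norm_num)
    simp only [DecisionTree.eval, labelValue, DecisionTree.leafSum, hfr]
    push_cast
    rw [← hc]
    have h1 : (S.sum fun x => |w x - f lev S d / (q * c)|) ≤
        (S.sum fun x => |w x - S.sum w / c|) + |S.sum w / c - f lev S d / (q * c)| * c := by
      have hconst := S.sum_const |S.sum w / c - f lev S d / (q * c)|
      rw [← hcdef] at hconst
      rw [← hconst, ← Subcube.sum_add]
      exact Subcube.sum_mono fun x _ => abs_sub_le _ _ _
    have h2 : |S.sum w / c - f lev S d / (q * c)| * c = |q * S.sum w - f lev S d| / q := by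
      rw [show S.sum w / c - f lev S d / (q * c) = (q * S.sum w - f lev S d) / (q * c) by
        field_simp, abs_div, abs_of_pos (mul_pos hq' hcp)]
      field_simp
    have h3 : |q * S.sum w - f lev S d| / q ≤ |(q : ℝ) - H| / q * S.sum w + 2 / q := by
      rw [div_mul_eq_mul_div, ← add_div]
      refine div_le_div_of_nonneg_right ?_ hq'.le
      have h4 := (hf.mass lev (by omega) S).le
      have h5 := abs_sub_le (q * S.sum w) (H * S.sum w) (f lev S d)
      rw [← sub_mul, abs_mul, abs_of_nonneg hD, abs_sub_comm (H * S.sum w)] at h5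
      linarith
    have h6 := (sum_abs_sub_mean_le w S).trans (hη.totalInfluence_le hw hs hμ S)
    have h7 : 2 / (q : ℝ) ≤ 2 ^ k * (2 / q) := le_mul_of_one_le_left (by positivity) hpow
    rw [← hcdef] at h6
    rw [h2] at h1
    linarith
  | 0, _, _, .node _ _ _, _, ht, _, _, _ => by simp [DecisionTree.depth] at ht
  | k + 1, lev, S, .node i l r, hk, ht, hv, hl, hS => by
    simp only [DecisionTree.depth] at ht
    have hi := hv.1.1
    have h1 := hf.sum_abs_sub_labelValue_le hη hs hw hμ hq k (lev + 1) (S.fix i false) l (by omega)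
      (by omega) hv.2.1 hl.1 (by have := Subcube.free_fix hi false; omega)
    have h2 := hf.sum_abs_sub_labelValue_le hη hs hw hμ hq k (lev + 1) (S.fix i true) r (by omega)
      (by omega) hv.2.2 hl.2 (by have := Subcube.free_fix hi true; omega)
    rw [Subcube.sum_fix hi, Subcube.sum_fix hi w]
    simp only [DecisionTree.leafSum]
    have e1 : ((S.fix i false).sum fun x =>
        |w x - labelValue d q ((DecisionTree.node i l r).eval x)|) =
        (S.fix i false).sum fun x => |w x - labelValue d q (l.eval x)| :=
      Subcube.sum_congr fun x hx => by
        simp [DecisionTree.eval, ((Subcube.mem_fix hi _ x).1 hx).2]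
    have e2 : ((S.fix i true).sum fun x =>
        |w x - labelValue d q ((DecisionTree.node i l r).eval x)|) =
        (S.fix i true).sum fun x => |w x - labelValue d q (r.eval x)| :=
      Subcube.sum_congr fun x hx => by
        simp [DecisionTree.eval, ((Subcube.mem_fix hi _ x).1 hx).2]
    rw [e1, e2, pow_succ]
    linarith

end accurate

/-- The output tree for a tree with leaf labels `(mass, level)`, if the total mass is `q`. -/
def outputTree {d q : ℕ} (hq : 0 < q) : DecisionTree d (ℕ × ℕ) → DecisionTree d (ℕ × ℕ+)
  | .leaf v => .leaf (v.1, ⟨q * 2 ^ (d - v.2), by positivity⟩)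
  | .node i l r => .node i (outputTree hq l) (outputTree hq r)

theorem outputWord_eq {d q : ℕ} (hq : 0 < q) (t : DecisionTree d (ℕ × ℕ)) :
    outputWord q t = (outputTree hq t).encode := by
  induction t with
  | leaf v => rfl
  | node i l r ihl ihr => simp [outputWord, outputTree, DecisionTree.encode, ihl, ihr]

theorem depth_outputTree {d q : ℕ} (hq : 0 < q) (t : DecisionTree d (ℕ × ℕ)) :
    (outputTree hq t).depth = t.depth := by
  induction t with
  | leaf v => rfl
  | node i l r ihl ihr => simp [outputTree, DecisionTree.depth, ihl, ihr]

theorem eval_outputTree {d q : ℕ} (hq : 0 < q) (t : DecisionTree d (ℕ × ℕ)) (x : Cube d) :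
    (((outputTree hq t).eval x).1 : ℝ) / ((((outputTree hq t).eval x).2 : ℕ) : ℝ) =
      labelValue d q (t.eval x) := by
  induction t with
  | leaf v => rfl
  | node i l r ihl ihr =>
    simp only [outputTree, DecisionTree.eval]
    split_ifs
    · exact ihr
    · exact ihl

/-- The probability mass function as a real-valued function. -/
noncomputable def prob {d : ℕ} (D : PMF (Cube d)) (x : Cube d) : ℝ := (D x).toReal

theorem prob_nonneg {d : ℕ} (D : PMF (Cube d)) (x : Cube d) : 0 ≤ prob D x := ENNReal.toReal_nonneg

theorem Subcube.sum_univ {d : ℕ} (g : Cube d → ℝ) : sum (fun _ => none) g = ∑ x, g x := by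
  simp [sum, points]

theorem sum_prob {d : ℕ} (D : PMF (Cube d)) : ∑ x, prob D x = 1 := by
  simp only [prob]
  rw [← ENNReal.toReal_sum fun x _ => D.apply_ne_top x]
  have := D.tsum_coe
  rw [tsum_fintype] at this
  simp [this]

theorem Representable.sensitivity {d ℓ : ℕ} {D : PMF (Cube d)} (h : Representable D ℓ) :
    Sensitivity (prob D) ℓ := by
  classical
  obtain ⟨T, hT, hc⟩ := h
  have : prob D = T.eval := funext hc
  intro x
  rw [this]
  exact (T.sensitivity x).trans hT

/-! ### From accurate estimates to small total variation. -/

section final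
variable {d : ℕ} {D : PMF (Cube d)} {f : Est d} {ℓ a : ℕ} {η : Fin d → Cube d → ℝ}

/-- Here `A = p ^ 6`, and the choice `μ = p ^ 3` in `EdgeBound.sum_halfDiff_le` balances its two
terms: both masses come with `1 / (2 p ^ 3)`. The rest uses `12A + 5 ≤ 17A`. -/
theorem halfDiff_le_of_not_flagged (ha : 1 ≤ a) (hη : EdgeBound (prob D) η)
    (hf : Accurate f (resolution ℓ a) ℓ (prob D) η) {lev : ℕ} (hlev : lev ≤ ℓ) {S : Subcube d}
    {i : Fin d} (hi : S i = none) (hi' : ¬ f.Flagged (scale ℓ a ^ 6) lev S i) :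
    S.sum (halfDiff (prob D) i) ≤ 1 / (scale ℓ a : ℝ) ^ 3 * S.sum (prob D) +
      9 * (scale ℓ a : ℝ) ^ 3 / resolution ℓ a := by
  have hp : (1 : ℝ) ≤ scale ℓ a := by exact_mod_cast Nat.mul_pos (Nat.succ_pos ℓ) ha
  have h1 := hf.le_of_not_flagged hη hlev hi hi'
  have h2 := hη.sum_halfDiff_le (prob_nonneg D) (μ := (scale ℓ a : ℝ) ^ 3) (by positivity) hi
  have hH : (0 : ℝ) < resolution ℓ a := by
    simp only [resolution]; push_cast; positivity
  set p := ((scale ℓ a : ℕ) : ℝ)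
  set H := ((resolution ℓ a : ℕ) : ℝ)
  set I := S.sum (η i)
  set m := S.sum (prob D)
  push_cast at h1
  have hp6 : 1 ≤ p ^ 6 := one_le_pow₀ hp
  have h3 : p ^ 3 / 2 * I ≤ m / (2 * p ^ 3) + 17 / 2 * p ^ 3 / H := by
    have e : p ^ 3 / 2 * I = (p ^ 6 * (H * I)) / (2 * p ^ 3 * H) := by field_simp
    have e2 : m / (2 * p ^ 3) + 17 / 2 * p ^ 3 / H = (H * m + 17 * p ^ 6) / (2 * p ^ 3 * H) := by
      field_simp
    rw [e, e2]
    refine div_le_div_of_nonneg_right ?_ (by positivity)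
    linarith
  have h4 : 17 / 2 * p ^ 3 / H ≤ 9 * p ^ 3 / H :=
    div_le_div_of_nonneg_right (by nlinarith [pow_pos (by linarith : 0 < p) 3]) hH.le
  have h5 : 1 / p ^ 3 * m = m / (2 * p ^ 3) + m / (2 * p ^ 3) := by field_simp; ring
  linarith

/-- If the estimates are accurate, the leaves of the tree that is found have small influence. -/
theorem Accurate.leafSum_le (ha1 : 1 ≤ a) (hD : Representable D ℓ)
    (hη : EdgeBound (prob D) η) (hf : Accurate f (resolution ℓ a) ℓ (prob D) η)
    {P : Plan d} (hP : P = f.plan (scale ℓ a ^ 6) (fanOut ℓ a) ℓ 0 fun _ => none) :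
    (scale ℓ a : ℝ) / 2 * P.tree.leafSum (totalInfluence η) (fun _ => none) ≤ 1 / (2 * a) := by
  have ha0 : (0 : ℝ) < a := by exact_mod_cast ha1
  have hs := hD.sensitivity
  have hw := prob_nonneg D
  have hroot : Subcube.sum (fun _ => none) (prob D) = 1 := by rw [Subcube.sum_univ, sum_prob]
  have hpnat : 1 ≤ scale ℓ a := Nat.mul_pos (Nat.succ_pos ℓ) ha1
  have hp : (1 : ℝ) ≤ scale ℓ a := by exact_mod_cast hpnat
  have hHdef : (resolution ℓ a : ℝ) = 32 * 2 ^ ℓ * (scale ℓ a : ℝ) ^ 6 := by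
    simp only [resolution]; push_cast; ring
  have hpa : (scale ℓ a : ℝ) = (ℓ + 1) * a := by simp only [scale]; push_cast; ring
  have hH0 : 0 < resolution ℓ a := by simp only [resolution]; positivity
  have hC := f.correct_plan (scale ℓ a ^ 6) (fanOut ℓ a) ℓ 0 fun _ => none
  have hdep := f.depth_plan_le (scale ℓ a ^ 6) (fanOut ℓ a) ℓ 0 fun _ => none
  -- The fan-out is `p ^ 7`, so `ℓ * A ≤ K` amounts to `ℓ ≤ p`, which holds for `p = (ℓ + 1) * a`.
  have hK := hf.mem_choices hη hH0 hs hw (A := scale ℓ a ^ 6) (K := fanOut ℓ a) (by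
    rw [fanOut, pow_succ (scale ℓ a) 6, mul_comm]
    refine Nat.mul_le_mul_left _ ?_
    rw [scale]; nlinarith)
  have hopt := fun t => Est.treeGain_le_plan (V := Unit) hK ℓ 0 (fun _ => none) t (by omega)
  rw [← hP] at hC hdep hopt
  set S0 : Subcube d := fun _ => none with hS0
  set p := ((scale ℓ a : ℕ) : ℝ) with hpdef
  set H := resolution ℓ a with hHn
  have hHr : (0 : ℝ) < H := by exact_mod_cast hH0
  have hp6 : 1 ≤ p ^ 6 := one_le_pow₀ hp
  have hp3 : 1 ≤ p ^ 3 := one_le_pow₀ hp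
  -- the optimal plan has small leaf sum
  obtain ⟨T, hT, hc⟩ := hD
  obtain ⟨t, ht1, ht2, ht3⟩ := exists_valid_tree (f := f) (A := scale ℓ a ^ 6) hs hη.le hw
    (τ := 1 / p ^ 3) (γ := 9 * p ^ 3 / H) (by positivity) (by positivity)
    (fun lev hlev S i hi hi' => halfDiff_le_of_not_flagged ha1 hη hf hlev hi hi') ℓ 0 S0 T
    (by omega) hT
  have herr : (S0.sum fun x => |prob D x - T.eval x|) = 0 := by
    rw [hS0, Subcube.sum_univ]
    refine Finset.sum_eq_zero fun x _ => ?_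
    have : prob D x = T.eval x := hc x
    simp [this]
  rw [herr, hroot, mul_one, zero_add] at ht3
  have g1 := (abs_le.1 (hf.treeGain hη ℓ 0 S0 t (by omega) ht1 ht2)).1
  have g2 := (abs_le.1 (hf.treeGain hη ℓ 0 S0 P.tree (by omega) hC.valid hdep)).2
  have g3 : (f.treeGain 0 S0 t : ℝ) ≤ f.treeGain 0 S0 P.tree := by
    have := hopt t ht1 ht2
    rw [hC.gain] at this
    exact_mod_cast this
  set L := P.tree.leafSum (totalInfluence η) S0
  set L' := t.leafSum (totalInfluence η) S0
  have hHL : H * L ≤ H * L' + 12 * 2 ^ ℓ := by nlinarith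
  -- The factor `2 ^ ℓ` in the resolution is there to cancel the accumulated error, which is
  -- proportional to the number of nodes.
  have hH2 : (2 : ℝ) ^ ℓ = H / (32 * p ^ 6) := by rw [hHdef]; field_simp
  have hL : L ≤ L' + 12 / (32 * p ^ 6) := by
    rw [hH2] at hHL
    have : H * L ≤ H * (L' + 12 / (32 * p ^ 6)) := by
      rw [mul_add]; refine hHL.trans (le_of_eq ?_); field_simp
    exact le_of_mul_le_mul_left this hHr
  have hL' : L' ≤ ℓ * (ℓ / p ^ 3 + 9 / (32 * p ^ 3)) := by
    refine ht3.trans (mul_le_mul_of_nonneg_left (add_le_add (le_of_eq (by ring)) ?_)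
      (Nat.cast_nonneg _))
    calc ((2 : ℝ) ^ ℓ - 1) * (9 * p ^ 3 / H) ≤ 2 ^ ℓ * (9 * p ^ 3 / H) :=
          mul_le_mul_of_nonneg_right (by linarith) (by positivity)
      _ = 9 / (32 * p ^ 3) := by rw [hH2]; field_simp
  have h1 : L ≤ (ℓ + 1) ^ 2 / p ^ 3 := by
    have h2 : 12 / (32 * p ^ 6) ≤ 12 / (32 * p ^ 3) :=
      div_le_div_of_nonneg_left (by norm_num) (by positivity) (by nlinarith)
    have h3 : (ℓ : ℝ) * (ℓ / p ^ 3 + 9 / (32 * p ^ 3)) + 12 / (32 * p ^ 3) =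
        ((ℓ : ℝ) ^ 2 + ℓ * (9 / 32) + 12 / 32) / p ^ 3 := by field_simp
    have h4 : ((ℓ : ℝ) ^ 2 + ℓ * (9 / 32) + 12 / 32) / p ^ 3 ≤ (ℓ + 1) ^ 2 / p ^ 3 :=
      div_le_div_of_nonneg_right (by nlinarith [(Nat.cast_nonneg ℓ : (0 : ℝ) ≤ ℓ)])
        (by positivity)
    linarith
  -- Substituting `p = (ℓ + 1) * a` removes the dependence on `ℓ`.
  calc p / 2 * L ≤ p / 2 * ((ℓ + 1) ^ 2 / p ^ 3) :=
        mul_le_mul_of_nonneg_left h1 (by positivity)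
    _ = (ℓ + 1) ^ 2 / (2 * p ^ 2) := by field_simp
    _ = 1 / (2 * a ^ 2) := by rw [hpa]; field_simp
    _ ≤ 1 / (2 * a) := by
        refine div_le_div_of_nonneg_left (by norm_num) (by positivity) ?_
        have : (1 : ℝ) ≤ a := by exact_mod_cast ha1
        nlinarith

/-- If the estimates are accurate, then the output is good. -/
theorem Accurate.goodOutput {α : ℝ} (hα : 0 < α) (ha : 1 / α ≤ a) (hD : Representable D ℓ)
    (hη : EdgeBound (prob D) η) (hf : Accurate f (resolution ℓ a) ℓ (prob D) η)
    {P : Plan d} (hP : P = f.plan (scale ℓ a ^ 6) (fanOut ℓ a) ℓ 0 fun _ => none) :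
    GoodOutput D ℓ α (outputWord P.mass P.tree) := by
  have ha0 : (0 : ℝ) < a := lt_of_lt_of_le (by positivity) ha
  have ha1 : 1 ≤ a := by exact_mod_cast ha0
  have hs := hD.sensitivity
  have hw := prob_nonneg D
  have hroot : Subcube.sum (fun _ => none) (prob D) = 1 := by rw [Subcube.sum_univ, sum_prob]
  have hfree : Subcube.free (fun _ : Fin d => none) + 0 = d := by simp [Subcube.free]
  have hpnat : 1 ≤ scale ℓ a := Nat.mul_pos (Nat.succ_pos ℓ) ha1
  have hp : (1 : ℝ) ≤ scale ℓ a := by exact_mod_cast hpnat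
  have hHdef : (resolution ℓ a : ℝ) = 32 * 2 ^ ℓ * (scale ℓ a : ℝ) ^ 6 := by
    simp only [resolution]; push_cast; ring
  have hpa : (scale ℓ a : ℝ) = (ℓ + 1) * a := by simp only [scale]; push_cast; ring
  have hH0 : 0 < resolution ℓ a := by simp only [resolution]; positivity
  have hC := f.correct_plan (scale ℓ a ^ 6) (fanOut ℓ a) ℓ 0 fun _ => none
  have hdep := f.depth_plan_le (scale ℓ a ^ 6) (fanOut ℓ a) ℓ 0 fun _ => none
  have hLp := hf.leafSum_le ha1 hD hη hP
  rw [← hP] at hC hdep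
  clear hP
  set S0 : Subcube d := fun _ => none with hS0
  set p := ((scale ℓ a : ℕ) : ℝ) with hpdef
  set H := resolution ℓ a with hHn
  have hHr : (0 : ℝ) < H := by exact_mod_cast hH0
  have hp6 : 1 ≤ p ^ 6 := one_le_pow₀ hp
  have htwo : (0 : ℝ) < 2 ^ ℓ := by positivity
  have hℓp : (ℓ : ℝ) / (2 * p) ≤ 1 / (2 * a) := by
    rw [hpa, div_le_div_iff₀ (by positivity) (by positivity)]
    nlinarith
  -- the total mass
  have hm := hf.treeMass ℓ 0 S0 P.tree (by omega) hC.valid hdep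
  rw [← hC.mass, hroot, mul_one] at hm
  set q := P.mass with hq
  -- The true total mass is `1`, so the estimated one deviates from `H` by at most `2 * 2 ^ ℓ`,
  -- which is at most `H / 16`.
  have hqH : (30 / 32 : ℝ) * H ≤ q := by
    have h1 := (abs_le.1 hm).1
    have h2 : 2 * (2 : ℝ) ^ ℓ ≤ 2 / 32 * H := by rw [hHdef]; nlinarith [mul_le_mul_of_nonneg_left hp6 htwo.le]
    linarith
  have hq0 : 0 < q := by
    have : (0 : ℝ) < q := lt_of_lt_of_le (by positivity) hqH
    exact_mod_cast this
  have hq0' : (0 : ℝ) < q := by exact_mod_cast hq0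
  -- The factor `p ^ 6 ≥ a` of the resolution makes the accumulated rounding error small relative to
  -- `q`, by a factor of order `a`.
  have hpow : 2 * 2 ^ ℓ / (q : ℝ) ≤ 1 / (15 * a) := by
    have hap : (a : ℝ) ≤ p ^ 6 := by
      calc (a : ℝ) ≤ p := by rw [hpa]; nlinarith [(Nat.cast_nonneg ℓ : (0 : ℝ) ≤ ℓ)]
        _ ≤ p ^ 6 := le_self_pow₀ hp (by norm_num)
    have h30 : 30 * 2 ^ ℓ * (a : ℝ) ≤ q := by
      refine le_trans ?_ hqH
      rw [hHdef]
      have := mul_le_mul_of_nonneg_left hap htwo.le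
      linarith
    rw [div_le_div_iff₀ hq0' (by positivity)]
    linarith
  have hl1 := hf.sum_abs_sub_labelValue_le hη hs hw (μ := p) (by positivity) hq0 ℓ 0 S0 P.tree
    (by omega) hdep hC.valid hC.labeled hfree
  rw [hroot, mul_one] at hl1
  have hqq : |(q : ℝ) - H| / q ≤ 2 * 2 ^ ℓ / q := div_le_div_of_nonneg_right hm hq0'.le
  have hlast : (2 : ℝ) ^ ℓ * (2 / q) = 2 * 2 ^ ℓ / q := by ring
  have ha15 : 1 / (15 * (a : ℝ)) ≤ 1 / (2 * a) :=
    div_le_div_of_nonneg_left (by norm_num) (by positivity) (by linarith)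
  have ha2 : 1 / (2 * (a : ℝ)) = 1 / a / 2 := by field_simp
  have haα : 1 / (a : ℝ) ≤ α := by
    rw [div_le_iff₀ ha0]
    rw [div_le_iff₀ hα] at ha
    linarith
  -- Four contributions of at most `1 / (2a)` each: influence left at the leaves, the term `ℓ /
  -- (2p)`, the normalization, and the estimated masses. Total variation is half of this sum.
  have htot : (S0.sum fun x => |prob D x - labelValue d q (P.tree.eval x)|) ≤ 2 * α := by
    linarith
  -- the output
  have hsum : ∑ x, labelValue d q (P.tree.eval x) = 1 := by
    rw [← Subcube.sum_univ, sum_labelValue 0 S0 P.tree hC.valid hC.labeled hfree, ← hC.mass, ← hq,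
      div_self hq0'.ne']
  have hnn : ∀ x, 0 ≤ labelValue d q (P.tree.eval x) := fun x => by
    simp only [labelValue]; positivity
  let D' : PMF (Cube d) := PMF.ofFintype
    (fun x => ENNReal.ofReal (labelValue d q (P.tree.eval x))) (by
      rw [← ENNReal.ofReal_sum_of_nonneg fun x _ => hnn x, hsum, ENNReal.ofReal_one])
  have hD' : ∀ x, (D' x).toReal = labelValue d q (P.tree.eval x) := fun x => by
    simp only [D', PMF.ofFintype_apply]
    exact ENNReal.toReal_ofReal (hnn x)
  refine ⟨outputTree hq0 P.tree, D', outputWord_eq hq0 P.tree, ?_, fun x => ?_, ?_⟩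
  · rw [depth_outputTree]; exact hdep
  · rw [hD']; exact (eval_outputTree hq0 P.tree x).symm
  · rw [hS0, Subcube.sum_univ] at htot
    simp only [tv, hD']
    change 1 / 2 * ∑ x, |prob D x - labelValue d q (P.tree.eval x)| ≤ α
    linarith

end final
open MeasureTheory ProbabilityTheory

/-! ### Concentration of sums over disjoint blocks of answers -/

/-- The answers to `n` consecutive queries. -/
abbrev Block (d n : ℕ) : Type := Fin n × Subcube d → Cube d

/-- The answers to the queries `t * n, …, t * n + n - 1`. -/
def block {d : ℕ} (n : ℕ) (ω : Answers d) (t : ℕ) : Block d n := fun p => ω (t * n + p.1, p.2)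

/-- The law of a block of answers. -/
noncomputable def blockLaw {d : ℕ} (n : ℕ) (O : Oracle d) : Measure (Block d n) :=
  Measure.infinitePi fun p : Fin n × Subcube d => (O p.2).toMeasure

section block
variable {d n : ℕ} (O : Oracle d)

instance : IsProbabilityMeasure (blockLaw n O) := by
  unfold blockLaw; infer_instance

instance : IsProbabilityMeasure (answerLaw O) := by
  unfold answerLaw; infer_instance

theorem measurable_block : Measurable (block (d := d) n) :=
  measurable_pi_lambda _ fun _ => measurable_pi_lambda _ fun _ => measurable_pi_apply _

/-- The index map `(t, j) ↦ t * n + j` is injective, so different blocks read disjoint coordinates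
of the product measure and are independent and identically distributed. -/
theorem answerLaw_map_block :
    (answerLaw O).map (block n) = Measure.infinitePi fun _ : ℕ => blockLaw n O := by
  let e : ℕ × (Fin n × Subcube d) → ℕ × Subcube d := fun p => (p.1 * n + p.2.1, p.2.2)
  have he : Function.Injective e := by
    rintro ⟨t, j, S⟩ ⟨t', j', S'⟩ h
    simp only [e, Prod.mk.injEq] at h ⊢
    have hn : 0 < n := j.pos
    have h1 : t = t' := by
      have := congrArg (· / n) h.1
      simpa [Nat.mul_comm _ n, Nat.mul_add_div hn, Nat.div_eq_of_lt j.2, Nat.div_eq_of_lt j'.2]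
        using this
    subst h1
    exact ⟨rfl, Fin.ext (by omega), h.2⟩
  have h1 := Measure.map_infinitePi_infinitePi_of_inj
    (P := fun q : ℕ × Subcube d => (O q.2).toMeasure) he
  have h2 := Measure.infinitePi_map_curry
    (fun (_ : ℕ) (p : Fin n × Subcube d) => (O p.2).toMeasure)
  change _ = Measure.infinitePi fun p : ℕ × (Fin n × Subcube d) => (O p.2.2).toMeasure at h1
  rw [← h1, Measure.map_map (by fun_prop) (by fun_prop)] at h2
  exact h2

/-- Hoeffding's inequality for independent variables in `[0, 1]`, applied to the centred sum and to
its negative. Within a block the answers may be used adaptively; only different blocks must be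
independent. -/
theorem blockSum_tail {F : Block d n → ℝ} (hF : ∀ z, F z ∈ Set.Icc (0 : ℝ) 1) (m : ℕ) {E : ℝ}
    (hE : 0 ≤ E) :
    answerLaw O {ω | E ≤ |∑ t ∈ Finset.range m, F (block n ω t) - m * ∫ z, F z ∂blockLaw n O|} ≤
      ENNReal.ofReal (2 * Real.exp (-2 * E ^ 2 / m)) := by
  have hmeas : Measurable F := Measurable.of_discrete
  set q := ∫ z, F z ∂blockLaw n O with hq
  set ν := Measure.infinitePi fun _ : ℕ => blockLaw n O with hν
  have key : ∀ s : ℝ, s = 1 ∨ s = -1 →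
      ν.real {y | E ≤ ∑ t ∈ Finset.range m, s * (F (y t) - q)} ≤
        Real.exp (-2 * E ^ 2 / m) := by
    intro s hs
    have hind : iIndepFun (fun t (y : ℕ → Block d n) => s * (F (y t) - q)) ν :=
      iIndepFun_infinitePi (P := fun _ : ℕ => blockLaw n O)
        (X := fun _ z => s * (F z - q)) fun _ => Measurable.of_discrete
    have hint : ∀ t : ℕ, ∫ y, F (y t) ∂ν = q := by
      intro t
      have h0 := Measure.infinitePi_map_eval (fun _ : ℕ => blockLaw n O) t
      rw [hq, ← h0, integral_map (measurable_pi_apply t).aemeasurable hmeas.aestronglyMeasurable]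
    have hsub : ∀ t < m, HasSubgaussianMGF (fun y : ℕ → Block d n => s * (F (y t) - q))
        ((‖(1 : ℝ) - 0‖₊ / 2) ^ 2) ν := by
      intro t _
      have h1 := hasSubgaussianMGF_of_mem_Icc (μ := ν) (X := fun y : ℕ → Block d n => F (y t))
        (a := 0) (b := 1) (hmeas.comp (measurable_pi_apply t)).aemeasurable
        (Filter.Eventually.of_forall fun y => hF _)
      simp only [hint] at h1
      rcases hs with rfl | rfl
      · simpa using h1
      · convert h1.neg using 1
        ext y; simp
    refine (HasSubgaussianMGF.measure_sum_range_ge_le_of_iIndepFun hind hsub hE).trans (le_of_eq ?_)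
    congr 1
    -- For `m = 0` both exponents vanish, since division by zero gives zero.
    rcases eq_or_ne (m : ℝ) 0 with h | h
    · simp [h]
    · simp
      field_simp
  have hsubset : {ω : Answers d | E ≤ |∑ t ∈ Finset.range m, F (block n ω t) - m * q|} ⊆
      block n ⁻¹' ({y | E ≤ ∑ t ∈ Finset.range m, 1 * (F (y t) - q)} ∪
        {y | E ≤ ∑ t ∈ Finset.range m, -1 * (F (y t) - q)}) := by
    intro ω hω
    simp only [Set.mem_ofPred_eq, Set.preimage_union, Set.mem_union, Set.mem_preimage] at hω ⊢
    rw [← Finset.mul_sum, ← Finset.mul_sum, Finset.sum_sub_distrib]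
    simp only [Finset.sum_const, Finset.card_range, nsmul_eq_mul, one_mul]
    rcases le_abs.1 hω with h | h
    · exact Or.inl h
    · exact Or.inr (by linarith)
  refine (measure_mono hsubset).trans ?_
  refine (Measure.le_map_apply measurable_block.aemeasurable _).trans ?_
  rw [answerLaw_map_block]
  refine (measure_union_le _ _).trans ?_
  have h1 := key 1 (Or.inl rfl)
  have h2 := key (-1) (Or.inr rfl)
  rw [measureReal_def] at h1 h2
  have e1 := (ENNReal.le_ofReal_iff_toReal_le (measure_ne_top _ _) (Real.exp_nonneg _)).2 h1
  have e2 := (ENNReal.le_ofReal_iff_toReal_le (measure_ne_top _ _) (Real.exp_nonneg _)).2 h2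
  rw [two_mul, ENNReal.ofReal_add (Real.exp_nonneg _) (Real.exp_nonneg _)]
  exact add_le_add e1 e2

end block

/-! ### The random offsets -/

theorem bits_lt (r : Coins) (n b : ℕ) : bits r n b < 2 ^ b := by
  induction b with
  | zero => simp [bits]
  | succ b ih =>
    have := Bool.toNat_lt (r (n + b))
    rw [bits, pow_succ]
    omega

theorem bits_congr {r r' : Coins} {n b : ℕ} (h : ∀ i < b, r (n + i) = r' (n + i)) :
    bits r n b = bits r' n b := by
  induction b with
  | zero => rfl
  | succ b ih => rw [bits, bits, ih fun i hi => h i (by omega), h b (by omega)]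

theorem bits_inj {r r' : Coins} {n b : ℕ} (h : bits r n b = bits r' n b) :
    ∀ i < b, r (n + i) = r' (n + i) := by
  induction b with
  | zero => simp
  | succ b ih =>
    intro i hi
    rw [bits, bits] at h
    have h1 := Bool.toNat_lt (r (n + b))
    have h2 := Bool.toNat_lt (r' (n + b))
    rcases Nat.lt_succ_iff_lt_or_eq.1 hi with hi | rfl
    · exact ih (by omega) i hi
    · have h3 : (r (n + i)).toNat = (r' (n + i)).toNat := by omega
      revert h3
      cases r (n + i) <;> cases r' (n + i) <;> simp

instance : IsProbabilityMeasure coinLaw := by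
  unfold coinLaw; infer_instance

theorem coinLaw_cylinder (r : Coins) (n : ℕ) :
    coinLaw {r' | ∀ i < n, r' i = r i} = (2⁻¹ : ENNReal) ^ n := by
  have : {r' : Coins | ∀ i < n, r' i = r i} = Set.pi (Finset.range n : Set ℕ) fun i => {r i} := by
    ext r'; simp [Set.mem_pi]
  rw [this, coinLaw, Measure.infinitePi_pi _ fun _ _ => measurableSet_singleton _]
  simp

/-- If the last of the numbers with `b` binary digits falls, for every history, into a set of at
most `N` elements, this has probability at most `N / 2 ^ b`. -/
theorem coinLaw_bits_mem_le {n b N : ℕ} {A : Coins → Finset ℕ}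
    (hA : ∀ r r' : Coins, (∀ i < n, r i = r' i) → A r = A r') (hN : ∀ r, (A r).card ≤ N) :
    coinLaw {r | bits r n b ∈ A r} ≤ N * (2⁻¹ : ENNReal) ^ b := by
  classical
  -- A history consists of the first `n` coins, padded to an infinite string; by `hA` the padding
  -- does not influence the set.
  let ext : (Fin n → Bool) → Coins := fun u i => if h : i < n then u ⟨i, h⟩ else false
  have hsub : {r : Coins | bits r n b ∈ A r} ⊆ ⋃ u ∈ (Finset.univ : Finset (Fin n → Bool)),
      ⋃ o ∈ A (ext u), {r | (∀ i < n, r i = ext u i) ∧ bits r n b = o} := by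
    intro r hr
    have h0 : ∀ i < n, r i = ext (fun i => r i) i := fun i hi => by simp [ext, hi]
    simp only [Set.mem_iUnion, Set.mem_ofPred_eq, exists_prop]
    exact ⟨fun i => r i, Finset.mem_univ _, _, by rw [← hA r _ h0]; exact hr, h0, rfl⟩
  -- History and number together determine `n + b` coins, so the event is empty or contained in a
  -- cylinder. Summing over the `2 ^ n` histories leaves the factor `2 ^ (-b)`.
  have hcyl : ∀ (u : Fin n → Bool) (o : ℕ),
      coinLaw {r | (∀ i < n, r i = ext u i) ∧ bits r n b = o} ≤ (2⁻¹ : ENNReal) ^ (n + b) := by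
    intro u o
    rcases Set.eq_empty_or_nonempty {r : Coins | (∀ i < n, r i = ext u i) ∧ bits r n b = o} with
      h | ⟨r0, h0, h1⟩
    · rw [h]; simp
    · rw [← coinLaw_cylinder r0]
      refine measure_mono fun r hr i hi => ?_
      rcases lt_or_ge i n with h | h
      · rw [hr.1 i h, h0 i h]
      · have := bits_inj (hr.2.trans h1.symm) (i - n) (by omega)
        rwa [Nat.add_sub_cancel' h] at this
  calc coinLaw {r | bits r n b ∈ A r}
      ≤ ∑ u : Fin n → Bool, ∑ o ∈ A (ext u), (2⁻¹ : ENNReal) ^ (n + b) :=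
        (measure_mono hsub).trans <| (measure_biUnion_finset_le _ _).trans <|
          Finset.sum_le_sum fun u _ => (measure_biUnion_finset_le _ _).trans <|
            Finset.sum_le_sum fun o _ => hcyl u o
    _ ≤ ∑ u : Fin n → Bool, N * (2⁻¹ : ENNReal) ^ (n + b) := by
        refine Finset.sum_le_sum fun u _ => ?_
        rw [Finset.sum_const, nsmul_eq_mul]
        gcongr
        exact_mod_cast hN _
    _ = N * (2⁻¹ : ENNReal) ^ b := by
        rw [Finset.sum_const, nsmul_eq_mul, pow_add]
        simp only [Finset.card_univ, Fintype.card_fun, Fintype.card_bool, Fintype.card_fin]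
        push_cast
        rw [mul_left_comm (N : ENNReal), ← mul_assoc, ← mul_pow,
          ENNReal.mul_inv_cancel (by simp) (by simp), one_pow, one_mul]

/-- Few offsets separate two numbers that are close to each other. -/
theorem card_separating_le {W lo hi : ℕ} (h : lo ≤ hi) :
    ((Finset.range W).filter fun o => (lo + o) / W ≠ (hi + o) / W).card ≤ hi - lo := by
  induction hi, h using Nat.le_induction with
  | base => simp
  | succ hi h ih =>
    -- Increasing the count by one changes the quotient only if it reaches a multiple of `W`.
    have hsub : ((Finset.range W).filter fun o => (lo + o) / W ≠ (hi + 1 + o) / W) ⊆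
        ((Finset.range W).filter fun o => (lo + o) / W ≠ (hi + o) / W) ∪
          (Finset.range W).filter fun o => W ∣ hi + o + 1 := by
      intro o ho
      simp only [Finset.mem_filter, Finset.mem_union] at ho ⊢
      by_cases hd : W ∣ hi + o + 1
      · exact Or.inr ⟨ho.1, hd⟩
      · refine Or.inl ⟨ho.1, ?_⟩
        have := ho.2
        rwa [Nat.add_right_comm, Nat.succ_div, if_neg hd, add_zero] at this
    -- Two offsets below `W` with this property would differ by a multiple of `W`.
    have h1 : ((Finset.range W).filter fun o => W ∣ hi + o + 1).card ≤ 1 := by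
      refine Finset.card_le_one.2 fun o ho o' ho' => ?_
      simp only [Finset.mem_filter, Finset.mem_range] at ho ho'
      wlog hle : o ≤ o' generalizing o o' with this
      · exact (this (o := o') (o' := o) ho' ho (by omega)).symm
      have := (Nat.dvd_sub ho'.2 ho.2)
      have h2 := Nat.eq_zero_of_dvd_of_lt this (by omega)
      omega
    have := (Finset.card_le_card hsub).trans (Finset.card_union_le _ _)
    omega

/-! ### The subcubes that matter -/

namespace Est
variable {d : ℕ} (A K : ℕ) (f : Est d)

/-- The subcubes at a level that the search for the best plan may reach. -/
def reach : ℕ → Finset (Subcube d)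
  | 0 => {fun _ => none}
  | j + 1 => (reach j).biUnion fun S =>
      ((f.choices A K j S).toFinset ×ˢ Finset.univ).image fun p : Fin d × Bool => S.fix p.1 p.2

variable {A K f}

theorem fix_mem_reach {j : ℕ} {S : Subcube d} (hS : S ∈ f.reach A K j) {i : Fin d}
    (hi : i ∈ f.choices A K j S) (b : Bool) : S.fix i b ∈ f.reach A K (j + 1) := by
  simp only [reach, Finset.mem_biUnion, Finset.mem_image]
  exact ⟨S, hS, (i, b), by simp [hi], rfl⟩

variable (A K f)

theorem card_reach_le (j : ℕ) : (f.reach A K j).card ≤ (2 * K) ^ j := by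
  induction j with
  | zero => simp [reach]
  | succ j ih =>
    rw [pow_succ]
    refine Finset.card_biUnion_le_card_mul _ _ _ (fun S _ => ?_) |>.trans (Nat.mul_le_mul_right _ ih)
    refine Finset.card_image_le.trans ?_
    rw [Finset.card_product, Finset.card_univ, Fintype.card_bool, Nat.mul_comm]
    refine Nat.mul_le_mul_left _ ((List.toFinset_card_le _).trans ?_)
    exact List.length_take_le _ _

variable {f}

theorem gain_congr {f' : Est d} {l : ℕ} {S : Subcube d} (h : ∀ i ≤ d, f l S i = f' l S i) {i : ℕ}
    (hi : i ≤ d) : f.gain l S i = f'.gain l S i := by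
  simp only [gain, h i hi, h d le_rfl]

theorem choices_congr {f' : Est d} {l : ℕ} {S : Subcube d} (h : ∀ i ≤ d, f l S i = f' l S i) :
    f.choices A K l S = f'.choices A K l S := by
  unfold choices
  congr 2
  funext i
  exact decide_eq_decide.2 (by rw [Flagged, Flagged, gain_congr h i.2.le, h d le_rfl])

/-- The subcubes reached at level `j` are determined by the estimates at strictly lower levels. This
makes the offset of level `j` independent of the subcubes to which it is applied. -/
theorem reach_congr {f' : Est d} (j : ℕ) (h : ∀ l < j, ∀ S, ∀ i ≤ d, f l S i = f' l S i) :
    f.reach A K j = f'.reach A K j := by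
  induction j with
  | zero => rfl
  | succ j ih =>
    rw [reach, reach, ih fun l hl => h l (by omega)]
    refine Finset.biUnion_congr rfl fun S _ => ?_
    rw [choices_congr A K (h j (by omega) S)]

/-- Agreement is required only on reached subcubes. Rounding of this width cannot be made stable on
all `3 ^ d` subcubes by a union bound, but it can on these few. -/
theorem plan_congr_reach {f' : Est d} {L : ℕ}
    (h : ∀ l ≤ L, ∀ S ∈ f.reach A K l, ∀ i ≤ d, f l S i = f' l S i) :
    ∀ k lev, lev + k ≤ L → ∀ S ∈ f.reach A K lev, f.plan A K k lev S = f'.plan A K k lev S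
  | 0, lev, hk, S, hS => by
    simp only [plan, asLeaf, h lev (by omega) S hS d le_rfl]
  | k + 1, lev, hk, S, hS => by
    have h0 := h lev (by omega) S hS
    have hst : f.asLeaf lev S = f'.asLeaf lev S := by simp only [asLeaf, h0 d le_rfl]
    rw [plan, plan, ← choices_congr A K h0, hst]
    refine List.foldr_ext _ _ _ fun i hi acc => ?_
    rw [plan_congr_reach h k (lev + 1) (by omega) _ (fix_mem_reach hS hi false),
      plan_congr_reach h k (lev + 1) (by omega) _ (fix_mem_reach hS hi true)]
    rw [improve, improve, gain_congr h0 i.2.le]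

end Est

/-! ### Stability of rounding with random offsets. -/

section offsets
variable {d : ℕ} (lo hi : Subcube d → ℕ → ℕ) (A K b : ℕ)

/-- The estimates for given counts, with random offsets of `b` bits. -/
def shiftedEst (r : Coins) : Est d := fun lev S i => (lo S i + offset r b lev) / 2 ^ b

theorem sum_two_mul_pow_le (K ℓ : ℕ) : ∑ j ∈ Finset.range (ℓ + 1), (2 * K) ^ j ≤ (2 * K + 1) ^ ℓ := by
  induction ℓ with
  | zero => simp
  | succ ℓ ih =>
    rw [Finset.sum_range_succ, pow_succ (2 * K), pow_succ (2 * K + 1), mul_add, mul_one, add_comm]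
    exact Nat.add_le_add (Nat.mul_le_mul_right _ (Nat.pow_le_pow_left (by omega) _)) ih

/-- With high probability, the rounded estimates are the same for the lower and the upper counts, on
all subcubes that matter. -/
theorem coinLaw_shiftedEst_ne_le {Δ : ℕ} (h : ∀ S i, lo S i ≤ hi S i)
    (hΔ : ∀ S i, hi S i ≤ lo S i + Δ) (ℓ : ℕ) :
    coinLaw {r | ∃ j ≤ ℓ, ∃ S ∈ (shiftedEst lo b r).reach A K j, ∃ i ≤ d,
        shiftedEst lo b r j S i ≠ shiftedEst hi b r j S i} ≤
      ((2 * K + 1) ^ ℓ * ((d + 1) * Δ) : ℕ) * (2⁻¹ : ENNReal) ^ b := by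
  classical
  -- The values of the offset of level `j` for which rounding separates the lower from the upper
  -- count on some subcube reached there. By `hloc` this set depends only on the coins read for
  -- lower levels.
  let bad : ℕ → Coins → Finset ℕ := fun j r => ((shiftedEst lo b r).reach A K j).biUnion fun S =>
    (Finset.range (d + 1)).biUnion fun i =>
      (Finset.range (2 ^ b)).filter fun o => (lo S i + o) / 2 ^ b ≠ (hi S i + o) / 2 ^ b
  have hcard : ∀ j r, (bad j r).card ≤ (2 * K) ^ j * ((d + 1) * Δ) := by
    intro j r
    refine (Finset.card_biUnion_le_card_mul _ _ ((d + 1) * Δ) fun S _ => ?_).trans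
      (Nat.mul_le_mul_right _ (Est.card_reach_le A K _ j))
    refine (Finset.card_biUnion_le_card_mul _ _ Δ fun i _ => ?_).trans (by simp)
    exact (card_separating_le (h S i)).trans (by have := hΔ S i; omega)
  have hloc : ∀ j, ∀ r r' : Coins, (∀ i < j * b, r i = r' i) → bad j r = bad j r' := by
    intro j r r' hr
    have : (shiftedEst lo b r).reach A K j = (shiftedEst lo b r').reach A K j := by
      refine Est.reach_congr A K j fun l hl S i _ => ?_
      have : offset r b l = offset r' b l := bits_congr fun i hi => hr _ (by
        have : (l + 1) * b ≤ j * b := Nat.mul_le_mul_right _ hl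
        rw [Nat.succ_mul] at this
        omega)
      simp only [shiftedEst, this]
    simp only [bad, this]
  have hsub : {r : Coins | ∃ j ≤ ℓ, ∃ S ∈ (shiftedEst lo b r).reach A K j, ∃ i ≤ d,
      shiftedEst lo b r j S i ≠ shiftedEst hi b r j S i} ⊆
      ⋃ j ∈ Finset.range (ℓ + 1), {r | bits r (j * b) b ∈ bad j r} := by
    rintro r ⟨j, hj, S, hS, i, hi', hne⟩
    simp only [Set.mem_iUnion, Finset.mem_range, exists_prop, Set.mem_ofPred_eq]
    refine ⟨j, by omega, Finset.mem_biUnion.2 ⟨S, hS, Finset.mem_biUnion.2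
      ⟨i, Finset.mem_range.2 (by omega), Finset.mem_filter.2
        ⟨Finset.mem_range.2 (bits_lt _ _ _), hne⟩⟩⟩⟩
  calc _ ≤ ∑ j ∈ Finset.range (ℓ + 1),
        (((2 * K) ^ j * ((d + 1) * Δ) : ℕ) : ENNReal) * (2⁻¹ : ENNReal) ^ b :=
        (measure_mono hsub).trans <| (measure_biUnion_finset_le _ _).trans <|
          Finset.sum_le_sum fun j _ => coinLaw_bits_mem_le (hloc j) (hcard j)
    _ = ((∑ j ∈ Finset.range (ℓ + 1), (2 * K) ^ j) * ((d + 1) * Δ) : ℕ) * (2⁻¹ : ENNReal) ^ b := by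
        push_cast
        simp only [Finset.sum_mul]
    _ ≤ _ := by
        gcongr
        exact sum_two_mul_pow_le K ℓ

end offsets

/-! ### Estimates from blocks of answers -/

/-- The contribution of a block of answers to the count of `i` in `S`; the index `d` counts the
samples. -/
def hit {d n : ℕ} (x : Block d n → Cube d) (F : Block d n → ℕ → ℕ) (S : Subcube d) (i : ℕ)
    (z : Block d n) : ℕ :=
  if x z ∈ S.points then if i = d then 1 else F z i else 0

/-- The sample in a block. -/
def Block.sample {d w : ℕ} (z : Block d (w + 1)) : Cube d := z (0, fun _ => none)

/-- The marks `mark` are functions `F` of the blocks with `w + 1` answers of `O`, and measure the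
influences `η` of the coordinates. -/
structure Measures {d : ℕ} (D : PMF (Cube d)) (O : Oracle d) (w : ℕ)
    (mark : Answers d → ℕ → Cube d → ℕ → ℕ) (F : Block d (w + 1) → ℕ → ℕ)
    (η : Fin d → Cube d → ℝ) : Prop where
  root : O (fun _ => none) = D
  mark_eq : ∀ ω t, ∀ i < d, mark ω (t * (w + 1) + 1) (sampleAt (w + 1) ω t) i =
    F (block (w + 1) ω t) i
  le_one : ∀ z i, F z i ≤ 1
  edge : EdgeBound (prob D) η
  mean : ∀ (S : Subcube d) (i : Fin d), S i = none →
    ∫ z, (hit Block.sample F S i z : ℝ) ∂blockLaw (w + 1) O = (S.sum (prob D) + S.sum (η i)) / 2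

section event
variable {d w : ℕ} (O : Oracle d) (F : Block d (w + 1) → ℕ → ℕ)

/-- Expected contribution of a block. -/
noncomputable def rate (S : Subcube d) (i : ℕ) : ℝ :=
  ∫ z, (hit Block.sample F S i z : ℝ) ∂blockLaw (w + 1) O

/-- Contribution of `m` blocks. -/
def hits (ω : Answers d) (m : ℕ) (S : Subcube d) (i : ℕ) : ℕ :=
  ∑ t ∈ Finset.range m, hit Block.sample F S i (block (w + 1) ω t)

/-- All counts deviate by less than `E` from their expectations. -/
def typical (m : ℕ) (E : ℝ) : Set (Answers d) :=
  {ω | ∀ S, ∀ i ≤ d, |(hits F ω m S i : ℝ) - m * rate O F S i| < E}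

variable {O F}

theorem hit_le_one (hF : ∀ z i, F z i ≤ 1) (S : Subcube d) (i : ℕ) (z : Block d (w + 1)) :
    hit Block.sample F S i z ≤ 1 := by
  unfold hit
  split_ifs
  exacts [le_rfl, hF z i, zero_le_one]

/-- A union bound over all `3 ^ d` subcubes and `d + 1` indices. Because the tail is exponential,
this costs only a term linear in `d` in the number of samples. -/
theorem typical_compl_le (hF : ∀ z i, F z i ≤ 1) (m : ℕ) {E : ℝ} (hE : 0 ≤ E) :
    answerLaw O (typical O F m E)ᶜ ≤
      ENNReal.ofReal (3 ^ d * (d + 1) * (2 * Real.exp (-2 * E ^ 2 / m))) := by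
  have hsub : (typical O F m E)ᶜ ⊆ ⋃ S ∈ (Finset.univ : Finset (Subcube d)),
      ⋃ i ∈ Finset.range (d + 1), {ω | E ≤ |∑ t ∈ Finset.range m,
        (hit Block.sample F S i (block (w + 1) ω t) : ℝ) - m * rate O F S i|} := by
    intro ω hω
    simp only [typical, Set.mem_compl_iff, Set.mem_ofPred_eq, not_forall, not_lt, hits] at hω
    obtain ⟨S, i, hi, h⟩ := hω
    simp only [Set.mem_iUnion, Finset.mem_range, exists_prop, Set.mem_ofPred_eq]
    exact ⟨S, Finset.mem_univ _, i, by omega, by exact_mod_cast h⟩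
  calc _ ≤ ∑ S : Subcube d, ∑ i ∈ Finset.range (d + 1),
        ENNReal.ofReal (2 * Real.exp (-2 * E ^ 2 / m)) :=
        (measure_mono hsub).trans <| (measure_biUnion_finset_le _ _).trans <|
          Finset.sum_le_sum fun S _ => (measure_biUnion_finset_le _ _).trans <|
            Finset.sum_le_sum fun i _ =>
              blockSum_tail O (F := fun z => (hit Block.sample F S i z : ℝ))
                (fun z => ⟨by positivity, by exact_mod_cast hit_le_one hF S i z⟩) m hE
    _ = _ := by
        rw [Finset.sum_const, Finset.sum_const, Finset.card_univ, Finset.card_range, nsmul_eq_mul,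
          nsmul_eq_mul, ← ENNReal.ofReal_natCast, ← ENNReal.ofReal_natCast,
          ← ENNReal.ofReal_mul (by positivity), ← ENNReal.ofReal_mul (by positivity)]
        congr 1
        simp [mul_assoc]

theorem Measures.rate_mass {D : PMF (Cube d)} {mark : Answers d → ℕ → Cube d → ℕ → ℕ}
    {η : Fin d → Cube d → ℝ} (h : Measures D O w mark F η) (S : Subcube d) :
    rate O F S d = S.sum (prob D) := by
  have h1 : rate O F S d = ∫ x, (if x ∈ S.points then (1 : ℝ) else 0) ∂D.toMeasure := by
    have h0 := Measure.infinitePi_map_eval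
      (fun p : Fin (w + 1) × Subcube d => (O p.2).toMeasure) (0, fun _ => none)
    simp only [h.root] at h0
    rw [← h0, integral_map (measurable_pi_apply _).aemeasurable
      (Measurable.of_discrete).aestronglyMeasurable, rate]
    refine integral_congr_ae (Filter.Eventually.of_forall fun z => ?_)
    simp [hit, Block.sample]
  rw [h1, PMF.integral_eq_sum]
  simp [Subcube.sum, prob]

end event

/-! ### Concentration for the sample size of the learner -/

section learner
variable {d ℓ a q B : ℕ}

/-- The deviation of the counts that is allowed for. -/
noncomputable def deviation (d ℓ a q B : ℕ) : ℝ := width d ℓ a q B / slack d ℓ a q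

theorem slack_pos (hq : 1 ≤ q) : 0 < slack d ℓ a q := by
  unfold slack nodeBound; positivity

theorem resolution_pos (ha : 1 ≤ a) : 0 < resolution ℓ a := by
  unfold resolution scale; positivity

theorem width_pos : 0 < width d ℓ a q B := by
  unfold width; positivity

theorem minWidth_le_width : minWidth d ℓ a q B ≤ width d ℓ a q B :=
  Nat.le_pow_clog (by norm_num) _

/-- The ratio equals `width / (slack² * resolution)`, and `minWidth` was chosen to make it large
enough. -/
theorem deviation_sq (ha : 1 ≤ a) (hq : 1 ≤ q) :
    (3 * d + B.size + 3 : ℕ) ≤ deviation d ℓ a q B ^ 2 / sampleSize d ℓ a q B := by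
  have h1 : (0 : ℝ) < slack d ℓ a q := by exact_mod_cast slack_pos hq
  have h2 : (0 : ℝ) < resolution ℓ a := by exact_mod_cast resolution_pos ha
  have h3 : (0 : ℝ) < width d ℓ a q B := by exact_mod_cast width_pos
  have h4 : ((minWidth d ℓ a q B : ℕ) : ℝ) ≤ width d ℓ a q B := by exact_mod_cast minWidth_le_width
  rw [minWidth] at h4
  push_cast [sampleSize, deviation] at h4 ⊢
  rw [le_div_iff₀ (by positivity), div_pow, le_div_iff₀ (by positivity)]
  nlinarith

theorem one_le_deviation (ha : 1 ≤ a) (hq : 1 ≤ q) : 1 ≤ deviation d ℓ a q B := by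
  have h1 : (0 : ℝ) < slack d ℓ a q := by exact_mod_cast slack_pos hq
  rw [deviation, le_div_iff₀ h1, one_mul]
  have h2 := slack_pos (d := d) (ℓ := ℓ) (a := a) hq
  have h3 := resolution_pos (ℓ := ℓ) ha
  have : slack d ℓ a q ≤ minWidth d ℓ a q B := by
    unfold minWidth
    calc slack d ℓ a q = slack d ℓ a q * 1 * 1 * 1 := by ring
      _ ≤ _ := by gcongr <;> omega
  exact_mod_cast this.trans minWidth_le_width

/-- As `exp (-2) ≤ 1/4`, the exponential is at most `4 ^ (-(3d + B.size + 3))`. This outweighs `3 ^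
d ≤ 4 ^ d`, `d + 1 ≤ 4 ^ d` and the factor `2`, and what remains is at most `2 ^ (-B.size) ≤ 1 / B ≤
β`. -/
theorem tail_le {β : ℝ} (hβ : 0 < β) (hB : 1 / β ≤ B) {x : ℝ} (hx : (3 * d + B.size + 3 : ℕ) ≤ x) :
    3 ^ d * (d + 1) * (2 * Real.exp (-2 * x)) ≤ β := by
  have he : Real.exp (-2) ≤ 1 / 4 := by
    have h1 : (4 : ℝ) ≤ Real.exp 2 := by
      have := Real.add_one_le_exp (1 : ℝ)
      have h2 : Real.exp 2 = Real.exp 1 * Real.exp 1 := by rw [← Real.exp_add]; norm_num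
      nlinarith
    rw [Real.exp_neg, ← one_div]
    exact one_div_le_one_div_of_le (by norm_num) h1
  have h2 : Real.exp (-2 * x) ≤ (1 / 4) ^ (3 * d + B.size + 3) := by
    calc Real.exp (-2 * x) ≤ Real.exp ((3 * d + B.size + 3 : ℕ) * (-2)) :=
          Real.exp_le_exp.2 (by linarith)
      _ = Real.exp (-2) ^ (3 * d + B.size + 3) := Real.exp_nat_mul _ _
      _ ≤ _ := pow_le_pow_left₀ (Real.exp_nonneg _) he _
  have h3 : (1 / 2 : ℝ) ^ B.size ≤ β := by
    have h4 : (B : ℝ) ≤ 2 ^ B.size := by exact_mod_cast (Nat.lt_size_self B).le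
    rw [one_div_pow, one_div_le (by positivity) hβ]
    exact hB.trans h4
  have h5 : (3 : ℝ) ^ d ≤ 4 ^ d := pow_le_pow_left₀ (by norm_num) (by norm_num) d
  have h6 : (d : ℝ) + 1 ≤ 4 ^ d := by exact_mod_cast (Nat.lt_pow_self (by norm_num) : d < 4 ^ d)
  have h7 : (1 / 4 : ℝ) ^ B.size ≤ (1 / 2) ^ B.size :=
    pow_le_pow_left₀ (by norm_num) (by norm_num) _
  calc (3 : ℝ) ^ d * (d + 1) * (2 * Real.exp (-2 * x))
      ≤ 4 ^ d * 4 ^ d * (4 ^ 3 * (1 / 4) ^ (3 * d + B.size + 3)) := by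
        gcongr
        norm_num
    _ = (4 ^ d * (1 / 4) ^ d) * (4 ^ d * (1 / 4) ^ d) * (1 / 4) ^ d * (1 / 4) ^ B.size := by
        rw [pow_add, pow_add, Nat.mul_comm 3 d, pow_mul]
        norm_num
        ring
    _ ≤ 1 * 1 * 1 * (1 / 2) ^ B.size := by
        rw [← mul_pow]
        gcongr
        · norm_num
        · norm_num
        · exact pow_le_one₀ (by norm_num) (by norm_num)
    _ ≤ β := by simpa using h3

variable {w : ℕ} {O : Oracle d} {F : Block d (w + 1) → ℕ → ℕ}

theorem learner_typical_compl_le (hF : ∀ z i, F z i ≤ 1) (ha : 1 ≤ a) (hq : 1 ≤ q) {β : ℝ}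
    (hβ : 0 < β) (hB : 1 / β ≤ B) :
    answerLaw O (typical O F (sampleSize d ℓ a q B) (deviation d ℓ a q B))ᶜ ≤ ENNReal.ofReal β := by
  refine (typical_compl_le hF _ (zero_le_one.trans (one_le_deviation ha hq))).trans
    (ENNReal.ofReal_le_ofReal ?_)
  rw [mul_div_assoc]
  exact tail_le hβ hB (deviation_sq ha hq)

/-- The rounded estimates of the learner. -/
def learnerEst (F : Block d (w + 1) → ℕ → ℕ) (ℓ a q B : ℕ) (r : Coins) (ω : Answers d) : Est d :=
  shiftedEst (hits F ω (sampleSize d ℓ a q B)) (offsetBits d ℓ a q B) r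

/-- The number of samples is `resolution` times the width, so a count divided by the width estimates
`resolution` times the rate. The deviation is at most one width, and offset and rounding move the
value by less than one in either direction. This holds for every value of the coins. -/
theorem accurate_learnerEst {D : PMF (Cube d)} {mark : Answers d → ℕ → Cube d → ℕ → ℕ}
    {η : Fin d → Cube d → ℝ} (h : Measures D O w mark F η) (hq : 1 ≤ q) (r : Coins) {ω : Answers d}
    (hω : ω ∈ typical O F (sampleSize d ℓ a q B) (deviation d ℓ a q B)) :
    Accurate (learnerEst F ℓ a q B r ω) (resolution ℓ a) ℓ (prob D) η := by
  have key : ∀ lev S, ∀ i ≤ d,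
      |(learnerEst F ℓ a q B r ω lev S i : ℝ) - resolution ℓ a * rate O F S i| < 2 := by
    intro lev S i hi
    have hW : (0 : ℝ) < width d ℓ a q B := by exact_mod_cast width_pos
    have hs : (1 : ℝ) ≤ slack d ℓ a q := by exact_mod_cast slack_pos hq
    have h1 := hω S i hi
    set n := hits F ω (sampleSize d ℓ a q B) S i with hn
    have ho : offset r (offsetBits d ℓ a q B) lev < width d ℓ a q B := bits_lt _ _ _
    have h2 : learnerEst F ℓ a q B r ω lev S i =
        (n + offset r (offsetBits d ℓ a q B) lev) / width d ℓ a q B := rfl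
    set v := learnerEst F ℓ a q B r ω lev S i
    set o := offset r (offsetBits d ℓ a q B) lev
    have h3 : v * width d ℓ a q B ≤ n + o := by rw [h2]; exact Nat.div_mul_le_self _ _
    have h4 : n + o < (v + 1) * width d ℓ a q B := by
      rw [h2, Nat.mul_comm]; exact Nat.lt_mul_div_succ _ width_pos
    have h3' : (v : ℝ) * width d ℓ a q B ≤ n + o := by exact_mod_cast h3
    have h4' : (n : ℝ) + o < (v + 1) * width d ℓ a q B := by exact_mod_cast h4
    have ho' : (o : ℝ) < width d ℓ a q B := by exact_mod_cast ho
    have h5 : deviation d ℓ a q B ≤ width d ℓ a q B := by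
      rw [deviation]; exact div_le_self hW.le hs
    rw [sampleSize] at h1
    push_cast at h1
    have ho0 : (0 : ℝ) ≤ o := Nat.cast_nonneg _
    rw [abs_lt] at h1 ⊢
    constructor
    · by_contra hc
      nlinarith
    · by_contra hc
      nlinarith
  constructor
  · intro lev _ S
    rw [← h.rate_mass S]
    exact key lev S d le_rfl
  · intro lev _ S i hi
    rw [← h.mean S i hi]
    exact key lev S i i.2.le

/-- The typical counts lie between these numbers. -/
noncomputable def lowCount (O : Oracle d) (F : Block d (w + 1) → ℕ → ℕ) (ℓ a q B : ℕ)
    (S : Subcube d) (i : ℕ) : ℕ :=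
  ⌈sampleSize d ℓ a q B * rate O F S i - deviation d ℓ a q B⌉₊

/-- The typical counts lie between these numbers. -/
noncomputable def highCount (O : Oracle d) (F : Block d (w + 1) → ℕ → ℕ) (ℓ a q B : ℕ)
    (S : Subcube d) (i : ℕ) : ℕ :=
  ⌊sampleSize d ℓ a q B * rate O F S i + deviation d ℓ a q B⌋₊

theorem rate_nonneg (S : Subcube d) (i : ℕ) : 0 ≤ rate O F S i :=
  integral_nonneg fun _ => Nat.cast_nonneg _

/-- The interval has length at least `2` and a nonnegative midpoint, so it contains a natural
number. -/
theorem lowCount_le_highCount (ha : 1 ≤ a) (hq : 1 ≤ q) (S : Subcube d) (i : ℕ) :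
    lowCount O F ℓ a q B S i ≤ highCount O F ℓ a q B S i := by
  have h1 := one_le_deviation (d := d) (ℓ := ℓ) (B := B) ha hq
  have h2 : 0 ≤ sampleSize d ℓ a q B * rate O F S i := mul_nonneg (Nat.cast_nonneg _) (rate_nonneg S i)
  refine Nat.le_floor ?_
  rcases le_total (sampleSize d ℓ a q B * rate O F S i) (deviation d ℓ a q B) with h | h
  · rw [lowCount, Nat.ceil_eq_zero.2 (by linarith)]
    simp only [Nat.cast_zero]
    linarith
  · have := Nat.ceil_lt_add_one (sub_nonneg.2 h)
    rw [lowCount]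
    linarith

theorem highCount_le (ha : 1 ≤ a) (hq : 1 ≤ q) (S : Subcube d) (i : ℕ) :
    highCount O F ℓ a q B S i ≤ lowCount O F ℓ a q B S i + ⌊2 * deviation d ℓ a q B⌋₊ := by
  have h1 := one_le_deviation (d := d) (ℓ := ℓ) (B := B) ha hq
  have h2 : 0 ≤ sampleSize d ℓ a q B * rate O F S i := mul_nonneg (Nat.cast_nonneg _) (rate_nonneg S i)
  rw [← Nat.sub_le_iff_le_add']
  refine Nat.le_floor ?_
  rw [Nat.cast_sub (lowCount_le_highCount ha hq S i)]
  have h3 : (highCount O F ℓ a q B S i : ℝ) ≤ _ := Nat.floor_le (by linarith)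
  have h4 := Nat.le_ceil (sampleSize d ℓ a q B * rate O F S i - deviation d ℓ a q B)
  rw [lowCount]
  linarith

theorem hits_mem {ω : Answers d}
    (hω : ω ∈ typical O F (sampleSize d ℓ a q B) (deviation d ℓ a q B)) (S : Subcube d) {i : ℕ}
    (hi : i ≤ d) : lowCount O F ℓ a q B S i ≤ hits F ω (sampleSize d ℓ a q B) S i ∧
      hits F ω (sampleSize d ℓ a q B) S i ≤ highCount O F ℓ a q B S i := by
  have := abs_lt.1 (hω S i hi)
  exact ⟨Nat.ceil_le.2 (by linarith), Nat.le_floor (by linarith)⟩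

/-- The offsets for which the estimates from typical answers need not agree. -/
def badOffsets (O : Oracle d) (F : Block d (w + 1) → ℕ → ℕ) (ℓ a q B : ℕ) : Set Coins :=
  {r | ∃ j ≤ ℓ, ∃ S ∈ (shiftedEst (lowCount O F ℓ a q B) (offsetBits d ℓ a q B) r).reach
      (scale ℓ a ^ 6) (fanOut ℓ a) j, ∃ i ≤ d,
    shiftedEst (lowCount O F ℓ a q B) (offsetBits d ℓ a q B) r j S i ≠
      shiftedEst (highCount O F ℓ a q B) (offsetBits d ℓ a q B) r j S i}

/-- By the definition of `slack`, the bound `nodeBound * (d + 1) * 2 * deviation / width` is exactly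
`1 / (6q)`. -/
theorem coinLaw_badOffsets_le (ha : 1 ≤ a) (hq : 1 ≤ q) :
    coinLaw (badOffsets O F ℓ a q B) ≤ ENNReal.ofReal (1 / (6 * q)) := by
  refine (coinLaw_shiftedEst_ne_le _ _ (scale ℓ a ^ 6) (fanOut ℓ a) (offsetBits d ℓ a q B)
    (lowCount_le_highCount ha hq) (highCount_le ha hq) ℓ).trans ?_
  have hW : (0 : ℝ) < width d ℓ a q B := by exact_mod_cast width_pos
  have hN : (0 : ℝ) < nodeBound ℓ a := by
    unfold nodeBound; positivity
  have hq' : (0 : ℝ) < q := by exact_mod_cast hq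
  have h1 : ((2⁻¹ : ENNReal)) ^ offsetBits d ℓ a q B = ENNReal.ofReal (1 / width d ℓ a q B) := by
    rw [one_div, ENNReal.ofReal_inv_of_pos hW, ENNReal.ofReal_natCast, width, ← ENNReal.inv_pow]
    push_cast
    rfl
  rw [h1, ← ENNReal.ofReal_natCast, ← ENNReal.ofReal_mul (Nat.cast_nonneg _)]
  refine ENNReal.ofReal_le_ofReal ?_
  have h2 : ((⌊2 * deviation d ℓ a q B⌋₊ : ℕ) : ℝ) ≤ 2 * deviation d ℓ a q B :=
    Nat.floor_le (by have := one_le_deviation (d := d) (ℓ := ℓ) (B := B) ha hq; linarith)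
  have h3 : (((2 * fanOut ℓ a + 1) ^ ℓ * ((d + 1) * ⌊2 * deviation d ℓ a q B⌋₊) : ℕ) : ℝ) ≤
      nodeBound ℓ a * ((d + 1) * (2 * deviation d ℓ a q B)) := by
    rw [nodeBound]
    push_cast
    gcongr
  refine (mul_le_mul_of_nonneg_right h3 (by positivity)).trans (le_of_eq ?_)
  rw [deviation, slack]
  push_cast
  field_simp
  norm_num

/-- The right-hand side does not involve the answers. Rounding is monotone, so a typical count is
squeezed between two numbers that round equally on all subcubes reached. -/
theorem learnerPlan_eq {r : Coins} (hr : r ∉ badOffsets O F ℓ a q B) {ω : Answers d}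
    (hω : ω ∈ typical O F (sampleSize d ℓ a q B) (deviation d ℓ a q B)) :
    (learnerEst F ℓ a q B r ω).plan (scale ℓ a ^ 6) (fanOut ℓ a) ℓ 0 (fun _ => none) =
    (shiftedEst (lowCount O F ℓ a q B) (offsetBits d ℓ a q B) r).plan (scale ℓ a ^ 6) (fanOut ℓ a)
      ℓ 0 (fun _ => none) := by
  refine (Est.plan_congr_reach _ _ (L := ℓ) (fun l hl S hS i hi => ?_) ℓ 0 (by omega) _
    (by simp [Est.reach])).symm
  have h1 : shiftedEst (lowCount O F ℓ a q B) (offsetBits d ℓ a q B) r l S i =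
      shiftedEst (highCount O F ℓ a q B) (offsetBits d ℓ a q B) r l S i := by
    by_contra h
    exact hr ⟨l, hl, S, hS, i, hi, h⟩
  obtain ⟨h2, h3⟩ := hits_mem hω S hi
  refine le_antisymm ?_ ?_
  · exact Nat.div_le_div_right (Nat.add_le_add_right h2 _)
  · rw [h1]
    exact Nat.div_le_div_right (Nat.add_le_add_right h3 _)

end learner

/-! ### The two kinds of marks measure influences -/

theorem integral_toMeasure {d : ℕ} (D : PMF (Cube d)) (g : Cube d → ℝ) :
    ∫ x, g x ∂D.toMeasure = ∑ x, prob D x * g x := by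
  rw [PMF.integral_eq_sum]
  rfl

/-- If `i` is free, the subcube is a union of edges in direction `i`, so it suffices to compare sums
over edges. -/
theorem Subcube.sum_symmetrize {d : ℕ} {S : Subcube d} {i : Fin d} (hi : S i = none)
    {g h : Cube d → ℝ} (H : ∀ x, g x + g (Cube.flip x i) = h x + h (Cube.flip x i)) :
    S.sum g = S.sum h := by
  have h1 := sum_add S g fun x => g (Cube.flip x i)
  have h2 := sum_add S h fun x => h (Cube.flip x i)
  rw [sum_flip hi] at h1 h2
  rw [sum_congr fun x _ => H x, h2] at h1
  linarith

theorem edgeBound_halfDiff {d : ℕ} {w : Cube d → ℝ} (hw : ∀ x, 0 ≤ w x) :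
    EdgeBound w (halfDiff w) where
  nonneg i x := by unfold halfDiff; positivity
  le i x := le_rfl
  ge i x := by
    have h1 := abs_nonneg (w x - w (Cube.flip x i))
    have h2 : |w x - w (Cube.flip x i)| ≤ w x + w (Cube.flip x i) := by
      rw [abs_le]; constructor <;> linarith [hw x, hw (Cube.flip x i)]
    rw [halfDiff, ← sq_abs]
    nlinarith

/-- The squared difference along an edge, divided by twice the mass of the edge. -/
noncomputable def edgeVariance {d : ℕ} (w : Cube d → ℝ) (i : Fin d) (x : Cube d) : ℝ :=
  (w x - w (Cube.flip x i)) ^ 2 / (2 * (w x + w (Cube.flip x i)))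

theorem edgeBound_edgeVariance {d : ℕ} {w : Cube d → ℝ} (hw : ∀ x, 0 ≤ w x) :
    EdgeBound w (edgeVariance w) := by
  have key : ∀ i x, edgeVariance w i x ≤ halfDiff w i x ∧
      (w x - w (Cube.flip x i)) ^ 2 / 2 ≤ edgeVariance w i x * (w x + w (Cube.flip x i)) := by
    intro i x
    have h1 := abs_nonneg (w x - w (Cube.flip x i))
    have ha := hw x
    have hb := hw (Cube.flip x i)
    have h2 : |w x - w (Cube.flip x i)| ≤ w x + w (Cube.flip x i) := by
      rw [abs_le]; constructor <;> linarith
    rw [edgeVariance, halfDiff, ← sq_abs]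
    -- On an edge of mass zero the quotient is `0` by the convention for division, and all
    -- differences vanish.
    rcases (add_nonneg ha hb).eq_or_lt with h | h
    · rw [← h] at h2 ⊢
      have h3 : |w x - w (Cube.flip x i)| = 0 := le_antisymm h2 h1
      simp [h3]
    · constructor
      · rw [div_le_div_iff₀ (by positivity) (by norm_num)]
        nlinarith
      · refine le_of_eq ?_
        field_simp
  refine ⟨fun i x => ?_, fun i x => (key i x).1, fun i x => (key i x).2⟩
  have := hw x
  have := hw (Cube.flip x i)
  unfold edgeVariance
  positivity

/-! ### Marks from plain samples of a monotone distribution. -/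

section plain
variable {d : ℕ}

/-- The plain marks as a function of the block. -/
def plainHit (z : Block d 1) (i : ℕ) : ℕ := plainMark (fun _ => z.sample) 0 z.sample i

/-- On an edge the mark selects the endpoint with `x i = 1`, which by monotonicity has the larger
mass. The larger of two numbers is half of their sum plus half of their distance; summing over edges
gives the mean. -/
theorem measures_plainMark {D : PMF (Cube d)} (hD : MonotoneDist D) :
    Measures D (sampleOracle D) 0 plainMark plainHit (halfDiff (prob D)) where
  root := rfl
  mark_eq ω t i hi := by
    simp [plainHit, plainMark, Block.sample, block, sampleAt]
  le_one z i := by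
    unfold plainHit plainMark
    split_ifs
    exacts [Bool.toNat_le _, zero_le_one]
  edge := edgeBound_halfDiff (prob_nonneg D)
  mean S i hi := by
    have h0 := Measure.infinitePi_map_eval
      (fun p : Fin (0 + 1) × Subcube d => (sampleOracle D p.2).toMeasure) (0, fun _ => none)
    have h1 : ∫ z, (hit Block.sample plainHit S i z : ℝ) ∂blockLaw (0 + 1) (sampleOracle D) =
        ∫ x, (if x ∈ S.points then if x i then (1 : ℝ) else 0 else 0) ∂D.toMeasure := by
      simp only [sampleOracle] at h0
      rw [← h0, integral_map (measurable_pi_apply _).aemeasurable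
        (Measurable.of_discrete).aestronglyMeasurable]
      refine integral_congr_ae (Filter.Eventually.of_forall fun z => ?_)
      simp only [hit, plainHit, plainMark, i.2, i.2.ne, dif_pos, if_false, Block.sample]
      cases z (0, fun _ => none) i <;> simp
    have h2 : ∫ z, (hit Block.sample plainHit S i z : ℝ) ∂blockLaw (0 + 1) (sampleOracle D) =
        S.sum fun x => if x i then prob D x else 0 := by
      rw [h1, integral_toMeasure]
      refine Finset.sum_congr rfl fun x _ => ?_
      split_ifs <;> simp_all
    rw [h2, ← Subcube.sum_add, div_eq_inv_mul, ← Subcube.sum_mul]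
    refine Subcube.sum_symmetrize hi fun x => ?_
    have hmono : ∀ x : Cube d, x i = true → prob D (Cube.flip x i) ≤ prob D x := by
      intro x hx
      refine ENNReal.toReal_mono (D.apply_ne_top x) (hD _ _ fun j => ?_)
      rcases eq_or_ne j i with rfl | hj
      · rw [hx]; exact Bool.le_true _
      · rw [Cube.flip_ne x hj]
    simp only [halfDiff, Cube.flip_flip, Cube.flip_same]
    cases hx : x i
    · have := hmono (Cube.flip x i) (by simp [Cube.flip_same, hx])
      rw [Cube.flip_flip] at this
      rw [abs_of_nonpos (by linarith), abs_of_nonneg (by linarith)]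
      simp
      ring
    · have := hmono x hx
      rw [abs_of_nonneg (by linarith), abs_of_nonpos (by linarith)]
      simp
      ring

end plain

/-! ### Marks from conditional samples on edges. -/

section pair
variable {d : ℕ} {D : PMF (Cube d)} {O : Oracle d}

theorem Subcube.mem_edge {x y : Cube d} {i : Fin d} :
    y ∈ (edge x i).points ↔ y = x ∨ y = Cube.flip x i := by
  have h1 : y ∈ (edge x i).points ↔ ∀ j ≠ i, y j = x j := by
    constructor
    · intro h j hj
      exact h j (x j) (by simp [edge, hj])
    · intro h j b hb
      rcases eq_or_ne j i with rfl | hj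
      · simp [edge] at hb
      · rw [edge, Function.update_of_ne hj, Option.some.injEq] at hb
        rw [h j hj, hb]
  rw [h1]
  constructor
  · intro h
    rcases eq_or_ne (y i) (x i) with hi | hi
    · exact Or.inl (funext fun j => by rcases eq_or_ne j i with rfl | hj; exacts [hi, h j hj])
    · refine Or.inr (funext fun j => ?_)
      rcases eq_or_ne j i with rfl | hj
      · rw [Cube.flip_same]
        revert hi
        cases y j <;> cases x j <;> simp
      · rw [Cube.flip_ne x hj, h j hj]
  · rintro (rfl | rfl) j hj
    · rfl
    · exact Cube.flip_ne x hj

theorem Subcube.sum_edge (x : Cube d) (i : Fin d) (g : Cube d → ℝ) :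
    (edge x i).sum g = g x + g (Cube.flip x i) := by
  have hne : x ≠ Cube.flip x i := fun h => by
    have := congrFun h i
    rw [Cube.flip_same] at this
    cases hx : x i <;> simp [hx] at this
  have : ∀ y, (if y ∈ (edge x i).points then g y else 0) =
      if y ∈ ({x, Cube.flip x i} : Finset (Cube d)) then g y else 0 := fun y => by
    simp only [Subcube.mem_edge, Finset.mem_insert, Finset.mem_singleton]
  rw [sum, Finset.sum_congr rfl fun y _ => this y, Finset.sum_ite_mem, Finset.univ_inter,
    Finset.sum_pair hne]

theorem prob_filter (S : Subcube d) (h : ∃ x ∈ S.points, x ∈ D.support) (x : Cube d) :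
    prob (D.filter S.points h) x = (if x ∈ S.points then prob D x else 0) / S.sum (prob D) := by
  have h1 : ∀ y, (S.points.indicator D y).toReal = if y ∈ S.points then prob D y else 0 := by
    intro y
    rw [Set.indicator_apply]
    split_ifs <;> simp [prob]
  rw [prob, PMF.filter_apply, ENNReal.toReal_mul, h1, ENNReal.toReal_inv, tsum_fintype,
    ENNReal.toReal_sum, div_eq_mul_inv]
  · simp only [h1, Subcube.sum]
  · intro y _
    rw [Set.indicator_apply]
    split_ifs <;> simp [PMF.apply_ne_top]

theorem IsSubcubeOracle.root (hO : IsSubcubeOracle D O) : O (fun _ => none) = D := by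
  have hmem : ∀ x : Cube d, x ∈ Subcube.points fun _ => none := fun x => by simp [Subcube.points]
  obtain ⟨x, hx⟩ := D.support_nonempty
  have h1 := hO (fun _ => none) ⟨x, hmem x, hx⟩
  refine PMF.ext fun y => ?_
  rw [← ENNReal.toReal_eq_toReal_iff' (PMF.apply_ne_top _ _) (PMF.apply_ne_top _ _), h1]
  have h2 := prob_filter (D := D) (fun _ => none) ⟨x, hmem x, hx⟩ y
  rw [if_pos (hmem y), Subcube.sum_univ, sum_prob, div_one] at h2
  exact h2

/-- If `x` has mass zero both sides vanish whatever the oracle does; otherwise its edge has positive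
mass. So the unspecified answers on subcubes of mass zero never matter. -/
theorem IsSubcubeOracle.edge (hO : IsSubcubeOracle D O) (x : Cube d) (i : Fin d) :
    prob D x * ∫ y, (if y i = x i then (1 : ℝ) else 0) ∂(O (Subcube.edge x i)).toMeasure =
      prob D x ^ 2 / (prob D x + prob D (Cube.flip x i)) := by
  rcases (prob_nonneg D x).eq_or_lt with h0 | h0
  · simp [← h0]
  have hx : x ∈ D.support := by
    rw [PMF.mem_support_iff]
    intro h
    simp [prob, h] at h0
  have hmem : x ∈ (Subcube.edge x i).points := Subcube.mem_edge.2 (Or.inl rfl)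
  have h1 : ∫ y, (if y i = x i then (1 : ℝ) else 0) ∂(O (Subcube.edge x i)).toMeasure =
      (Subcube.edge x i).sum (fun y => prob D y * if y i = x i then (1 : ℝ) else 0) /
        (Subcube.edge x i).sum (prob D) := by
    rw [hO _ ⟨x, hmem, hx⟩, integral_toMeasure, Subcube.sum, Finset.sum_div]
    refine Finset.sum_congr rfl fun y _ => ?_
    rw [prob_filter]
    split_ifs <;> simp
  rw [h1, Subcube.sum_edge, Subcube.sum_edge, Cube.flip_same]
  simp
  ring

/-- The marks from edges as a function of the block. -/
def pairHit (z : Block d (d + 1)) (i : ℕ) : ℕ :=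
  if h : i < d then
    if z (⟨i + 1, by omega⟩, Subcube.edge z.sample ⟨i, h⟩) ⟨i, h⟩ = z.sample ⟨i, h⟩ then 1 else 0
  else 0

/-- The fresh sample agrees with `x` with probability `u / (u + v)`, where `u`, `v` are the masses
of `x` and its neighbour. The edge thus contributes `(u² + v²) / (u + v) = (u + v) / 2 + (u - v)² /
(2 (u + v))`. -/
theorem measures_pairMark (hO : IsSubcubeOracle D O) :
    Measures D O d pairMark pairHit (edgeVariance (prob D)) where
  root := hO.root
  mark_eq ω t i hi := by
    simp [pairHit, pairMark, Block.sample, block, sampleAt, hi, Nat.add_assoc, Nat.add_comm 1 i]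
  le_one z i := by
    unfold pairHit
    split_ifs <;> simp
  edge := edgeBound_edgeVariance (prob_nonneg D)
  mean S i hi := by
    have h1 : ∀ x : Cube d, ∫ z, (if Block.sample z = x then (1 : ℝ) else 0) *
        (if z (i.succ, Subcube.edge x i) i = x i then (1 : ℝ) else 0) ∂blockLaw (d + 1) O =
        prob D x ^ 2 / (prob D x + prob D (Cube.flip x i)) := by
      intro x
      have hne : ((0 : Fin (d + 1)), (fun _ => none : Subcube d)) ≠ (i.succ, Subcube.edge x i) :=
        fun h => Fin.succ_ne_zero i (congrArg Prod.fst h).symm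
      have h0 := Measure.infinitePi_map_eval_prod
        (P := fun p : Fin (d + 1) × Subcube d => (O p.2).toMeasure) hne
      have h2 := integral_prod_mul (μ := (O fun _ => none).toMeasure)
        (ν := (O (Subcube.edge x i)).toMeasure) (fun y : Cube d => if y = x then (1 : ℝ) else 0)
        (fun y => if y i = x i then (1 : ℝ) else 0)
      rw [← h0, integral_map (by fun_prop) (Measurable.of_discrete).aestronglyMeasurable] at h2
      refine h2.trans ?_
      rw [← hO.edge x i, hO.root, integral_toMeasure]
      simp
    have h2 : ∫ z, (hit Block.sample pairHit S i z : ℝ) ∂blockLaw (d + 1) O =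
        S.sum fun x => prob D x ^ 2 / (prob D x + prob D (Cube.flip x i)) := by
      -- The second query depends on the first answer. Summing over the possible samples `x` fixes
      -- the edge, and for fixed `x` the two answers have different indices and are independent.
      have h3 : ∀ z : Block d (d + 1), (hit Block.sample pairHit S i z : ℝ) =
          ∑ x, (if x ∈ S.points then (1 : ℝ) else 0) * ((if z.sample = x then (1 : ℝ) else 0) *
            (if z (i.succ, Subcube.edge x i) i = x i then (1 : ℝ) else 0)) := by
        intro z
        rw [Finset.sum_eq_single z.sample (fun x _ hx => by simp [hx.symm]) (by simp)]
        simp only [hit, pairHit, i.2, i.2.ne, dif_pos, if_false, if_true, one_mul]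
        split_ifs <;> simp_all [Fin.succ]
      simp only [h3]
      rw [integral_finsetSum _ fun x _ => Integrable.of_finite]
      refine Finset.sum_congr rfl fun x _ => ?_
      rw [integral_const_mul, h1]
      split_ifs <;> simp
    rw [h2, ← Subcube.sum_add, div_eq_inv_mul, ← Subcube.sum_mul]
    refine Subcube.sum_symmetrize hi fun x => ?_
    simp only [edgeVariance, Cube.flip_flip]
    have ha := prob_nonneg D x
    have hb := prob_nonneg D (Cube.flip x i)
    rcases (add_nonneg ha hb).eq_or_lt with h | h
    · have e1 : prob D x = 0 := by linarith
      have e2 : prob D (Cube.flip x i) = 0 := by linarith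
      simp [e1, e2]
    · have h' : 0 < prob D (Cube.flip x i) + prob D x := by linarith
      rw [add_comm (prob D (Cube.flip x i)) (prob D x)]
      field_simp
      ring

end pair

/-! ### The learner learns replicably -/

section learner
variable {P : ACode} {w : ℕ → ℕ} {mark : ∀ {d : ℕ}, Answers d → ℕ → Cube d → ℕ → ℕ}

theorem learnerProgram_outputs (hwf : (learnerCode P).Wf) (hP : Marks P w mark)
    (hw : ∀ k ∈ P.writes, k ∈ [20, 22, 23, 51]) (he : P.emits = false) {d : ℕ} {D : PMF (Cube d)}
    {O : Oracle d} {F : Block d (w d + 1) → ℕ → ℕ} {η : Fin d → Cube d → ℝ}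
    (h : Measures D O (w d) mark F η) {ℓ a : ℕ} (q B : ℕ) (ha : 1 ≤ a) (r : Coins)
    (ω : Answers d) : ∃ p : Plan d,
      p = (learnerEst F ℓ a q B r ω).plan (scale ℓ a ^ 6) (fanOut ℓ a) ℓ 0 (fun _ => none) ∧
      Outputs (learnerProgram P) [d, ℓ, a, q, B] r ω (outputWord p.mass p.tree) := by
  obtain ⟨g, hg, p, hp, hout⟩ := learnerCode_den r ω hP hw he ℓ a q B ha
  obtain ⟨c, hc⟩ := learnerProgram_exec P hwf
  obtain ⟨t, n, h1, h2, -⟩ := hc d ℓ a q B (d.size + ℓ.size + a.size + q.size + B.size + 1) r ω (by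
    simp; omega)
  refine ⟨p, ?_, t, n, h1, h2.trans hout⟩
  rw [hp]
  refine Est.plan_congr _ _ _ _ _ fun l _ _ S i hi => ?_
  have : count (sampleAt (w d + 1) ω) g (sampleSize d ℓ a q B) S i =
      hits F ω (sampleSize d ℓ a q B) S i := by
    refine Finset.sum_congr rfl fun t ht => ?_
    obtain ⟨hg1, hg2⟩ := hg t (Finset.mem_range.1 ht)
    have hs : Block.sample (block (w d + 1) ω t) = sampleAt (w d + 1) ω t := by
      simp [Block.sample, block, sampleAt]
    rw [hit, hs]
    rcases hi.eq_or_lt with rfl | hi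
    · rw [if_pos rfl, hg2]
    · rw [if_neg hi.ne, hg1 i hi, h.mark_eq ω t i hi]
  rw [roundedEst, this]
  rfl

variable {d ℓ : ℕ} {α ρ β : ℝ} {D : PMF (Cube d)} {O : Oracle d} {F : Block d (w d + 1) → ℕ → ℕ}
  {η : Fin d → Cube d → ℝ}

theorem one_le_ceil_inv {x : ℝ} (hx : 0 < x) : 1 ≤ ⌈1 / x⌉₊ :=
  Nat.one_le_ceil_iff.2 (by positivity)

/-- Typical answers give accurate estimates for every choice of offsets, so the coins play no role
for correctness. -/
theorem learnerProgram_learns (hwf : (learnerCode P).Wf) (hP : Marks P w mark)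
    (hw : ∀ k ∈ P.writes, k ∈ [20, 22, 23, 51]) (he : P.emits = false)
    (h : Measures D O (w d) mark F η) (hα : 0 < α) (hρ : 0 < ρ) (hβ : 0 < β)
    (hD : Representable D ℓ) :
    Learns (learnerProgram P) (learnerInput d ℓ α ρ β) O D ℓ α β := by
  intro r
  have ha := one_le_ceil_inv hα
  have hq := one_le_ceil_inv hρ
  have hG := learner_typical_compl_le (O := O) (ℓ := ℓ) h.le_one ha hq hβ (Nat.le_ceil (1 / β))
  set G := typical O F (sampleSize d ℓ ⌈1 / α⌉₊ ⌈1 / ρ⌉₊ ⌈1 / β⌉₊)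
    (deviation d ℓ ⌈1 / α⌉₊ ⌈1 / ρ⌉₊ ⌈1 / β⌉₊)
  have hsub : G ⊆ {ω : Answers d | ∃ w : List ℕ,
      Outputs (learnerProgram P) (learnerInput d ℓ α ρ β) r ω w ∧ GoodOutput D ℓ α w} := by
    intro ω hω
    obtain ⟨p, hp, hout⟩ := learnerProgram_outputs (ℓ := ℓ) hwf hP hw he h ⌈1 / ρ⌉₊ ⌈1 / β⌉₊ ha r ω
    exact ⟨_, hout, (accurate_learnerEst h hq r hω).goodOutput hα (Nat.le_ceil _) hD h.edge hp⟩
  refine le_trans ?_ (measure_mono hsub)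
  rw [ENNReal.ofReal_sub _ hβ.le, ENNReal.ofReal_one]
  refine tsub_le_iff_right.2 (le_trans ?_ (add_le_add_right hG _))
  have := measure_union_le (μ := answerLaw O) G Gᶜ
  rwa [Set.union_compl_self, measure_univ] at this

/-- Disagreement requires bad offsets or atypical answers in one of the two executions. The total `ρ
/ 6 + 2 * β` is below `ρ` because `β < ρ / 3`. -/
theorem learnerProgram_replicable (hwf : (learnerCode P).Wf) (hP : Marks P w mark)
    (hw : ∀ k ∈ P.writes, k ∈ [20, 22, 23, 51]) (he : P.emits = false)
    (h : Measures D O (w d) mark F η) (hα : 0 < α) (hρ : 0 < ρ) (hβ : 0 < β) (hβρ : β < ρ / 3) :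
    Replicable (learnerProgram P) (learnerInput d ℓ α ρ β) O ρ := by
  have ha := one_le_ceil_inv hα
  have hq := one_le_ceil_inv hρ
  have hG := learner_typical_compl_le (O := O) (ℓ := ℓ) h.le_one ha hq hβ (Nat.le_ceil (1 / β))
  have hB := coinLaw_badOffsets_le (O := O) (F := F) (ℓ := ℓ) (B := ⌈1 / β⌉₊) ha hq
  set G := typical O F (sampleSize d ℓ ⌈1 / α⌉₊ ⌈1 / ρ⌉₊ ⌈1 / β⌉₊)
    (deviation d ℓ ⌈1 / α⌉₊ ⌈1 / ρ⌉₊ ⌈1 / β⌉₊) with hGdef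
  set bad := badOffsets O F ℓ ⌈1 / α⌉₊ ⌈1 / ρ⌉₊ ⌈1 / β⌉₊ with hbad
  have hsub : {z : Coins × Answers d × Answers d | ¬ ∃ w : List ℕ,
      Outputs (learnerProgram P) (learnerInput d ℓ α ρ β) z.1 z.2.1 w ∧
      Outputs (learnerProgram P) (learnerInput d ℓ α ρ β) z.1 z.2.2 w} ⊆
      bad ×ˢ Set.univ ∪ (Set.univ ×ˢ (Gᶜ ×ˢ Set.univ) ∪ Set.univ ×ˢ (Set.univ ×ˢ Gᶜ)) := by
    rintro ⟨r, ω, ω'⟩ hz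
    by_contra hc
    simp only [Set.mem_union, Set.mem_prod, Set.mem_univ, and_true, true_and, not_or,
      Set.mem_compl_iff, not_not] at hc
    obtain ⟨hr, h1, h2⟩ := hc
    obtain ⟨p, hp, hout⟩ := learnerProgram_outputs (ℓ := ℓ) hwf hP hw he h ⌈1 / ρ⌉₊ ⌈1 / β⌉₊ ha r ω
    obtain ⟨p', hp', hout'⟩ :=
      learnerProgram_outputs (ℓ := ℓ) hwf hP hw he h ⌈1 / ρ⌉₊ ⌈1 / β⌉₊ ha r ω'
    have : p = p' := by
      rw [hp, hp', learnerPlan_eq hr h1, learnerPlan_eq hr h2]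
    subst this
    exact hz ⟨_, hout, hout'⟩
  have hρ' : 1 / (6 * (⌈1 / ρ⌉₊ : ℝ)) ≤ ρ / 6 := by
    have := Nat.le_ceil (1 / ρ)
    rw [div_le_iff₀ hρ] at this
    have hq' : (0 : ℝ) < ⌈1 / ρ⌉₊ := by exact_mod_cast hq
    rw [div_le_div_iff₀ (by positivity) (by norm_num)]
    linarith
  calc _ ≤ coinLaw bad + (answerLaw O Gᶜ + answerLaw O Gᶜ) := by
        refine (measure_mono hsub).trans ((measure_union_le _ _).trans
          (add_le_add (le_of_eq ?_) ((measure_union_le _ _).trans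
            (add_le_add (le_of_eq ?_) (le_of_eq ?_)))))
        · rw [Measure.prod_prod, measure_univ, mul_one]
        · rw [Measure.prod_prod, Measure.prod_prod, measure_univ, measure_univ, mul_one, one_mul]
        · rw [Measure.prod_prod, Measure.prod_prod, measure_univ, measure_univ, one_mul, one_mul]
    _ ≤ ENNReal.ofReal (ρ / 6) + (ENNReal.ofReal β + ENNReal.ofReal β) :=
        add_le_add (hB.trans (ENNReal.ofReal_le_ofReal hρ')) (add_le_add hG hG)
    _ = ENNReal.ofReal (ρ / 6 + (β + β)) := by
        rw [ENNReal.ofReal_add (by positivity) (by positivity), ENNReal.ofReal_add hβ.le hβ.le]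
    _ ≤ ENNReal.ofReal ρ := ENNReal.ofReal_le_ofReal (by linarith)

end learner

/-! ### Polynomial bounds for the running time -/

section bounds
variable {d ℓ : ℕ} {α ρ β : ℝ}

/-- For a number of `s` bits, `2 ^ (s - 1)` is at most the number, here at most `2 / β`; the factor
`2` in the result covers division by `log 2 > 1 / 2`. -/
theorem size_ceil_inv_le (hβ : 0 < β) (hβ1 : β < 1) :
    ((⌈1 / β⌉₊.size : ℕ) : ℝ) ≤ 2 + 2 * Real.log (1 / β) := by
  set B := ⌈1 / β⌉₊ with hB
  have h1 : 1 < 1 / β := by rw [lt_div_iff₀ hβ]; linarith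
  have hB1 : (B : ℝ) < 1 / β + 1 := Nat.ceil_lt_add_one (by linarith)
  have hsz : 0 < B.size := Nat.size_pos.2 (Nat.ceil_pos.2 (by linarith))
  have h2 : 2 ^ (B.size - 1) ≤ B := Nat.lt_size.1 (by omega)
  have h3 : (2 : ℝ) ^ (B.size - 1) ≤ 2 * (1 / β) := by
    have : ((2 : ℝ)) ^ (B.size - 1) ≤ B := by exact_mod_cast h2
    linarith
  have h4 := Real.log_le_log (by positivity) h3
  rw [Real.log_pow, Real.log_mul (by norm_num) (by positivity), Nat.cast_sub hsz] at h4
  have h5 := Real.log_two_gt_d9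
  have h6 : 0 < Real.log (1 / β) := Real.log_pos h1
  push_cast at h4
  by_contra hc
  push Not at hc
  nlinarith

end bounds

/-- Here `t` stands for `2ℓ / α`. From `(ℓ + 1) * a ≤ 2t ≤ t²` the base `2 * ((ℓ + 1) * a) ^ 7 + 1`
is at most `t ^ 16`. -/
theorem nodeBound_le {ℓ a : ℕ} (hℓ : ℓ ≠ 0) {t : ℝ} (ht : 2 ≤ t) (ha : (ℓ + 1) * (a : ℝ) ≤ 2 * t) :
    (nodeBound ℓ a : ℝ) ≤ (t ^ ℓ) ^ 16 := by
  rw [← pow_mul, Nat.mul_comm, pow_mul, nodeBound, fanOut, scale]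
  push_cast
  refine pow_le_pow_left₀ (by positivity) ?_ _
  have e4 : (ℓ + 1) * (a : ℝ) ≤ t ^ 2 := by nlinarith
  have e5 := pow_le_pow_left₀ (by positivity) e4 7
  have e6 : (1 : ℝ) ≤ (t ^ 2) ^ 7 := one_le_pow₀ (by nlinarith)
  have e7 : (4 : ℝ) ≤ t ^ 2 := by nlinarith
  calc 2 * ((ℓ + 1) * (a : ℝ)) ^ 7 + 1 ≤ 4 * (t ^ 2) ^ 7 := by linarith
    _ ≤ t ^ 2 * (t ^ 2) ^ 7 := mul_le_mul_of_nonneg_right e7 (by linarith)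
    _ = t ^ 16 := by ring

theorem width_le {d ℓ a q B : ℕ} : width d ℓ a q B ≤ 2 * minWidth d ℓ a q B + 1 := by
  rw [width, offsetBits]
  rcases Nat.lt_or_ge 1 (minWidth d ℓ a q B) with h | h
  · have e1 := Nat.pow_pred_clog_lt_self (by norm_num : 1 < 2) h
    have e2 := Nat.clog_pos (by norm_num : 1 < 2) h
    obtain ⟨k, hk⟩ := Nat.exists_eq_succ_of_ne_zero e2.ne'
    rw [hk, Nat.pred_succ] at e1
    rw [hk, pow_succ]
    omega
  · rw [Nat.clog_of_right_le_one h]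
    simp

/-- Everything is expressed through powers of a single number `Z ≥ 2`, with constants absorbed as `2
^ i ≤ Z ^ i`; no attempt is made to keep exponents small. -/
theorem budget_le {d ℓ a q B Z : ℕ} (hZ : 2 ≤ Z) (hd : d + 1 ≤ Z) (ha : a ≤ Z) (hq : q ≤ Z)
    (hB : B.size ≤ Z * Z) (hs : scale ℓ a ≤ Z) (hℓ : ℓ ≤ Z) (h2 : 2 ^ ℓ ≤ Z)
    (hN : nodeBound ℓ a ≤ Z ^ 16) : budget d ℓ a q B ≤ Z ^ 80 := by
  have two : ∀ i : ℕ, 2 ^ i ≤ Z ^ i := fun i => Nat.pow_le_pow_left hZ i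
  have mono : ∀ i ≤ 74, Z ^ i ≤ Z ^ 74 := fun i hi => Nat.pow_le_pow_right (by omega) hi
  have b_res : resolution ℓ a ≤ Z ^ 12 :=
    calc 32 * 2 ^ ℓ * scale ℓ a ^ 6 ≤ Z ^ 5 * Z * Z ^ 6 :=
          Nat.mul_le_mul (Nat.mul_le_mul (two 5) h2) (Nat.pow_le_pow_left hs 6)
      _ = Z ^ 12 := by ring
  have b_slack : slack d ℓ a q ≤ Z ^ 22 :=
    calc 12 * nodeBound ℓ a * (d + 1) * q ≤ Z ^ 4 * Z ^ 16 * Z * Z :=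
          Nat.mul_le_mul (Nat.mul_le_mul (Nat.mul_le_mul
            ((by norm_num : 12 ≤ 2 ^ 4).trans (two 4)) hN) hd) hq
      _ = Z ^ 22 := by ring
  have b_rest : 3 * d + B.size + 3 ≤ Z ^ 4 :=
    calc 3 * d + B.size + 3 ≤ 3 * Z + Z * Z := by omega
      _ ≤ (2 * 2) * (Z * Z) := by nlinarith
      _ ≤ (Z * Z) * (Z * Z) := Nat.mul_le_mul_right _ (Nat.mul_le_mul hZ hZ)
      _ = Z ^ 4 := by ring
  have b_min : minWidth d ℓ a q B ≤ Z ^ 60 :=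
    calc slack d ℓ a q * slack d ℓ a q * resolution ℓ a * (3 * d + B.size + 3)
        ≤ Z ^ 22 * Z ^ 22 * Z ^ 12 * Z ^ 4 :=
          Nat.mul_le_mul (Nat.mul_le_mul (Nat.mul_le_mul b_slack b_slack) b_res) b_rest
      _ = Z ^ 60 := by ring
  have b_width : width d ℓ a q B ≤ Z ^ 62 :=
    calc width d ℓ a q B ≤ 2 * minWidth d ℓ a q B + 1 := width_le
      _ ≤ 2 ^ 2 * Z ^ 60 := by
        have := Nat.one_le_pow 60 Z (by omega)
        omega
      _ ≤ Z ^ 2 * Z ^ 60 := Nat.mul_le_mul_right _ (two 2)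
      _ = Z ^ 62 := by ring
  have b_sample : sampleSize d ℓ a q B ≤ Z ^ 74 :=
    calc width d ℓ a q B * resolution ℓ a ≤ Z ^ 62 * Z ^ 12 := Nat.mul_le_mul b_width b_res
      _ = Z ^ 74 := by ring
  have b_scale := (Nat.pow_le_pow_left hs 7).trans (mono 7 (by norm_num))
  have z0 := mono 0 (by norm_num)
  have z1 := mono 1 (by norm_num)
  have z2 := mono 2 (by norm_num)
  rw [pow_zero] at z0
  rw [pow_one] at z1
  rw [pow_two] at z2
  have b_res' := b_res.trans (mono 12 (by norm_num))
  have b_slack' := b_slack.trans (mono 22 (by norm_num))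
  have b_min' := b_min.trans (mono 60 (by norm_num))
  have b_node := hN.trans (mono 16 (by norm_num))
  calc budget d ℓ a q B ≤ 2 ^ 6 * Z ^ 74 := by
        rw [budget]
        generalize Z ^ 74 = Y at *
        omega
    _ ≤ Z ^ 6 * Z ^ 74 := Nat.mul_le_mul_right _ (two 6)
    _ = Z ^ 80 := by ring

/-- All quantities that determine the running time are polynomially bounded. -/
theorem learner_budget_le {d ℓ : ℕ} {α ρ β : ℝ} (hα : 0 < α) (hα1 : α < 1) (hρ : 0 < ρ)
    (hρ1 : ρ < 1) (hβ : 0 < β) (hβ1 : β < 1) {Z : ℝ}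
    (hZ : Z = ((d : ℝ) + 1 / α + 1 / ρ + Real.log (1 / β)) * (2 * (ℓ : ℝ) / α) ^ ℓ) :
    2 ≤ Z ∧ (budget d ℓ ⌈1 / α⌉₊ ⌈1 / ρ⌉₊ ⌈1 / β⌉₊ : ℝ) ≤ Z ^ (2 * 80) := by
  have h1 : 1 < 1 / α := by rw [lt_div_iff₀ hα]; linarith
  have h2 : 1 < 1 / ρ := by rw [lt_div_iff₀ hρ]; linarith
  have h3 : 0 < Real.log (1 / β) := Real.log_pos (by rw [lt_div_iff₀ hβ]; linarith)
  have hsz := size_ceil_inv_le hβ hβ1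
  have ha := Nat.ceil_lt_add_one (zero_le_one.trans h1.le)
  have hq := Nat.ceil_lt_add_one (zero_le_one.trans h2.le)
  have hd : (0 : ℝ) ≤ d := Nat.cast_nonneg d
  set X := (d : ℝ) + 1 / α + 1 / ρ + Real.log (1 / β) with hX
  set t := 2 * (ℓ : ℝ) / α with ht
  set a := ⌈1 / α⌉₊
  set q := ⌈1 / ρ⌉₊
  set B := ⌈1 / β⌉₊
  have hX2 : 2 ≤ X := by linarith
  have hY : (ℓ : ℝ) + 1 ≤ t ^ ℓ ∧ (2 : ℝ) ^ ℓ ≤ t ^ ℓ ∧ (nodeBound ℓ a : ℝ) ≤ (t ^ ℓ) ^ 16 := by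
    -- For `ℓ = 0` the base `t` is zero and the inequalities hold only through `0 ^ 0 = 1`.
    rcases eq_or_ne ℓ 0 with rfl | hℓ
    · simp [nodeBound]
    · have hl : (1 : ℝ) ≤ ℓ := by exact_mod_cast Nat.one_le_iff_ne_zero.2 hℓ
      have e : t = 2 * ℓ * (1 / α) := by rw [ht]; ring
      have e1 : 2 ≤ t := by rw [e]; nlinarith
      have e2 : (ℓ : ℝ) + 1 ≤ t := by rw [e]; nlinarith
      have e3 : (ℓ + 1) * (a : ℝ) ≤ 2 * t := by
        have : (a : ℝ) ≤ 2 * (1 / α) := by linarith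
        calc (ℓ + 1) * (a : ℝ) ≤ (2 * ℓ) * (2 * (1 / α)) :=
              mul_le_mul (by linarith) this (Nat.cast_nonneg _) (by linarith)
          _ = 2 * t := by rw [e]; ring
      exact ⟨e2.trans (le_self_pow₀ (by linarith) hℓ), pow_le_pow_left₀ (by norm_num) e1 _,
        nodeBound_le hℓ e1 e3⟩
  obtain ⟨hY1, hY2, hY3⟩ := hY
  generalize t ^ ℓ = Y at hY1 hY2 hY3 hZ
  have hY0 : 1 ≤ Y := by linarith [(Nat.cast_nonneg ℓ : (0 : ℝ) ≤ ℓ)]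
  have hXZ : X ≤ Z := by rw [hZ]; nlinarith
  have hYZ : Y ≤ Z := by rw [hZ]; nlinarith
  have hZ2 : 2 ≤ Z := hX2.trans hXZ
  have hn : Z ≤ ⌈Z⌉₊ := Nat.le_ceil Z
  -- Passing to a natural number doubles the exponent, since `Z + 1 ≤ Z ^ 2` for `Z ≥ 2`.
  have hn' : (⌈Z⌉₊ : ℝ) ≤ Z ^ 2 := by
    have := Nat.ceil_lt_add_one (zero_le_two.trans hZ2)
    nlinarith
  have b_scale : (scale ℓ a : ℝ) ≤ Z := by
    rw [scale, hZ, mul_comm X]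
    push_cast
    exact mul_le_mul hY1 (by linarith) (Nat.cast_nonneg _) (by linarith)
  have b_node : (nodeBound ℓ a : ℝ) ≤ (⌈Z⌉₊ : ℝ) ^ 16 :=
    hY3.trans (pow_le_pow_left₀ (by linarith) (hYZ.trans hn) _)
  have hbud : budget d ℓ a q B ≤ ⌈Z⌉₊ ^ 80 := by
    refine budget_le ?_ ?_ ?_ ?_ ?_ ?_ ?_ ?_ ?_
    · exact_mod_cast hZ2.trans hn
    · exact_mod_cast (show (d : ℝ) + 1 ≤ (⌈Z⌉₊ : ℝ) by linarith)
    · exact_mod_cast (show (a : ℝ) ≤ (⌈Z⌉₊ : ℝ) by linarith)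
    · exact_mod_cast (show (q : ℝ) ≤ (⌈Z⌉₊ : ℝ) by linarith)
    · exact_mod_cast (show (B.size : ℝ) ≤ (⌈Z⌉₊ : ℝ) * ⌈Z⌉₊ by nlinarith)
    · exact_mod_cast b_scale.trans hn
    · exact_mod_cast (show (ℓ : ℝ) ≤ (⌈Z⌉₊ : ℝ) by linarith)
    · exact_mod_cast (hY2.trans hYZ).trans hn
    · exact_mod_cast b_node
  refine ⟨hZ2, ?_⟩
  rw [pow_mul]
  refine le_trans ?_ (pow_le_pow_left₀ (Nat.cast_nonneg _) hn' _)
  exact_mod_cast hbud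

theorem le_pow_of_steps_le {U N n c c' : ℕ} (hU : 2 ≤ U) (hN : N ≤ U ^ c)
    (hn : n ≤ c' * ((U + N) * (N + 1))) : n ≤ c' * U ^ (2 * c + 4) := by
  refine hn.trans (Nat.mul_le_mul_left _ ?_)
  have e1 : U ≤ U ^ (c + 1) := Nat.le_self_pow (by omega) _
  have e2 : U ^ c ≤ U ^ (c + 1) := Nat.pow_le_pow_right (by omega) (by omega)
  have e3 : 1 ≤ U ^ (c + 1) := Nat.one_le_pow _ _ (by omega)
  calc (U + N) * (N + 1) ≤ (2 * U ^ (c + 1)) * (2 * U ^ (c + 1)) :=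
        Nat.mul_le_mul (by omega) (by omega)
    _ ≤ (U * U ^ (c + 1)) * (U * U ^ (c + 1)) :=
        Nat.mul_le_mul (Nat.mul_le_mul_right _ hU) (Nat.mul_le_mul_right _ hU)
    _ = U ^ (2 * c + 4) := by ring

theorem le_mul_pow_of_le {U n k e c : ℕ} {Z : ℝ} (hZ : 1 ≤ Z) (hU : (U : ℝ) ≤ Z ^ e)
    (hn : n ≤ c * U ^ k) : (n : ℝ) ≤ (c + e * k : ℕ) * Z ^ (c + e * k) := by
  calc (n : ℝ) ≤ c * (U : ℝ) ^ k := by exact_mod_cast hn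
    _ ≤ (c + e * k : ℕ) * (Z ^ e) ^ k :=
        mul_le_mul (by exact_mod_cast Nat.le_add_right _ _)
          (pow_le_pow_left₀ (Nat.cast_nonneg _) hU k) (by positivity) (Nat.cast_nonneg _)
    _ ≤ (c + e * k : ℕ) * Z ^ (c + e * k) := by
        rw [← pow_mul]
        exact mul_le_mul_of_nonneg_left (pow_le_pow_right₀ hZ (Nat.le_add_left _ _))
          (Nat.cast_nonneg _)

theorem learnerProgram_runsWithin {P : ACode} (hwf : (learnerCode P).Wf)
    (hst : (drawCode P).Static) {w : ℕ → ℕ}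
    {mark : ∀ {d : ℕ}, Answers d → ℕ → Cube d → ℕ → ℕ} (hP : Marks P w mark)
    (hw : ∀ k ∈ P.writes, k ∈ [20, 22, 23, 51]) (he : P.emits = false)
    (hPb : ∀ U M, M 0 0 0 ≤ U → P.Bounded U M) :
    ∃ C : ℕ, ∀ (d ℓ : ℕ) (α ρ β : ℝ), 0 < α → α < 1 → 0 < ρ → ρ < 1 → 0 < β → β < 1 →
      RunsWithin d (learnerProgram P) (learnerInput d ℓ α ρ β) (complexityBound C d ℓ α ρ β) := by
  obtain ⟨c, hc⟩ := exists_steps_le P hst hP hw he hPb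
  obtain ⟨c', hc'⟩ := learnerProgram_exec P hwf
  refine ⟨c' + 2 * 80 * (2 * c + 4), fun d ℓ α ρ β hα hα1 hρ hρ1 hβ hβ1 r ω => ?_⟩
  obtain ⟨hZ2, hbud⟩ := learner_budget_le (d := d) (ℓ := ℓ) hα hα1 hρ hρ1 hβ hβ1 rfl
  have hsize : ∀ v ∈ [d, ℓ, ⌈1 / α⌉₊, ⌈1 / ρ⌉₊, ⌈1 / β⌉₊, 1],
      v.size ≤ budget d ℓ ⌈1 / α⌉₊ ⌈1 / ρ⌉₊ ⌈1 / β⌉₊ := by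
    have h1 := size_le_self d
    have h2 := size_le_self ℓ
    have h3 := size_le_self ⌈1 / α⌉₊
    have h4 := size_le_self ⌈1 / ρ⌉₊
    have h5 := Nat.two_pow_pos ℓ
    simp only [List.mem_cons, List.not_mem_nil, or_false, forall_eq_or_imp, forall_eq, budget,
      Nat.size_one]
    omega
  obtain ⟨t, n, h1, -, h3⟩ := hc' d ℓ ⌈1 / α⌉₊ ⌈1 / ρ⌉₊ ⌈1 / β⌉₊ _ r ω hsize
  have hU2 : 2 ≤ budget d ℓ ⌈1 / α⌉₊ ⌈1 / ρ⌉₊ ⌈1 / β⌉₊ := by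
    have := Nat.two_pow_pos ℓ
    unfold budget
    omega
  have hn := le_mul_pow_of_le (one_le_two.trans hZ2) hbud
    (le_pow_of_steps_le hU2 (hc r ω ℓ _ _ _ (one_le_ceil_inv hα)) h3)
  -- The same constant serves as factor and as exponent, so a power of the product splits into the
  -- two powers in `complexityBound`.
  rw [mul_pow, ← pow_mul, Nat.mul_comm ℓ, ← mul_assoc] at hn
  refine ⟨t, n, h1, hn, le_trans ?_ hn⟩
  have h5 : t.draws ≤ n := by simpa [initial] using h1.draws_le
  exact Nat.cast_le.2 h5

end ReplicableDT

theorem theoremD1 :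
    (∃ (P : ReplicableDT.Program) (C : ℕ),
      ∀ (d ℓ : ℕ) (α ρ β : ℝ), 0 < α → α < 1 → 0 < ρ → ρ < 1 → 0 < β → β < ρ / 3 →
        ReplicableDT.RunsWithin d P (ReplicableDT.learnerInput d ℓ α ρ β)
          (ReplicableDT.complexityBound C d ℓ α ρ β) ∧
        ∀ D : PMF (ReplicableDT.Cube d),
          ReplicableDT.Representable D ℓ → ReplicableDT.MonotoneDist D →
            ReplicableDT.Replicable P (ReplicableDT.learnerInput d ℓ α ρ β)
              (ReplicableDT.sampleOracle D) ρ ∧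
            ReplicableDT.Learns P (ReplicableDT.learnerInput d ℓ α ρ β)
              (ReplicableDT.sampleOracle D) D ℓ α β) ∧
    (∃ (P : ReplicableDT.Program) (C : ℕ),
      ∀ (d ℓ : ℕ) (α ρ β : ℝ), 0 < α → α < 1 → 0 < ρ → ρ < 1 → 0 < β → β < ρ / 3 →
        ReplicableDT.RunsWithin d P (ReplicableDT.learnerInput d ℓ α ρ β)
          (ReplicableDT.complexityBound C d ℓ α ρ β) ∧
        ∀ D : PMF (ReplicableDT.Cube d), ReplicableDT.Representable D ℓ →
          ∀ O : ReplicableDT.Oracle d, ReplicableDT.IsSubcubeOracle D O →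
            ReplicableDT.Replicable P (ReplicableDT.learnerInput d ℓ α ρ β) O ρ ∧
            ReplicableDT.Learns P (ReplicableDT.learnerInput d ℓ α ρ β) O D ℓ α β) := by
  constructor
  · have hb : ∀ U M, M 0 0 0 ≤ U → ReplicableDT.plainMarks.Bounded U M := fun U M h => by
      simpa [ReplicableDT.plainMarks, ReplicableDT.ACode.Bounded, ReplicableDT.AExpr.Bounded,
        ReplicableDT.AExpr.eval] using h
    have hw : ∀ k ∈ ReplicableDT.plainMarks.writes, k ∈ [20, 22, 23, 51] := by
      simp [ReplicableDT.plainMarks, ReplicableDT.ACode.writes]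
    obtain ⟨C, hC⟩ := ReplicableDT.learnerProgram_runsWithin
      ReplicableDT.learnerCode_plainMarks_wf ReplicableDT.drawCode_plainMarks_static
      ReplicableDT.marks_plainMarks hw rfl hb
    refine ⟨ReplicableDT.learnerProgram ReplicableDT.plainMarks, C,
      fun d ℓ α ρ β hα hα1 hρ hρ1 hβ hβρ =>
        ⟨hC d ℓ α ρ β hα hα1 hρ hρ1 hβ (by linarith), fun D hD hmono => ?_⟩⟩
    have hM := ReplicableDT.measures_plainMark hmono
    exact ⟨ReplicableDT.learnerProgram_replicable ReplicableDT.learnerCode_plainMarks_wf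
        ReplicableDT.marks_plainMarks hw rfl hM hα hρ hβ hβρ,
      ReplicableDT.learnerProgram_learns ReplicableDT.learnerCode_plainMarks_wf
        ReplicableDT.marks_plainMarks hw rfl hM hα hρ hβ hD⟩
  · have hb : ∀ U M, M 0 0 0 ≤ U → ReplicableDT.pairMarks.Bounded U M := fun U M h => by
      simpa [ReplicableDT.pairMarks, ReplicableDT.ACode.block, ReplicableDT.ACode.Bounded,
        ReplicableDT.AExpr.Bounded, ReplicableDT.AExpr.eval] using h
    have hw : ∀ k ∈ ReplicableDT.pairMarks.writes, k ∈ [20, 22, 23, 51] := by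
      simp [ReplicableDT.pairMarks, ReplicableDT.ACode.block, ReplicableDT.ACode.writes]
    obtain ⟨C, hC⟩ := ReplicableDT.learnerProgram_runsWithin
      ReplicableDT.learnerCode_pairMarks_wf ReplicableDT.drawCode_pairMarks_static
      ReplicableDT.marks_pairMarks hw rfl hb
    refine ⟨ReplicableDT.learnerProgram ReplicableDT.pairMarks, C,
      fun d ℓ α ρ β hα hα1 hρ hρ1 hβ hβρ =>
        ⟨hC d ℓ α ρ β hα hα1 hρ hρ1 hβ (by linarith), fun D hD O hO => ?_⟩⟩
    have hM := ReplicableDT.measures_pairMark hO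
    exact ⟨ReplicableDT.learnerProgram_replicable ReplicableDT.learnerCode_pairMarks_wf
        ReplicableDT.marks_pairMarks hw rfl hM hα hρ hβ hβρ,
      ReplicableDT.learnerProgram_learns ReplicableDT.learnerCode_pairMarks_wf
        ReplicableDT.marks_pairMarks hw rfl hM hα hρ hβ hD⟩
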